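/- Let $d,n_1,n_2\ge 1$ and $n=n_1+n_2$. Let $A^1,\dots,A^d$ be real symmetric $n\times n$ matrices and $D$ a real symmetric positive definite $n_2\times n_2$ matrix, with $$A^i=\begin{pmatrix}0&A^i_{1,2}\\ A^i_{2,1}&A^i_{2,2}\end{pmatrix},\qquad L=\begin{pmatrix}0&0\\0&D\end{pmatrix},$$ and assume the Shizuta–Kawashima condition: if $\varphi\in\mathbb R^n$, $L\varphi=0$ and $\lambda\varphi+\sum_i\omega_iA^i\varphi=0$ for some $\lambda\in\mathbb R$ and $\omega\in\mathbb S^{d-1}$, then $\varphi=0$. Consider the linear Cauchy problem, in the sense of tempered distributions on $\mathbb R^d$, $$\partial_tV+\sum_{i=1}^dA^i\partial_{x_i}V+LV=0\quad(t\ge 0),\qquad V(0)=V_0,\qquad V=(V_1,V_2).$$ Write $\mathbf PV=(V_1,0)$, $\{\mathbf I-\mathbf P\}V=(0,V_2)$, $\langle t\rangle=\sqrt{1+t^2}$, $$\Psi_0=V_{1,0}-\sum_iA^i_{1,2}D^{-1}\partial_{x_i}V_{2,0},\qquad \mathcal A=\sum_{i,l}A^i_{1,2}D^{-1}A^l_{2,1}\partial^2_{x_ix_l},$$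 $$V^*=\Big(e^{t\mathcal A}\Psi_0,\;-\sum_iD^{-1}A^i_{2,1}\partial_{x_i}e^{t\mathcal A}\Psi_0\Big).$$ Let $\chi$ be a smooth radial non-increasing function, compactly supported in $B(0,\frac43)$ and equal to $1$ on $B(0,\frac34)$; put $\varphi(\xi)=\chi(\xi/2)-\chi(\xi)$ and $\dot\Delta_j=\varphi(2^{-j}D_x)$ with $D_x=-\mathrm i\nabla$. Let $\|u\|_{\dot B^\sigma_{p,r}}=\|(2^{j\sigma}\|\dot\Delta_ju\|_{L^p})_{j\in\mathbb Z}\|_{\ell^r}$ (summed over the components of a vector), let $\dot B^\sigma_{p,r}$ be the set of tempered distributions modulo polynomials for which it is finite, and let $\dot{\mathcal B}^{\sigma}_{p,\infty}$ be the set of $f\in\dot B^\sigma_{p,\infty}$ for which there are $c,M>0$ and integers $j_k\to-\infty$ with $|j_k-j_{k+1}|\le M$ and $2^{\sigma j_k}\|\dot\Delta_{j_k}f\|_{L^p}\ge c$ for all $k$. For a threshold $J_0\in\mathbb Z$ put $u^\ell=\sum_{j\le J_0-1}\dot\Delta_ju$, $u^h=u-u^\ell$, $\|u\|^h_{\dot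 B^s_{2,1}}=\sum_{j\ge J_0-1}2^{js}\|\dot\Delta_ju\|_{L^2}$ and $\|u\|_{\dot{\mathbb B}^{\sigma,s}_{p,2}}=\|u^\ell\|_{\dot B^\sigma_{p,1}}+\|u\|^h_{\dot B^s_{2,1}}$. Let $1<p<\infty$. Then for every sufficiently small (i.e. sufficiently negative) $J_0$, depending only on $p$, $\chi$ and the system, the following holds for all $\sigma_1,s\in\mathbb R$, $\sigma>\sigma_1$, $\sigma'>\sigma_1+1$ and all $V_0$ with $(\{\mathbf I-\mathbf P\}V_0)^\ell\in\dot B^{\sigma_1+1}_{p,\infty}$, $V_0^h\in\dot B^s_{2,1}$ and $\|V_0\|^h_{\dot B^s_{2,1}}<\infty$, where $V$ is the solution with initial data $V_0$ and $c,C>0$ denote constants independent of $t$. (Upper bounds.) There is $C>0$ such that for all $t>0$ $$\|\mathbf PV(t)\|_{\dot{\mathbb B}^{\sigma,s}_{p,2}}\le C\langle t\rangle^{-\frac12(\sigma-\sigma_1)},\qquad \|\{\mathbf I-\mathbf P\}V(t)\|_{\dot{\mathbb B}^{\sigma',s}_{p,2}}\le C\langle t\rangle^{-\frac12(\sigma'-\sigma_1)-\frac12}\tag{1}$$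 if and only if $(\mathbf PV_0)^\ell\in\dot B^{\sigma_1}_{p,\infty}$. (Asymptotics.) If $(\mathbf PV_0)^\ell\in\dot B^{\sigma_1}_{p,\infty}$, then there are $\tilde t_0>0$ and $C>0$ such that for all $t\ge\tilde t_0$ $$\|\mathbf P(V-V^*)(t)\|_{\dot{\mathbb B}^{\sigma,s}_{p,2}}\le C\langle t\rangle^{-\frac12(\sigma-\sigma_1)-\frac12},\qquad \|\{\mathbf I-\mathbf P\}(V-V^*)(t)\|_{\dot{\mathbb B}^{\sigma',s}_{p,2}}\le C\langle t\rangle^{-\frac12(\sigma'-\sigma_1)-1}.$$ (Two-sided bounds.) (1) holds for some $C>0$ and all $t>0$, and there are $\tilde t_1>0$ and $c,C>0$ such that for all $t\ge\tilde t_1$ $$c\langle t\rangle^{-\frac12(\sigma-\sigma_1)}\le\|\mathbf PV(t)\|_{\dot{\mathbb B}^{\sigma,s}_{p,2}}\le C\langle t\rangle^{-\frac12(\sigma-\sigma_1)},\qquad c\langle t\rangle^{-\frac12(\sigma'-\sigma_1)-\frac12}\le\|\{\mathbf I-\mathbf P\}V(t)\|_{\dot{\mathbb B}^{\sigma',s}_{p,2}}\le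 C\langle t\rangle^{-\frac12(\sigma'-\sigma_1)-\frac12},$$ if and only if $\Psi_0^\ell\in\dot{\mathcal B}^{\sigma_1}_{p,\infty}$. -/

import Mathlib

open MeasureTheory Filter Topology
open scoped ENNReal SchwartzMap LineDeriv

namespace DissipativeSystem

noncomputable section

/-- The physical (and frequency) space `ℝ^d` with its Euclidean norm. -/
abbrev Space (d : ℕ) : Type := EuclideanSpace ℝ (Fin d)

/-- Scalar tempered distributions on `ℝ^d`. Besov norms below do not change if a polynomial is
added to a distribution, so the elements of `𝓢'/polynomials` are handled through
representatives. -/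
abbrev TDist (d : ℕ) : Type := 𝓢'(Space d, ℂ)

/-- The `i`-th vector of the canonical basis of `ℝ^d`. -/
def basisVec {d : ℕ} (i : Fin d) : Space d := EuclideanSpace.single i 1

/-- The partial derivative `∂_{x_i} u` of a tempered distribution. -/
def partialDeriv {d : ℕ} (i : Fin d) (u : TDist d) : TDist d := ∂_{basisVec i} u

/-- The Fourier multiplier `m(D) u`, `D = -i∇`, i.e. multiplication by `m(ξ)` for the Fourier
transform with kernel `e^{-i x·ξ}`. Mathlib's Fourier transform has the kernel `e^{-2πi x·ξ}`, hence
the dilation by `2π`. -/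
def multiplier {d : ℕ} (m : Space d → ℂ) (u : TDist d) : TDist d :=
  TemperedDistribution.fourierMultiplierCLM ℂ (fun ξ : Space d => m ((2 * Real.pi) • ξ)) u

/-- The `L^p` norm of a tempered distribution; it is `∞` if `u` is not given by a function
in `L^p`. -/
def distLpNorm {d : ℕ} (p : ℝ≥0∞) (u : TDist d) : ℝ≥0∞ :=
  ⨅ (f : Space d → ℂ)
    (_ : MemLp f p volume ∧ ∀ φ : 𝓢(Space d, ℂ), u φ = ∫ x, φ x * f x), eLpNorm f p volume

/-! ### Littlewood-Paley theory -/

/-- `χ` is a smooth radial non-increasing cut-off, compactly supported in `B(0, 4/3)` and equal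
to `1` on `B(0, 3/4)`. -/
structure IsCutoff {d : ℕ} (χ : Space d → ℝ) : Prop where
  smooth : ContDiff ℝ (⊤ : ℕ∞) χ
  radial_noninc : ∀ x y : Space d, ‖x‖ ≤ ‖y‖ → χ y ≤ χ x
  tsupport_subset : tsupport χ ⊆ Metric.ball 0 (4 / 3)
  eq_one : ∀ x ∈ Metric.ball (0 : Space d) (3 / 4), χ x = 1

/-- `φ(ξ) = χ(ξ/2) - χ(ξ)`. -/
def annulusBump {d : ℕ} (χ : Space d → ℝ) (ξ : Space d) : ℝ := χ ((1 / 2 : ℝ) • ξ) - χ ξ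

/-- The homogeneous dyadic block `Δ̇_j u = φ(2^{-j} D) u`. -/
def dyadicBlock {d : ℕ} (χ : Space d → ℝ) (j : ℤ) (u : TDist d) : TDist d :=
  multiplier (fun ξ => (annulusBump χ ((2 : ℝ) ^ (-j) • ξ) : ℂ)) u

/-- The low-frequency part `u^ℓ = ∑_{j ≤ J - 1} Δ̇_j u` of a vector of distributions. The symbols
`φ(2^{-j} ξ)`, `j ≤ J - 1`, telescope to `χ(2^{-J} ξ)` for `ξ ≠ 0`, so `u^ℓ = χ(2^{-J} D) u` modulo
polynomials. -/
def lowFreq {d : ℕ} {ι : Type} (χ : Space d → ℝ) (J : ℤ) (u : ι → TDist d) : ι → TDist d :=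
  fun a => multiplier (fun ξ => (χ ((2 : ℝ) ^ (-J) • ξ) : ℂ)) (u a)

/-- The high-frequency part `u^h = u - u^ℓ`. -/
def highFreq {d : ℕ} {ι : Type} (χ : Space d → ℝ) (J : ℤ) (u : ι → TDist d) : ι → TDist d :=
  fun a => u a - lowFreq χ J u a

/-- `2^{jσ} ‖Δ̇_j u‖_{L^p}`. -/
def weightedBlock {d : ℕ} (χ : Space d → ℝ) (σ : ℝ) (p : ℝ≥0∞) (j : ℤ) (u : TDist d) : ℝ≥0∞ :=
  ENNReal.ofReal ((2 : ℝ) ^ ((j : ℝ) * σ)) * distLpNorm p (dyadicBlock χ j u)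

/-- The norm of `Ḃ^σ_{p,1}`; the norm of a vector is the sum of the norms of its components. -/
def besovNormOne {d : ℕ} {ι : Type} [Fintype ι] (χ : Space d → ℝ) (σ : ℝ) (p : ℝ≥0∞)
    (u : ι → TDist d) : ℝ≥0∞ :=
  ∑ a, ∑' j : ℤ, weightedBlock χ σ p j (u a)

/-- The norm of `Ḃ^σ_{p,∞}`. -/
def besovNormInf {d : ℕ} {ι : Type} [Fintype ι] (χ : Space d → ℝ) (σ : ℝ) (p : ℝ≥0∞)
    (u : ι → TDist d) : ℝ≥0∞ :=
  ∑ a, ⨆ j : ℤ, weightedBlock χ σ p j (u a)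

/-- The high-frequency norm `‖u‖^h_{Ḃ^s_{2,1}} = ∑_{j ≥ J - 1} 2^{js} ‖Δ̇_j u‖_{L^2}`. -/
def highNorm {d : ℕ} {ι : Type} [Fintype ι] (χ : Space d → ℝ) (J : ℤ) (s : ℝ)
    (u : ι → TDist d) : ℝ≥0∞ :=
  ∑ a, ∑' j : Set.Ici (J - 1), weightedBlock χ s 2 j (u a)

/-- The hybrid norm `‖u^ℓ‖_{Ḃ^σ_{p,1}} + ‖u‖^h_{Ḃ^s_{2,1}}`. -/
def hybridNorm {d : ℕ} {ι : Type} [Fintype ι] (χ : Space d → ℝ) (J : ℤ) (σ s : ℝ) (p : ℝ≥0∞)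
    (u : ι → TDist d) : ℝ≥0∞ :=
  besovNormOne χ σ p (lowFreq χ J u) + highNorm χ J s u

/-- `u ∈ Ḃ^σ_{p,∞}` (as a class modulo polynomials). -/
def MemBesovInf {d : ℕ} {ι : Type} [Fintype ι] (χ : Space d → ℝ) (σ : ℝ) (p : ℝ≥0∞)
    (u : ι → TDist d) : Prop :=
  besovNormInf χ σ p u < ⊤

/-- The subset of those `u ∈ Ḃ^σ_{p,∞}` for which there are `c, M > 0` and integers
`j_k → -∞` with `|j_k - j_{k+1}| ≤ M` and `2^{σ j_k} ‖Δ̇_{j_k} u‖_{L^p} ≥ c`. -/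
def MemBesovInfLower {d : ℕ} {ι : Type} [Fintype ι] (χ : Space d → ℝ) (σ : ℝ) (p : ℝ≥0∞)
    (u : ι → TDist d) : Prop :=
  MemBesovInf χ σ p u ∧
    ∃ c M : ℝ, 0 < c ∧ 0 < M ∧ ∃ j : ℕ → ℤ, Tendsto j atTop atBot ∧
      (∀ k, |(j k : ℝ) - (j (k + 1) : ℝ)| ≤ M) ∧
      ∀ k, ENNReal.ofReal c ≤ ∑ a, weightedBlock χ σ p (j k) (u a)

/-! ### The partially dissipative system `∂_t V + ∑ A^i ∂_{x_i} V + L V = 0` -/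

/-- `L = diag(0, D)`. -/
def dampingMatrix {n₁ n₂ : ℕ} (D : Matrix (Fin n₂) (Fin n₂) ℝ) :
    Matrix (Fin n₁ ⊕ Fin n₂) (Fin n₁ ⊕ Fin n₂) ℝ :=
  Matrix.fromBlocks 0 0 0 D

/-- The standing structural assumptions: the `A^i` are symmetric with vanishing upper left block,
`D` is symmetric positive definite, and the Shizuta-Kawashima stability condition holds. -/
structure IsPartiallyDissipative {d n₁ n₂ : ℕ}
    (A : Fin d → Matrix (Fin n₁ ⊕ Fin n₂) (Fin n₁ ⊕ Fin n₂) ℝ)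
    (D : Matrix (Fin n₂) (Fin n₂) ℝ) : Prop where
  symm : ∀ i, (A i).IsSymm
  block₁₁ : ∀ i, (A i).toBlocks₁₁ = 0
  posDef : D.PosDef
  shizuta_kawashima : ∀ (φ : Fin n₁ ⊕ Fin n₂ → ℝ) (l : ℝ) (ω : Space d), ‖ω‖ = 1 →
    (dampingMatrix D).mulVec φ = 0 →
    l • φ + (∑ i, ω i • A i).mulVec φ = 0 → φ = 0

/-- The conservative part `P V = (V_1, 0)`. -/
def projP {d n₁ n₂ : ℕ} (u : Fin n₁ ⊕ Fin n₂ → TDist d) : Fin n₁ ⊕ Fin n₂ → TDist d :=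
  Sum.elim (fun a => u (Sum.inl a)) (fun _ => 0)

/-- The dissipative part `(I - P) V = (0, V_2)`. -/
def projIP {d n₁ n₂ : ℕ} (u : Fin n₁ ⊕ Fin n₂ → TDist d) : Fin n₁ ⊕ Fin n₂ → TDist d :=
  Sum.elim (fun _ => 0) (fun b => u (Sum.inr b))

/-- `(∑ A^i ∂_{x_i} + L) u`. -/
def spatialOp {d n₁ n₂ : ℕ} (A : Fin d → Matrix (Fin n₁ ⊕ Fin n₂) (Fin n₁ ⊕ Fin n₂) ℝ)
    (D : Matrix (Fin n₂) (Fin n₂) ℝ) (u : Fin n₁ ⊕ Fin n₂ → TDist d) :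
    Fin n₁ ⊕ Fin n₂ → TDist d :=
  fun a => ∑ i, ∑ b, ((A i a b : ℝ) : ℂ) • partialDeriv i (u b) +
    ∑ b, ((dampingMatrix D a b : ℝ) : ℂ) • u b

/-- `V` solves the Cauchy problem on `[0, ∞)` in the sense of tempered distributions:
`V(0) = V_0`, and tested against any Schwartz function, `V` is differentiable in time on `[0, ∞)`
with `∂_t V = -(∑ A^i ∂_{x_i} V + L V)`. -/
structure IsSolution {d n₁ n₂ : ℕ} (A : Fin d → Matrix (Fin n₁ ⊕ Fin n₂) (Fin n₁ ⊕ Fin n₂) ℝ)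
    (D : Matrix (Fin n₂) (Fin n₂) ℝ) (V₀ : Fin n₁ ⊕ Fin n₂ → TDist d)
    (V : ℝ → Fin n₁ ⊕ Fin n₂ → TDist d) : Prop where
  initial : V 0 = V₀
  equation : ∀ t : ℝ, 0 ≤ t → ∀ (a : Fin n₁ ⊕ Fin n₂) (φ : 𝓢(Space d, ℂ)),
    HasDerivWithinAt (fun τ : ℝ => V τ a φ) (-(spatialOp A D (V t) a φ)) (Set.Ici 0) t

/-! ### The effective quantity and the diffusive profile -/

/-- `Ψ_0 = V_{1,0} - ∑ A^i_{1,2} D^{-1} ∂_{x_i} V_{2,0}`. -/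
def effective {d n₁ n₂ : ℕ} (A : Fin d → Matrix (Fin n₁ ⊕ Fin n₂) (Fin n₁ ⊕ Fin n₂) ℝ)
    (D : Matrix (Fin n₂) (Fin n₂) ℝ) (V₀ : Fin n₁ ⊕ Fin n₂ → TDist d) : Fin n₁ → TDist d :=
  fun a => V₀ (Sum.inl a) -
    ∑ i, ∑ b, ((((A i).toBlocks₁₂ * D⁻¹) a b : ℝ) : ℂ) • partialDeriv i (V₀ (Sum.inr b))

/-- The symbol `-∑_{i,l} A^i_{1,2} D^{-1} A^l_{2,1} ξ_i ξ_l` of the operator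
`𝒜 = ∑_{i,l} A^i_{1,2} D^{-1} A^l_{2,1} ∂²_{x_i x_l}`. -/
def diffusionSymbol {d n₁ n₂ : ℕ} (A : Fin d → Matrix (Fin n₁ ⊕ Fin n₂) (Fin n₁ ⊕ Fin n₂) ℝ)
    (D : Matrix (Fin n₂) (Fin n₂) ℝ) (ξ : Space d) : Matrix (Fin n₁) (Fin n₁) ℝ :=
  -∑ i, ∑ l, (ξ i * ξ l) • ((A i).toBlocks₁₂ * D⁻¹ * (A l).toBlocks₂₁)

/-- The semigroup `e^{t𝒜}` of the parabolic system `∂_t v = 𝒜 v`, for `t ≥ 0`. -/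
def diffusionFlow {d n₁ n₂ : ℕ} (A : Fin d → Matrix (Fin n₁ ⊕ Fin n₂) (Fin n₁ ⊕ Fin n₂) ℝ)
    (D : Matrix (Fin n₂) (Fin n₂) ℝ) (t : ℝ) (w : Fin n₁ → TDist d) : Fin n₁ → TDist d :=
  fun a => ∑ b, multiplier
    (fun ξ => ((NormedSpace.exp (t • diffusionSymbol A D ξ) a b : ℝ) : ℂ)) (w b)

/-- The profile `V^* = (e^{t𝒜} Ψ_0, -∑ D^{-1} A^i_{2,1} ∂_{x_i} e^{t𝒜} Ψ_0)`. -/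
def profile {d n₁ n₂ : ℕ} (A : Fin d → Matrix (Fin n₁ ⊕ Fin n₂) (Fin n₁ ⊕ Fin n₂) ℝ)
    (D : Matrix (Fin n₂) (Fin n₂) ℝ) (V₀ : Fin n₁ ⊕ Fin n₂ → TDist d) (t : ℝ) :
    Fin n₁ ⊕ Fin n₂ → TDist d :=
  Sum.elim (diffusionFlow A D t (effective A D V₀))
    (fun b => -∑ i, ∑ a, (((D⁻¹ * (A i).toBlocks₂₁) b a : ℝ) : ℂ) •
      partialDeriv i (diffusionFlow A D t (effective A D V₀) a))

/-- The rate `C ⟨t⟩^{-θ}`, `⟨t⟩ = √(1 + t²)`, as an extended nonnegative real. -/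
def rate (C θ t : ℝ) : ℝ≥0∞ := ENNReal.ofReal (C * Real.sqrt (1 + t ^ 2) ^ (-θ))

end

end DissipativeSystem

/-! The estimates are proved on each dyadic block and then summed. Dilation by `l = 2^j` moves block
`j` to unit frequency. There the symbols may be changed off the annulus without affecting the block,
and they are replaced by matrix symbols that are smooth and constant near infinity. Such symbols act
boundedly on `L^p`, and `opMat` is an algebra homomorphism on them. The class is stable under smooth
functional calculus, in particular under exponentials (`opMat_exp`) and under inversion of pointwise
invertible symbols (`SymbolMatrix.inv`). So the `L^p` spectrum is controlled by pointwise spectra.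
If `H` is uniformly accretive, then `w - e^{-H(D)}` is invertible for `|w| ≥ 1`; the spectral radius
of `e^{-H(D)}` is below one and the semigroup decays exponentially, for every `1 < p < ∞` and
without kernel estimates (`exists_norm_exp_opMat_le_half`).

Low frequencies. The Shizuta-Kawashima condition with `λ = 0` on vectors `(φ₁, 0)` says that
`A_{21}(ξ)` is injective for `ξ ≠ 0`. As `A_{12} = A_{21}^*`, the diffusion symbol `A_{12} D⁻¹
A_{21}` is coercive (`exists_gSymbol_accretive`). For small `l` there are bounded operators `X`, `Y`
solving a Riccati and a Sylvester equation (`exists_decoupling`), and the unknowns `w = v₂ + i l X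
v₁`, `z = v₁ - i l Y w` decouple the system exactly. The mode `w` decays like `e^{-ct}`; the mode
`z` follows a semigroup in the time `l² t` whose generator is within `O(l)` of the diffusion
operator, because `X = D⁻¹ a₂₁ + O(l)`. Comparing the two semigroups gives `exists_block_decay`:
solution and profile differ by one more power of `l`, up to terms of size `e^{-ct}`. This power is
the extra `t^{-1/2}` in the asymptotics.

High frequencies. The energy dissipates only `v₂`; a small multiple of `Im ⟨A_{21} v₁, v₂⟩` added to
it recovers `v₁`, uniformly for `|ξ| ≥ r` (`lyapunov_decay`), and Plancherel turns this into
exponential decay of the `L²` blocks.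

Since the solution is only a family of tempered distributions, the formula `e^{-tE(D)} V₀` has to be
derived from the equation. After a frequency cut-off a Taylor expansion in time converges, because
the cut-off powers of the symbol divided by `√k!` form a bounded sequence of Schwartz functions and
the uniform boundedness principle controls the remainder (`multiplier_eq_matMul_exp`).

What remains concerns sequences of block norms (`FlowBlocks`). The sum of `2^{jα} e^{-c 4^j t}` over
`j` is of order `t^{-α/2}`, so bounded data blocks give the upper bounds and the asymptotics.
Conversely, at the time `t = 4^{-j}` the heat flow changes block `j` only by a constant factor, so
the decay rate bounds the data; the coupling error carries a factor `2^j` and is absorbed when the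
threshold is low (`exists_N₁_le`). For lower bounds, at time `t` essentially only the blocks with
`4^j t` of order one contribute. A lower bound valid at all large times therefore means that blocks
of `Ψ₀` stay away from zero along indices with bounded gaps (`exists_lower_S`, `exists_blocks`). -/

set_option linter.unusedSectionVars false
set_option linter.unusedSimpArgs false

namespace DissipativeSystem

noncomputable section

/-! ### The `L^p` norm of a tempered distribution -/

section DistLpNorm

variable {d : ℕ} {p : ℝ≥0∞} [hp : Fact (1 ≤ p)]

/-- The tempered distribution given by an `L^p` function. -/
abbrev toTD (f : Lp ℂ p (volume : Measure (Space d))) : TDist d := Lp.toTemperedDistribution f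

/-- A distribution has at most one `L^p` density. Hence the infimum in `distLpNorm` runs over at
most one a.e. class and equals the `L^p` norm of the density, or `∞`. -/
lemma toTD_injective :
    Function.Injective (toTD : Lp ℂ p (volume : Measure (Space d)) → TDist d) := by
  have h := LinearMap.ker_eq_bot.1
    (Lp.ker_toTemperedDistributionCLM_eq_bot (F := ℂ) (μ := (volume : Measure (Space d))) (p := p))
  exact h

lemma toTD_add (f g : Lp ℂ p (volume : Measure (Space d))) : toTD (f + g) = toTD f + toTD g :=
  map_add (Lp.toTemperedDistributionCLM ℂ volume p) f g

lemma toTD_sub (f g : Lp ℂ p (volume : Measure (Space d))) : toTD (f - g) = toTD f - toTD g :=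
  map_sub (Lp.toTemperedDistributionCLM ℂ volume p) f g

lemma toTD_smul (c : ℂ) (f : Lp ℂ p (volume : Measure (Space d))) :
    toTD (c • f) = c • toTD f :=
  map_smul (Lp.toTemperedDistributionCLM ℂ volume p) c f

lemma toTD_zero : toTD (0 : Lp ℂ p (volume : Measure (Space d))) = 0 :=
  map_zero (Lp.toTemperedDistributionCLM ℂ volume p)

lemma toTD_sum {ι : Type*} (s : Finset ι) (f : ι → Lp ℂ p (volume : Measure (Space d))) :
    toTD (∑ i ∈ s, f i) = ∑ i ∈ s, toTD (f i) :=
  map_sum (Lp.toTemperedDistributionCLM ℂ volume p) f s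

lemma toTD_toLp_eq_iff {u : TDist d} {f : Space d → ℂ} (hf : MemLp f p volume) :
    toTD (hf.toLp f) = u ↔ ∀ φ : 𝓢(Space d, ℂ), u φ = ∫ x, φ x * f x := by
  have key : ∀ φ : 𝓢(Space d, ℂ), toTD (hf.toLp f) φ = ∫ x, φ x * f x := fun φ => by
    rw [Lp.toTemperedDistribution_apply]
    refine integral_congr_ae ?_
    filter_upwards [hf.coeFn_toLp] with x hx
    rw [hx, smul_eq_mul]
  constructor
  · rintro rfl φ
    exact key φ
  · intro h
    ext φ
    rw [key, h]

lemma distLpNorm_toTD (f : Lp ℂ p (volume : Measure (Space d))) :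
    distLpNorm p (toTD f) = ‖f‖ₑ := by
  have h0 : ∀ φ : 𝓢(Space d, ℂ), toTD f φ = ∫ x, φ x * f x :=
    (toTD_toLp_eq_iff (Lp.memLp f)).1 (by rw [Lp.toLp_coeFn])
  rw [Lp.enorm_def]
  refine le_antisymm (iInf₂_le _ ⟨Lp.memLp f, h0⟩) (le_iInf₂ fun g hg => ?_)
  have : hg.1.toLp g = f := toTD_injective ((toTD_toLp_eq_iff hg.1).2 hg.2)
  rw [← this]
  exact (eLpNorm_congr_ae hg.1.coeFn_toLp).le

lemma exists_toTD_of_distLpNorm_lt_top {u : TDist d} (hu : distLpNorm p u < ⊤) :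
    ∃ f : Lp ℂ p (volume : Measure (Space d)), toTD f = u := by
  simp only [distLpNorm, iInf_lt_iff] at hu
  obtain ⟨f, hf, -⟩ := hu
  exact ⟨hf.1.toLp f, (toTD_toLp_eq_iff hf.1).2 hf.2⟩

lemma distLpNorm_zero : distLpNorm p (0 : TDist d) = 0 := by
  rw [← toTD_zero (p := p), distLpNorm_toTD, enorm_zero]

lemma distLpNorm_add_le (u v : TDist d) :
    distLpNorm p (u + v) ≤ distLpNorm p u + distLpNorm p v := by
  by_cases hu : distLpNorm p u < ⊤
  · by_cases hv : distLpNorm p v < ⊤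
    · obtain ⟨f, rfl⟩ := exists_toTD_of_distLpNorm_lt_top hu
      obtain ⟨g, rfl⟩ := exists_toTD_of_distLpNorm_lt_top hv
      rw [← toTD_add, distLpNorm_toTD, distLpNorm_toTD, distLpNorm_toTD]
      exact enorm_add_le f g
    · simp [not_lt_top_iff.1 hv]
  · simp [not_lt_top_iff.1 hu]

lemma distLpNorm_smul (c : ℂ) (hc : c ≠ 0) (u : TDist d) :
    distLpNorm p (c • u) = ‖c‖ₑ * distLpNorm p u := by
  have key : ∀ (c : ℂ), c ≠ 0 → ∀ u : TDist d,
      distLpNorm p (c • u) ≤ ‖c‖ₑ * distLpNorm p u := by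
    intro c hc u
    by_cases hu : distLpNorm p u < ⊤
    · obtain ⟨f, rfl⟩ := exists_toTD_of_distLpNorm_lt_top hu
      rw [← toTD_smul, distLpNorm_toTD, distLpNorm_toTD, enorm_smul]
    · rw [not_lt_top_iff.1 hu, ENNReal.mul_top (by simpa using hc)]
      exact le_top
  refine le_antisymm (key c hc u) ?_
  have h := key c⁻¹ (inv_ne_zero hc) (c • u)
  rw [inv_smul_smul₀ hc] at h
  calc ‖c‖ₑ * distLpNorm p u ≤ ‖c‖ₑ * (‖c⁻¹‖ₑ * distLpNorm p (c • u)) := by gcongr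
    _ = distLpNorm p (c • u) := by
      rw [← mul_assoc, ← enorm_mul, mul_inv_cancel₀ hc, enorm_one, one_mul]

lemma distLpNorm_neg (u : TDist d) : distLpNorm p (-u) = distLpNorm p u := by
  have := distLpNorm_smul (p := p) (-1 : ℂ) (by simp) u
  rwa [neg_one_smul ℂ u, enorm_neg, enorm_one, one_mul] at this

lemma distLpNorm_sub_le (u v : TDist d) :
    distLpNorm p (u - v) ≤ distLpNorm p u + distLpNorm p v := by
  rw [sub_eq_add_neg, ← distLpNorm_neg (p := p) v]
  exact distLpNorm_add_le u (-v)

lemma distLpNorm_sum_le {ι : Type*} (s : Finset ι) (u : ι → TDist d) :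
    distLpNorm p (∑ i ∈ s, u i) ≤ ∑ i ∈ s, distLpNorm p (u i) := by
  classical
  induction s using Finset.induction_on with
  | empty => simp [distLpNorm_zero]
  | insert a s ha ih =>
    rw [Finset.sum_insert ha, Finset.sum_insert ha]
    exact (distLpNorm_add_le _ _).trans (by gcongr)

/-- The norm of a finite vector of distributions: the sum of the `L^p` norms of the components. -/
def vecNorm {ι : Type*} [Fintype ι] (p : ℝ≥0∞) (u : ι → TDist d) : ℝ≥0∞ :=
  ∑ a, distLpNorm p (u a)

variable {ι : Type*} [Fintype ι]

omit hp in
lemma distLpNorm_le_vecNorm (u : ι → TDist d) (a : ι) : distLpNorm p (u a) ≤ vecNorm p u :=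
  Finset.single_le_sum (f := fun a => distLpNorm p (u a)) (fun _ _ => zero_le) (Finset.mem_univ a)

lemma vecNorm_add_le (u v : ι → TDist d) : vecNorm p (u + v) ≤ vecNorm p u + vecNorm p v := by
  rw [vecNorm, vecNorm, vecNorm, ← Finset.sum_add_distrib]
  exact Finset.sum_le_sum fun a _ => distLpNorm_add_le _ _

lemma vecNorm_sub_le (u v : ι → TDist d) : vecNorm p (u - v) ≤ vecNorm p u + vecNorm p v := by
  rw [vecNorm, vecNorm, vecNorm, ← Finset.sum_add_distrib]
  exact Finset.sum_le_sum fun a _ => distLpNorm_sub_le _ _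

lemma exists_toTD_of_vecNorm_lt_top {u : ι → TDist d} (hu : vecNorm p u < ⊤) :
    ∃ f : ι → Lp ℂ p (volume : Measure (Space d)), u = fun a => toTD (f a) := by
  have h : ∀ a, ∃ f : Lp ℂ p (volume : Measure (Space d)), toTD f = u a := fun a =>
    exists_toTD_of_distLpNorm_lt_top ((distLpNorm_le_vecNorm u a).trans_lt hu)
  choose f hf using h
  exact ⟨f, funext fun a => (hf a).symm⟩

/-- Products of `L^p` carry the sup norm while `vecNorm` is a sum. This bound and the next pass
between the two, so that operator norms can be used on vectors. -/
lemma vecNorm_toTD_le (f : ι → Lp ℂ p (volume : Measure (Space d))) :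
    vecNorm p (fun a => toTD (f a)) ≤ Fintype.card ι * ‖f‖ₑ := by
  simp only [vecNorm, distLpNorm_toTD]
  refine (Finset.sum_le_card_nsmul _ _ ‖f‖ₑ fun a _ => ?_).trans (by simp)
  rw [← ofReal_norm, ← ofReal_norm]
  exact ENNReal.ofReal_le_ofReal (norm_le_pi_norm f a)

lemma enorm_le_vecNorm_toTD (f : ι → Lp ℂ p (volume : Measure (Space d))) :
    ‖f‖ₑ ≤ vecNorm p (fun a => toTD (f a)) := by
  simp only [vecNorm, distLpNorm_toTD]
  rw [← ofReal_norm]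
  simp_rw [← ofReal_norm (E := Lp ℂ p (volume : Measure (Space d)))]
  rw [← ENNReal.ofReal_sum_of_nonneg fun _ _ => norm_nonneg _]
  refine ENNReal.ofReal_le_ofReal ((pi_norm_le_iff_of_nonneg
    (Finset.sum_nonneg fun _ _ => norm_nonneg _)).2 fun a => ?_)
  exact Finset.single_le_sum (f := fun a => ‖f a‖) (fun _ _ => norm_nonneg _) (Finset.mem_univ a)

end DistLpNorm

/-! ### Algebra of Fourier multipliers -/

section Multipliers

variable {d : ℕ}

lemma hasTemperateGrowth_comp_smul {F : Type*} [NormedAddCommGroup F] [NormedSpace ℝ F]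
    {m : Space d → F} (hm : m.HasTemperateGrowth) (c : ℝ) :
    (fun ξ : Space d => m (c • ξ)).HasTemperateGrowth :=
  hm.comp (g := m) (f := fun ξ : Space d => c • ξ)
    (ContinuousLinearMap.hasTemperateGrowth (c • ContinuousLinearMap.id ℝ (Space d)))

lemma hasTemperateGrowth_coord_complex (i : Fin d) :
    (fun ξ : Space d => ((ξ i : ℝ) : ℂ)).HasTemperateGrowth :=
  (Complex.ofRealCLM.comp (EuclideanSpace.proj (𝕜 := ℝ) i)).hasTemperateGrowth

lemma multiplier_map_sub (m : Space d → ℂ) (u v : TDist d) :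
    multiplier m (u - v) = multiplier m u - multiplier m v := map_sub _ u v

lemma multiplier_map_neg (m : Space d → ℂ) (u : TDist d) :
    multiplier m (-u) = -multiplier m u := map_neg _ u

lemma multiplier_map_zero (m : Space d → ℂ) : multiplier m (0 : TDist d) = 0 := map_zero _

lemma multiplier_map_sum {ι : Type*} (m : Space d → ℂ) (s : Finset ι) (u : ι → TDist d) :
    multiplier m (∑ i ∈ s, u i) = ∑ i ∈ s, multiplier m (u i) := map_sum _ u s

lemma multiplier_multiplier {m₁ m₂ : Space d → ℂ} (h₁ : m₁.HasTemperateGrowth)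
    (h₂ : m₂.HasTemperateGrowth) (u : TDist d) :
    multiplier m₁ (multiplier m₂ u) = multiplier (fun ξ => m₁ ξ * m₂ ξ) u := by
  rw [multiplier, multiplier, TemperedDistribution.fourierMultiplierCLM_fourierMultiplierCLM_apply
    (hasTemperateGrowth_comp_smul h₂ _) (hasTemperateGrowth_comp_smul h₁ _), multiplier]
  congr 2
  ext ξ
  simp [mul_comm]

lemma multiplier_const (c : ℂ) (u : TDist d) : multiplier (fun _ => c) u = c • u := by
  rw [multiplier, TemperedDistribution.fourierMultiplierCLM_const]
  rfl

lemma multiplier_add {m₁ m₂ : Space d → ℂ} (h₁ : m₁.HasTemperateGrowth)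
    (h₂ : m₂.HasTemperateGrowth) (u : TDist d) :
    multiplier (fun ξ => m₁ ξ + m₂ ξ) u = multiplier m₁ u + multiplier m₂ u := by
  have h : ∀ i ∈ (Finset.univ : Finset (Fin 2)),
      (![fun ξ : Space d => m₁ ((2 * Real.pi) • ξ),
        fun ξ => m₂ ((2 * Real.pi) • ξ)] i).HasTemperateGrowth := by
    intro i _
    fin_cases i
    · exact hasTemperateGrowth_comp_smul h₁ _
    · exact hasTemperateGrowth_comp_smul h₂ _
  have := TemperedDistribution.fourierMultiplierCLM_sum ℂ h
  simp only [Fin.sum_univ_two, Matrix.cons_val_zero, Matrix.cons_val_one] at this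
  simp only [multiplier]
  rw [this]
  rfl

lemma multiplier_const_mul {m : Space d → ℂ} (hm : m.HasTemperateGrowth) (c : ℂ) (u : TDist d) :
    multiplier (fun ξ => c * m ξ) u = c • multiplier m u := by
  rw [← multiplier_const c, multiplier_multiplier (.const c) hm]

lemma multiplier_zero (u : TDist d) : multiplier (fun _ => 0) u = 0 := by
  rw [multiplier_const, zero_smul ℂ u]

lemma multiplier_sum {ι : Type*} (s : Finset ι) {m : ι → Space d → ℂ}
    (h : ∀ i ∈ s, (m i).HasTemperateGrowth) (u : TDist d) :
    multiplier (fun ξ => ∑ i ∈ s, m i ξ) u = ∑ i ∈ s, multiplier (m i) u := by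
  classical
  induction s using Finset.induction_on with
  | empty => simpa using multiplier_zero u
  | insert a s ha ih =>
    simp only [Finset.sum_insert ha]
    rw [multiplier_add (h a (Finset.mem_insert_self a s))
      (.sum fun i hi => h i (Finset.mem_insert_of_mem hi)),
      ih fun i hi => h i (Finset.mem_insert_of_mem hi)]

/-- The factor `2π` in the derivative rule for the kernel `e^{-2πi x·ξ}` is the dilation built into
`multiplier`, which leaves the symbol `iξ_i`. -/
lemma partialDeriv_eq_multiplier (i : Fin d) (u : TDist d) :
    partialDeriv i u = multiplier (fun ξ => Complex.I * (ξ i : ℂ)) u := by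
  rw [multiplier_const_mul (hasTemperateGrowth_coord_complex i), partialDeriv,
    TemperedDistribution.lineDeriv_eq_fourierMultiplierCLM]
  have h1 : (fun ξ : Space d => ((inner ℝ ξ (basisVec i) : ℝ) : ℂ)) =
      fun ξ => ((ξ i : ℝ) : ℂ) := by
    ext ξ
    simp [basisVec, EuclideanSpace.inner_single_right]
  rw [h1, multiplier]
  have h2 : (fun ξ : Space d => ((((2 * Real.pi) • ξ) i : ℝ) : ℂ)) =
      ((2 * Real.pi : ℝ) : ℂ) • fun ξ : Space d => ((ξ i : ℝ) : ℂ) := by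
    ext ξ
    simp
  rw [h2, TemperedDistribution.fourierMultiplierCLM_smul (hasTemperateGrowth_coord_complex i)]
  rw [smul_apply, smul_smul]
  congr 1
  push_cast
  ring

/-- The matrix Fourier multiplier `M(D)`, acting on vectors of distributions. -/
def matMul {ι κ : Type*} [Fintype κ] (M : Space d → Matrix ι κ ℂ) (u : κ → TDist d) :
    ι → TDist d :=
  fun a => ∑ b, multiplier (fun ξ => M ξ a b) (u b)

/-- All entries of a matrix symbol are of temperate growth. -/
def TemperateMatrix {ι κ : Type*} (M : Space d → Matrix ι κ ℂ) : Prop :=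
  ∀ a b, (fun ξ => M ξ a b).HasTemperateGrowth

variable {ι κ μ : Type*} [Fintype ι] [Fintype κ] [Fintype μ]

omit [Fintype ι] [Fintype μ] in
lemma TemperateMatrix.mul {M : Space d → Matrix ι κ ℂ} {N : Space d → Matrix κ μ ℂ}
    (hM : TemperateMatrix M) (hN : TemperateMatrix N) : TemperateMatrix fun ξ => M ξ * N ξ :=
  fun a b => by
    simp only [Matrix.mul_apply]
    exact .sum fun i _ => (hM a i).mul (hN i b)

omit [Fintype ι] [Fintype κ] in
lemma TemperateMatrix.add {M N : Space d → Matrix ι κ ℂ}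
    (hM : TemperateMatrix M) (hN : TemperateMatrix N) : TemperateMatrix fun ξ => M ξ + N ξ :=
  fun a b => (hM a b).add (hN a b)

omit [Fintype ι] [Fintype κ] in
lemma TemperateMatrix.smul {m : Space d → ℂ} {M : Space d → Matrix ι κ ℂ}
    (hm : m.HasTemperateGrowth) (hM : TemperateMatrix M) : TemperateMatrix fun ξ => m ξ • M ξ :=
  fun a b => hm.mul (hM a b)

omit [Fintype ι] [Fintype κ] in
lemma TemperateMatrix.const (M : Matrix ι κ ℂ) : TemperateMatrix fun _ : Space d => M :=
  fun _ _ => .const _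

omit [Fintype ι] [Fintype μ] in
lemma matMul_matMul {M : Space d → Matrix ι κ ℂ} {N : Space d → Matrix κ μ ℂ} [Fintype μ]
    (hM : TemperateMatrix M) (hN : TemperateMatrix N) (u : μ → TDist d) :
    matMul M (matMul N u) = matMul (fun ξ => M ξ * N ξ) u := by
  ext1 a
  simp only [matMul, multiplier_map_sum, Matrix.mul_apply]
  rw [Finset.sum_comm]
  refine Finset.sum_congr rfl fun c _ => ?_
  rw [multiplier_sum _ (m := fun i ξ => M ξ a i * N ξ i c) fun i _ => (hM a i).mul (hN i c)]
  exact Finset.sum_congr rfl fun b _ => multiplier_multiplier (hM a b) (hN b c) _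

omit [Fintype ι] in
lemma matMul_add {M N : Space d → Matrix ι κ ℂ} (hM : TemperateMatrix M)
    (hN : TemperateMatrix N) (u : κ → TDist d) :
    matMul (fun ξ => M ξ + N ξ) u = matMul M u + matMul N u := by
  ext1 a
  simp only [matMul, Matrix.add_apply, Pi.add_apply, ← Finset.sum_add_distrib]
  exact Finset.sum_congr rfl fun b _ => multiplier_add (hM a b) (hN a b) _

omit [Fintype ι] in
lemma matMul_const_smul (c : ℂ) {M : Space d → Matrix ι κ ℂ} (hM : TemperateMatrix M)
    (u : κ → TDist d) : matMul (fun ξ => c • M ξ) u = c • matMul M u := by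
  ext1 a
  simp only [matMul, Matrix.smul_apply, smul_eq_mul, Pi.smul_apply, Finset.smul_sum]
  exact Finset.sum_congr rfl fun b _ => multiplier_const_mul (hM a b) _ _

omit [Fintype ι] in
lemma matMul_neg {M : Space d → Matrix ι κ ℂ} (hM : TemperateMatrix M)
    (u : κ → TDist d) : matMul (fun ξ => -M ξ) u = -matMul M u := by
  have := matMul_const_smul (-1) hM u
  simp only [neg_one_smul] at this
  rw [this]
  ext1 a
  exact neg_one_smul ℂ (matMul M u a)

lemma matMul_one [DecidableEq ι] (u : ι → TDist d) : matMul (fun _ => (1 : Matrix ι ι ℂ)) u = u := by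
  ext1 a
  simp only [matMul, multiplier_const]
  rw [Finset.sum_eq_single a]
  · rw [Matrix.one_apply_eq, one_smul ℂ]
  · intro b _ hb
    rw [Matrix.one_apply_ne hb.symm]
    exact zero_smul ℂ (u b)
  · simp

omit [Fintype ι] in
lemma multiplier_matMul {m : Space d → ℂ} {M : Space d → Matrix ι κ ℂ}
    (hm : m.HasTemperateGrowth) (hM : TemperateMatrix M) (u : κ → TDist d) (a : ι) :
    multiplier m (matMul M u a) = matMul (fun ξ => m ξ • M ξ) u a := by
  simp only [matMul, multiplier_map_sum]
  exact Finset.sum_congr rfl fun b _ => multiplier_multiplier hm (hM a b) _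

omit [Fintype ι] in
lemma matMul_multiplier {m : Space d → ℂ} {M : Space d → Matrix ι κ ℂ}
    (hm : m.HasTemperateGrowth) (hM : TemperateMatrix M) (u : κ → TDist d) :
    matMul M (fun b => multiplier m (u b)) = matMul (fun ξ => m ξ • M ξ) u := by
  ext1 a
  refine Finset.sum_congr rfl fun b _ => ?_
  rw [multiplier_multiplier (hM a b) hm]
  simp [mul_comm]

end Multipliers

/-! ### Fourier multipliers on `L^p` with smooth symbols that are constant near infinity -/

section LpMultipliers

/-- Hölder's inequality for the measure `a dμ`, applied to `b` and `1` with conjugate exponents `r`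
and `r'`; the power `r - 1` is `r / r'`. -/
lemma lintegral_mul_rpow_le {α : Type*} [MeasurableSpace α] {μ : Measure α} {r : ℝ} (hr : 1 < r)
    {a b : α → ℝ≥0∞} (ha : Measurable a) (hb : Measurable b) :
    (∫⁻ x, a x * b x ∂μ) ^ r ≤ (∫⁻ x, a x ∂μ) ^ (r - 1) * ∫⁻ x, a x * b x ^ r ∂μ := by
  have hq := Real.HolderConjugate.conjExponent hr
  have h := ENNReal.lintegral_mul_le_Lp_mul_Lq (μ.withDensity a) hq hb.aemeasurable
    (g := fun _ => 1) aemeasurable_const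
  have h1 : (∫⁻ x, a x * b x ∂μ) = ∫⁻ x, (b * (fun _ => 1 : α → ℝ≥0∞)) x ∂(μ.withDensity a) := by
    rw [lintegral_withDensity_eq_lintegral_mul _ ha (by fun_prop)]
    simp
  have h2 : (∫⁻ x, a x * b x ^ r ∂μ) = ∫⁻ x, b x ^ r ∂(μ.withDensity a) := by
    rw [lintegral_withDensity_eq_lintegral_mul _ ha (by fun_prop)]
    simp
  have h3 : (∫⁻ x, a x ∂μ) = ∫⁻ x, (1 : ℝ≥0∞) ^ r.conjExponent ∂(μ.withDensity a) := by
    rw [lintegral_withDensity_eq_lintegral_mul _ ha (by fun_prop)]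
    simp
  rw [h1, h2, h3]
  refine (ENNReal.rpow_le_rpow h (by linarith)).trans ?_
  rw [ENNReal.mul_rpow_of_nonneg _ _ (by linarith), ← ENNReal.rpow_mul, ← ENNReal.rpow_mul,
    one_div_mul_cancel (by linarith), ENNReal.rpow_one, mul_comm]
  have h4 : 1 / r.conjExponent * r = r - 1 := by
    rw [Real.conjExponent]
    field_simp
  rw [h4]

variable {d : ℕ} {p : ℝ≥0∞}

/-- Young's inequality `‖k ⋆ f‖_p ≤ ‖k‖_1 ‖f‖_p` for Schwartz functions. -/
lemma eLpNorm_schwartz_convolution_le (hp₁ : 1 < p) (hp₂ : p < ⊤) (k f : 𝓢(Space d, ℂ)) :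
    eLpNorm (SchwartzMap.convolution (ContinuousLinearMap.mul ℂ ℂ) k f) p volume ≤
      (∫⁻ y, ‖k y‖ₑ) * eLpNorm f p volume := by
  have hp0 : p ≠ 0 := (zero_lt_one.trans hp₁).ne'
  have hr : 1 < p.toReal := by
    rw [← ENNReal.toReal_one]
    exact (ENNReal.toReal_lt_toReal (by simp) hp₂.ne).2 hp₁
  have hr0 : 0 < p.toReal := by linarith
  set r := p.toReal
  set K := ∫⁻ y, ‖k y‖ₑ
  rw [eLpNorm_eq_lintegral_rpow_enorm_toReal hp0 hp₂.ne,
    eLpNorm_eq_lintegral_rpow_enorm_toReal hp0 hp₂.ne]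
  have hk : Measurable fun y => ‖k y‖ₑ := k.continuous.enorm.measurable
  have hf2 : Measurable fun z : Space d × Space d => ‖k z.2‖ₑ * ‖f (z.1 - z.2)‖ₑ ^ r := by
    have h1 : Measurable fun z : Space d × Space d => ‖k z.2‖ₑ :=
      (k.continuous.comp continuous_snd).enorm.measurable
    have h2 : Measurable fun z : Space d × Space d => ‖f (z.1 - z.2)‖ₑ :=
      (f.continuous.comp (continuous_fst.sub continuous_snd)).enorm.measurable
    exact h1.mul (h2.pow_const _)
  have key : ∫⁻ x, ‖SchwartzMap.convolution (ContinuousLinearMap.mul ℂ ℂ) k f x‖ₑ ^ r ≤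
      K ^ r * ∫⁻ x, ‖f x‖ₑ ^ r := by
    calc ∫⁻ x, ‖SchwartzMap.convolution (ContinuousLinearMap.mul ℂ ℂ) k f x‖ₑ ^ r
        ≤ ∫⁻ x, K ^ (r - 1) * ∫⁻ y, ‖k y‖ₑ * ‖f (x - y)‖ₑ ^ r := by
          refine lintegral_mono fun x => ?_
          refine le_trans ?_ (lintegral_mul_rpow_le hr hk ?_)
          · refine ENNReal.rpow_le_rpow ?_ hr0.le
            rw [SchwartzMap.convolution_apply, convolution_def]
            refine (enorm_integral_le_lintegral_enorm _).trans (lintegral_mono fun y => ?_)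
            simp [enorm_mul]
          · exact (f.continuous.comp (continuous_const.sub continuous_id)).enorm.measurable
      _ = K ^ (r - 1) * ∫⁻ x, ∫⁻ y, ‖k y‖ₑ * ‖f (x - y)‖ₑ ^ r := by
          rw [lintegral_const_mul _ hf2.lintegral_prod_right']
      _ = K ^ (r - 1) * ∫⁻ y, ∫⁻ x, ‖k y‖ₑ * ‖f (x - y)‖ₑ ^ r := by
          rw [lintegral_lintegral_swap hf2.aemeasurable]
      _ = K ^ (r - 1) * ∫⁻ y, ‖k y‖ₑ * ∫⁻ x, ‖f x‖ₑ ^ r := by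
          congr 1
          refine lintegral_congr fun y => ?_
          have hm : Measurable fun x => ‖f (x - y)‖ₑ ^ r :=
            (f.continuous.comp (continuous_id.sub continuous_const)).enorm.measurable.pow_const _
          rw [lintegral_const_mul _ hm]
          rw [lintegral_sub_right_eq_self (fun x => ‖f x‖ₑ ^ r) y]
      _ = K ^ r * ∫⁻ x, ‖f x‖ₑ ^ r := by
          rw [lintegral_mul_const _ hk, ← mul_assoc]
          congr 1
          change K ^ (r - 1) * K = K ^ r
          -- Subtracting exponents needs `K` to be neither `0` nor `∞`; it is finite because `k` is
          -- integrable.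
          by_cases h0 : K = 0
          · rw [h0, ENNReal.zero_rpow_of_pos hr0, mul_zero]
          · have hK : K ≠ ⊤ := (k.integrable (μ := volume)).2.ne
            rw [ENNReal.rpow_sub _ _ h0 hK, ENNReal.rpow_one,
              ENNReal.div_mul_cancel h0 hK]
  refine (ENNReal.rpow_le_rpow key (by positivity)).trans ?_
  rw [ENNReal.mul_rpow_of_nonneg _ _ (by positivity), ← ENNReal.rpow_mul,
    mul_one_div_cancel hr0.ne', ENNReal.rpow_one]

open FourierTransform in
lemma fourierMultiplierCLM_schwartz_eq_convolution (g f : 𝓢(Space d, ℂ)) :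
    SchwartzMap.fourierMultiplierCLM ℂ (g : Space d → ℂ) f =
      SchwartzMap.convolution (ContinuousLinearMap.mul ℂ ℂ) (𝓕⁻ g) f := by
  rw [SchwartzMap.fourierMultiplierCLM_apply]
  simp only [SchwartzMap.convolution, LinearMap.coe_mk, AddHom.coe_mk,
    ContinuousLinearMap.comp_apply, FourierTransform.fourierCLM_apply,
    FourierTransform.fourierInvCLM_apply]
  congr 1
  ext ξ
  rw [SchwartzMap.smulLeftCLM_apply_apply g.hasTemperateGrowth]
  simp

/-- A smooth function that is constant outside a ball. -/
def IsSymbol {F : Type*} [NormedAddCommGroup F] [NormedSpace ℝ F] (m : Space d → F) : Prop :=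
  ContDiff ℝ (⊤ : ℕ∞) m ∧ ∃ (c : F) (R : ℝ), ∀ ξ, R ≤ ‖ξ‖ → m ξ = c

lemma hasCompactSupport_of_eq_zero {F : Type*} [NormedAddCommGroup F] {m : Space d → F} {R : ℝ}
    (h : ∀ ξ, R ≤ ‖ξ‖ → m ξ = 0) : HasCompactSupport m :=
  HasCompactSupport.intro (isCompact_closedBall (0 : Space d) R) fun ξ hξ => h ξ (by
    simp only [Metric.mem_closedBall, dist_zero_right, not_le] at hξ
    exact hξ.le)

lemma IsSymbol.hasTemperateGrowth {F : Type*} [NormedAddCommGroup F] [NormedSpace ℝ F]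
    {m : Space d → F} (hm : IsSymbol m) : m.HasTemperateGrowth := by
  obtain ⟨h, c, R, hR⟩ := hm
  have h1 : (fun ξ => m ξ - c).HasTemperateGrowth :=
    HasCompactSupport.hasTemperateGrowth
      (hasCompactSupport_of_eq_zero (R := R) fun ξ hξ => by rw [hR ξ hξ, sub_self])
      (h.sub contDiff_const)
  have h2 := h1.add (Function.HasTemperateGrowth.const c)
  have h3 : ((fun ξ => m ξ - c) + fun _ => c) = m := by
    ext ξ
    simp
  rwa [h3] at h2

lemma norm_toLp_fourierMultiplier_le [Fact (1 ≤ p)] (hp₁ : 1 < p) (hp₂ : p < ⊤)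
    (g f : 𝓢(Space d, ℂ)) :
    ‖(SchwartzMap.fourierMultiplierCLM ℂ (g : Space d → ℂ) f).toLp p volume‖ ≤
      (∫⁻ y, ‖(FourierTransform.fourierInv g : 𝓢(Space d, ℂ)) y‖ₑ).toReal *
        ‖f.toLp p volume‖ := by
  have hY := eLpNorm_schwartz_convolution_le hp₁ hp₂ (FourierTransform.fourierInv g) f
  rw [← fourierMultiplierCLM_schwartz_eq_convolution] at hY
  rw [SchwartzMap.norm_toLp, SchwartzMap.norm_toLp, ← ENNReal.toReal_mul]
  refine ENNReal.toReal_mono (ENNReal.mul_ne_top ?_ ?_) hY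
  · exact ((FourierTransform.fourierInv g : 𝓢(Space d, ℂ)).integrable (μ := volume)).2.ne
  · exact (f.eLpNorm_lt_top p volume).ne

/-- Young's inequality bounds the convolution with the Schwartz kernel on the Schwartz functions,
which are dense in `L^p` for `p < ∞`; the operator is the extension by density. -/
lemma exists_lpOp_schwartz [Fact (1 ≤ p)] (hp₁ : 1 < p) (hp₂ : p < ⊤) (g : 𝓢(Space d, ℂ)) :
    ∃ T : Lp ℂ p (volume : Measure (Space d)) →L[ℂ] Lp ℂ p (volume : Measure (Space d)),
      ∀ f, toTD (T f) = TemperedDistribution.fourierMultiplierCLM ℂ (g : Space d → ℂ) (toTD f) := by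
  obtain ⟨e, he, hd⟩ : ∃ e : 𝓢(Space d, ℂ) →ₗ[ℂ] Lp ℂ p (volume : Measure (Space d)),
      (∀ f : 𝓢(Space d, ℂ), e f = SchwartzMap.toLpCLM ℂ (E := Space d) ℂ p volume f) ∧
        DenseRange e :=
    ⟨(SchwartzMap.toLpCLM ℂ (E := Space d) ℂ p volume).toLinearMap, fun _ => rfl,
      (SchwartzMap.denseRange_toLpCLM (F := ℂ) (E := Space d) (μ := volume) hp₂.ne :)⟩
  obtain ⟨T₀, hT₀⟩ : ∃ T₀ : 𝓢(Space d, ℂ) →ₗ[ℂ] 𝓢(Space d, ℂ),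
      ∀ f, T₀ f = SchwartzMap.fourierMultiplierCLM ℂ (g : Space d → ℂ) f :=
    ⟨(SchwartzMap.fourierMultiplierCLM ℂ (g : Space d → ℂ)).toLinearMap, fun _ => rfl⟩
  have hb : ∃ C : ℝ, ∀ f : 𝓢(Space d, ℂ), ‖(e ∘ₗ T₀) f‖ ≤ C * ‖e f‖ := by
    refine ⟨(∫⁻ y, ‖(FourierTransform.fourierInv g : 𝓢(Space d, ℂ)) y‖ₑ).toReal, fun f => ?_⟩
    rw [LinearMap.comp_apply, he, he, hT₀, SchwartzMap.toLpCLM_apply, SchwartzMap.toLpCLM_apply]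
    exact norm_toLp_fourierMultiplier_le hp₁ hp₂ g f
  refine ⟨(e ∘ₗ T₀).extendOfNorm e, fun f => ?_⟩
  refine hd.induction_on (p := fun f => toTD ((e ∘ₗ T₀).extendOfNorm e f) =
    TemperedDistribution.fourierMultiplierCLM ℂ (g : Space d → ℂ) (toTD f)) f ?_ fun φ => ?_
  -- Both sides are continuous from `L^p` to tempered distributions, so the identity only has to be
  -- checked on the dense range.
  · have c1 : Continuous (toTD : Lp ℂ p (volume : Measure (Space d)) → TDist d) :=
      (Lp.toTemperedDistributionCLM ℂ volume p).continuous
    exact isClosed_eq (c1.comp (ContinuousLinearMap.continuous _))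
      ((ContinuousLinearMap.continuous _).comp c1)
  · have h1 := LinearMap.extendOfNorm_eq (f := e ∘ₗ T₀) (e := e) hd hb φ
    rw [h1, LinearMap.comp_apply, he, he, hT₀, SchwartzMap.toLpCLM_apply, SchwartzMap.toLpCLM_apply,
      toTD, toTD, Lp.toTemperedDistribution_toLp_eq,
      Lp.toTemperedDistribution_toLp_eq,
      TemperedDistribution.fourierMultiplierCLM_toTemperedDistributionCLM_eq g.hasTemperateGrowth]

lemma exists_lpOp_of_hasCompactSupport [Fact (1 ≤ p)] (hp₁ : 1 < p) (hp₂ : p < ⊤)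
    {m : Space d → ℂ} (hm : HasCompactSupport m) (hs : ContDiff ℝ (⊤ : ℕ∞) m) :
    ∃ T : Lp ℂ p (volume : Measure (Space d)) →L[ℂ] Lp ℂ p (volume : Measure (Space d)),
      ∀ f, toTD (T f) = multiplier m (toTD f) := by
  have h1 : HasCompactSupport fun ξ : Space d => m ((2 * Real.pi) • ξ) :=
    hm.comp_isClosedEmbedding
      (Homeomorph.smulOfNeZero (2 * Real.pi) (by positivity)).isClosedEmbedding
  have h2 : ContDiff ℝ (⊤ : ℕ∞) fun ξ : Space d => m ((2 * Real.pi) • ξ) :=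
    hs.comp (contDiff_const_smul _)
  exact exists_lpOp_schwartz hp₁ hp₂ (h1.toSchwartzMap h2)

/-- Subtracting the value `c` at infinity leaves a compactly supported smooth symbol; the constant
acts as `c` times the identity. -/
lemma exists_lpOp [Fact (1 ≤ p)] (hp₁ : 1 < p) (hp₂ : p < ⊤) {m : Space d → ℂ}
    (hm : IsSymbol m) :
    ∃ T : Lp ℂ p (volume : Measure (Space d)) →L[ℂ] Lp ℂ p (volume : Measure (Space d)),
      ∀ f, toTD (T f) = multiplier m (toTD f) := by
  obtain ⟨h, c, R, hR⟩ := hm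
  have hcs : HasCompactSupport fun ξ => m ξ - c :=
    hasCompactSupport_of_eq_zero (R := R) fun ξ hξ => by rw [hR ξ hξ, sub_self]
  have hsm : ContDiff ℝ (⊤ : ℕ∞) fun ξ => m ξ - c := h.sub contDiff_const
  obtain ⟨T, hT⟩ := exists_lpOp_of_hasCompactSupport hp₁ hp₂ hcs hsm
  refine ⟨T + c • ContinuousLinearMap.id ℂ _, fun f => ?_⟩
  have : m = fun ξ => (m ξ - c) + c := by ext; simp
  rw [this, multiplier_add (hcs.hasTemperateGrowth hsm) (.const c), ← hT, multiplier_const,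
    ← toTD_smul, ← toTD_add]
  rfl

end LpMultipliers

/-! ### Matrix-valued symbols acting on vectors of `L^p` functions -/

section MatrixSymbols

variable {d : ℕ} {p : ℝ≥0∞} [hp : Fact (1 ≤ p)]

/-- Smooth functional calculus preserves the class. Smoothness of `g` is asked only at the values of
the symbol, so that inversion of units is admitted. -/
lemma IsSymbol.comp_contDiffAt {F G : Type*} [NormedAddCommGroup F] [NormedSpace ℝ F]
    [NormedAddCommGroup G] [NormedSpace ℝ G] {m : Space d → F} (hm : IsSymbol m) {g : F → G}
    (hg : ∀ ξ, ContDiffAt ℝ (⊤ : ℕ∞) g (m ξ)) : IsSymbol fun ξ => g (m ξ) := by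
  obtain ⟨h, c, R, hR⟩ := hm
  refine ⟨contDiff_iff_contDiffAt.2 fun ξ => (hg ξ).comp ξ h.contDiffAt, g c, R, fun ξ hξ => ?_⟩
  simp only [hR ξ hξ]

lemma IsSymbol.const {F : Type*} [NormedAddCommGroup F] [NormedSpace ℝ F] (c : F) :
    IsSymbol fun _ : Space d => c := ⟨contDiff_const, c, 0, fun _ _ => rfl⟩

lemma IsSymbol.prodMk {F G : Type*} [NormedAddCommGroup F] [NormedSpace ℝ F]
    [NormedAddCommGroup G] [NormedSpace ℝ G] {m : Space d → F} {m' : Space d → G}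
    (hm : IsSymbol m) (hm' : IsSymbol m') : IsSymbol fun ξ => (m ξ, m' ξ) := by
  obtain ⟨h, c, R, hR⟩ := hm
  obtain ⟨h', c', R', hR'⟩ := hm'
  refine ⟨h.prodMk h', (c, c'), max R R', fun ξ hξ => ?_⟩
  simp only [hR ξ ((le_max_left _ _).trans hξ), hR' ξ ((le_max_right _ _).trans hξ)]

lemma IsSymbol.add {F : Type*} [NormedAddCommGroup F] [NormedSpace ℝ F] {m m' : Space d → F}
    (hm : IsSymbol m) (hm' : IsSymbol m') : IsSymbol fun ξ => m ξ + m' ξ :=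
  (hm.prodMk hm').comp_contDiffAt (g := fun z => z.1 + z.2) fun _ =>
    (contDiff_fst.add contDiff_snd).contDiffAt

lemma IsSymbol.mul {m m' : Space d → ℂ} (hm : IsSymbol m) (hm' : IsSymbol m') :
    IsSymbol fun ξ => m ξ * m' ξ :=
  (hm.prodMk hm').comp_contDiffAt (g := fun z => z.1 * z.2) fun _ =>
    (contDiff_fst.mul contDiff_snd).contDiffAt

lemma IsSymbol.sum {F : Type*} [NormedAddCommGroup F] [NormedSpace ℝ F] {ι : Type*}
    (s : Finset ι) {m : ι → Space d → F} (h : ∀ i ∈ s, IsSymbol (m i)) :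
    IsSymbol fun ξ => ∑ i ∈ s, m i ξ := by
  classical
  induction s using Finset.induction_on with
  | empty => simpa using IsSymbol.const (0 : F)
  | insert a s ha ih =>
    simp only [Finset.sum_insert ha]
    exact (h a (Finset.mem_insert_self a s)).add (ih fun i hi => h i (Finset.mem_insert_of_mem hi))

lemma IsSymbol.exists_bound {F : Type*} [NormedAddCommGroup F] [NormedSpace ℝ F]
    {m : Space d → F} (hm : IsSymbol m) : ∃ K : ℝ, ∀ ξ, ‖m ξ‖ ≤ K := by
  obtain ⟨h, c, R, hR⟩ := hm
  obtain ⟨K, hK⟩ := (isCompact_closedBall (0 : Space d) R).exists_bound_of_continuousOn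
    h.continuous.continuousOn
  refine ⟨max K ‖c‖, fun ξ => ?_⟩
  rcases le_total R ‖ξ‖ with h1 | h1
  · rw [hR ξ h1]
    exact le_max_right _ _
  · exact (hK ξ (by simpa using h1)).trans (le_max_left _ _)

/-- All entries of a matrix symbol are smooth and constant near infinity. -/
def SymbolMatrix {ι κ : Type*} (M : Space d → Matrix ι κ ℂ) : Prop :=
  ∀ a b, IsSymbol fun ξ => M ξ a b

lemma SymbolMatrix.temperate {ι κ : Type*} {M : Space d → Matrix ι κ ℂ} (hM : SymbolMatrix M) :
    TemperateMatrix M := fun a b => (hM a b).hasTemperateGrowth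

variable {ι κ μ : Type*} [Fintype ι] [Fintype κ] [Fintype μ]

omit [Fintype ι] [Fintype μ] in
lemma SymbolMatrix.mul {M : Space d → Matrix ι κ ℂ} {N : Space d → Matrix κ μ ℂ}
    (hM : SymbolMatrix M) (hN : SymbolMatrix N) : SymbolMatrix fun ξ => M ξ * N ξ :=
  fun a b => by
    simp only [Matrix.mul_apply]
    exact .sum _ fun i _ => (hM a i).mul (hN i b)

omit [Fintype ι] [Fintype κ] in
lemma SymbolMatrix.const (M : Matrix ι κ ℂ) : SymbolMatrix fun _ : Space d => M :=
  fun _ _ => .const _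

omit [Fintype ι] [Fintype κ] in
lemma SymbolMatrix.add {M N : Space d → Matrix ι κ ℂ}
    (hM : SymbolMatrix M) (hN : SymbolMatrix N) : SymbolMatrix fun ξ => M ξ + N ξ :=
  fun a b => (hM a b).add (hN a b)

omit [Fintype ι] [Fintype κ] in
lemma SymbolMatrix.smul {m : Space d → ℂ} {M : Space d → Matrix ι κ ℂ}
    (hm : IsSymbol m) (hM : SymbolMatrix M) : SymbolMatrix fun ξ => m ξ • M ξ :=
  fun a b => hm.mul (hM a b)

omit [Fintype ι] [Fintype κ] in
lemma SymbolMatrix.const_smul (c : ℂ) {M : Space d → Matrix ι κ ℂ}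
    (hM : SymbolMatrix M) : SymbolMatrix fun ξ => c • M ξ :=
  SymbolMatrix.smul (.const c) hM

omit [Fintype ι] [Fintype κ] in
lemma SymbolMatrix.neg {M : Space d → Matrix ι κ ℂ}
    (hM : SymbolMatrix M) : SymbolMatrix fun ξ => -M ξ := by
  simpa using SymbolMatrix.const_smul (-1) hM

lemma SymbolMatrix.pow [DecidableEq ι] {M : Space d → Matrix ι ι ℂ} (hM : SymbolMatrix M) (k : ℕ) :
    SymbolMatrix fun ξ => M ξ ^ k := by
  induction k with
  | zero => simpa using SymbolMatrix.const (1 : Matrix ι ι ℂ)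
  | succ k ih =>
    simp only [pow_succ]
    exact ih.mul hM

open scoped Matrix.Norms.Operator in
lemma SymbolMatrix.isSymbol {M : Space d → Matrix ι κ ℂ} [DecidableEq ι] [DecidableEq κ]
    (hM : SymbolMatrix M) : IsSymbol M := by
  have h : M = fun ξ => ∑ a, ∑ b, M ξ a b • Matrix.single a b (1 : ℂ) := by
    ext ξ : 1
    conv_lhs => rw [Matrix.matrix_eq_sum_single (M ξ)]
    simp [Matrix.smul_single]
  rw [h]
  refine .sum _ fun a _ => .sum _ fun b _ => ?_
  exact (hM a b).comp_contDiffAt (g := fun z : ℂ => z • Matrix.single a b (1 : ℂ)) fun _ =>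
    (contDiff_id.smul contDiff_const).contDiffAt

open scoped Matrix.Norms.Operator in
/-- Reading off an entry of a matrix. -/
def entryCLM (a : ι) (b : κ) : Matrix ι κ ℂ →L[ℝ] ℂ :=
  LinearMap.toContinuousLinearMap
    { toFun := fun M => M a b, map_add' := fun _ _ => rfl, map_smul' := fun _ _ => rfl }

open scoped Matrix.Norms.Operator in
lemma isSymbol_symbolMatrix {M : Space d → Matrix ι κ ℂ} (hM : IsSymbol M) : SymbolMatrix M :=
  fun a b => hM.comp_contDiffAt (g := fun N : Matrix ι κ ℂ => N a b) fun _ =>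
    (entryCLM a b).contDiff.contDiffAt

open scoped Matrix.Norms.Operator in
lemma contDiff_matrix_exp [DecidableEq ι] :
    ContDiff ℝ (⊤ : ℕ∞) (NormedSpace.exp : Matrix ι ι ℂ → Matrix ι ι ℂ) :=
  contDiff_iff_contDiffAt.2 fun M => (NormedSpace.exp_analytic (𝕂 := ℝ) M).contDiffAt

open scoped Matrix.Norms.Operator in
lemma IsSymbol.matrix_exp [DecidableEq ι] {M : Space d → Matrix ι ι ℂ} (hM : IsSymbol M) :
    SymbolMatrix fun ξ => NormedSpace.exp (M ξ) :=
  isSymbol_symbolMatrix (hM.comp_contDiffAt fun _ => contDiff_matrix_exp.contDiffAt)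

lemma SymbolMatrix.exp [DecidableEq ι] {M : Space d → Matrix ι ι ℂ} (hM : SymbolMatrix M) :
    SymbolMatrix fun ξ => NormedSpace.exp (M ξ) :=
  hM.isSymbol.matrix_exp

-- Inversion is smooth at units. Pointwise invertibility is enough: the symbol is constant near
-- infinity, so no uniform lower bound on the determinant has to be assumed.
open scoped Matrix.Norms.Operator in
lemma SymbolMatrix.inv [DecidableEq ι] {M : Space d → Matrix ι ι ℂ} (hM : SymbolMatrix M)
    (hu : ∀ ξ, IsUnit (M ξ)) : SymbolMatrix fun ξ => (M ξ)⁻¹ := by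
  simp only [Matrix.nonsing_inv_eq_ringInverse]
  refine isSymbol_symbolMatrix (hM.isSymbol.comp_contDiffAt fun ξ => ?_)
  obtain ⟨u, hu⟩ := hu ξ
  rw [← hu]
  exact contDiffAt_ringInverse ℝ u

/-- Vectors of `L^p` functions. -/
abbrev LpVec (d : ℕ) (p : ℝ≥0∞) (ι : Type*) : Type _ := ι → Lp ℂ p (volume : Measure (Space d))

/-- The vector of distributions given by a vector of `L^p` functions. -/
def vecTD {ι : Type*} (f : LpVec d p ι) : ι → TDist d := fun a => toTD (f a)

omit [Fintype ι] in
lemma vecTD_injective : Function.Injective (vecTD : LpVec d p ι → ι → TDist d) :=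
  fun _ _ h => funext fun a => toTD_injective (congrFun h a)

omit [Fintype ι] in
lemma exists_opMat (hp₁ : 1 < p) (hp₂ : p < ⊤) {M : Space d → Matrix ι κ ℂ}
    (hM : SymbolMatrix M) :
    ∃ T : LpVec d p κ →L[ℂ] LpVec d p ι, ∀ f, vecTD (T f) = matMul M (vecTD f) := by
  choose T hT using fun a b => exists_lpOp (p := p) hp₁ hp₂ (hM a b)
  refine ⟨ContinuousLinearMap.pi fun a => ∑ b, (T a b).comp (ContinuousLinearMap.proj b),
    fun f => ?_⟩
  ext1 a
  simp only [vecTD, ContinuousLinearMap.pi_apply, matMul, ← hT]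
  rw [← toTD_sum]
  congr 1
  simp

/-- The bounded operator on vectors of `L^p` functions with a given matrix symbol. -/
def opMat (p : ℝ≥0∞) [Fact (1 ≤ p)] (M : Space d → Matrix ι κ ℂ) :
    LpVec d p κ →L[ℂ] LpVec d p ι :=
  -- The operator is unique because `vecTD` is injective. The default value `0` is never met: for a
  -- `SymbolMatrix` and `1 < p < ∞` existence is `exists_opMat`.
  open Classical in
  if h : ∃ T : LpVec d p κ →L[ℂ] LpVec d p ι, ∀ f, vecTD (T f) = matMul M (vecTD f) then h.choose
  else 0

variable (hp₁ : 1 < p) (hp₂ : p < ⊤)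
include hp₁ hp₂

lemma vecTD_opMat {M : Space d → Matrix ι κ ℂ} (hM : SymbolMatrix M) (f : LpVec d p κ) :
    vecTD (opMat p M f) = matMul M (vecTD f) := by
  have h := exists_opMat hp₁ hp₂ hM
  rw [opMat, dif_pos h]
  exact h.choose_spec f

/-- This and the next identities make `opMat p` a unital algebra homomorphism. Each is checked on
distributions, where it is the symbol calculus of `matMul`, and lifted by injectivity of `vecTD`. -/
lemma opMat_mul {M : Space d → Matrix ι κ ℂ} {N : Space d → Matrix κ μ ℂ}
    (hM : SymbolMatrix M) (hN : SymbolMatrix N) :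
    opMat p (fun ξ => M ξ * N ξ) = (opMat p M).comp (opMat p N) := by
  ext1 f
  apply vecTD_injective
  rw [vecTD_opMat hp₁ hp₂ (hM.mul hN), ContinuousLinearMap.comp_apply, vecTD_opMat hp₁ hp₂ hM,
    vecTD_opMat hp₁ hp₂ hN, matMul_matMul hM.temperate hN.temperate]

lemma opMat_add {M N : Space d → Matrix ι κ ℂ} (hM : SymbolMatrix M) (hN : SymbolMatrix N) :
    opMat p (fun ξ => M ξ + N ξ) = opMat p M + opMat p N := by
  ext1 f
  apply vecTD_injective
  rw [vecTD_opMat hp₁ hp₂ (hM.add hN), matMul_add hM.temperate hN.temperate,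
    ← vecTD_opMat hp₁ hp₂ hM, ← vecTD_opMat hp₁ hp₂ hN]
  exact funext fun a => (toTD_add _ _).symm

lemma opMat_const_smul (c : ℂ) {M : Space d → Matrix ι κ ℂ} (hM : SymbolMatrix M) :
    opMat p (fun ξ => c • M ξ) = c • opMat p M := by
  ext1 f
  apply vecTD_injective
  rw [vecTD_opMat hp₁ hp₂ (hM.const_smul c), matMul_const_smul c hM.temperate,
    ← vecTD_opMat hp₁ hp₂ hM]
  exact funext fun a => (toTD_smul _ _).symm

lemma opMat_neg {M : Space d → Matrix ι κ ℂ} (hM : SymbolMatrix M) :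
    opMat p (fun ξ => -M ξ) = -opMat p M := by
  ext1 f
  apply vecTD_injective
  rw [vecTD_opMat hp₁ hp₂ hM.neg, matMul_neg hM.temperate, ← vecTD_opMat hp₁ hp₂ hM]
  exact funext fun a => (map_neg (Lp.toTemperedDistributionCLM ℂ volume p) _).symm

lemma opMat_one [DecidableEq ι] : opMat p (fun _ : Space d => (1 : Matrix ι ι ℂ)) = 1 := by
  ext1 f
  apply vecTD_injective
  rw [vecTD_opMat hp₁ hp₂ (SymbolMatrix.const _), matMul_one]
  rfl

lemma opMat_pow [DecidableEq ι] {M : Space d → Matrix ι ι ℂ} (hM : SymbolMatrix M) (k : ℕ) :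
    opMat p (fun ξ => M ξ ^ k) = opMat p M ^ k := by
  induction k with
  | zero => simpa using opMat_one hp₁ hp₂
  | succ k ih =>
    simp only [pow_succ]
    rw [opMat_mul hp₁ hp₂ (hM.pow k) hM, ih]
    rfl

end MatrixSymbols

/-! ### Exponentials of matrix multipliers and their decay -/

section ExpMultipliers

variable {d : ℕ} {p : ℝ≥0∞} [hp : Fact (1 ≤ p)] {ι : Type*} [Fintype ι] [DecidableEq ι]

-- For Schwartz `f` the pairing is an integral on the Fourier side, in which the symbol enters
-- linearly; limits of symbols can then be taken by dominated convergence.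
open FourierTransform in
lemma multiplier_toTD_toLp {m : Space d → ℂ} (hm : m.HasTemperateGrowth) (f g : 𝓢(Space d, ℂ)) :
    multiplier m (toTD (f.toLp p)) g =
      ∫ ξ, m ((2 * Real.pi) • ξ) * ((𝓕⁻ g : 𝓢(Space d, ℂ)) ξ * (𝓕 f : 𝓢(Space d, ℂ)) ξ) := by
  rw [multiplier, TemperedDistribution.fourierMultiplierCLM_apply_apply, toTD,
    Lp.toTemperedDistribution_toLp_eq]
  refine (SchwartzMap.toTemperedDistributionCLM_apply_apply volume f _).trans ?_
  simp only [smul_eq_mul]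
  rw [SchwartzMap.integral_fourier_mul_eq]
  refine integral_congr_ae (.of_forall fun ξ => ?_)
  simp only []
  rw [SchwartzMap.smulLeftCLM_apply_apply (hasTemperateGrowth_comp_smul hm _), smul_eq_mul,
    mul_assoc]

open scoped Matrix.Norms.Operator in
lemma norm_entry_le_norm {κ : Type*} [Fintype κ] (M : Matrix ι κ ℂ) (a : ι) (b : κ) :
    ‖M a b‖ ≤ ‖M‖ := by
  rw [Matrix.linfty_opNorm_def]
  have h1 : ‖M a b‖₊ ≤ ∑ j, ‖M a j‖₊ :=
    Finset.single_le_sum (f := fun j => ‖M a j‖₊) (fun _ _ => zero_le) (Finset.mem_univ b)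
  have h2 : ∑ j, ‖M a j‖₊ ≤ Finset.univ.sup fun i => ∑ j, ‖M i j‖₊ :=
    Finset.le_sup (f := fun i => ∑ j, ‖M i j‖₊) (Finset.mem_univ a)
  exact_mod_cast h1.trans h2

open scoped Matrix.Norms.Operator in
lemma hasSum_exp_entry (M : Matrix ι ι ℂ) (a b : ι) :
    HasSum (fun k : ℕ => ((k.factorial : ℂ)⁻¹ * (M ^ k) a b)) (NormedSpace.exp M a b) := by
  have h := NormedSpace.exp_series_hasSum_exp' (𝕂 := ℂ) M
  exact h.mapL ((Matrix.entryLinearMap ℂ ℂ a b).toContinuousLinearMap)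

open scoped Matrix.Norms.Operator in
lemma norm_pow_entry_le (M : Matrix ι ι ℂ) (k : ℕ) (a b : ι) :
    ‖(M ^ k) a b‖ ≤ (‖M‖ + 1) ^ k := by
  refine (norm_entry_le_norm _ a b).trans ?_
  rcases isEmpty_or_nonempty ι with h | h
  · exact (h.false a).elim
  · exact (norm_pow_le M k).trans (by gcongr; simp)

-- No bound of `‖opMat p M‖` by finitely many derivatives of the symbol is used. On Schwartz `f`,
-- tested against `g`, both sides are the sum of the same exponential series: for the operator
-- exponential by norm convergence, for the symbol exponential by dominated convergence on the
-- Fourier side. Density of Schwartz functions concludes.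
open scoped Matrix.Norms.Operator FourierTransform in
lemma opMat_exp (hp₁ : 1 < p) (hp₂ : p < ⊤) {M : Space d → Matrix ι ι ℂ} (hM : SymbolMatrix M) :
    opMat p (fun ξ => NormedSpace.exp (M ξ)) = NormedSpace.exp (opMat p M) := by
  have hd : DenseRange (Pi.map fun (_ : ι) (φ : 𝓢(Space d, ℂ)) =>
      SchwartzMap.toLpCLM ℝ (E := Space d) ℂ p volume φ) :=
    DenseRange.piMap fun _ => SchwartzMap.denseRange_toLpCLM hp₂.ne
  refine ContinuousLinearMap.coeFn_injective (hd.equalizer (ContinuousLinearMap.continuous _)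
    (ContinuousLinearMap.continuous _) ?_)
  ext1 φ
  simp only [Function.comp_apply]
  set f : LpVec d p ι := Pi.map (fun (_ : ι) (φ : 𝓢(Space d, ℂ)) =>
      SchwartzMap.toLpCLM ℝ (E := Space d) ℂ p volume φ) φ with hf
  have hfb : ∀ b, f b = (φ b).toLp p := fun b => rfl
  apply vecTD_injective
  ext a g
  obtain ⟨K, hK⟩ := hM.isSymbol.exists_bound
  have hK0 : 0 ≤ K := (norm_nonneg _).trans (hK 0)
  have h1 : HasSum (fun k : ℕ => vecTD (((k.factorial : ℂ)⁻¹ • opMat p M ^ k) f) a g)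
      (vecTD (NormedSpace.exp (opMat p M) f) a g) := by
    have h := NormedSpace.exp_series_hasSum_exp' (𝕂 := ℂ) (opMat p M)
    have h2 := (h.mapL (ContinuousLinearMap.apply ℂ (LpVec d p ι) f)).mapL
      (ContinuousLinearMap.proj (R := ℂ) (φ := fun _ : ι => Lp ℂ p (volume : Measure (Space d))) a)
    have h3 := h2.mapL (Lp.toTemperedDistributionCLM ℂ volume p)
    exact h3.mapL (PointwiseConvergenceCLM.evalCLM (RingHom.id ℂ) ℂ g)
  have h2 : HasSum (fun k : ℕ => vecTD (((k.factorial : ℂ)⁻¹ • opMat p M ^ k) f) a g)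
      (vecTD (opMat p (fun ξ => NormedSpace.exp (M ξ)) f) a g) := by
    have e1 : ∀ {N : Space d → Matrix ι ι ℂ}, SymbolMatrix N → vecTD (opMat p N f) a g =
        ∑ b, ∫ ξ, N ((2 * Real.pi) • ξ) a b *
          ((𝓕⁻ g : 𝓢(Space d, ℂ)) ξ * (𝓕 (φ b) : 𝓢(Space d, ℂ)) ξ) := by
      intro N hN
      rw [vecTD_opMat hp₁ hp₂ hN, matMul, sum_apply]
      refine Finset.sum_congr rfl fun b _ => ?_
      rw [vecTD, hfb, multiplier_toTD_toLp (hN a b).hasTemperateGrowth]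
    have e2 : ∀ k : ℕ, (k.factorial : ℂ)⁻¹ • opMat p M ^ k =
        opMat p fun ξ => (k.factorial : ℂ)⁻¹ • M ξ ^ k := fun k => by
      rw [opMat_const_smul hp₁ hp₂ _ (hM.pow k), opMat_pow hp₁ hp₂ hM]
    simp only [e2]
    rw [e1 hM.exp]
    simp_rw [e1 ((hM.pow _).const_smul _)]
    refine hasSum_sum fun b _ => ?_
    have hint : Integrable (fun ξ => (𝓕⁻ g : 𝓢(Space d, ℂ)) ξ * (𝓕 (φ b) : 𝓢(Space d, ℂ)) ξ)
        volume :=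
      (𝓕⁻ g : 𝓢(Space d, ℂ)).integrable.mul_bdd (c := SchwartzMap.seminorm ℝ 0 0 (𝓕 (φ b)))
        (SchwartzMap.continuous _).aestronglyMeasurable
        (.of_forall fun x => SchwartzMap.norm_le_seminorm ℝ _ x)
    refine hasSum_integral_of_dominated_convergence (fun k ξ => ((K + 1) ^ k / k.factorial) *
      ‖(𝓕⁻ g : 𝓢(Space d, ℂ)) ξ * (𝓕 (φ b) : 𝓢(Space d, ℂ)) ξ‖) (fun k => ?_)
      (fun k => .of_forall fun ξ => ?_) (.of_forall fun ξ => ?_) ?_ (.of_forall fun ξ => ?_)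
    · refine Continuous.aestronglyMeasurable ?_
      have := (((hM.pow k).const_smul (k.factorial : ℂ)⁻¹) a b).1.continuous
      exact (this.comp (continuous_const_smul _)).mul
        ((SchwartzMap.continuous _).mul (SchwartzMap.continuous _))
    · rw [norm_mul]
      gcongr
      rw [Matrix.smul_apply, norm_smul, div_eq_inv_mul, norm_inv, Complex.norm_natCast]
      gcongr
      refine (norm_pow_entry_le _ k a b).trans ?_
      gcongr
      exact hK _
    · exact (Real.summable_pow_div_factorial (K + 1)).mul_right _
    · simp_rw [tsum_mul_right]
      exact hint.norm.const_mul _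
    · simp only [Matrix.smul_apply, smul_eq_mul]
      exact (hasSum_exp_entry (M ((2 * Real.pi) • ξ)) a b).mul_right _
  exact h2.unique h1

end ExpMultipliers

/-! ### Decay of semigroups -/

section SemigroupDecay

open scoped Matrix

lemma hasDerivAt_exp_neg_smul_apply {E : Type*} [NormedAddCommGroup E] [NormedSpace ℂ E]
    [CompleteSpace E] (B : E →L[ℂ] E) (x : E) (t : ℝ) :
    HasDerivAt (fun s : ℝ => NormedSpace.exp ((-s) • B) x)
      (-(B (NormedSpace.exp ((-t) • B) x))) t := by
  have h := (hasDerivAt_exp_smul_const' (𝕂 := ℝ) B (-t)).scomp t (hasDerivAt_neg t)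
  have h2 := ((ContinuousLinearMap.apply ℂ E x).restrictScalars ℝ).hasFDerivAt.comp_hasDerivAt t h
  simpa [Function.comp_def] using h2

lemma hasDerivAt_exp_smul_apply {E : Type*} [NormedAddCommGroup E] [NormedSpace ℂ E]
    [CompleteSpace E] (B : E →L[ℂ] E) (x : E) (t : ℝ) :
    HasDerivAt (fun s : ℝ => NormedSpace.exp (s • B) x)
      (B (NormedSpace.exp (t • B) x)) t := by
  have h := hasDerivAt_exp_smul_const' (𝕂 := ℝ) B t
  have h2 := ((ContinuousLinearMap.apply ℂ E x).restrictScalars ℝ).hasFDerivAt.comp_hasDerivAt t h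
  simpa [Function.comp_def] using h2

/-- Differential inequality `g' ≤ -c g` integrated. -/
lemma le_exp_mul_of_deriv_le {g g' : ℝ → ℝ} {c : ℝ} (hg : ∀ t, HasDerivAt g (g' t) t)
    (h : ∀ t, g' t ≤ -c * g t) {t : ℝ} (ht : 0 ≤ t) : g t ≤ Real.exp (-c * t) * g 0 := by
  have hd : ∀ t, HasDerivAt (fun t => Real.exp (c * t) * g t)
      (Real.exp (c * t) * (c * 1) * g t + Real.exp (c * t) * g' t) t := fun t =>
    (((hasDerivAt_id t).const_mul c).exp).mul (hg t)
  have hanti : Antitone fun t => Real.exp (c * t) * g t := by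
    refine antitone_of_deriv_nonpos (fun t => (hd t).differentiableAt) fun t => ?_
    rw [(hd t).deriv]
    have := mul_le_mul_of_nonneg_left (h t) (Real.exp_pos (c * t)).le
    nlinarith
  have h2 := hanti ht
  simp only [mul_zero, Real.exp_zero, one_mul] at h2
  calc g t = Real.exp (-c * t) * (Real.exp (c * t) * g t) := by
        rw [← mul_assoc, ← Real.exp_add]; simp
    _ ≤ _ := by gcongr

lemma hasDerivAt_norm_sq {E : Type*} [NormedAddCommGroup E] [InnerProductSpace ℂ E]
    {f : ℝ → E} {f' : E} {t : ℝ} (hf : HasDerivAt f f' t) :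
    HasDerivAt (fun s => ‖f s‖ ^ 2) (2 * (inner ℂ (f t) f').re) t := by
  have h := hf.inner ℂ hf
  have h2 := Complex.reCLM.hasFDerivAt.comp_hasDerivAt t h
  have e1 : (fun s => ‖f s‖ ^ 2) = (Complex.reCLM ∘ fun s => inner ℂ (f s) (f s)) := by
    ext s
    rw [Function.comp_apply, Complex.reCLM_apply, inner_self_eq_norm_sq_to_K]
    norm_cast
  rw [e1]
  refine h2.congr_deriv ?_
  rw [Complex.reCLM_apply, Complex.add_re, ← inner_conj_symm f' (f t), Complex.conj_re]
  ring

/-- A strictly accretive operator generates an exponentially decaying semigroup. -/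
lemma norm_exp_neg_smul_apply_le {E : Type*} [NormedAddCommGroup E] [InnerProductSpace ℂ E]
    [CompleteSpace E] {B : E →L[ℂ] E} {c : ℝ}
    (hB : ∀ x, c * ‖x‖ ^ 2 ≤ (inner ℂ x (B x)).re) (x : E) {t : ℝ} (ht : 0 ≤ t) :
    ‖NormedSpace.exp ((-t) • B) x‖ ≤ Real.exp (-c * t) * ‖x‖ := by
  have h := le_exp_mul_of_deriv_le (c := 2 * c)
    (fun t => hasDerivAt_norm_sq (hasDerivAt_exp_neg_smul_apply B x t)) (fun t => by
      rw [inner_neg_right, Complex.neg_re]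
      linarith [hB (NormedSpace.exp ((-t) • B) x)]) ht
  simp only [neg_zero, zero_smul, NormedSpace.exp_zero, one_apply_eq_self] at h
  refine le_of_sq_le_sq ?_ (by positivity)
  calc _ ≤ _ := h
    _ = _ := by rw [mul_pow, ← Real.exp_nat_mul]; congr 2; push_cast; ring

open scoped Matrix.Norms.Operator in
lemma toEuclideanCLM_exp {ι : Type*} [Fintype ι] [DecidableEq ι] (M : Matrix ι ι ℂ) :
    Matrix.toEuclideanCLM (𝕜 := ℂ) (NormedSpace.exp M) =
      NormedSpace.exp (Matrix.toEuclideanCLM (𝕜 := ℂ) M) := by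
  have hc : Continuous (Matrix.toEuclideanCLM (n := ι) (𝕜 := ℂ)) :=
    LinearMap.continuous_of_finiteDimensional
      (Matrix.toEuclideanCLM (n := ι) (𝕜 := ℂ)).toAlgEquiv.toLinearMap
  exact NormedSpace.map_exp (Matrix.toEuclideanCLM (n := ι) (𝕜 := ℂ)) hc M

variable {d : ℕ} {p : ℝ≥0∞} [hp : Fact (1 ≤ p)] {ι : Type*} [Fintype ι] [DecidableEq ι]

/-- The matrix `M` is accretive with lower bound `c`. -/
def Accretive (c : ℝ) (M : Matrix ι ι ℂ) : Prop :=
  ∀ x : EuclideanSpace ℂ ι, c * ‖x‖ ^ 2 ≤ (inner ℂ x (Matrix.toEuclideanCLM (𝕜 := ℂ) M x)).re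

/-- If `e^{-M} v = w v` with `|w| ≥ 1`, then `‖v‖ ≤ ‖e^{-M} v‖ ≤ e^{-c} ‖v‖`, which forces `v = 0`;
a square matrix with trivial kernel is invertible. -/
lemma Accretive.isUnit_smul_one_sub_exp {c : ℝ} (hc : 0 < c) {M : Matrix ι ι ℂ}
    (hM : Accretive c M) {w : ℂ} (hw : 1 ≤ ‖w‖) :
    IsUnit (w • (1 : Matrix ι ι ℂ) - NormedSpace.exp (-M)) := by
  rw [← Matrix.mulVec_injective_iff_isUnit]
  refine (injective_iff_map_eq_zero (Matrix.mulVecLin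
    (w • (1 : Matrix ι ι ℂ) - NormedSpace.exp (-M)))).2 fun v hv => ?_
  have h1 : w • v = NormedSpace.exp (-M) *ᵥ v := by
    rw [Matrix.mulVecLin_apply, Matrix.sub_mulVec, sub_eq_zero, Matrix.smul_mulVec,
      Matrix.one_mulVec] at hv
    exact hv
  have h2 := norm_exp_neg_smul_apply_le hM (WithLp.toLp 2 v) zero_le_one
  have h3 : NormedSpace.exp ((-1 : ℝ) • Matrix.toEuclideanCLM (𝕜 := ℂ) M) (WithLp.toLp 2 v) =
      w • (WithLp.toLp 2 v) := by
    have e : (-1 : ℝ) • Matrix.toEuclideanCLM (𝕜 := ℂ) M = -Matrix.toEuclideanCLM (𝕜 := ℂ) M := by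
      ext x : 1
      simp
    rw [e, ← map_neg, ← toEuclideanCLM_exp, Matrix.toEuclideanCLM_toLp, ← h1]
    rfl
  rw [h3, norm_smul] at h2
  by_contra hne
  have h4 : 0 < ‖(WithLp.toLp 2 v : EuclideanSpace ℂ ι)‖ := by
    rw [norm_pos_iff]
    exact fun h => hne (by simpa using h)
  have h5 : Real.exp (-c * 1) < 1 := by
    rw [Real.exp_lt_one_iff]
    linarith
  nlinarith

/-- The spectrum is compact, so a spectrum inside the open unit disc has spectral radius below one,
and Gelfand's formula makes the powers small. -/
lemma exists_norm_pow_le_half {A : Type*} [NormedRing A] [NormedAlgebra ℂ A] [CompleteSpace A]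
    {a : A} (ha : ∀ w ∈ spectrum ℂ a, ‖w‖ < 1) : ∃ n : ℕ, 0 < n ∧ ‖a ^ n‖ ≤ 1 / 2 := by
  -- In the zero algebra the spectrum is empty and the spectral radius theorems do not apply.
  rcases subsingleton_or_nontrivial A with hs | hs
  · exact ⟨1, one_pos, by rw [Subsingleton.elim (a ^ 1) 0, norm_zero]; norm_num⟩
  have h1 : spectralRadius ℂ a < (1 : NNReal) :=
    spectrum.spectralRadius_lt_of_forall_lt a fun w hw => by exact_mod_cast ha w hw
  obtain ⟨s, hs1, hs2⟩ := ENNReal.lt_iff_exists_nnreal_btwn.1 h1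
  have hs2' : s < 1 := by exact_mod_cast hs2
  have h2 := (spectrum.pow_nnnorm_pow_one_div_tendsto_nhds_spectralRadius a).eventually_lt_const hs1
  have h3 : ∀ᶠ n : ℕ in atTop, s ^ n < 1 / 2 :=
    (tendsto_pow_atTop_nhds_zero_of_lt_one (zero_le) hs2').eventually_lt_const (by norm_num)
  obtain ⟨n, hn, hn3, hn0⟩ := (h2.and (h3.and (eventually_gt_atTop 0))).exists
  refine ⟨n, hn0, ?_⟩
  have h4 : (‖a ^ n‖₊ : ℝ≥0∞) < (s : ℝ≥0∞) ^ n := by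
    have := ENNReal.rpow_lt_rpow hn (show (0 : ℝ) < n by exact_mod_cast hn0)
    rwa [← ENNReal.rpow_mul, one_div_mul_cancel (by exact_mod_cast hn0.ne'), ENNReal.rpow_one,
      ENNReal.rpow_natCast] at this
  have h5 : ‖a ^ n‖₊ < s ^ n := by exact_mod_cast h4
  have h6 : ‖a ^ n‖₊ ≤ 1 / 2 := (h5.trans hn3).le
  exact_mod_cast h6

lemma exp_neg_natCast_smul {E : Type*} [NormedAddCommGroup E] [NormedSpace ℂ E] [CompleteSpace E]
    (T : E →L[ℂ] E) (n : ℕ) :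
    NormedSpace.exp ((-(n : ℝ)) • T) = NormedSpace.exp (-T) ^ n := by
  have e : (-(n : ℝ)) • T = n • (-T) := by
    ext x
    simp [← Nat.cast_smul_eq_nsmul ℝ]
  let : NormedAlgebra ℚ (E →L[ℂ] E) := NormedAlgebra.restrictScalars ℚ ℂ _
  rw [e, NormedSpace.exp_nsmul]

/-- The hypothesis keeps the spectrum of `e^{-T}` inside the open unit disc, and `t₀` is the
exponent of a small power. The plus sign with a negation fits the additivity rule `opMat_add`. -/
lemma exists_norm_exp_neg_smul_le_half {E : Type*} [NormedAddCommGroup E] [NormedSpace ℂ E]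
    [CompleteSpace E] (T : E →L[ℂ] E)
    (h : ∀ w : ℂ, 1 ≤ ‖w‖ → IsUnit (w • 1 + -NormedSpace.exp (-T))) :
    ∃ t₀ : ℝ, 0 < t₀ ∧ ‖NormedSpace.exp ((-t₀) • T)‖ ≤ 1 / 2 := by
  have hspec : ∀ w ∈ spectrum ℂ (NormedSpace.exp (-T)), ‖w‖ < 1 := by
    intro w hw
    by_contra hw1
    refine hw ?_
    rw [spectrum.mem_resolventSet_iff, Algebra.algebraMap_eq_smul_one, sub_eq_add_neg]
    exact h w (not_lt.1 hw1)
  obtain ⟨n, hn, h⟩ := exists_norm_pow_le_half hspec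
  refine ⟨n, by exact_mod_cast hn, ?_⟩
  rw [exp_neg_natCast_smul]
  exact h

/-- The pointwise inverse is again a symbol of the class, hence gives the inverse operator. This is
what bounds the `L^p` spectrum by the spectra of the matrices `N ξ`, independently of `p`. -/
lemma isUnit_opMat (hp₁ : 1 < p) (hp₂ : p < ⊤) {N : Space d → Matrix ι ι ℂ}
    (hN : SymbolMatrix N) (hu : ∀ ξ, IsUnit (N ξ)) : IsUnit (opMat p N) := by
  have hi : SymbolMatrix fun ξ => (N ξ)⁻¹ := hN.inv hu
  refine isUnit_iff_exists.2 ⟨opMat p fun ξ => (N ξ)⁻¹, ?_, ?_⟩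
  · have := opMat_mul hp₁ hp₂ hN hi
    simp only [fun ξ => Matrix.mul_nonsing_inv (N ξ) ((Matrix.isUnit_iff_isUnit_det _).1 (hu ξ)),
      opMat_one hp₁ hp₂] at this
    exact this.symm
  · have := opMat_mul hp₁ hp₂ hi hN
    simp only [fun ξ => Matrix.nonsing_inv_mul (N ξ) ((Matrix.isUnit_iff_isUnit_det _).1 (hu ξ)),
      opMat_one hp₁ hp₂] at this
    exact this.symm

/-- If the symbol `H` is uniformly accretive, the semigroup `e^{-tH(D)}` is eventually small in
`L^p`. -/
lemma exists_norm_exp_opMat_le_half (hp₁ : 1 < p) (hp₂ : p < ⊤) {H : Space d → Matrix ι ι ℂ}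
    (hH : SymbolMatrix H) {c : ℝ} (hc : 0 < c) (hacc : ∀ ξ, Accretive c (H ξ)) :
    ∃ t₀ : ℝ, 0 < t₀ ∧ ‖NormedSpace.exp ((-t₀) • opMat p H)‖ ≤ 1 / 2 := by
  refine exists_norm_exp_neg_smul_le_half _ fun w hw => ?_
  -- The operator `w - e^{-H(D)}` is itself the multiplier with symbol `w - e^{-H(ξ)}`, so its
  -- invertibility is a statement about matrices.
  have e1 : w • 1 + -NormedSpace.exp (-opMat p H) =
      opMat p fun ξ => w • (1 : Matrix ι ι ℂ) + -NormedSpace.exp (-H ξ) := by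
    rw [opMat_add hp₁ hp₂ (SymbolMatrix.const _) hH.neg.exp.neg,
      opMat_const_smul hp₁ hp₂ _ (SymbolMatrix.const _), opMat_one hp₁ hp₂,
      opMat_neg hp₁ hp₂ hH.neg.exp, opMat_exp hp₁ hp₂ hH.neg, opMat_neg hp₁ hp₂ hH]
  rw [e1]
  refine isUnit_opMat hp₁ hp₂ ((SymbolMatrix.const _).add hH.neg.exp.neg) fun ξ => ?_
  rw [← sub_eq_add_neg]
  exact (hacc ξ).isUnit_smul_one_sub_exp hc hw

end SemigroupDecay

/-! ### Perturbed semigroups in Banach spaces -/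

section AbstractSemigroup

variable {E : Type*} [NormedAddCommGroup E] [NormedSpace ℂ E] [CompleteSpace E]

lemma norm_exp_clm_le (T : E →L[ℂ] E) : ‖NormedSpace.exp T‖ ≤ Real.exp ‖T‖ := by
  have h1 := NormedSpace.exp_series_hasSum_exp' (𝕂 := ℂ) T
  have h2 := NormedSpace.exp_series_hasSum_exp' (𝕂 := ℝ) ‖T‖
  rw [← Real.exp_eq_exp_ℝ] at h2
  refine h1.norm_le_of_bounded h2 fun n => ?_
  rw [norm_smul, norm_inv, Complex.norm_natCast, smul_eq_mul]
  gcongr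
  rcases n with _ | n
  · rw [pow_zero, pow_zero]
    exact ContinuousLinearMap.norm_id_le
  · exact norm_pow_le' T n.succ_pos

lemma exp_add_smul (T : E →L[ℂ] E) (s t : ℝ) :
    NormedSpace.exp ((s + t) • T) = NormedSpace.exp (s • T) * NormedSpace.exp (t • T) := by
  let : NormedAlgebra ℚ (E →L[ℂ] E) := NormedAlgebra.restrictScalars ℚ ℂ _
  have e : (s + t) • T = s • T + t • T := by
    ext x
    simp [add_smul]
  rw [e]
  refine NormedSpace.exp_add_of_commute ?_
  exact ((Commute.refl T).smul_left s).smul_right t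

/-- A small perturbation of the generator of an exponentially decaying semigroup generates an
exponentially decaying semigroup. -/
lemma exists_norm_exp_neg_smul_le {T₀ : E →L[ℂ] E} {t₀ : ℝ} (ht₀ : 0 < t₀)
    (h : ‖NormedSpace.exp ((-t₀) • T₀)‖ ≤ 1 / 2) :
    ∃ C c η : ℝ, 0 < C ∧ 0 < c ∧ 0 < η ∧ ∀ T : E →L[ℂ] E, ‖T - T₀‖ ≤ η → ∀ t : ℝ, 0 ≤ t →
      ‖NormedSpace.exp ((-t) • T)‖ ≤ C * Real.exp (-c * t) := by
  -- Smallness at the single time `t₀` is an open condition on the generator; this yields decay with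
  -- constants uniform in a ball around `T₀`.
  have hcont : Continuous fun T : E →L[ℂ] E => ‖NormedSpace.exp ((-t₀) • T)‖ := by
    let : NormedAlgebra ℚ (E →L[ℂ] E) := NormedAlgebra.restrictScalars ℚ ℂ _
    exact (NormedSpace.exp_continuous.comp (continuous_const_smul _)).norm
  have hev : ∀ᶠ T in 𝓝 T₀, ‖NormedSpace.exp ((-t₀) • T)‖ < 3 / 4 :=
    hcont.continuousAt.eventually_lt_const (by linarith)
  obtain ⟨η, hη, hball⟩ := Metric.eventually_nhds_iff_ball.1 hev
  have hlog : 0 < Real.log (4 / 3) := Real.log_pos (by norm_num)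
  -- Write `t = n t₀ + r` with `0 ≤ r < t₀`. The remainder `r` costs `e^{t₀(‖T₀‖ + η)}`, and
  -- `(3/4)^n` with `n > t/t₀ - 1` gives the rate `log(4/3)/t₀` and the factor `4/3`. Halving `η`
  -- brings the closed ball into the open one.
  refine ⟨Real.exp (t₀ * (‖T₀‖ + η)) * (4 / 3), Real.log (4 / 3) / t₀, η / 2, by positivity,
    by positivity, by positivity, fun T hT t ht => ?_⟩
  have h1 : ‖NormedSpace.exp ((-t₀) • T)‖ ≤ 3 / 4 := by
    refine (hball T ?_).le
    rw [Metric.mem_ball, dist_eq_norm]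
    linarith
  have h2 : ‖T‖ ≤ ‖T₀‖ + η := by
    have := norm_add_le (T - T₀) T₀
    rw [sub_add_cancel] at this
    linarith
  set n : ℕ := ⌊t / t₀⌋₊ with hn
  have hn1 : (n : ℝ) * t₀ ≤ t := by
    rw [← le_div_iff₀ ht₀]
    exact Nat.floor_le (by positivity)
  have hn2 : t < (n + 1) * t₀ := by
    rw [← div_lt_iff₀ ht₀]
    exact Nat.lt_floor_add_one _
  have e1 : NormedSpace.exp ((-t) • T) =
      NormedSpace.exp ((-(t - n * t₀)) • T) * NormedSpace.exp ((-t₀) • T) ^ n := by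
    have h3 : NormedSpace.exp ((-t₀) • T) ^ n = NormedSpace.exp ((-(n * t₀)) • T) := by
      let : NormedAlgebra ℚ (E →L[ℂ] E) := NormedAlgebra.restrictScalars ℚ ℂ _
      rw [← NormedSpace.exp_nsmul]
      congr 1
      ext x
      simp [← Nat.cast_smul_eq_nsmul ℝ, smul_smul]
    rw [h3, ← exp_add_smul]
    congr 2
    ring
  have h4 : ‖NormedSpace.exp ((-(t - n * t₀)) • T)‖ ≤ Real.exp (t₀ * (‖T₀‖ + η)) := by
    refine (norm_exp_clm_le _).trans (Real.exp_le_exp.2 ?_)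
    have h5 : ‖(-(t - n * t₀)) • T‖ ≤ |t - n * t₀| * ‖T‖ := by
      rw [norm_smul, norm_neg, Real.norm_eq_abs]
    refine h5.trans ?_
    rw [abs_of_nonneg (by linarith)]
    refine mul_le_mul (by linarith) h2 (norm_nonneg _) ht₀.le
  have h6 : ‖NormedSpace.exp ((-t₀) • T) ^ n‖ ≤ 4 / 3 * Real.exp (-(Real.log (4 / 3) / t₀) * t) := by
    have h7 : ‖NormedSpace.exp ((-t₀) • T) ^ n‖ ≤ (3 / 4) ^ n := by
      rcases n with _ | n
      · rw [pow_zero, pow_zero]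
        exact ContinuousLinearMap.norm_id_le
      · exact (norm_pow_le' _ n.succ_pos).trans (by gcongr)
    refine h7.trans ?_
    have e2 : ((3 : ℝ) / 4) ^ n = Real.exp (-(Real.log (4 / 3) * n)) := by
      rw [show (3 : ℝ) / 4 = (4 / 3)⁻¹ by norm_num, inv_pow, Real.exp_neg, mul_comm,
        Real.exp_nat_mul, Real.exp_log (by norm_num)]
    have e3 : (4 : ℝ) / 3 = Real.exp (Real.log (4 / 3)) := (Real.exp_log (by norm_num)).symm
    rw [e2]
    nth_rewrite 2 [e3]
    rw [← Real.exp_add]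
    refine Real.exp_le_exp.2 ?_
    have : t / t₀ ≤ n + 1 := by
      rw [div_le_iff₀ ht₀]
      exact hn2.le
    have h8 : Real.log (4 / 3) / t₀ * t = Real.log (4 / 3) * (t / t₀) := by ring
    rw [neg_mul, h8]
    nlinarith
  rw [e1]
  refine (norm_mul_le _ _).trans ?_
  calc _ ≤ Real.exp (t₀ * (‖T₀‖ + η)) * (4 / 3 * Real.exp (-(Real.log (4 / 3) / t₀) * t)) := by
        gcongr
    _ = _ := by ring

lemma hasDerivAt_exp_smul_apply_comp (T : E →L[ℂ] E) {w : ℝ → E} {w' : E} {t : ℝ}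
    (hw : HasDerivAt w w' t) (r : ℝ) :
    HasDerivAt (fun s : ℝ => NormedSpace.exp ((s - r) • T) (w s))
      (NormedSpace.exp ((t - r) • T) (T (w t) + w')) t := by
  have h1 := (hasDerivAt_exp_smul_const (𝕂 := ℝ) T (t - r)).scomp t
    ((hasDerivAt_id t).sub_const r)
  have h2 := (ContinuousLinearMap.restrictScalarsL ℂ E E ℝ ℝ).hasFDerivAt.comp_hasDerivAt t h1
  have h3 := h2.clm_apply hw
  refine h3.congr_deriv ?_
  simp

/-- Uniqueness for linear autonomous equations. -/
lemma eq_exp_neg_smul_apply (T : E →L[ℂ] E) {w : ℝ → E}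
    (hw : ∀ t, HasDerivAt w (-(T (w t))) t) (t : ℝ) :
    w t = NormedSpace.exp ((-t) • T) (w 0) := by
  have h := fun s => hasDerivAt_exp_smul_apply_comp T (hw s) t
  have h2 := is_const_of_deriv_eq_zero (fun s => (h s).differentiableAt)
    (fun s => by rw [(h s).deriv]; simp) t 0
  simpa using h2

/-- Exponentially decaying semigroups depend on their generators in a Lipschitz way. -/
lemma norm_exp_neg_smul_sub_le {T T₀ : E →L[ℂ] E} {C c : ℝ} (hC : 0 < C) (hc : 0 < c)
    (h₀ : ∀ t : ℝ, 0 ≤ t → ‖NormedSpace.exp ((-t) • T₀)‖ ≤ C * Real.exp (-c * t))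
    (h : ∀ t : ℝ, 0 ≤ t → ‖NormedSpace.exp ((-t) • T)‖ ≤ C * Real.exp (-c * t))
    {t : ℝ} (ht : 0 ≤ t) (x : E) :
    ‖NormedSpace.exp ((-t) • T) x - NormedSpace.exp ((-t) • T₀) x‖ ≤
      2 * C ^ 2 / c * ‖T - T₀‖ * Real.exp (-(c / 2) * t) * ‖x‖ := by
  -- Duhamel's interpolation: `s ↦ e^{(s-t)T} e^{-sT₀} x` joins the two semigroups, and its
  -- derivative contains `T - T₀` between two decaying factors whose exponentials multiply to
  -- `e^{-ct}`.
  have hd := fun s => hasDerivAt_exp_smul_apply_comp T (hasDerivAt_exp_neg_smul_apply T₀ x s) t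
  have hb : ∀ s ∈ Set.Ico 0 t, ‖NormedSpace.exp ((s - t) • T)
      (T (NormedSpace.exp ((-s) • T₀) x) + -(T₀ (NormedSpace.exp ((-s) • T₀) x)))‖ ≤
      C ^ 2 * ‖T - T₀‖ * Real.exp (-c * t) * ‖x‖ := by
    intro s hs
    have h1 := h (t - s) (by linarith [hs.2])
    rw [neg_sub] at h1
    have h2 := h₀ s hs.1
    rw [← sub_eq_add_neg, ← sub_apply]
    refine (ContinuousLinearMap.le_of_opNorm_le _ h1 _).trans ?_
    calc _ ≤ C * Real.exp (-c * (t - s)) * (‖T - T₀‖ * ((C * Real.exp (-c * s)) * ‖x‖)) := by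
          gcongr
          exact ContinuousLinearMap.le_opNorm_of_le _ (ContinuousLinearMap.le_of_opNorm_le _ h2 _)
      _ = C ^ 2 * ‖T - T₀‖ * (Real.exp (-c * (t - s)) * Real.exp (-c * s)) * ‖x‖ := by ring
      _ = _ := by
          rw [← Real.exp_add]
          congr 3
          ring
  have h3 := norm_image_sub_le_of_norm_deriv_le_segment' (fun s _ => (hd s).hasDerivWithinAt) hb t
    ⟨ht, le_rfl⟩
  simp only [sub_self, zero_smul, NormedSpace.exp_zero, one_apply_eq_self,
    sub_zero, neg_zero, zero_sub] at h3
  rw [norm_sub_rev]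
  refine h3.trans ?_
  -- The factor `t` from the length of the interval is absorbed by giving up half of the decay rate.
  have h4 : t * Real.exp (-c * t) ≤ 2 / c * Real.exp (-(c / 2) * t) := by
    have h5 : c / 2 * t ≤ Real.exp (c / 2 * t) := by
      linarith [Real.add_one_le_exp (c / 2 * t)]
    have h6 : Real.exp (-c * t) = Real.exp (-(c / 2) * t) * (Real.exp (c / 2 * t))⁻¹ := by
      rw [← Real.exp_neg, ← Real.exp_add]
      congr 1
      ring
    have h7 : c / 2 * t * (Real.exp (c / 2 * t))⁻¹ ≤ 1 := by
      rw [← div_eq_mul_inv, div_le_one (Real.exp_pos _)]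
      exact h5
    rw [h6]
    calc _ = 2 / c * Real.exp (-(c / 2) * t) * (c / 2 * t * (Real.exp (c / 2 * t))⁻¹) := by
          field_simp
      _ ≤ 2 / c * Real.exp (-(c / 2) * t) * 1 := by gcongr
      _ = _ := mul_one _
  calc _ = C ^ 2 * ‖T - T₀‖ * ‖x‖ * (t * Real.exp (-c * t)) := by ring
    _ ≤ C ^ 2 * ‖T - T₀‖ * ‖x‖ * (2 / c * Real.exp (-(c / 2) * t)) := by gcongr
    _ = _ := by ring

/-- Banach's fixed point theorem for `z ↦ z₀ + l N z` on the ball of radius `‖z₀‖ + 1`. The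
condition `l B ≤ 1/2` gives both invariance of the ball and the contraction factor `1/2`; the
displacement bound `l B` is the `O(l)` expansion of the solution. -/
lemma exists_eq_add_smul {S : Type*} [NormedAddCommGroup S] [NormedSpace ℂ S] [CompleteSpace S]
    (z₀ : S) (N : S → S) {B l : ℝ} (hl : 0 ≤ l) (hlB : l * B ≤ 1 / 2)
    (h1 : ∀ z, ‖z‖ ≤ ‖z₀‖ + 1 → ‖N z‖ ≤ B)
    (h2 : ∀ z z', ‖z‖ ≤ ‖z₀‖ + 1 → ‖z'‖ ≤ ‖z₀‖ + 1 → ‖N z - N z'‖ ≤ B * ‖z - z'‖) :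
    ∃ z, ‖z‖ ≤ ‖z₀‖ + 1 ∧ ‖z - z₀‖ ≤ l * B ∧ z = z₀ + (l : ℂ) • N z := by
  have hn : ‖(l : ℂ)‖ = l := by rw [Complex.norm_real, Real.norm_of_nonneg hl]
  set s : Set S := Metric.closedBall 0 (‖z₀‖ + 1) with hs
  set F : S → S := fun z => z₀ + (l : ℂ) • N z with hF
  have hdist : ∀ z, ‖z‖ ≤ ‖z₀‖ + 1 → ‖F z - z₀‖ ≤ l * B := fun z hz => by
    rw [hF, add_sub_cancel_left, norm_smul, hn]
    exact mul_le_mul_of_nonneg_left (h1 z hz) hl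
  have hmaps : Set.MapsTo F s s := fun z hz => by
    rw [hs, mem_closedBall_zero_iff] at hz ⊢
    have := norm_add_le (F z - z₀) z₀
    rw [sub_add_cancel] at this
    linarith [hdist z hz]
  have hcontr : ContractingWith (1 / 2) (hmaps.restrict F s s) := by
    refine ⟨by rw [← NNReal.coe_lt_coe]; norm_num, LipschitzWith.of_dist_le_mul ?_⟩
    rintro ⟨z, hz⟩ ⟨z', hz'⟩
    rw [hs, mem_closedBall_zero_iff] at hz hz'
    change dist (F z) (F z') ≤ _ * dist z z'
    rw [dist_eq_norm, dist_eq_norm, hF, add_sub_add_left_eq_sub, ← smul_sub, norm_smul, hn]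
    have := mul_le_mul_of_nonneg_left (h2 z z' hz hz') hl
    have h3 := mul_le_mul_of_nonneg_right hlB (norm_nonneg (z - z'))
    push_cast
    linarith
  obtain ⟨z, hz, hfix, -⟩ := ContractingWith.exists_fixedPoint' (Metric.isClosed_closedBall.isComplete)
    hmaps hcontr (x := z₀) (by rw [hs, mem_closedBall_zero_iff]; linarith) (edist_ne_top _ _)
  rw [hs, mem_closedBall_zero_iff] at hz
  have hfix' : F z = z := hfix
  refine ⟨z, hz, ?_, hfix'.symm⟩
  have := hdist z hz
  rwa [hfix'] at this

end AbstractSemigroup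

/-! ### Approximate block diagonalization -/

section BlockDiagonalization

variable {E₁ E₂ : Type*} [NormedAddCommGroup E₁] [NormedSpace ℂ E₁] [CompleteSpace E₁]
  [NormedAddCommGroup E₂] [NormedSpace ℂ E₂] [CompleteSpace E₂]

lemma norm_comp_le_of_le {F₁ F₂ F₃ : Type*} [NormedAddCommGroup F₁] [NormedSpace ℂ F₁]
    [NormedAddCommGroup F₂] [NormedSpace ℂ F₂] [NormedAddCommGroup F₃] [NormedSpace ℂ F₃]
    {g : F₂ →L[ℂ] F₃} {f : F₁ →L[ℂ] F₂} {a b : ℝ} (hg : ‖g‖ ≤ a) (hf : ‖f‖ ≤ b) :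
    ‖g.comp f‖ ≤ a * b :=
  (g.opNorm_comp_le f).trans (mul_le_mul hg hf (norm_nonneg _) ((norm_nonneg _).trans hg))

lemma norm_ofReal_smul_le {G : Type*} [NormedAddCommGroup G] [NormedSpace ℂ G] {l : ℝ}
    (hl : 0 ≤ l) (hl1 : l ≤ 1) (g : G) : ‖(l : ℂ) • g‖ ≤ ‖g‖ := by
  rw [norm_smul, Complex.norm_real, Real.norm_of_nonneg hl]
  exact mul_le_of_le_one_left (norm_nonneg _) hl1

lemma norm_I_smul {G : Type*} [NormedAddCommGroup G] [NormedSpace ℂ G] (g : G) :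
    ‖Complex.I • g‖ = ‖g‖ := by
  rw [norm_smul, Complex.norm_I, one_mul]

set_option maxHeartbeats 1000000 in
/-- Existence of the Riccati operators which decouple the damped and the diffusive modes. -/
lemma exists_decoupling (K : E₁ →L[ℂ] E₁) (a₁₂ : E₂ →L[ℂ] E₁) (a₂₁ : E₁ →L[ℂ] E₂)
    (a₂₂ Dinv : E₂ →L[ℂ] E₂) :
    ∃ C l₀ : ℝ, 1 ≤ C ∧ 0 < l₀ ∧ l₀ ≤ 1 ∧ ∀ l : ℝ, 0 ≤ l → l ≤ l₀ →
      ∃ (X : E₁ →L[ℂ] E₂) (Y : E₂ →L[ℂ] E₁),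
        ‖X‖ ≤ C ∧ ‖Y‖ ≤ C ∧ ‖X - Dinv.comp a₂₁‖ ≤ C * l ∧ ‖Y - a₁₂.comp Dinv‖ ≤ C * l ∧
        X = Dinv.comp (a₂₁ + (l : ℂ) • (-(Complex.I • a₂₂.comp X) +
          (l : ℂ) • (X.comp K + X.comp (a₁₂.comp X)))) ∧
        Y = (a₁₂ + (l : ℂ) • ((l : ℂ) • (K + a₁₂.comp X).comp Y -
          Y.comp (Complex.I • a₂₂ - (l : ℂ) • X.comp a₁₂))).comp Dinv := by
  obtain ⟨M, hM1, hK, h12, h21, h22, hD⟩ : ∃ M : ℝ, 1 ≤ M ∧ ‖K‖ ≤ M ∧ ‖a₁₂‖ ≤ M ∧ ‖a₂₁‖ ≤ M ∧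
      ‖a₂₂‖ ≤ M ∧ ‖Dinv‖ ≤ M := by
    refine ⟨1 + ‖K‖ + ‖a₁₂‖ + ‖a₂₁‖ + ‖a₂₂‖ + ‖Dinv‖, ?_, ?_, ?_, ?_, ?_, ?_⟩ <;>
    linarith [norm_nonneg K, norm_nonneg a₁₂, norm_nonneg a₂₁, norm_nonneg a₂₂, norm_nonneg Dinv]
  have hM0 : 0 ≤ M := zero_le_one.trans hM1
  -- Both unperturbed solutions, `Dinv a₂₁` and `a₁₂ Dinv`, have norm at most `M²`; `R` bounds the
  -- radius of both fixed point balls.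
  set R : ℝ := M * M + 1 with hR
  have hR1 : 1 ≤ R := by nlinarith
  have hR0 : 0 ≤ R := by linarith
  -- One constant dominating the size and the Lipschitz constants of both nonlinearities on the
  -- ball; the four inequalities below are the cases needed.
  set B : ℝ := M * (M + M + 2 * (R * M)) * R + M * (M * R + M * R + R * M) * R with hB
  have hB1 : M * (M * R + (R * M + R * (M * R))) ≤ B := by
    have : 0 ≤ M * (R * M * R) := by positivity
    nlinarith
  have hB2 : M * (M + (M + 2 * (R * M))) ≤ B := by
    have h1 : 0 ≤ M * (M + M + 2 * (R * M)) := by positivity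
    have h2 : 0 ≤ M * (M * R + M * R + R * M) * R := by positivity
    nlinarith
  have hB3 : ((M + M * R) + (M + R * M)) * M * R ≤ B := by
    have h2 : 0 ≤ M * (M * R + M * R + R * M) * R := by positivity
    nlinarith
  have hB4 : ((M + M * R) + (M + R * M)) * M ≤ B := by
    have h1 : 0 ≤ ((M + M * R) + (M + R * M)) * M := by positivity
    nlinarith
  have hB0 : 0 < B := lt_of_lt_of_le (by positivity) hB2
  refine ⟨R + B, min 1 (1 / (2 * B)), by linarith, by positivity, min_le_left _ _,
    fun l hl hl' => ?_⟩
  have hl1 : l ≤ 1 := hl'.trans (min_le_left _ _)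
  have hlB : l * B ≤ 1 / 2 := by
    have := hl'.trans (min_le_right _ _)
    rw [le_div_iff₀ (by positivity)] at this
    linarith
  have hz : ‖Dinv.comp a₂₁‖ ≤ M * M := norm_comp_le_of_le hD h21
  obtain ⟨X, hX, hX', hXeq⟩ := exists_eq_add_smul (Dinv.comp a₂₁)
    (fun Z : E₁ →L[ℂ] E₂ => Dinv.comp (-(Complex.I • a₂₂.comp Z) +
          (l : ℂ) • (Z.comp K + Z.comp (a₁₂.comp Z)))) hl hlB
    (fun Z hZ => by
      have hZ : ‖Z‖ ≤ R := by linarith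
      refine le_trans (norm_comp_le_of_le hD ?_) hB1
      refine (norm_add_le _ _).trans (add_le_add ?_ ((norm_ofReal_smul_le hl hl1 _).trans ((norm_add_le _ _).trans
        (add_le_add (norm_comp_le_of_le hZ hK)
          (norm_comp_le_of_le hZ (norm_comp_le_of_le h12 hZ))))))
      rw [norm_neg]
      refine (norm_I_smul (a₂₂.comp Z)).le.trans ?_
      exact norm_comp_le_of_le h22 hZ)
    (fun Z Z' hZ hZ' => by
      have hZ : ‖Z‖ ≤ R := by linarith
      have hZ' : ‖Z'‖ ≤ R := by linarith
      have e : Dinv.comp (-(Complex.I • a₂₂.comp Z) + (l : ℂ) • (Z.comp K + Z.comp (a₁₂.comp Z))) -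
          Dinv.comp (-(Complex.I • a₂₂.comp Z') +
            (l : ℂ) • (Z'.comp K + Z'.comp (a₁₂.comp Z'))) =
          Dinv.comp (-(Complex.I • a₂₂.comp (Z - Z')) + (l : ℂ) • ((Z - Z').comp K +
            ((Z - Z').comp (a₁₂.comp Z) + Z'.comp (a₁₂.comp (Z - Z'))))) := by
        ext x
        simp only [sub_apply, add_apply, neg_apply, smul_apply, ContinuousLinearMap.comp_apply,
          map_sub, map_add, map_neg, map_smul]
        module
      rw [e]
      refine le_trans (b := M * (M * ‖Z - Z'‖ + (‖Z - Z'‖ * M +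
        (‖Z - Z'‖ * (M * R) + R * (M * ‖Z - Z'‖))))) (norm_comp_le_of_le hD ?_) ?_
      · refine (norm_add_le _ _).trans (add_le_add ?_ ((norm_ofReal_smul_le hl hl1 _).trans ((norm_add_le _ _).trans
          (add_le_add (norm_comp_le_of_le le_rfl hK) ((norm_add_le _ _).trans (add_le_add
            (norm_comp_le_of_le le_rfl (norm_comp_le_of_le h12 hZ))
            (norm_comp_le_of_le hZ' (norm_comp_le_of_le h12 le_rfl))))))))
        rw [norm_neg]
        refine (norm_I_smul (a₂₂.comp (Z - Z'))).le.trans ?_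
        exact norm_comp_le_of_le h22 le_rfl
      · have := mul_le_mul_of_nonneg_right hB2 (norm_nonneg (Z - Z'))
        linarith)
  have hXR : ‖X‖ ≤ R := by linarith
  have hy : ‖a₁₂.comp Dinv‖ ≤ M * M := norm_comp_le_of_le h12 hD
  have hG : ‖K + a₁₂.comp X‖ ≤ M + M * R :=
    (norm_add_le _ _).trans (add_le_add hK (norm_comp_le_of_le h12 hXR))
  have hδ : ‖Complex.I • a₂₂ - (l : ℂ) • X.comp a₁₂‖ ≤ M + R * M := by
    refine (norm_sub_le _ _).trans (add_le_add ?_ ((norm_ofReal_smul_le hl hl1 _).trans (norm_comp_le_of_le hXR h12)))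
    exact (norm_I_smul _).le.trans h22
  -- With `X` already fixed the equation for `Y` is affine, so one bound of the linear part serves
  -- for both the size and the Lipschitz estimate.
  have hN : ∀ Z : E₂ →L[ℂ] E₁, ‖((l : ℂ) • (K + a₁₂.comp X).comp Z -
      Z.comp (Complex.I • a₂₂ - (l : ℂ) • X.comp a₁₂)).comp Dinv‖ ≤
      ((M + M * R) + (M + R * M)) * M * ‖Z‖ := fun Z => by
    refine le_trans (norm_comp_le_of_le ((norm_sub_le _ _).trans (add_le_add
      ((norm_ofReal_smul_le hl hl1 _).trans (norm_comp_le_of_le hG le_rfl)) (norm_comp_le_of_le le_rfl hδ))) hD) ?_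
    exact le_of_eq (by ring)
  obtain ⟨Y, hY, hY', hYeq⟩ := exists_eq_add_smul (a₁₂.comp Dinv)
    (fun Z : E₂ →L[ℂ] E₁ => ((l : ℂ) • (K + a₁₂.comp X).comp Z -
          Z.comp (Complex.I • a₂₂ - (l : ℂ) • X.comp a₁₂)).comp Dinv) hl hlB
    (fun Z hZ => by
      refine (hN Z).trans (le_trans ?_ hB3)
      have hZ : ‖Z‖ ≤ R := by linarith
      gcongr)
    (fun Z Z' hZ hZ' => by
      have e : ((l : ℂ) • (K + a₁₂.comp X).comp Z -
          Z.comp (Complex.I • a₂₂ - (l : ℂ) • X.comp a₁₂)).comp Dinv -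
          ((l : ℂ) • (K + a₁₂.comp X).comp Z' -
          Z'.comp (Complex.I • a₂₂ - (l : ℂ) • X.comp a₁₂)).comp Dinv =
          ((l : ℂ) • (K + a₁₂.comp X).comp (Z - Z') -
          (Z - Z').comp (Complex.I • a₂₂ - (l : ℂ) • X.comp a₁₂)).comp Dinv := by
        ext x
        simp only [sub_apply, add_apply, neg_apply, smul_apply, ContinuousLinearMap.comp_apply,
          map_sub, map_add, map_neg, map_smul]
        module
      rw [e]
      refine (hN _).trans ?_
      gcongr)
  refine ⟨X, Y, by linarith, by linarith, ?_, ?_, ?_, ?_⟩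
  · have : 0 ≤ R * l := by positivity
    linarith
  · have : 0 ≤ R * l := by positivity
    linarith
  · nth_rewrite 1 [hXeq]
    ext x
    simp only [sub_apply, add_apply, neg_apply, smul_apply, ContinuousLinearMap.comp_apply,
          map_sub, map_add, map_neg, map_smul]
  · nth_rewrite 1 [hYeq]
    ext x
    simp only [sub_apply, add_apply, neg_apply, smul_apply, ContinuousLinearMap.comp_apply,
          map_sub, map_add, map_neg, map_smul]

end BlockDiagonalization

/-! ### Asymptotics of the block system -/

section BlockDecay

variable {E₁ E₂ : Type*} [NormedAddCommGroup E₁] [NormedSpace ℂ E₁] [CompleteSpace E₁]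
  [NormedAddCommGroup E₂] [NormedSpace ℂ E₂] [CompleteSpace E₂]

lemma norm_ofReal_smul {G : Type*} [NormedAddCommGroup G] [NormedSpace ℂ G] {l : ℝ}
    (hl : 0 ≤ l) (g : G) : ‖(l : ℂ) • g‖ = l * ‖g‖ := by
  rw [norm_smul, Complex.norm_real, Real.norm_of_nonneg hl]

lemma norm_I_mul_smul {G : Type*} [NormedAddCommGroup G] [NormedSpace ℂ G] {l : ℝ}
    (hl : 0 ≤ l) (g : G) : ‖((l : ℂ) * Complex.I) • g‖ = l * ‖g‖ := by
  rw [norm_smul, norm_mul, Complex.norm_I, mul_one, Complex.norm_real, Real.norm_of_nonneg hl]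

/-- In the equation for `v₂ + i l X v₁` the coefficient of `v₁` closes up exactly when `X` solves
the Riccati equation `hX`; its quadratic term comes from inserting the `v₂` part of the first
equation. -/
lemma hasDerivAt_damped_mode {K : E₁ →L[ℂ] E₁} {a₁₂ : E₂ →L[ℂ] E₁} {a₂₁ X : E₁ →L[ℂ] E₂}
    {a₂₂ Dm : E₂ →L[ℂ] E₂} {l : ℝ} {v₁ : ℝ → E₁} {v₂ : ℝ → E₂} {t : ℝ}
    (h₁ : HasDerivAt v₁ (-(((l : ℂ) ^ 2) • K (v₁ t) + ((l : ℂ) * Complex.I) • a₁₂ (v₂ t))) t)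
    (h₂ : HasDerivAt v₂ (-(((l : ℂ) * Complex.I) • a₂₁ (v₁ t) + Dm (v₂ t) +
      ((l : ℂ) * Complex.I) • a₂₂ (v₂ t))) t)
    (hX : ∀ x, Dm (X x) = a₂₁ x + (l : ℂ) • (-(Complex.I • a₂₂ (X x)) +
      (l : ℂ) • (X (K x) + X (a₁₂ (X x))))) :
    HasDerivAt (fun s => v₂ s + ((l : ℂ) * Complex.I) • X (v₁ s))
      (-((Dm + (l : ℂ) • (Complex.I • a₂₂ - (l : ℂ) • X.comp a₁₂))
        (v₂ t + ((l : ℂ) * Complex.I) • X (v₁ t)))) t := by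
  have hx : HasDerivAt (fun s => X (v₁ s)) _ t :=
    (X.restrictScalars ℝ).hasFDerivAt.comp_hasDerivAt t h₁
  refine (h₂.add (hx.const_smul ((l : ℂ) * Complex.I))).congr_deriv ?_
  simp only [ContinuousLinearMap.coe_restrictScalars', sub_apply, add_apply, neg_apply, smul_apply,
    ContinuousLinearMap.comp_apply, map_sub, map_add, map_neg, map_smul, hX]
  have hI := Complex.I_sq
  -- Coefficients are compared one by one; the alternatives differ in how `i² = -1` enters.
  match_scalars <;> first | ring1 | linear_combination (l : ℂ) ^ 2 * hI | linear_combination (-(l : ℂ) ^ 2) * hI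

/-- Once `w` evolves on its own, subtracting `i l Y w` from `v₁` removes the remaining coupling
exactly when `Y` solves the linear equation `hY`. The generator left for the diffusive mode is `l²
(K + a₁₂ X)`. -/
lemma hasDerivAt_diffusive_mode {K : E₁ →L[ℂ] E₁} {a₁₂ Y : E₂ →L[ℂ] E₁} {X : E₁ →L[ℂ] E₂}
    {a₂₂ Dm : E₂ →L[ℂ] E₂} {l : ℝ} {v₁ : ℝ → E₁} {v₂ w : ℝ → E₂} {t : ℝ}
    (h₁ : HasDerivAt v₁ (-(((l : ℂ) ^ 2) • K (v₁ t) + ((l : ℂ) * Complex.I) • a₁₂ (v₂ t))) t)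
    (hw : HasDerivAt w (-((Dm + (l : ℂ) • (Complex.I • a₂₂ - (l : ℂ) • X.comp a₁₂)) (w t))) t)
    (hwt : w t = v₂ t + ((l : ℂ) * Complex.I) • X (v₁ t))
    (hY : ∀ x, Y (Dm x) = a₁₂ x + (l : ℂ) • ((l : ℂ) • (K (Y x) + a₁₂ (X (Y x))) -
      Y (Complex.I • a₂₂ x - (l : ℂ) • X (a₁₂ x)))) :
    HasDerivAt (fun s => v₁ s - ((l : ℂ) * Complex.I) • Y (w s))
      (-((((l : ℂ) ^ 2) • (K + a₁₂.comp X)) (v₁ t - ((l : ℂ) * Complex.I) • Y (w t)))) t := by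
  have hx : HasDerivAt (fun s => Y (w s)) _ t :=
    (Y.restrictScalars ℝ).hasFDerivAt.comp_hasDerivAt t hw
  have hv : v₂ t = w t - ((l : ℂ) * Complex.I) • X (v₁ t) := by rw [hwt, add_sub_cancel_right]
  refine (h₁.sub (hx.const_smul ((l : ℂ) * Complex.I))).congr_deriv ?_
  rw [hv]
  simp only [ContinuousLinearMap.coe_restrictScalars', sub_apply, add_apply, neg_apply, smul_apply,
    ContinuousLinearMap.comp_apply, map_sub, map_add, map_neg, map_smul, hY]
  have hI := Complex.I_sq
  match_scalars <;> first | ring1 | linear_combination (l : ℂ) ^ 2 * hI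

/-- Here `e₁ = e^{-c l² t}`, `e₂ = e^{-ct}`, and `A` dominates all constants. The three terms are
the errors made by replacing the generator, by replacing the initial value of the diffusive mode,
and by the damped mode. -/
lemma real_bound_conservative {A l a b e₁ e₂ : ℝ} (hA : 1 ≤ A) (hl : 0 ≤ l) (hl1 : l ≤ 1)
    (ha : 0 ≤ a) (hb : 0 ≤ b) (he₂ : 0 ≤ e₂) (he : e₂ ≤ e₁) :
    A * (A ^ 2 * l) * e₁ * (2 * A ^ 2 * (a + l * b)) + A * e₁ * (A ^ 2 * l ^ 2 * (a + b)) +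
      l * (A * (A * e₂ * (b + l * A * a))) ≤
    4 * A ^ 5 * (l * e₁ * a + (l ^ 2 * e₁ + l * e₂) * b) := by
  have h3 : A ^ 3 ≤ A ^ 5 := pow_le_pow_right₀ hA (by norm_num)
  have h2 : A ^ 2 ≤ A ^ 5 := pow_le_pow_right₀ hA (by norm_num)
  have hA0 : 0 ≤ A := by linarith
  have hA5 : 0 ≤ A ^ 5 := by positivity
  have he₁ : 0 ≤ e₁ := he₂.trans he
  have hll : l ^ 2 ≤ l := by nlinarith
  have i1 : A ^ 3 * (l ^ 2 * e₁ * a) ≤ A ^ 5 * (l * e₁ * a) := by gcongr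
  have i2 : A ^ 3 * (l ^ 2 * e₁ * b) ≤ A ^ 5 * (l ^ 2 * e₁ * b) := by gcongr
  have i3 : A ^ 2 * (l * e₂ * b) ≤ A ^ 5 * (l * e₂ * b) := by gcongr
  have i4 : A ^ 3 * (l ^ 2 * e₂ * a) ≤ A ^ 5 * (l * e₁ * a) := by gcongr
  have j1 : 0 ≤ A ^ 5 * (l ^ 2 * e₁ * b) := by positivity
  have j2 : 0 ≤ A ^ 5 * (l * e₂ * b) := by positivity
  linarith

/-- The three terms are the damped mode itself, `X` applied to the conservative error, and `X - D⁻¹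
a₂₁` applied to the profile. -/
lemma real_bound_dissipative {A l a b e₁ e₂ : ℝ} (hA : 1 ≤ A) (hl : 0 ≤ l) (hl1 : l ≤ 1)
    (ha : 0 ≤ a) (hb : 0 ≤ b) (he₂ : 0 ≤ e₂) (he : e₂ ≤ e₁) :
    A * e₂ * (b + l * A * a) + l * (A * (4 * A ^ 5 * (l * e₁ * a + (l ^ 2 * e₁ + l * e₂) * b))) +
      l * ((A * l) * (A * e₁ * (a + l * (A * (A * b))))) ≤
    9 * A ^ 6 * ((l ^ 2 * e₁ + l * e₂) * a + (l ^ 3 * e₁ + e₂) * b) := by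
  have h1 : A ≤ A ^ 6 := le_self_pow₀ hA (by norm_num)
  have h4 : A ^ 4 ≤ A ^ 6 := pow_le_pow_right₀ hA (by norm_num)
  have h2 : A ^ 2 ≤ A ^ 6 := pow_le_pow_right₀ hA (by norm_num)
  have hA0 : 0 ≤ A := by linarith
  have hA6 : 0 ≤ A ^ 6 := by positivity
  have he₁ : 0 ≤ e₁ := he₂.trans he
  have hll : l ^ 2 ≤ 1 := by nlinarith
  have i1 : A * (e₂ * b) ≤ A ^ 6 * (e₂ * b) := by gcongr
  have i2 : A ^ 2 * (l * e₂ * a) ≤ A ^ 6 * (l * e₂ * a) := by gcongr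
  have i3 : A ^ 6 * (l ^ 2 * (e₂ * b)) ≤ A ^ 6 * (1 * (e₂ * b)) := by gcongr
  have i4 : A ^ 2 * (l ^ 2 * e₁ * a) ≤ A ^ 6 * (l ^ 2 * e₁ * a) := by gcongr
  have i5 : A ^ 4 * (l ^ 3 * e₁ * b) ≤ A ^ 6 * (l ^ 3 * e₁ * b) := by gcongr
  have j1 : 0 ≤ A ^ 6 * (l ^ 2 * e₁ * a) := by positivity
  have j2 : 0 ≤ A ^ 6 * (l * e₂ * a) := by positivity
  have j3 : 0 ≤ A ^ 6 * (l ^ 3 * e₁ * b) := by positivity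
  have j4 : 0 ≤ A ^ 6 * (e₂ * b) := by positivity
  linarith

set_option maxHeartbeats 1000000 in
/-- The solution of the block system is `e^{-tl²G} ψ` up to better decaying terms. -/
lemma exists_block_decay (K : E₁ →L[ℂ] E₁) (a₁₂ : E₂ →L[ℂ] E₁) (a₂₁ : E₁ →L[ℂ] E₂)
    (a₂₂ Dm Dinv : E₂ →L[ℂ] E₂) (hD₁ : ∀ x, Dm (Dinv x) = x) (hD₂ : ∀ x, Dinv (Dm x) = x)
    {t₁ t₂ : ℝ} (ht₁ : 0 < t₁) (ht₂ : 0 < t₂)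
    (hG : ‖NormedSpace.exp ((-t₁) • (K + a₁₂.comp (Dinv.comp a₂₁)))‖ ≤ 1 / 2)
    (hD : ‖NormedSpace.exp ((-t₂) • Dm)‖ ≤ 1 / 2) :
    ∃ C c l₀ : ℝ, 0 < C ∧ 0 < c ∧ 0 < l₀ ∧ l₀ ≤ 1 ∧ ∀ l : ℝ, 0 < l → l ≤ l₀ →
      ∀ (v₁ : ℝ → E₁) (v₂ : ℝ → E₂),
      (∀ t, HasDerivAt v₁
        (-(((l : ℂ) ^ 2) • K (v₁ t) + ((l : ℂ) * Complex.I) • a₁₂ (v₂ t))) t) →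
      (∀ t, HasDerivAt v₂ (-(((l : ℂ) * Complex.I) • a₂₁ (v₁ t) + Dm (v₂ t) +
        ((l : ℂ) * Complex.I) • a₂₂ (v₂ t))) t) →
      ∀ t : ℝ, 0 ≤ t → ∀ S, S = NormedSpace.exp ((-(l ^ 2 * t)) • (K + a₁₂.comp (Dinv.comp a₂₁)))
          (v₁ 0 - ((l : ℂ) * Complex.I) • a₁₂ (Dinv (v₂ 0))) →
        ‖v₁ t - S‖ ≤ C * (l * Real.exp (-c * (l ^ 2 * t)) * ‖v₁ 0‖ +
          (l ^ 2 * Real.exp (-c * (l ^ 2 * t)) + l * Real.exp (-c * t)) * ‖v₂ 0‖) ∧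
        ‖v₂ t + ((l : ℂ) * Complex.I) • Dinv (a₂₁ S)‖ ≤
          C * ((l ^ 2 * Real.exp (-c * (l ^ 2 * t)) + l * Real.exp (-c * t)) * ‖v₁ 0‖ +
          (l ^ 3 * Real.exp (-c * (l ^ 2 * t)) + Real.exp (-c * t)) * ‖v₂ 0‖) := by
  set G := K + a₁₂.comp (Dinv.comp a₂₁) with hGdef
  obtain ⟨C₁, c₁, η₁, hC₁, hc₁, hη₁, hdec₁⟩ := exists_norm_exp_neg_smul_le ht₁ hG
  obtain ⟨C₂, c₂, η₂, hC₂, hc₂, hη₂, hdec₂⟩ := exists_norm_exp_neg_smul_le ht₂ hD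
  obtain ⟨C₃, l₃, hC₃, hl₃, hl₃1, hdecoup⟩ := exists_decoupling K a₁₂ a₂₁ a₂₂ Dinv
  obtain ⟨A, hA1, hA12, hA22, hADi, hAC₁, hAC₁', hAC₂, hAC₃⟩ : ∃ A : ℝ, 1 ≤ A ∧ ‖a₁₂‖ ≤ A ∧
      ‖a₂₂‖ ≤ A ∧ ‖Dinv‖ ≤ A ∧ C₁ ≤ A ∧ 2 * C₁ ^ 2 / c₁ ≤ A ∧ C₂ ≤ A ∧ C₃ ≤ A := by
    have : 0 ≤ 2 * C₁ ^ 2 / c₁ := by positivity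
    refine ⟨1 + ‖a₁₂‖ + ‖a₂₂‖ + ‖Dinv‖ + C₁ + 2 * C₁ ^ 2 / c₁ + C₂ + C₃, ?_, ?_, ?_, ?_, ?_, ?_,
      ?_, ?_⟩ <;>
    linarith [norm_nonneg a₁₂, norm_nonneg a₂₂, norm_nonneg Dinv]
  have hA0 : 0 < A := by linarith
  -- The comparison of semigroups in `norm_exp_neg_smul_sub_le` retains only half of the rate `c₁`.
  set c := min (c₁ / 2) c₂ with hc
  have hc0 : 0 < c := by positivity
  have hcc₁ : c ≤ c₁ / 2 := min_le_left _ _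
  have hcc₂ : c ≤ c₂ := min_le_right _ _
  -- The last two bounds on `l` keep the perturbed generators `Gt` and `Dt` in the balls of radius
  -- `η₁` and `η₂` in which the decay is uniform.
  refine ⟨9 * A ^ 6, c, min l₃ (min (η₁ / A ^ 2) (η₂ / (2 * A ^ 2))), by positivity, hc0,
    by positivity, (min_le_left _ _).trans hl₃1, fun l hl hl' v₁ v₂ h₁ h₂ t ht S hS => ?_⟩
  have hll₃ : l ≤ l₃ := hl'.trans (min_le_left _ _)
  have hl1 : l ≤ 1 := hll₃.trans hl₃1
  have hl2 : l ^ 2 ≤ 1 := pow_le_one₀ hl.le hl1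
  have hA2 : A ≤ A ^ 2 := le_self_pow₀ hA1 (by norm_num)
  have hA21 : 1 ≤ A ^ 2 := one_le_pow₀ hA1
  have hexp : ∀ {k s : ℝ}, c ≤ k → 0 ≤ s → -k * s ≤ -c * s := fun hk hs =>
    mul_le_mul_of_nonneg_right (neg_le_neg hk) hs
  have hlη₁ : A ^ 2 * l ≤ η₁ := by
    have := hl'.trans ((min_le_right _ _).trans (min_le_left _ _))
    rwa [le_div_iff₀' (by positivity)] at this
  have hlη₂ : 2 * A ^ 2 * l ≤ η₂ := by
    have := hl'.trans ((min_le_right _ _).trans (min_le_right _ _))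
    rwa [le_div_iff₀' (by positivity)] at this
  obtain ⟨X, Y, hXn, hYn, hXd, hYd, hXeq, hYeq⟩ := hdecoup l hl.le hll₃
  replace hXn := hXn.trans hAC₃
  replace hYn := hYn.trans hAC₃
  replace hXd : ‖X - Dinv.comp a₂₁‖ ≤ A * l := hXd.trans (by gcongr)
  replace hYd : ‖Y - a₁₂.comp Dinv‖ ≤ A * l := hYd.trans (by gcongr)
  have hX : ∀ x, Dm (X x) = a₂₁ x + (l : ℂ) • (-(Complex.I • a₂₂ (X x)) +
      (l : ℂ) • (X (K x) + X (a₁₂ (X x)))) := fun x => by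
    have := congrArg (fun T : E₁ →L[ℂ] E₂ => Dm (T x)) hXeq
    simpa only [ContinuousLinearMap.comp_apply, hD₁, add_apply, smul_apply, neg_apply] using this
  have hY : ∀ x, Y (Dm x) = a₁₂ x + (l : ℂ) • ((l : ℂ) • (K (Y x) + a₁₂ (X (Y x))) -
      Y (Complex.I • a₂₂ x - (l : ℂ) • X (a₁₂ x))) := fun x => by
    have := congrArg (fun T : E₂ →L[ℂ] E₁ => T (Dm x)) hYeq
    simpa only [ContinuousLinearMap.comp_apply, hD₂, add_apply, smul_apply, neg_apply,
      sub_apply] using this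
  set Gt := K + a₁₂.comp X with hGt
  set Dt := Dm + (l : ℂ) • (Complex.I • a₂₂ - (l : ℂ) • X.comp a₁₂) with hDt
  have hGtG : ‖Gt - G‖ ≤ A ^ 2 * l := by
    have e : Gt - G = a₁₂.comp (X - Dinv.comp a₂₁) := by
      rw [hGt, hGdef]
      ext x
      simp
    rw [e]
    exact (norm_comp_le_of_le hA12 hXd).trans_eq (by ring)
  have hDtD : ‖Dt - Dm‖ ≤ 2 * A ^ 2 * l := by
    have e : Dt - Dm = (l : ℂ) • (Complex.I • a₂₂ - (l : ℂ) • X.comp a₁₂) := by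
      rw [hDt, add_sub_cancel_left]
    rw [e]
    refine (norm_ofReal_smul hl.le (Complex.I • a₂₂ - (l : ℂ) • X.comp a₁₂)).le.trans ?_
    have h3 : ‖Complex.I • a₂₂ - (l : ℂ) • X.comp a₁₂‖ ≤ A + A * A :=
      (norm_sub_le _ _).trans (add_le_add ((norm_I_smul a₂₂).le.trans hA22)
        ((norm_ofReal_smul_le hl.le hl1 _).trans (norm_comp_le_of_le hXn hA12)))
    have h4 : A + A * A ≤ 2 * A ^ 2 := by linarith [sq A]
    calc _ ≤ l * (A + A * A) := by gcongr
      _ ≤ l * (2 * A ^ 2) := by gcongr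
      _ = _ := by ring
  set w : ℝ → E₂ := fun s => v₂ s + ((l : ℂ) * Complex.I) • X (v₁ s) with hw
  have hwd : ∀ s, HasDerivAt w (-(Dt (w s))) s := fun s => hasDerivAt_damped_mode (h₁ s) (h₂ s) hX
  set z : ℝ → E₁ := fun s => v₁ s - ((l : ℂ) * Complex.I) • Y (w s) with hz
  have hzd : ∀ s, HasDerivAt z (-((((l : ℂ) ^ 2) • Gt) (z s))) s := fun s =>
    hasDerivAt_diffusive_mode (h₁ s) (hwd s) rfl hY
  have hwt := eq_exp_neg_smul_apply Dt hwd t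
  have hzt := eq_exp_neg_smul_apply _ hzd t
  -- The factor `l²` is moved from the generator to the time, so the diffusive mode decays in the
  -- variable `l² t`.
  have esm : (-t) • (((l : ℂ) ^ 2) • Gt) = (-(l ^ 2 * t)) • Gt := by
    ext x
    simp only [smul_apply, neg_apply, neg_smul]
    rw [← Complex.coe_smul t, ← Complex.coe_smul (l ^ 2 * t), smul_smul]
    push_cast
    rw [mul_comm]
  rw [esm] at hzt
  set a := ‖v₁ 0‖ with ha
  set b := ‖v₂ 0‖ with hb
  have ha0 : 0 ≤ a := norm_nonneg _
  have hb0 : 0 ≤ b := norm_nonneg _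
  set e₁ := Real.exp (-c * (l ^ 2 * t)) with he₁
  set e₂ := Real.exp (-c * t) with he₂
  have he₁0 : 0 ≤ e₁ := (Real.exp_pos _).le
  have he₂0 : 0 ≤ e₂ := (Real.exp_pos _).le
  have hτ : 0 ≤ l ^ 2 * t := by positivity
  have he : e₂ ≤ e₁ := by
    refine Real.exp_le_exp.2 ?_
    have : l ^ 2 * t ≤ t := mul_le_of_le_one_left ht hl2
    exact mul_le_mul_of_nonpos_left this (neg_nonpos.2 hc0.le)
  have hw0 : ‖w 0‖ ≤ b + l * A * a := by
    refine (norm_add_le _ _).trans (add_le_add le_rfl ?_)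
    rw [norm_I_mul_smul hl.le, mul_assoc]
    exact mul_le_mul_of_nonneg_left (X.le_of_opNorm_le hXn _) hl.le
  have hz0 : ‖z 0‖ ≤ 2 * A ^ 2 * (a + l * b) := by
    have h5 : ‖z 0‖ ≤ a + l * (A * (b + l * A * a)) := by
      refine (norm_sub_le _ _).trans (add_le_add le_rfl ?_)
      rw [norm_I_mul_smul hl.le]
      exact mul_le_mul_of_nonneg_left ((Y.le_of_opNorm_le hYn _).trans (by gcongr)) hl.le
    have h6 : A ≤ A ^ 2 := le_self_pow₀ hA1 (by norm_num)
    have h7 : l * A * b ≤ l * A ^ 2 * b := by gcongr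
    have h8 : l ^ 2 * A ^ 2 * a ≤ 1 * A ^ 2 * a := by
      gcongr
    have h9 : a ≤ A ^ 2 * a := le_mul_of_one_le_left ha0 hA21
    have h10 : 0 ≤ l * A ^ 2 * b := by positivity
    linarith
  set ψ := v₁ 0 - ((l : ℂ) * Complex.I) • a₁₂ (Dinv (v₂ 0)) with hψ
  -- The terms of order `l` in `z 0` and in `ψ` cancel up to `Y - a₁₂ D⁻¹ = O(l)`. This is why the
  -- effective quantity, and not `v₁`, is the initial value of the profile.
  have hzψ : ‖z 0 - ψ‖ ≤ A ^ 2 * l ^ 2 * (a + b) := by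
    have e : z 0 - ψ = -(((l : ℂ) * Complex.I) • ((Y - a₁₂.comp Dinv) (v₂ 0) +
        ((l : ℂ) * Complex.I) • Y (X (v₁ 0)))) := by
      simp only [hz, hψ, hw, map_add, map_smul, sub_apply, ContinuousLinearMap.comp_apply]
      module
    rw [e, norm_neg, norm_I_mul_smul hl.le]
    have h5 : ‖(Y - a₁₂.comp Dinv) (v₂ 0) + ((l : ℂ) * Complex.I) • Y (X (v₁ 0))‖ ≤
        A * l * b + l * (A * (A * a)) := by
      refine (norm_add_le _ _).trans (add_le_add (ContinuousLinearMap.le_of_opNorm_le _ hYd _) ?_)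
      rw [norm_I_mul_smul hl.le]
      exact mul_le_mul_of_nonneg_left ((Y.le_of_opNorm_le hYn _).trans
        (mul_le_mul_of_nonneg_left (X.le_of_opNorm_le hXn _) hA0.le)) hl.le
    have h6 : A ≤ A ^ 2 := le_self_pow₀ hA1 (by norm_num)
    calc _ ≤ l * (A * l * b + l * (A * (A * a))) := by gcongr
      _ = l ^ 2 * (A * b) + l ^ 2 * (A ^ 2 * a) := by ring
      _ ≤ l ^ 2 * (A ^ 2 * b) + l ^ 2 * (A ^ 2 * a) := by gcongr
      _ = _ := by ring
  have hψn : ‖ψ‖ ≤ a + l * (A * (A * b)) := by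
    refine (norm_sub_le _ _).trans (add_le_add le_rfl ?_)
    rw [norm_I_mul_smul hl.le]
    exact mul_le_mul_of_nonneg_left ((a₁₂.le_of_opNorm_le hA12 _).trans
      (mul_le_mul_of_nonneg_left (Dinv.le_of_opNorm_le hADi _) hA0.le)) hl.le
  have hdG : ∀ s : ℝ, 0 ≤ s → ‖NormedSpace.exp ((-s) • G)‖ ≤ C₁ * Real.exp (-c₁ * s) :=
    hdec₁ G (by rw [sub_self, norm_zero]; exact hη₁.le)
  have hdGt : ∀ s : ℝ, 0 ≤ s → ‖NormedSpace.exp ((-s) • Gt)‖ ≤ C₁ * Real.exp (-c₁ * s) :=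
    hdec₁ Gt (hGtG.trans hlη₁)
  have hSn : ∀ x, ‖NormedSpace.exp ((-(l ^ 2 * t)) • G) x‖ ≤ A * e₁ * ‖x‖ := fun x => by
    refine (ContinuousLinearMap.le_of_opNorm_le _ (hdG _ hτ) _).trans ?_
    gcongr
    exact Real.exp_le_exp.2 (hexp (by linarith) hτ)
  have hwn : ‖w t‖ ≤ A * e₂ * (b + l * A * a) := by
    rw [hwt]
    refine (ContinuousLinearMap.le_of_opNorm_le _ (hdec₂ Dt (hDtD.trans hlη₂) t ht) _).trans ?_
    gcongr
    exact Real.exp_le_exp.2 (hexp hcc₂ ht)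
  have hdiff : ‖z t - NormedSpace.exp ((-(l ^ 2 * t)) • G) (z 0)‖ ≤
      A * (A ^ 2 * l) * e₁ * (2 * A ^ 2 * (a + l * b)) := by
    rw [hzt]
    refine (norm_exp_neg_smul_sub_le hC₁ hc₁ hdG hdGt hτ _).trans ?_
    gcongr
    exact Real.exp_le_exp.2 (hexp hcc₁ hτ)
  have hb₁ : ‖v₁ t - S‖ ≤ 4 * A ^ 5 * (l * e₁ * a + (l ^ 2 * e₁ + l * e₂) * b) := by
    refine le_trans ?_ (real_bound_conservative hA1 hl.le hl1 ha0 hb0 he₂0 he)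
    -- Difference of generators, difference of initial values, and contribution of the damped mode.
    have e : v₁ t - S = (z t - NormedSpace.exp ((-(l ^ 2 * t)) • G) (z 0)) +
        NormedSpace.exp ((-(l ^ 2 * t)) • G) (z 0 - ψ) + ((l : ℂ) * Complex.I) • Y (w t) := by
      have e' : v₁ t = z t + ((l : ℂ) * Complex.I) • Y (w t) := by rw [hz, sub_add_cancel]
      rw [hS, map_sub _ (z 0) ψ, e']
      abel
    rw [e]
    refine (norm_add₃_le).trans (add_le_add (add_le_add hdiff ?_) ?_)
    · exact (hSn _).trans (by gcongr)
    · rw [norm_I_mul_smul hl.le]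
      exact mul_le_mul_of_nonneg_left ((Y.le_of_opNorm_le hYn _).trans
        (mul_le_mul_of_nonneg_left hwn hA0.le)) hl.le
  have hSS : ‖S‖ ≤ A * e₁ * (a + l * (A * (A * b))) := by
    rw [hS]
    exact (hSn _).trans (by gcongr)
  constructor
  · refine hb₁.trans ?_
    have : A ^ 5 ≤ A ^ 6 := pow_le_pow_right₀ hA1 (by norm_num)
    have h6 : 0 ≤ A ^ 6 := by positivity
    gcongr ?_ * _
    linarith
  · refine le_trans ?_ (real_bound_dissipative hA1 hl.le hl1 ha0 hb0 he₂0 he)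
    -- Solve `w = v₂ + i l X v₁` for `v₂`, then replace `v₁` by `S` and `X` by `D⁻¹ a₂₁`.
    have e : v₂ t + ((l : ℂ) * Complex.I) • Dinv (a₂₁ S) = w t +
        -(((l : ℂ) * Complex.I) • X (v₁ t - S)) +
        -(((l : ℂ) * Complex.I) • (X - Dinv.comp a₂₁) S) := by
      simp only [hw, map_sub, sub_apply, ContinuousLinearMap.comp_apply]
      module
    rw [e]
    refine (norm_add₃_le).trans (add_le_add (add_le_add hwn ?_) ?_)
    · rw [norm_neg, norm_I_mul_smul hl.le]
      exact mul_le_mul_of_nonneg_left ((X.le_of_opNorm_le hXn _).trans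
        (mul_le_mul_of_nonneg_left hb₁ hA0.le)) hl.le
    · rw [norm_neg, norm_I_mul_smul hl.le]
      exact mul_le_mul_of_nonneg_left ((ContinuousLinearMap.le_of_opNorm_le _ hXd _).trans
        (mul_le_mul_of_nonneg_left hSS (by positivity))) hl.le

end BlockDecay

/-! ### Dilations of tempered distributions -/

section Dilation

open scoped FourierTransform

variable {d : ℕ} {p : ℝ≥0∞} [hp : Fact (1 ≤ p)]

/-- Dilation of the argument of a Schwartz function. -/
def schwartzDil (a : ℝ) (ha : a ≠ 0) : 𝓢(Space d, ℂ) →L[ℂ] 𝓢(Space d, ℂ) :=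
  SchwartzMap.compCLMOfContinuousLinearEquiv ℂ (ContinuousLinearEquiv.smulLeft (Units.mk0 a ha))

lemma schwartzDil_apply (a : ℝ) (ha : a ≠ 0) (φ : 𝓢(Space d, ℂ)) (x : Space d) :
    schwartzDil a ha φ x = φ (a • x) := rfl

/-- The dilation `⟨dil a u, φ⟩ = ⟨u, φ(a ·)⟩`; its Fourier transform is `û(a ·)`. -/
def dil (a : ℝ) (ha : a ≠ 0) (u : TDist d) : TDist d :=
  PointwiseConvergenceCLM.precomp ℂ (schwartzDil a ha) u

lemma dil_apply (a : ℝ) (ha : a ≠ 0) (u : TDist d) (φ : 𝓢(Space d, ℂ)) :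
    dil a ha u φ = u (schwartzDil a ha φ) := rfl

lemma fourierInv_schwartzDil (a : ℝ) (ha : a ≠ 0) (φ : 𝓢(Space d, ℂ)) :
    𝓕⁻ (schwartzDil a ha φ) = ((|a|⁻¹ ^ d : ℝ) : ℂ) •
      schwartzDil a⁻¹ (inv_ne_zero ha) (𝓕⁻ φ) := by
  ext ξ
  rw [smul_apply, schwartzDil_apply, SchwartzMap.fourierInv_coe, SchwartzMap.fourierInv_coe,
    Real.fourierInv_eq', Real.fourierInv_eq']
  have h := Measure.integral_comp_smul (volume : Measure (Space d))
    (fun v => Complex.exp (((2 * Real.pi * inner ℝ v (a⁻¹ • ξ) : ℝ) : ℂ) * Complex.I) • φ v) a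
  rw [finrank_euclideanSpace_fin] at h
  rw [← Complex.coe_smul, abs_inv, abs_pow, ← inv_pow] at h
  rw [← h]
  refine integral_congr_ae (.of_forall fun v => ?_)
  simp only [schwartzDil_apply, inner_smul_left, inner_smul_right]
  congr 4
  simp [ha]

lemma fourier_schwartzDil (a : ℝ) (ha : a ≠ 0) (φ : 𝓢(Space d, ℂ)) :
    schwartzDil a ha (𝓕 φ) = ((|a|⁻¹ ^ d : ℝ) : ℂ) •
      𝓕 (schwartzDil a⁻¹ (inv_ne_zero ha) φ) := by
  have h := congrArg (fun ψ => 𝓕 ψ) (fourierInv_schwartzDil a ha (𝓕 φ))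
  simpa [FourierTransform.fourier_smul] using h

lemma smulLeft_schwartzDil {m : Space d → ℂ} (hm : m.HasTemperateGrowth) (a : ℝ) (ha : a ≠ 0)
    (φ : 𝓢(Space d, ℂ)) :
    SchwartzMap.smulLeftCLM ℂ m (schwartzDil a ha φ) =
      schwartzDil a ha (SchwartzMap.smulLeftCLM ℂ (fun ξ => m (a⁻¹ • ξ)) φ) := by
  ext x
  rw [schwartzDil_apply, SchwartzMap.smulLeftCLM_apply_apply hm,
    SchwartzMap.smulLeftCLM_apply_apply (hasTemperateGrowth_comp_smul hm _), schwartzDil_apply,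
    smul_smul, inv_mul_cancel₀ ha, one_smul]

/-- Dilation rescales symbols. With `a = 2^j` every block is carried to the same annulus, so one
symbol calculus gives bounds uniform in `j`. -/
lemma dil_multiplier {m : Space d → ℂ} (hm : m.HasTemperateGrowth) (a : ℝ) (ha : a ≠ 0)
    (u : TDist d) :
    dil a ha (multiplier m u) = multiplier (fun ξ => m (a • ξ)) (dil a ha u) := by
  ext φ
  simp only [multiplier, dil_apply, TemperedDistribution.fourierMultiplierCLM_apply_apply]
  congr 1
  rw [fourierInv_schwartzDil, map_smul, smulLeft_schwartzDil (hasTemperateGrowth_comp_smul hm _),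
    FourierTransform.fourier_smul, fourier_schwartzDil]
  congr 4
  ext ξ
  simp [smul_comm a (2 * Real.pi)]

lemma dil_sum {ι : Type*} (s : Finset ι) (u : ι → TDist d) (a : ℝ) (ha : a ≠ 0) :
    dil a ha (∑ i ∈ s, u i) = ∑ i ∈ s, dil a ha (u i) :=
  map_sum (PointwiseConvergenceCLM.precomp ℂ (schwartzDil a ha)) u s

lemma dil_inv_dil (a : ℝ) (ha : a ≠ 0) (u : TDist d) :
    dil a⁻¹ (inv_ne_zero ha) (dil a ha u) = u := by
  ext φ
  rw [dil_apply, dil_apply]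
  congr 1
  ext x
  rw [schwartzDil_apply, schwartzDil_apply, smul_smul, inv_mul_cancel₀ ha, one_smul]

/-- The factor by which a dilation changes the `L^p` norm. -/
def dilFactor (d : ℕ) (p : ℝ≥0∞) (a : ℝ) : ℝ≥0∞ :=
  ENNReal.ofReal (|a|⁻¹ ^ d) * ENNReal.ofReal (|a| ^ d) ^ (1 / p).toReal

/-- Block estimates compare norms under the same dilation, so for them it only matters that this
factor is neither `0` nor `∞` and cancels. -/
lemma dilFactor_ne_zero {a : ℝ} (ha : a ≠ 0) : dilFactor d p a ≠ 0 := by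
  refine mul_ne_zero (ENNReal.ofReal_pos.2 (by positivity)).ne'
    (ENNReal.rpow_pos (ENNReal.ofReal_pos.2 (by positivity)) ENNReal.ofReal_ne_top).ne'

lemma dilFactor_ne_top (a : ℝ) : dilFactor d p a ≠ ⊤ :=
  ENNReal.mul_ne_top ENNReal.ofReal_ne_top
    (ENNReal.rpow_ne_top_of_nonneg ENNReal.toReal_nonneg ENNReal.ofReal_ne_top)

lemma dilFactor_mul_inv {a : ℝ} (ha : a ≠ 0) : dilFactor d p a * dilFactor d p a⁻¹ = 1 := by
  have h : 0 < |a| ^ d := by positivity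
  rw [dilFactor, dilFactor, mul_mul_mul_comm, ← ENNReal.ofReal_mul (by positivity),
    ← ENNReal.mul_rpow_of_nonneg _ _ ENNReal.toReal_nonneg, ← ENNReal.ofReal_mul (by positivity),
    abs_inv, ← mul_pow, ← mul_pow, inv_inv, mul_inv_cancel₀ (abs_ne_zero.2 ha),
    inv_mul_cancel₀ (abs_ne_zero.2 ha)]
  simp

lemma eLpNorm_comp_inv_smul (f : Space d → ℂ) {a : ℝ} (ha : a ≠ 0) :
    eLpNorm (fun x => f (a⁻¹ • x)) p volume =
      ENNReal.ofReal (|a| ^ d) ^ (1 / p).toReal * eLpNorm f p volume := by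
  have he : MeasurableEmbedding fun x : Space d => a⁻¹ • x :=
    (Homeomorph.smulOfNeZero a⁻¹ (inv_ne_zero ha)).measurableEmbedding
  have h := he.eLpNorm_map_measure (g := f) (p := p) (μ := volume)
  rw [Measure.map_addHaar_smul volume (inv_ne_zero ha), finrank_euclideanSpace_fin,
    eLpNorm_smul_measure_of_ne_zero (by
      exact (ENNReal.ofReal_pos.2 (by positivity)).ne'), smul_eq_mul] at h
  rw [show (fun x => f (a⁻¹ • x)) = f ∘ fun x => a⁻¹ • x from rfl, ← h]
  simp [abs_pow]

lemma distLpNorm_dil_le (a : ℝ) (ha : a ≠ 0) (u : TDist d) :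
    distLpNorm p (dil a ha u) ≤ dilFactor d p a * distLpNorm p u := by
  by_cases htop : distLpNorm p u = ⊤
  · rw [htop, ENNReal.mul_top (dilFactor_ne_zero ha)]
    exact le_top
  obtain ⟨f, rfl⟩ := exists_toTD_of_distLpNorm_lt_top (lt_top_iff_ne_top.2 htop)
  have hf : ∀ φ : 𝓢(Space d, ℂ), toTD f φ = ∫ x, φ x * f x :=
    (toTD_toLp_eq_iff (Lp.memLp f)).1 (by rw [Lp.toLp_coeFn])
  set g : Space d → ℂ := fun x => ((|a|⁻¹ ^ d : ℝ) : ℂ) • f (a⁻¹ • x) with hg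
  have hfa : AEStronglyMeasurable (fun x => f (a⁻¹ • x)) volume :=
    (Lp.aestronglyMeasurable f).comp_quasiMeasurePreserving
      ⟨measurable_const_smul _, by
        rw [Measure.map_addHaar_smul volume (inv_ne_zero ha)]
        exact Measure.smul_absolutelyContinuous⟩
  have hgn : eLpNorm g p volume = dilFactor d p a * eLpNorm f p volume := by
    refine (eLpNorm_const_smul ((|a|⁻¹ ^ d : ℝ) : ℂ) (fun x => f (a⁻¹ • x)) p volume).trans ?_
    rw [eLpNorm_comp_inv_smul _ ha, dilFactor, ← mul_assoc]
    congr 2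
    rw [← ofReal_norm, Complex.norm_real, Real.norm_of_nonneg (by positivity)]
  have hgm : MemLp g p volume := ⟨hfa.const_smul ((|a|⁻¹ ^ d : ℝ) : ℂ), by
    rw [hgn]
    exact ENNReal.mul_lt_top (lt_top_iff_ne_top.2 (dilFactor_ne_top a)) (Lp.memLp f).2⟩
  rw [distLpNorm_toTD, Lp.enorm_def, ← hgn]
  refine iInf₂_le _ ⟨hgm, fun φ => ?_⟩
  rw [dil_apply, hf]
  have h := Measure.integral_comp_smul (volume : Measure (Space d))
    (fun v => φ v * f (a⁻¹ • v)) a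
  rw [finrank_euclideanSpace_fin, ← Complex.coe_smul, abs_inv, abs_pow, ← inv_pow,
    ← integral_smul] at h
  simp only [smul_smul, inv_mul_cancel₀ ha, one_smul] at h
  simp only [schwartzDil_apply]
  rw [h]
  refine integral_congr_ae (.of_forall fun v => ?_)
  simp only [hg, smul_eq_mul]
  ring

lemma distLpNorm_dil (a : ℝ) (ha : a ≠ 0) (u : TDist d) :
    distLpNorm p (dil a ha u) = dilFactor d p a * distLpNorm p u := by
  refine le_antisymm (distLpNorm_dil_le a ha u) ?_
  have h := distLpNorm_dil_le (p := p) a⁻¹ (inv_ne_zero ha) (dil a ha u)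
  rw [dil_inv_dil] at h
  calc _ ≤ dilFactor d p a * (dilFactor d p a⁻¹ * distLpNorm p (dil a ha u)) := by gcongr
    _ = _ := by rw [← mul_assoc, dilFactor_mul_inv ha, one_mul]

lemma vecNorm_dil {ι : Type*} [Fintype ι] (a : ℝ) (ha : a ≠ 0) (u : ι → TDist d) :
    vecNorm p (fun i => dil a ha (u i)) = dilFactor d p a * vecNorm p u := by
  simp only [vecNorm, distLpNorm_dil, Finset.mul_sum]

end Dilation

/-! ### Symbols of the system -/

section SystemSymbols

variable {d n₁ n₂ : ℕ} {ι κ : Type*} [Fintype ι] [Fintype κ]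

/-- The linear matrix symbol `∑ ξ_i N^i`. -/
def linSymb (N : Fin d → Matrix ι κ ℝ) (ξ : Space d) : Matrix ι κ ℂ :=
  fun a b => ∑ i, ((ξ i : ℝ) : ℂ) * ((N i a b : ℝ) : ℂ)

lemma linSymb_temperate (N : Fin d → Matrix ι κ ℝ) : TemperateMatrix (linSymb N) := fun _ _ =>
  .sum fun i _ => (hasTemperateGrowth_coord_complex i).mul (.const _)

lemma linSymb_smul (N : Fin d → Matrix ι κ ℝ) (c : ℝ) (ξ : Space d) :
    linSymb N (c • ξ) = (c : ℂ) • linSymb N ξ := by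
  ext a b
  simp [linSymb, Finset.mul_sum, mul_assoc]

lemma linSymb_comp_symbolMatrix (N : Fin d → Matrix ι κ ℝ) {f : Space d → Space d}
    (hf : IsSymbol f) : SymbolMatrix fun ξ => linSymb N (f ξ) := fun a b => by
  refine hf.comp_contDiffAt (g := fun η => linSymb N η a b) fun ξ => ContDiff.contDiffAt ?_
  exact (linSymb_temperate N a b).1

/-- The complexification of a real matrix. -/
def cmat (M : Matrix ι κ ℝ) : Matrix ι κ ℂ := M.map (algebraMap ℝ ℂ)

lemma cmat_apply (M : Matrix ι κ ℝ) (a : ι) (b : κ) : cmat M a b = ((M a b : ℝ) : ℂ) := rfl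

lemma cmat_mul {μ : Type*} (M : Matrix ι κ ℝ) (N : Matrix κ μ ℝ) :
    cmat (M * N) = cmat M * cmat N := Matrix.map_mul

lemma cmat_one [DecidableEq ι] : cmat (1 : Matrix ι ι ℝ) = 1 :=
  Matrix.map_one _ (map_zero _) (map_one _)

/-- The symbol of `∑ A^i ∂_{x_i} + L`. -/
def fullSymbol (A : Fin d → Matrix (Fin n₁ ⊕ Fin n₂) (Fin n₁ ⊕ Fin n₂) ℝ)
    (D : Matrix (Fin n₂) (Fin n₂) ℝ) (ξ : Space d) :
    Matrix (Fin n₁ ⊕ Fin n₂) (Fin n₁ ⊕ Fin n₂) ℂ :=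
  Complex.I • linSymb A ξ + cmat (dampingMatrix D)

variable {A : Fin d → Matrix (Fin n₁ ⊕ Fin n₂) (Fin n₁ ⊕ Fin n₂) ℝ}
  {D : Matrix (Fin n₂) (Fin n₂) ℝ}

lemma fullSymbol_temperate : TemperateMatrix (fullSymbol A D) :=
  (TemperateMatrix.smul (.const Complex.I) (linSymb_temperate A)).add (.const _)

lemma matMul_linSymb (N : Fin d → Matrix ι κ ℝ) (u : κ → TDist d) (a : ι) :
    matMul (fun ξ => Complex.I • linSymb N ξ) u a =
      ∑ i, ∑ b, ((N i a b : ℝ) : ℂ) • partialDeriv i (u b) := by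
  rw [Finset.sum_comm]
  refine Finset.sum_congr rfl fun b _ => ?_
  simp only [Matrix.smul_apply, linSymb, smul_eq_mul, Finset.mul_sum]
  have h : ∀ i ∈ (Finset.univ : Finset (Fin d)), (fun ξ : Space d =>
      Complex.I * (((ξ i : ℝ) : ℂ) * ((N i a b : ℝ) : ℂ))).HasTemperateGrowth := fun i _ =>
    .mul (.const _) ((hasTemperateGrowth_coord_complex i).mul (.const _))
  rw [multiplier_sum _ h]
  refine Finset.sum_congr rfl fun i _ => ?_
  have h2 := multiplier_const_mul (m := fun ξ : Space d => Complex.I * ((ξ i : ℝ) : ℂ))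
    (.mul (.const _) (hasTemperateGrowth_coord_complex i)) ((N i a b : ℝ) : ℂ) (u b)
  rw [partialDeriv_eq_multiplier, ← h2]
  congr 1
  ext ξ
  ring

lemma matMul_const (M : Matrix ι κ ℂ) (u : κ → TDist d) (a : ι) :
    matMul (fun _ => M) u a = ∑ b, M a b • u b := by
  simp only [matMul, multiplier_const]

lemma spatialOp_eq (u : Fin n₁ ⊕ Fin n₂ → TDist d) :
    spatialOp A D u = matMul (fullSymbol A D) u := by
  ext1 a
  have := matMul_add (TemperateMatrix.smul (.const Complex.I) (linSymb_temperate A))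
    (.const (cmat (dampingMatrix D))) u
  rw [show matMul (fullSymbol A D) u = _ from this, Pi.add_apply, matMul_linSymb, matMul_const]
  rfl

/-- The blocks of the `A^i`. -/
abbrev blk₁₂ (A : Fin d → Matrix (Fin n₁ ⊕ Fin n₂) (Fin n₁ ⊕ Fin n₂) ℝ) (i : Fin d) :
    Matrix (Fin n₁) (Fin n₂) ℝ := (A i).toBlocks₁₂

/-- The blocks of the `A^i`. -/
abbrev blk₂₁ (A : Fin d → Matrix (Fin n₁ ⊕ Fin n₂) (Fin n₁ ⊕ Fin n₂) ℝ) (i : Fin d) :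
    Matrix (Fin n₂) (Fin n₁) ℝ := (A i).toBlocks₂₁

/-- The blocks of the `A^i`. -/
abbrev blk₂₂ (A : Fin d → Matrix (Fin n₁ ⊕ Fin n₂) (Fin n₁ ⊕ Fin n₂) ℝ) (i : Fin d) :
    Matrix (Fin n₂) (Fin n₂) ℝ := (A i).toBlocks₂₂

lemma linSymb_mul_const {μ : Type*} [Fintype μ] (N : Fin d → Matrix ι κ ℝ) (M : Matrix κ μ ℝ)
    (ξ : Space d) : linSymb (fun i => N i * M) ξ = linSymb N ξ * cmat M := by
  ext a b
  simp only [linSymb, Matrix.mul_apply, cmat_apply, Complex.ofReal_sum, Complex.ofReal_mul,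
    Finset.mul_sum, Finset.sum_mul]
  rw [Finset.sum_comm]
  simp only [mul_assoc]

lemma const_mul_linSymb {μ : Type*} [Fintype μ] (M : Matrix μ ι ℝ) (N : Fin d → Matrix ι κ ℝ)
    (ξ : Space d) : linSymb (fun i => M * N i) ξ = cmat M * linSymb N ξ := by
  ext a b
  simp only [linSymb, Matrix.mul_apply, cmat_apply, Complex.ofReal_sum, Complex.ofReal_mul,
    Finset.mul_sum, Finset.sum_mul]
  rw [Finset.sum_comm]
  refine Finset.sum_congr rfl fun _ _ => Finset.sum_congr rfl fun _ _ => ?_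
  ring

lemma effective_eq (u : Fin n₁ ⊕ Fin n₂ → TDist d) :
    effective A D u = (fun a => u (Sum.inl a)) -
      matMul (fun ξ => Complex.I • (linSymb (blk₁₂ A) ξ * cmat D⁻¹)) fun b => u (Sum.inr b) := by
  ext1 a
  simp only [← linSymb_mul_const]
  rw [Pi.sub_apply, matMul_linSymb]
  rfl

/-- The complex matrix symbol `A_{12}(ξ) D⁻¹ A_{21}(ξ)`, the negative of the symbol of `𝒜`. -/
def gSymbol (A : Fin d → Matrix (Fin n₁ ⊕ Fin n₂) (Fin n₁ ⊕ Fin n₂) ℝ)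
    (D : Matrix (Fin n₂) (Fin n₂) ℝ) (ξ : Space d) : Matrix (Fin n₁) (Fin n₁) ℂ :=
  linSymb (blk₁₂ A) ξ * (cmat D⁻¹ * linSymb (blk₂₁ A) ξ)

lemma gSymbol_temperate : TemperateMatrix (gSymbol A D) :=
  (linSymb_temperate _).mul ((TemperateMatrix.const _).mul (linSymb_temperate _))

lemma gSymbol_smul (c : ℝ) (ξ : Space d) : gSymbol A D (c • ξ) = ((c : ℂ) ^ 2) • gSymbol A D ξ := by
  simp only [gSymbol, linSymb_smul, Matrix.smul_mul, Matrix.mul_smul, smul_smul, sq]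

lemma cmat_diffusionSymbol (ξ : Space d) : cmat (diffusionSymbol A D ξ) = -gSymbol A D ξ := by
  have h : gSymbol A D ξ = cmat (∑ i, ∑ l, (ξ i * ξ l) • (blk₁₂ A i * D⁻¹ * blk₂₁ A l)) := by
    have e : ∀ {κ κ' : Type} [Fintype κ] [Fintype κ'] (N : Fin d → Matrix κ κ' ℝ),
        linSymb N ξ = cmat (∑ i, ξ i • N i) := by
      intro κ κ' _ _ N
      ext a b
      simp [linSymb, cmat_apply, Matrix.sum_apply]
    rw [gSymbol, e, e, ← cmat_mul, ← cmat_mul]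
    congr 1
    rw [Matrix.sum_mul]
    refine Finset.sum_congr rfl fun i _ => ?_
    rw [Matrix.mul_sum, Matrix.mul_sum]
    refine Finset.sum_congr rfl fun l _ => ?_
    rw [Matrix.smul_mul, Matrix.mul_smul, Matrix.mul_smul, smul_smul, Matrix.mul_assoc]
  rw [h]
  ext a b
  simp [diffusionSymbol, cmat_apply]

open scoped Matrix.Norms.Operator in
lemma cmat_exp [DecidableEq ι] (M : Matrix ι ι ℝ) :
    cmat (NormedSpace.exp M) = NormedSpace.exp (cmat M) := by
  have h : Continuous (Complex.ofRealHom.mapMatrix : Matrix ι ι ℝ →+* Matrix ι ι ℂ) :=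
    continuous_id.matrix_map Complex.continuous_ofReal
  exact NormedSpace.map_exp _ h M

open scoped Matrix.Norms.Operator in
lemma diffusionFlow_eq (t : ℝ) (w : Fin n₁ → TDist d) :
    diffusionFlow A D t w = matMul (fun ξ => NormedSpace.exp (-((t : ℂ) • gSymbol A D ξ))) w := by
  ext1 a
  refine Finset.sum_congr rfl fun b _ => ?_
  congr 1
  ext ξ
  have h : cmat (t • diffusionSymbol A D ξ) = -((t : ℂ) • gSymbol A D ξ) := by
    rw [← smul_neg, ← cmat_diffusionSymbol]
    ext a b
    simp [cmat_apply]
  change _ = NormedSpace.exp (-((t : ℂ) • gSymbol A D ξ)) a b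
  rw [← h, ← cmat_exp, cmat_apply]

lemma profile_inr_eq (V₀ : Fin n₁ ⊕ Fin n₂ → TDist d) (t : ℝ) :
    (fun b => profile A D V₀ t (Sum.inr b)) =
      -matMul (fun ξ => Complex.I • (cmat D⁻¹ * linSymb (blk₂₁ A) ξ))
        (diffusionFlow A D t (effective A D V₀)) := by
  ext1 b
  simp only [← const_mul_linSymb]
  rw [Pi.neg_apply, matMul_linSymb]
  rfl

lemma fullSymbol_eq_fromBlocks (hA : IsPartiallyDissipative A D) (ξ : Space d) :
    fullSymbol A D ξ = Matrix.fromBlocks 0 (Complex.I • linSymb (blk₁₂ A) ξ)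
      (Complex.I • linSymb (blk₂₁ A) ξ) (Complex.I • linSymb (blk₂₂ A) ξ + cmat D) := by
  ext a b
  rcases a with a | a <;> rcases b with b | b
  · have h : ∀ i, A i (Sum.inl a) (Sum.inl b) = 0 := fun i =>
      congrFun (congrFun (hA.block₁₁ i) a) b
    simp [fullSymbol, linSymb, cmat_apply, dampingMatrix, h]
  all_goals simp [fullSymbol, linSymb, cmat_apply, dampingMatrix, Matrix.toBlocks₁₂,
    Matrix.toBlocks₂₁, Matrix.toBlocks₂₂]

end SystemSymbols

/-! ### Coercivity -/

section Coercivity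

open scoped Matrix

/-- A positive continuous function on the compact product of unit spheres has a positive minimum;
homogeneity of degree two in each variable extends the bound to all vectors. -/
lemma exists_pos_mul_sq_le {E F : Type*} [NormedAddCommGroup E] [NormedSpace ℝ E]
    [FiniteDimensional ℝ E] [NormedAddCommGroup F] [NormedSpace ℝ F] [FiniteDimensional ℝ F]
    {q : E → F → ℝ} (hq : Continuous (Function.uncurry q))
    (hpos : ∀ x y, x ≠ 0 → y ≠ 0 → 0 < q x y)
    (hhom : ∀ (a b : ℝ) x y, q (a • x) (b • y) = a ^ 2 * b ^ 2 * q x y) :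
    ∃ c : ℝ, 0 < c ∧ ∀ x y, c * ‖x‖ ^ 2 * ‖y‖ ^ 2 ≤ q x y := by
  have hzero : ∀ x y, x = 0 ∨ y = 0 → q x y = 0 := by
    rintro x y (rfl | rfl)
    · simpa using hhom 0 1 0 y
    · simpa using hhom 1 0 x 0
  set K := Metric.sphere (0 : E) 1 ×ˢ Metric.sphere (0 : F) 1 with hK
  have key : ∃ c : ℝ, 0 < c ∧ ∀ z ∈ K, c ≤ q z.1 z.2 := by
    -- A sphere is empty when its space is trivial; every constant is then admissible.
    rcases K.eq_empty_or_nonempty with he | hne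
    · exact ⟨1, one_pos, by simp [he]⟩
    have hKc : IsCompact K := (isCompact_sphere 0 1).prod (isCompact_sphere 0 1)
    obtain ⟨z, hz, hmin⟩ := hKc.exists_isMinOn hne hq.continuousOn
    refine ⟨q z.1 z.2, hpos _ _ ?_ ?_, fun w hw => hmin hw⟩
    · have := mem_sphere_zero_iff_norm.1 hz.1
      exact norm_ne_zero_iff.1 (by rw [this]; exact one_ne_zero)
    · have := mem_sphere_zero_iff_norm.1 hz.2
      exact norm_ne_zero_iff.1 (by rw [this]; exact one_ne_zero)
  obtain ⟨c, hc, h⟩ := key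
  refine ⟨c, hc, fun x y => ?_⟩
  by_cases hx : x = 0
  · rw [hzero x y (.inl hx), hx]; simp
  by_cases hy : y = 0
  · rw [hzero x y (.inr hy), hy]; simp
  have hx' : 0 < ‖x‖ := norm_pos_iff.2 hx
  have hy' : 0 < ‖y‖ := norm_pos_iff.2 hy
  have h1 := h (‖x‖⁻¹ • x, ‖y‖⁻¹ • y) ⟨by simp [norm_smul, hx'.ne'], by simp [norm_smul, hy'.ne']⟩
  simp only [hhom] at h1
  have h2 : ‖x‖ ^ 2 * ‖y‖ ^ 2 * (‖x‖⁻¹ ^ 2 * ‖y‖⁻¹ ^ 2 * q x y) = q x y := by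
    field_simp
  rw [← h2]
  have : 0 ≤ ‖x‖ ^ 2 * ‖y‖ ^ 2 := by positivity
  nlinarith

variable {d n₁ n₂ : ℕ} {ι κ : Type*} [Fintype ι] [Fintype κ] [DecidableEq ι]

lemma norm_toLp_sq (x : ι → ℂ) : ‖(WithLp.toLp 2 x : EuclideanSpace ℂ ι)‖ ^ 2 = ∑ i, ‖x i‖ ^ 2 :=
  EuclideanSpace.norm_sq_eq _

lemma accretive_iff {c : ℝ} {M : Matrix ι ι ℂ} :
    Accretive c M ↔ ∀ x : ι → ℂ, c * ∑ i, ‖x i‖ ^ 2 ≤ (star x ⬝ᵥ M *ᵥ x).re := by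
  have h : ∀ x : ι → ℂ, inner ℂ (WithLp.toLp 2 x : EuclideanSpace ℂ ι)
      (Matrix.toEuclideanCLM (𝕜 := ℂ) M (WithLp.toLp 2 x)) = star x ⬝ᵥ M *ᵥ x := fun x => by
    rw [Matrix.toEuclideanCLM_toLp, EuclideanSpace.inner_toLp_toLp, dotProduct_comm]
  constructor
  · intro hM x
    rw [← h, ← norm_toLp_sq]
    exact hM _
  · intro hM x
    have := hM x.ofLp
    rw [← h, ← norm_toLp_sq] at this
    exact this

omit [DecidableEq ι] in
lemma re_dotProduct_cmat (M : Matrix ι ι ℝ) (x : ι → ℂ) :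
    (star x ⬝ᵥ cmat M *ᵥ x).re =
      (fun i => (x i).re) ⬝ᵥ M *ᵥ (fun i => (x i).re) +
      (fun i => (x i).im) ⬝ᵥ M *ᵥ (fun i => (x i).im) := by
  simp only [dotProduct, Matrix.mulVec, Complex.re_sum, Finset.mul_sum, ← Finset.sum_add_distrib]
  refine Finset.sum_congr rfl fun i _ => Finset.sum_congr rfl fun j _ => ?_
  simp [cmat_apply]

lemma exists_accretive_cmat {M : Matrix ι ι ℝ} (hM : M.PosDef) :
    ∃ c : ℝ, 0 < c ∧ Accretive c (cmat M) := by
  -- The first variable is a dummy real factor `a²`, set to `1` at the end, which makes the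
  -- two-variable lemma apply to a quadratic form in one variable.
  obtain ⟨c, hc, h⟩ := exists_pos_mul_sq_le (E := ℝ) (F := EuclideanSpace ℂ ι)
    (q := fun a x => a ^ 2 * (star x.ofLp ⬝ᵥ cmat M *ᵥ x.ofLp).re) (by
      have h1 : Continuous fun z : ℝ × EuclideanSpace ℂ ι => z.2.ofLp :=
        (PiLp.continuous_ofLp 2 _).comp continuous_snd
      have h2 : Continuous fun z : ℝ × EuclideanSpace ℂ ι =>
          (star z.2.ofLp ⬝ᵥ cmat M *ᵥ z.2.ofLp).re :=
        Complex.continuous_re.comp (h1.star.dotProduct (continuous_const.matrix_mulVec h1))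
      exact (continuous_fst.pow 2).mul h2) (fun a x ha hx => by
      refine mul_pos (by positivity) ?_
      rw [re_dotProduct_cmat]
      have hnn : ∀ v : ι → ℝ, 0 ≤ v ⬝ᵥ M *ᵥ v := fun v => by
        simpa using hM.posSemidef.dotProduct_mulVec_nonneg v
      have hp : ∀ v : ι → ℝ, v ≠ 0 → 0 < v ⬝ᵥ M *ᵥ v := fun v hv => by
        simpa using hM.dotProduct_mulVec_pos hv
      by_cases hre : (fun i => (x i).re) = 0
      · have him : (fun i => (x i).im) ≠ 0 := fun him => hx <| by
          ext i
          exact Complex.ext (congrFun hre i) (congrFun him i)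
        linarith [hp _ him, hnn fun i => (x i).re]
      · linarith [hp _ hre, hnn fun i => (x i).im]) (fun a b x y => by
      have e : (star (b • y).ofLp ⬝ᵥ cmat M *ᵥ (b • y).ofLp).re =
          b ^ 2 * (star y.ofLp ⬝ᵥ cmat M *ᵥ y.ofLp).re := by
        rw [re_dotProduct_cmat, re_dotProduct_cmat]
        simp only [dotProduct, Matrix.mulVec, Finset.mul_sum, mul_add]
        congr 1 <;>
        · refine Finset.sum_congr rfl fun i _ => Finset.sum_congr rfl fun j _ => ?_
          simp
          ring
      rw [e, smul_eq_mul]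
      ring)
  refine ⟨c, hc, accretive_iff.2 fun x => ?_⟩
  have := h 1 (WithLp.toLp 2 x)
  simpa [EuclideanSpace.norm_sq_eq] using this

variable {A : Fin d → Matrix (Fin n₁ ⊕ Fin n₂) (Fin n₁ ⊕ Fin n₂) ℝ}
  {D : Matrix (Fin n₂) (Fin n₂) ℝ}

lemma IsPartiallyDissipative.cmat_mul_inv (hA : IsPartiallyDissipative A D) :
    cmat D * cmat D⁻¹ = 1 := by
  rw [← cmat_mul, Matrix.mul_nonsing_inv _ ((Matrix.isUnit_iff_isUnit_det _).1 hA.posDef.isUnit),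
    cmat_one]

lemma IsPartiallyDissipative.cmat_inv_mul (hA : IsPartiallyDissipative A D) :
    cmat D⁻¹ * cmat D = 1 := by
  rw [← cmat_mul, Matrix.nonsing_inv_mul _ ((Matrix.isUnit_iff_isUnit_det _).1 hA.posDef.isUnit),
    cmat_one]

lemma IsPartiallyDissipative.conjTranspose_linSymb_blk₂₁ (hA : IsPartiallyDissipative A D)
    (ξ : Space d) : (linSymb (blk₂₁ A) ξ)ᴴ = linSymb (blk₁₂ A) ξ := by
  ext a b
  simp only [linSymb, Matrix.conjTranspose_apply, Matrix.toBlocks₁₂, Matrix.toBlocks₂₁,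
    Matrix.of_apply, star_sum]
  refine Finset.sum_congr rfl fun i _ => ?_
  have h : A i (Sum.inr b) (Sum.inl a) = A i (Sum.inl a) (Sum.inr b) :=
    (hA.symm i).apply (Sum.inl a) (Sum.inr b)
  simp [h]

/-- The vector `(x, 0)` lies in the kernel of `L`. Since the upper left blocks vanish, `A(ω)(x, 0) =
(0, A_{21}(ω) x)`, and the Shizuta-Kawashima condition with `λ = 0` gives `x = 0`. -/
lemma IsPartiallyDissipative.eq_zero_of_blk₂₁ (hA : IsPartiallyDissipative A D) {ξ : Space d}
    (hξ : ξ ≠ 0) {x : Fin n₁ → ℝ} (hx : ∀ b, ∑ a, ∑ i, ξ i * A i (Sum.inr b) (Sum.inl a) * x a = 0) :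
    x = 0 := by
  have hξ' : ‖ξ‖ ≠ 0 := norm_ne_zero_iff.2 hξ
  have h := hA.shizuta_kawashima (Sum.elim x 0) 0 (‖ξ‖⁻¹ • ξ)
    (by rw [norm_smul, norm_inv, norm_norm, inv_mul_cancel₀ hξ']) ?_ ?_
  · ext a
    exact congrFun h (Sum.inl a)
  · ext c
    rcases c with c | c <;> simp [dampingMatrix, Matrix.mulVec, dotProduct]
  · ext c
    rw [zero_smul, zero_add]
    rcases c with c | c
    · have hz : ∀ i (a : Fin n₁), A i (Sum.inl c) (Sum.inl a) = 0 := fun i a =>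
        congrFun (congrFun (hA.block₁₁ i) c) a
      simp [Matrix.mulVec, dotProduct, Matrix.sum_apply, hz]
    · have := hx c
      simp only [Matrix.mulVec, dotProduct, Matrix.sum_apply, Fintype.sum_sum_type, Sum.elim_inl,
        Sum.elim_inr, Pi.zero_apply, mul_zero, Finset.sum_const_zero, add_zero, Matrix.smul_apply,
        PiLp.smul_apply, smul_eq_mul, Finset.sum_mul]
      rw [← mul_zero ‖ξ‖⁻¹, ← this]
      simp only [Finset.mul_sum, mul_assoc]

/-- Injectivity of the real matrix `A_{21}(ξ)`, applied to real and imaginary parts, is made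
quantitative by compactness and homogeneity. -/
lemma IsPartiallyDissipative.exists_blk₂₁_lower (hA : IsPartiallyDissipative A D) :
    ∃ γ : ℝ, 0 < γ ∧ ∀ (ξ : Space d) (x : Fin n₁ → ℂ),
      γ * ‖ξ‖ ^ 2 * ∑ a, ‖x a‖ ^ 2 ≤ ∑ b, ‖(linSymb (blk₂₁ A) ξ *ᵥ x) b‖ ^ 2 := by
  obtain ⟨c, hc, h⟩ := exists_pos_mul_sq_le (E := Space d) (F := EuclideanSpace ℂ (Fin n₁))
    (q := fun ξ x => ∑ b, ‖(linSymb (blk₂₁ A) ξ *ᵥ x.ofLp) b‖ ^ 2) (by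
      have h1 : ∀ b a, Continuous fun z : Space d × EuclideanSpace ℂ (Fin n₁) =>
          linSymb (blk₂₁ A) z.1 b a * z.2.ofLp a := fun b a =>
        ((linSymb_temperate (blk₂₁ A) b a).1.continuous.comp continuous_fst).mul
          ((PiLp.continuous_apply 2 _ a).comp continuous_snd)
      have h2 : ∀ b, Continuous fun z : Space d × EuclideanSpace ℂ (Fin n₁) =>
          ∑ a, linSymb (blk₂₁ A) z.1 b a * z.2.ofLp a := fun b =>
        continuous_finsetSum _ fun a _ => h1 b a
      exact continuous_finsetSum _ fun b _ => (h2 b).norm.pow 2) (fun ξ x hξ hx => by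
      refine lt_of_le_of_ne (Finset.sum_nonneg fun b _ => by positivity) fun h0 => hx ?_
      have h1 : ∀ b, (linSymb (blk₂₁ A) ξ *ᵥ x.ofLp) b = 0 := fun b => by
        have := (Finset.sum_eq_zero_iff_of_nonneg fun b _ => by positivity).1 h0.symm b
          (Finset.mem_univ b)
        simpa using this
      have hre := hA.eq_zero_of_blk₂₁ hξ (x := fun a => (x a).re) fun b => by
        have := congrArg Complex.re (h1 b)
        simp only [Matrix.mulVec, dotProduct, linSymb, Complex.re_sum, Finset.sum_mul] at this
        simpa [Matrix.toBlocks₂₁] using this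
      have him := hA.eq_zero_of_blk₂₁ hξ (x := fun a => (x a).im) fun b => by
        have := congrArg Complex.im (h1 b)
        simp only [Matrix.mulVec, dotProduct, linSymb, Complex.im_sum, Finset.sum_mul] at this
        simpa [Matrix.toBlocks₂₁] using this
      ext a
      exact Complex.ext (congrFun hre a) (congrFun him a)) (fun a b ξ x => by
      rw [Finset.mul_sum]
      refine Finset.sum_congr rfl fun c _ => ?_
      have e : linSymb (blk₂₁ A) (a • ξ) *ᵥ (b • x).ofLp =
          ((a * b : ℝ) : ℂ) • (linSymb (blk₂₁ A) ξ *ᵥ x.ofLp) := by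
        rw [linSymb_smul, Matrix.smul_mulVec, show (b • x).ofLp = (b : ℂ) • x.ofLp from rfl,
          Matrix.mulVec_smul, smul_smul]
        push_cast
        rfl
      rw [e, Pi.smul_apply, norm_smul, Complex.norm_real, mul_pow, Real.norm_eq_abs, sq_abs,
        mul_pow])
  refine ⟨c, hc, fun ξ x => ?_⟩
  have := h ξ (WithLp.toLp 2 x)
  rwa [norm_toLp_sq] at this

/-- Symmetry gives `A_{12} = A_{21}^*`, so the quadratic form of the symbol at `x` is that of `D⁻¹`
at `y = A_{21}(ξ) x`, and `‖y‖²` is at least `γ |ξ|² ‖x‖²`. -/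
lemma IsPartiallyDissipative.exists_gSymbol_accretive (hA : IsPartiallyDissipative A D) :
    ∃ c : ℝ, 0 < c ∧ ∀ ξ : Space d, Accretive (c * ‖ξ‖ ^ 2) (gSymbol A D ξ) := by
  obtain ⟨c, hc, hD⟩ := exists_accretive_cmat hA.posDef.inv
  obtain ⟨γ, hγ, h⟩ := hA.exists_blk₂₁_lower
  refine ⟨c * γ, by positivity, fun ξ => accretive_iff.2 fun x => ?_⟩
  set y := linSymb (blk₂₁ A) ξ *ᵥ x with hy
  have e : star x ⬝ᵥ gSymbol A D ξ *ᵥ x = star y ⬝ᵥ cmat D⁻¹ *ᵥ y := by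
    rw [gSymbol, ← hA.conjTranspose_linSymb_blk₂₁, ← Matrix.mulVec_mulVec, ← Matrix.mulVec_mulVec,
      Matrix.dotProduct_mulVec, ← Matrix.star_mulVec]
  rw [e]
  refine le_trans ?_ (accretive_iff.1 hD y)
  calc _ = c * (γ * ‖ξ‖ ^ 2 * ∑ a, ‖x a‖ ^ 2) := by ring
    _ ≤ _ := mul_le_mul_of_nonneg_left (h ξ x) hc.le

end Coercivity

/-! ### Decay of the symbol away from the zero frequency -/

section HighFrequencySymbol

open scoped Matrix

/-- Hypocoercivity. The energy `N` dissipates only `v₂`. The cross term `Q = Im ⟨b₂₁ v₁, v₂⟩` has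
derivative `-‖b₂₁ v₁‖²` up to terms controlled by half of it and by `‖v₂‖²`, so `N + (ε/(1+ρ²)) Q`
dissipates both components. The weight `1/(1+ρ²)` makes all constants uniform in `ρ ≥ r`. -/
lemma lyapunov_decay {E₁ E₂ : Type*} [NormedAddCommGroup E₁] [InnerProductSpace ℂ E₁]
    [NormedAddCommGroup E₂] [InnerProductSpace ℂ E₂] {M c γ r : ℝ} (hM : 1 ≤ M) (hc : 0 < c)
    (hγ : 0 < γ) (hr : 0 < r) :
    ∃ c' : ℝ, 0 < c' ∧ ∀ (b₂₁ : E₁ →L[ℂ] E₂) (b₁₂ : E₂ →L[ℂ] E₁) (b₂₂ Dm : E₂ →L[ℂ] E₂) (ρ : ℝ),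
      r ≤ ρ → (∀ x y, inner ℂ x (b₁₂ y) = inner ℂ (b₂₁ x) y) →
      (∀ y, (inner ℂ y (b₂₂ y)).im = 0) →
      (∀ x, ‖b₂₁ x‖ ≤ M * ρ * ‖x‖) → (∀ y, ‖b₁₂ y‖ ≤ M * ρ * ‖y‖) →
      (∀ y, ‖b₂₂ y‖ ≤ M * ρ * ‖y‖) → (∀ y, ‖Dm y‖ ≤ M * ‖y‖) →
      (∀ y, c * ‖y‖ ^ 2 ≤ (inner ℂ y (Dm y)).re) → (∀ x, γ * ρ ^ 2 * ‖x‖ ^ 2 ≤ ‖b₂₁ x‖ ^ 2) →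
      ∀ (v₁ : ℝ → E₁) (v₂ : ℝ → E₂), (∀ t, HasDerivAt v₁ (-(Complex.I • b₁₂ (v₂ t))) t) →
      (∀ t, HasDerivAt v₂
        (-(Complex.I • b₂₁ (v₁ t) + (Complex.I • b₂₂ (v₂ t) + Dm (v₂ t)))) t) →
      ∀ t : ℝ, 0 ≤ t → ‖v₁ t‖ ^ 2 + ‖v₂ t‖ ^ 2 ≤
        3 * Real.exp (-c' * t) * (‖v₁ 0‖ ^ 2 + ‖v₂ 0‖ ^ 2) := by
  have hM0 : 0 < M := by linarith
  -- Two requirements: `ε M ≤ 1`, so that the cross term is at most half the energy, and `2 M² ε ≤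
  -- c`, so that its bad term costs only half of the damping `2c`.
  set ε := min 1 c / (2 * M ^ 2) with hε
  have hε0 : 0 < ε := by positivity
  have hεc : 2 * M ^ 2 * ε ≤ c := by
    rw [hε, mul_div_cancel₀ _ (by positivity)]
    exact min_le_right _ _
  have hε1 : ε * M ≤ 1 := by
    have h1 : 2 * M ^ 2 * ε ≤ 1 := by
      rw [hε, mul_div_cancel₀ _ (by positivity)]
      exact min_le_left _ _
    have h2 : M ≤ M ^ 2 := le_self_pow₀ hM (by norm_num)
    have h3 : ε * M ≤ ε * M ^ 2 := by gcongr
    have h4 : 0 ≤ ε * M ^ 2 := by positivity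
    linarith
  -- A lower bound of `ρ²/(1+ρ²)` for `ρ ≥ r`; the hypothesis `r > 0` keeps the rate away from zero.
  set k := r ^ 2 / (1 + r ^ 2) with hk
  have hk0 : 0 < k := by positivity
  set c₁ := min c (ε * γ * k / 2) with hc₁
  have hc₁0 : 0 < c₁ := by positivity
  -- The functional lies between `N/2` and `3N/2`: its derivative is at most `-c₁ N`, hence at most
  -- `-2c₁/3` times the functional, and returning to `N` costs the factor `3`.
  refine ⟨2 * c₁ / 3, by positivity, ?_⟩
  intro b₂₁ b₁₂ b₂₂ Dm ρ hρ hadj hsym hb21 hb12 hb22 hDm hDc hlow v₁ v₂ h₁ h₂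
  have hρ0 : 0 < ρ := hr.trans_le hρ
  set R := 1 + ρ ^ 2 with hR
  have hR0 : 0 < R := by positivity
  have hkR : k * R ≤ ρ ^ 2 := by
    rw [hk, hR, div_mul_eq_mul_div, div_le_iff₀ (by positivity)]
    have : r ^ 2 ≤ ρ ^ 2 := by gcongr
    nlinarith
  set N : ℝ → ℝ := fun t => ‖v₁ t‖ ^ 2 + ‖v₂ t‖ ^ 2 with hN
  have hN0 : ∀ t, 0 ≤ N t := fun t => by positivity
  set Q : ℝ → ℝ := fun t => (inner ℂ (b₂₁ (v₁ t)) (v₂ t)).im with hQ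
  have hNd : ∀ t, ∃ n', HasDerivAt N n' t ∧ n' ≤ -(2 * c * ‖v₂ t‖ ^ 2) := fun t => by
    refine ⟨_, (hasDerivAt_norm_sq (h₁ t)).add (hasDerivAt_norm_sq (h₂ t)), ?_⟩
    have e1 : inner ℂ (v₂ t) (b₂₁ (v₁ t)) = (starRingEnd ℂ) (inner ℂ (b₂₁ (v₁ t)) (v₂ t)) :=
      (inner_conj_symm _ _).symm
    have e2 := hsym (v₂ t)
    have e3 := hDc (v₂ t)
    simp only [inner_neg_right, inner_add_right, inner_smul_right, hadj, e1, Complex.neg_re,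
      Complex.add_re, Complex.mul_re, Complex.I_re, Complex.I_im, zero_mul, one_mul, zero_sub,
      Complex.conj_im, e2]
    linarith
  have hQd : ∀ t, ∃ q', HasDerivAt Q q' t ∧
      q' ≤ -(‖b₂₁ (v₁ t)‖ ^ 2 / 2) + 2 * M ^ 2 * R * ‖v₂ t‖ ^ 2 := fun t => by
    have hd : HasDerivAt (fun s => b₂₁ (v₁ s)) _ t :=
      (b₂₁.restrictScalars ℝ).hasFDerivAt.comp_hasDerivAt t (h₁ t)
    have hd2 := Complex.imCLM.hasFDerivAt.comp_hasDerivAt t (hd.inner ℂ (h₂ t))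
    refine ⟨_, hd2, ?_⟩
    set s := ‖b₂₁ (v₁ t)‖ with hs
    set y := ‖v₂ t‖ with hy
    have hs0 : 0 ≤ s := norm_nonneg _
    have hy0 : 0 ≤ y := norm_nonneg _
    have i1 : |(inner ℂ (b₂₁ (b₁₂ (v₂ t))) (v₂ t) : ℂ).re| ≤ M ^ 2 * R * y ^ 2 := by
      refine (Complex.abs_re_le_norm _).trans ((norm_inner_le_norm _ _).trans ?_)
      calc _ ≤ M * ρ * (M * ρ * y) * y := by
            gcongr
            exact (hb21 _).trans (by gcongr; exact hb12 _)
        _ = M ^ 2 * ρ ^ 2 * y ^ 2 := by ring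
        _ ≤ _ := by gcongr; linarith
    have i2 : |(inner ℂ (b₂₁ (v₁ t)) (b₂₂ (v₂ t)) : ℂ).re| ≤ s * (M * ρ * y) :=
      (Complex.abs_re_le_norm _).trans ((norm_inner_le_norm _ _).trans (by
        gcongr; exact hb22 _))
    have i3 : |(inner ℂ (b₂₁ (v₁ t)) (Dm (v₂ t)) : ℂ).im| ≤ s * (M * y) :=
      (Complex.abs_im_le_norm _).trans ((norm_inner_le_norm _ _).trans (by
        gcongr; exact hDm _))
    have i4 : (inner ℂ (b₂₁ (v₁ t)) (b₂₁ (v₁ t)) : ℂ).re = s ^ 2 := by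
      rw [inner_self_eq_norm_sq_to_K]
      norm_cast
    have i5 : s * (M * ρ * y) + s * (M * y) ≤ s ^ 2 / 2 + M ^ 2 * R * y ^ 2 := by
      have j1 : 0 ≤ (s - M * (ρ + 1) * y) ^ 2 := sq_nonneg _
      have j2 : 0 ≤ M ^ 2 * y ^ 2 * (ρ - 1) ^ 2 := by positivity
      rw [hR]
      linarith
    simp only [Complex.imCLM_apply, ContinuousLinearMap.coe_restrictScalars', map_neg, map_smul,
      inner_neg_left, inner_neg_right, inner_add_right, inner_smul_left, inner_smul_right,
      Complex.add_im, Complex.neg_im, Complex.mul_im, Complex.I_re, Complex.I_im, Complex.conj_I,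
      Complex.neg_re, zero_mul, one_mul, zero_add, neg_zero, neg_neg, i4, neg_mul]
    have := abs_le.1 i1
    have := abs_le.1 i2
    have := abs_le.1 i3
    linarith
  choose n' hn' hn'le using hNd
  choose q' hq' hq'le using hQd
  have hQabs : ∀ t, |ε / R * Q t| ≤ N t / 2 := fun t => by
    have h1 : |Q t| ≤ M * ρ * ‖v₁ t‖ * ‖v₂ t‖ :=
      (Complex.abs_im_le_norm _).trans ((norm_inner_le_norm _ _).trans (by gcongr; exact hb21 _))
    have h2 : ρ ≤ R := by nlinarith [sq_nonneg (ρ - 1)]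
    have h3 : ‖v₁ t‖ * ‖v₂ t‖ ≤ N t / 2 := by
      have := two_mul_le_add_sq ‖v₁ t‖ ‖v₂ t‖
      simp only [hN]
      linarith
    have hRpos : 0 ≤ ε / R := by positivity
    rw [abs_mul, abs_of_nonneg hRpos]
    calc ε / R * |Q t| ≤ ε / R * (M * ρ * ‖v₁ t‖ * ‖v₂ t‖) := by gcongr
      _ = ε * M * (ρ / R) * (‖v₁ t‖ * ‖v₂ t‖) := by ring
      _ ≤ 1 * 1 * (N t / 2) := by
        have := hN0 t
        gcongr
        exact (div_le_one hR0).2 h2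
      _ = _ := by ring
  intro t ht
  have key := le_exp_mul_of_deriv_le (g := fun t => N t + ε / R * Q t) (c := 2 * c₁ / 3)
    (fun t => (hn' t).add ((hq' t).const_mul (ε / R))) (fun t => ?_) ht
  · have h1 := abs_le.1 (hQabs t)
    have h2 := abs_le.1 (hQabs 0)
    have h3 : 0 < Real.exp (-(2 * c₁ / 3) * t) := Real.exp_pos _
    have h4 : Real.exp (-(2 * c₁ / 3) * t) * (N 0 + ε / R * Q 0) ≤
        Real.exp (-(2 * c₁ / 3) * t) * (3 / 2 * N 0) := by
      gcongr
      linarith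
    have h5 : N t ≤ 3 * Real.exp (-(2 * c₁ / 3) * t) * N 0 := by linarith
    exact h5
  · have h1 := abs_le.1 (hQabs t)
    have h2 : ε / R * q' t ≤
        ε / R * (-(‖b₂₁ (v₁ t)‖ ^ 2 / 2) + 2 * M ^ 2 * R * ‖v₂ t‖ ^ 2) := by
      gcongr
      exact hq'le t
    have h3 : ε / R * (-(‖b₂₁ (v₁ t)‖ ^ 2 / 2) + 2 * M ^ 2 * R * ‖v₂ t‖ ^ 2) =
        -(ε / R * ‖b₂₁ (v₁ t)‖ ^ 2 / 2) + 2 * M ^ 2 * ε * ‖v₂ t‖ ^ 2 := by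
      field_simp
    have h4 : 2 * M ^ 2 * ε * ‖v₂ t‖ ^ 2 ≤ c * ‖v₂ t‖ ^ 2 := by gcongr
    have h5 : ε * γ * k * ‖v₁ t‖ ^ 2 ≤ ε / R * ‖b₂₁ (v₁ t)‖ ^ 2 := by
      calc _ = ε / R * (γ * (k * R) * ‖v₁ t‖ ^ 2) := by field_simp
        _ ≤ ε / R * (γ * ρ ^ 2 * ‖v₁ t‖ ^ 2) := by gcongr
        _ ≤ _ := by gcongr; exact hlow _
    have h6 : c₁ * ‖v₁ t‖ ^ 2 ≤ ε * γ * k / 2 * ‖v₁ t‖ ^ 2 := by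
      gcongr
      exact min_le_right _ _
    have h7 : c₁ * ‖v₂ t‖ ^ 2 ≤ c * ‖v₂ t‖ ^ 2 := by
      gcongr
      exact min_le_left _ _
    have h8 := hn'le t
    have h9 : c₁ * (ε / R * Q t) ≤ c₁ * (N t / 2) := by
      gcongr
      exact h1.2
    have h10 : N t = ‖v₁ t‖ ^ 2 + ‖v₂ t‖ ^ 2 := rfl
    have h11 : c₁ * N t = c₁ * ‖v₁ t‖ ^ 2 + c₁ * ‖v₂ t‖ ^ 2 := by rw [h10]; ring
    linarith

/-- A matrix as an operator between Euclidean spaces. -/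
def rectCLM {ι κ : Type*} [Fintype ι] [Fintype κ] [DecidableEq κ] (M : Matrix ι κ ℂ) :
    EuclideanSpace ℂ κ →L[ℂ] EuclideanSpace ℂ ι :=
  LinearMap.toContinuousLinearMap (Matrix.toEuclideanLin M)

variable {d n₁ n₂ : ℕ} {ι κ : Type*} [Fintype ι] [Fintype κ] [DecidableEq ι] [DecidableEq κ]

omit [DecidableEq ι] in
lemma rectCLM_apply (M : Matrix ι κ ℂ) (x : EuclideanSpace ℂ κ) :
    rectCLM M x = WithLp.toLp 2 (M *ᵥ x.ofLp) := rfl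

omit [DecidableEq ι] in
lemma norm_rectCLM_linSymb_le (N : Fin d → Matrix ι κ ℝ) :
    ∃ K : ℝ, 0 ≤ K ∧ ∀ (ξ : Space d) x, ‖rectCLM (linSymb N ξ) x‖ ≤ K * ‖ξ‖ * ‖x‖ := by
  refine ⟨∑ i, ‖rectCLM (cmat (N i))‖, by positivity, fun ξ x => ?_⟩
  have e : rectCLM (linSymb N ξ) x = ∑ i, ((ξ i : ℝ) : ℂ) • rectCLM (cmat (N i)) x := by
    ext a
    simp only [rectCLM_apply, WithLp.ofLp_sum, WithLp.ofLp_smul, Finset.sum_apply, Pi.smul_apply,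
      Matrix.mulVec, dotProduct, linSymb, cmat_apply, Finset.sum_mul, smul_eq_mul, Finset.mul_sum]
    rw [Finset.sum_comm]
    simp only [mul_assoc]
  rw [e, Finset.sum_mul, Finset.sum_mul]
  refine norm_sum_le_of_le _ fun i _ => ?_
  rw [norm_smul, Complex.norm_real, mul_comm ‖rectCLM _‖, mul_assoc]
  gcongr
  · exact PiLp.norm_apply_le ξ i
  · exact ContinuousLinearMap.le_opNorm _ _

variable {A : Fin d → Matrix (Fin n₁ ⊕ Fin n₂) (Fin n₁ ⊕ Fin n₂) ℝ}
  {D : Matrix (Fin n₂) (Fin n₂) ℝ}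

/-- Exponential decay of `e^{-tE(ξ)}` for `|ξ| ≥ r`. -/
lemma IsPartiallyDissipative.exists_norm_exp_fullSymbol_le (hA : IsPartiallyDissipative A D)
    {r : ℝ} (hr : 0 < r) :
    ∃ C c : ℝ, 0 < C ∧ 0 < c ∧ ∀ ξ : Space d, r ≤ ‖ξ‖ → ∀ t : ℝ, 0 ≤ t → ∀ a b,
      ‖NormedSpace.exp (-((t : ℂ) • fullSymbol A D ξ)) a b‖ ≤ C * Real.exp (-c * t) := by
  obtain ⟨c, hc, hD⟩ := exists_accretive_cmat hA.posDef
  obtain ⟨γ, hγ, hlow⟩ := hA.exists_blk₂₁_lower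
  obtain ⟨K₁, hK₁, h12⟩ := norm_rectCLM_linSymb_le (blk₁₂ A)
  obtain ⟨K₂, hK₂, h21⟩ := norm_rectCLM_linSymb_le (blk₂₁ A)
  obtain ⟨K₃, hK₃, h22⟩ := norm_rectCLM_linSymb_le (blk₂₂ A)
  set M := 1 + K₁ + K₂ + K₃ + ‖rectCLM (cmat D)‖ with hM
  have hnD : 0 ≤ ‖rectCLM (cmat D)‖ := norm_nonneg _
  obtain ⟨c', hc', hdec⟩ := lyapunov_decay (E₁ := EuclideanSpace ℂ (Fin n₁))
    (E₂ := EuclideanSpace ℂ (Fin n₂)) (M := M) (by linarith) hc hγ hr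
  -- Square roots of the constant `3` (enlarged to `4`) and of `e^{-c't}` in the energy estimate,
  -- which is applied to the column `e^{-tE(ξ)} e_b`.
  refine ⟨2, c' / 2, by positivity, by positivity, fun ξ hξ t ht a b => ?_⟩
  set T := Matrix.toEuclideanCLM (𝕜 := ℂ) (fullSymbol A D ξ) with hT
  set x : EuclideanSpace ℂ (Fin n₁ ⊕ Fin n₂) := EuclideanSpace.single b 1 with hx
  set w : ℝ → EuclideanSpace ℂ (Fin n₁ ⊕ Fin n₂) := fun t => NormedSpace.exp ((-t) • T) x with hw
  have hwd : ∀ t, HasDerivAt w (-(T (w t))) t := hasDerivAt_exp_neg_smul_apply T x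
  let P₁ : EuclideanSpace ℂ (Fin n₁ ⊕ Fin n₂) →L[ℂ] EuclideanSpace ℂ (Fin n₁) :=
    LinearMap.toContinuousLinearMap
      { toFun := fun v => WithLp.toLp 2 fun a => v (Sum.inl a)
        map_add' := fun _ _ => rfl
        map_smul' := fun _ _ => rfl }
  let P₂ : EuclideanSpace ℂ (Fin n₁ ⊕ Fin n₂) →L[ℂ] EuclideanSpace ℂ (Fin n₂) :=
    LinearMap.toContinuousLinearMap
      { toFun := fun v => WithLp.toLp 2 fun a => v (Sum.inr a)
        map_add' := fun _ _ => rfl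
        map_smul' := fun _ _ => rfl }
  have hP : ∀ v, ‖v‖ ^ 2 = ‖P₁ v‖ ^ 2 + ‖P₂ v‖ ^ 2 := fun v => by
    simp only [EuclideanSpace.norm_sq_eq, Fintype.sum_sum_type]
    rfl
  have hTv : ∀ v, T v = WithLp.toLp 2 (fullSymbol A D ξ *ᵥ v.ofLp) := fun v => rfl
  have hv : ∀ v : EuclideanSpace ℂ (Fin n₁ ⊕ Fin n₂),
      v.ofLp = Sum.elim (P₁ v).ofLp (P₂ v).ofLp := fun v => by
    ext (i | i) <;> rfl
  have hP₁ : ∀ v, P₁ (T v) = Complex.I • rectCLM (linSymb (blk₁₂ A) ξ) (P₂ v) := fun v => by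
    ext i
    change (fullSymbol A D ξ *ᵥ v.ofLp) (Sum.inl i) = _
    rw [fullSymbol_eq_fromBlocks hA, hv, Matrix.fromBlocks_mulVec]
    simp [rectCLM_apply, Matrix.smul_mulVec]
  have hP₂ : ∀ v, P₂ (T v) = Complex.I • rectCLM (linSymb (blk₂₁ A) ξ) (P₁ v) +
      (Complex.I • rectCLM (linSymb (blk₂₂ A) ξ) (P₂ v) + rectCLM (cmat D) (P₂ v)) := fun v => by
    ext i
    change (fullSymbol A D ξ *ᵥ v.ofLp) (Sum.inr i) = _
    rw [fullSymbol_eq_fromBlocks hA, hv, Matrix.fromBlocks_mulVec]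
    simp [rectCLM_apply, Matrix.smul_mulVec, Matrix.add_mulVec]
  have hρ : 0 ≤ ‖ξ‖ := norm_nonneg _
  have hinner : ∀ {l : Type} [Fintype l] (u v : EuclideanSpace ℂ l),
      inner ℂ u v = star u.ofLp ⬝ᵥ v.ofLp := fun u v => by
    rw [← dotProduct_comm]
    rfl
  have hwn := hdec (rectCLM (linSymb (blk₂₁ A) ξ)) (rectCLM (linSymb (blk₁₂ A) ξ))
    (rectCLM (linSymb (blk₂₂ A) ξ)) (rectCLM (cmat D)) ‖ξ‖ hξ (fun u v => by
      rw [hinner, hinner, rectCLM_apply, rectCLM_apply, ← hA.conjTranspose_linSymb_blk₂₁,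
        Matrix.dotProduct_mulVec, Matrix.star_mulVec]) (fun y => by
      have hs : (linSymb (blk₂₂ A) ξ)ᴴ = linSymb (blk₂₂ A) ξ := by
        ext i j
        simp only [linSymb, Matrix.conjTranspose_apply, Matrix.toBlocks₂₂, Matrix.of_apply,
          star_sum]
        refine Finset.sum_congr rfl fun k _ => ?_
        have h : A k (Sum.inr j) (Sum.inr i) = A k (Sum.inr i) (Sum.inr j) :=
          (hA.symm k).apply (Sum.inr i) (Sum.inr j)
        simp [h]
      have h1 : (starRingEnd ℂ) (inner ℂ y (rectCLM (linSymb (blk₂₂ A) ξ) y)) =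
          inner ℂ y (rectCLM (linSymb (blk₂₂ A) ξ) y) := by
        rw [inner_conj_symm, hinner, hinner, rectCLM_apply, Matrix.star_mulVec, hs,
          Matrix.dotProduct_mulVec]
      exact Complex.conj_eq_iff_im.1 h1)
    (fun u => (h21 ξ u).trans (by gcongr; linarith))
    (fun u => (h12 ξ u).trans (by gcongr; linarith))
    (fun u => (h22 ξ u).trans (by gcongr; linarith))
    (fun u => (ContinuousLinearMap.le_opNorm _ _).trans (by gcongr; linarith))
    (fun y => hD y)
    (fun u => by
      have := hlow ξ u.ofLp
      rwa [← norm_toLp_sq, ← norm_toLp_sq] at this)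
    (fun t => P₁ (w t)) (fun t => P₂ (w t))
    (fun t => by
      have := (P₁.restrictScalars ℝ).hasFDerivAt.comp_hasDerivAt t (hwd t)
      refine this.congr_deriv ?_
      rw [ContinuousLinearMap.coe_restrictScalars', map_neg, hP₁])
    (fun t => by
      have := (P₂.restrictScalars ℝ).hasFDerivAt.comp_hasDerivAt t (hwd t)
      refine this.congr_deriv ?_
      rw [ContinuousLinearMap.coe_restrictScalars', map_neg, hP₂]) t ht
  rw [← hP, ← hP] at hwn
  have hw0 : w 0 = x := by
    have h0 : (-(0 : ℝ)) • T = 0 := by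
      ext v : 1
      simp
    simp only [hw]
    rw [h0, NormedSpace.exp_zero]
    rfl
  rw [hw0, hx, PiLp.norm_single, norm_one, one_pow, mul_one] at hwn
  have e1 : NormedSpace.exp (-((t : ℂ) • fullSymbol A D ξ)) a b = w t a := by
    have h1 : (-t) • T = Matrix.toEuclideanCLM (𝕜 := ℂ) (-((t : ℂ) • fullSymbol A D ξ)) := by
      rw [map_neg, map_smul, ← hT]
      ext v : 1
      simp [Complex.coe_smul]
    rw [hw]
    simp only
    rw [h1, ← toEuclideanCLM_exp]
    change _ = (NormedSpace.exp (-((t : ℂ) • fullSymbol A D ξ)) *ᵥ x.ofLp) a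
    rw [hx, PiLp.ofLp_single, Matrix.mulVec_single_one]
    rfl
  rw [e1]
  refine (PiLp.norm_apply_le _ _).trans (le_of_sq_le_sq (hwn.trans ?_) (by positivity))
  rw [mul_pow, ← Real.exp_nat_mul]
  have e2 : ((2 : ℕ) : ℝ) * (-(c' / 2) * t) = -c' * t := by push_cast; ring
  rw [e2]
  have := Real.exp_pos (-c' * t)
  linarith

end HighFrequencySymbol

/-! ### Temperate growth of matrix exponentials -/

section TemperateExp

open scoped Matrix

variable {d : ℕ}

lemma hasTemperateGrowth_fderiv_apply {f : Space d → ℂ} (hf : f.HasTemperateGrowth)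
    (e : Space d) : (fun ξ => fderiv ℝ f ξ e).HasTemperateGrowth := by
  have h : (fderiv ℝ f).HasTemperateGrowth := by
    refine ⟨hf.1.fderiv_right (by simp), fun n => ?_⟩
    obtain ⟨k, C, h⟩ := hf.2 (n + 1)
    exact ⟨k, C, fun x => by rw [norm_iteratedFDeriv_fderiv]; exact h x⟩
  exact (ContinuousLinearMap.apply ℝ ℂ e).hasTemperateGrowth.comp h

/-- Polynomial bounds of order `n` for the partial derivatives give them at order `n + 1` for the
function: the differential is the sum of the partials times coordinate functionals. -/
lemma exists_iteratedFDeriv_succ_le {f : Space d → ℂ}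
    {g : Fin d → Space d → ℂ} (hg : ∀ i ξ, fderiv ℝ f ξ (basisVec i) = g i ξ)
    (hgc : ∀ i, ContDiff ℝ (⊤ : ℕ∞) (g i)) {n : ℕ}
    (h : ∀ i, ∃ (k : ℕ) (C : ℝ), ∀ ξ, ‖iteratedFDeriv ℝ n (g i) ξ‖ ≤ C * (1 + ‖ξ‖) ^ k) :
    ∃ (k : ℕ) (C : ℝ), ∀ ξ, ‖iteratedFDeriv ℝ (n + 1) f ξ‖ ≤ C * (1 + ‖ξ‖) ^ k := by
  choose k C h using h
  set L : Fin d → ℂ →L[ℝ] (Space d →L[ℝ] ℂ) := fun i =>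
    ContinuousLinearMap.smulRightL ℝ (Space d) ℂ (EuclideanSpace.proj i) with hL
  have hfd : fderiv ℝ f = fun ξ => ∑ i, L i (g i ξ) := by
    ext ξ v
    have hv : v = ∑ i, v i • basisVec i := by
      ext j
      simp [basisVec, Finset.sum_apply, Pi.single_apply]
    conv_lhs => rw [hv]
    simp only [map_sum, map_smul, hg, sum_apply]
    rfl
  have hLc : ∀ i, ContDiff ℝ (⊤ : ℕ∞) fun ξ => L i (g i ξ) := fun i =>
    (L i).contDiff.comp (hgc i)
  refine ⟨∑ i, k i, ∑ i, ‖L i‖ * |C i|, fun ξ => ?_⟩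
  rw [← norm_iteratedFDeriv_fderiv, hfd, iteratedFDeriv_fun_sum_apply fun i _ =>
    ((hLc i).of_le (mod_cast le_top)).contDiffAt, Finset.sum_mul]
  refine norm_sum_le_of_le _ fun i _ => ?_
  have h1 := (L i).norm_iteratedFDeriv_comp_left (f := g i) (x := ξ) (n := n)
    (hgc i).contDiffAt (mod_cast le_top)
  refine h1.trans ?_
  rw [mul_assoc]
  gcongr
  refine (h i ξ).trans ?_
  have hk : k i ≤ ∑ j, k j := Finset.single_le_sum (fun _ _ => Nat.zero_le _) (Finset.mem_univ i)
  calc _ ≤ |C i| * (1 + ‖ξ‖) ^ k i := by gcongr; exact le_abs_self _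
    _ ≤ _ := by
      gcongr
      linarith [norm_nonneg ξ]

/-- The first component of a vector indexed by a sum. -/
def sumFst (ι κ : Type*) [Fintype ι] [Fintype κ] :
    EuclideanSpace ℂ (ι ⊕ κ) →L[ℂ] EuclideanSpace ℂ ι :=
  LinearMap.toContinuousLinearMap
    { toFun := fun v => WithLp.toLp 2 fun a => v (Sum.inl a)
      map_add' := fun _ _ => rfl
      map_smul' := fun _ _ => rfl }

/-- The second component of a vector indexed by a sum. -/
def sumSnd (ι κ : Type*) [Fintype ι] [Fintype κ] :
    EuclideanSpace ℂ (ι ⊕ κ) →L[ℂ] EuclideanSpace ℂ κ :=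
  LinearMap.toContinuousLinearMap
    { toFun := fun v => WithLp.toLp 2 fun a => v (Sum.inr a)
      map_add' := fun _ _ => rfl
      map_smul' := fun _ _ => rfl }

lemma norm_sq_eq_sumFst_add_sumSnd {ι κ : Type*} [Fintype ι] [Fintype κ]
    (v : EuclideanSpace ℂ (ι ⊕ κ)) : ‖v‖ ^ 2 = ‖sumFst ι κ v‖ ^ 2 + ‖sumSnd ι κ v‖ ^ 2 := by
  simp only [EuclideanSpace.norm_sq_eq, Fintype.sum_sum_type]
  rfl

/-- Duhamel's formula for the triangular system in which `w₂` forces `w₁`. Only bounds of `e^{rT}`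
for `0 ≤ r ≤ 1` enter, and the two propagators around `H` give `K²`. -/
lemma norm_duhamel_le {E : Type*} [NormedAddCommGroup E] [NormedSpace ℂ E] [CompleteSpace E]
    {T H : E →L[ℂ] E} {K : ℝ} (hK : ∀ r : ℝ, 0 ≤ r → r ≤ 1 → ‖NormedSpace.exp (r • T)‖ ≤ K)
    {w₁ w₂ : ℝ → E} (h₁ : ∀ t, HasDerivAt w₁ (T (w₁ t) + H (w₂ t)) t)
    (h₂ : ∀ t, HasDerivAt w₂ (T (w₂ t)) t) :
    ‖w₂ 1‖ ≤ K * ‖w₂ 0‖ ∧ ‖w₁ 1‖ ≤ K * ‖w₁ 0‖ + K ^ 2 * ‖H‖ * ‖w₂ 0‖ := by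
  have hneg : ∀ r : ℝ, (-r) • (-T) = r • T := fun r => by
    ext x
    simp
  have hw₂ : ∀ t, w₂ t = NormedSpace.exp (t • T) (w₂ 0) := fun t => by
    rw [← hneg]
    exact eq_exp_neg_smul_apply (-T) (fun t => by simpa using h₂ t) t
  have hw₂K : ∀ t, 0 ≤ t → t ≤ 1 → ‖w₂ t‖ ≤ K * ‖w₂ 0‖ := fun t h0 h1 => by
    rw [hw₂ t]
    exact ContinuousLinearMap.le_of_opNorm_le _ (hK t h0 h1) _
  refine ⟨hw₂K 1 zero_le_one le_rfl, ?_⟩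
  have hK0 : 0 ≤ K := (norm_nonneg _).trans (hK 0 le_rfl zero_le_one)
  have hd := fun s => hasDerivAt_exp_smul_apply_comp (-T) (h₁ s) 1
  have hb : ∀ s ∈ Set.Ico (0 : ℝ) 1, ‖NormedSpace.exp ((s - 1) • (-T))
      ((-T) (w₁ s) + (T (w₁ s) + H (w₂ s)))‖ ≤ K ^ 2 * ‖H‖ * ‖w₂ 0‖ := by
    intro s hs
    rw [show (s - 1) = -(1 - s) by ring, hneg, neg_apply, neg_add_cancel_left]
    calc _ ≤ K * (‖H‖ * (K * ‖w₂ 0‖)) :=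
          (ContinuousLinearMap.le_of_opNorm_le _ (hK _ (by linarith [hs.2]) (by linarith [hs.1]))
            _).trans (by
            gcongr
            exact ContinuousLinearMap.le_opNorm_of_le _ (hw₂K s hs.1 hs.2.le))
      _ = _ := by ring
  have h3 := norm_image_sub_le_of_norm_deriv_le_segment' (fun s _ => (hd s).hasDerivWithinAt) hb 1
    ⟨zero_le_one, le_rfl⟩
  have e1 : ((1 : ℝ) - 1) • (-T) = 0 := by
    ext x
    simp
  rw [e1, NormedSpace.exp_zero, show ((0 : ℝ) - 1) = -1 by ring, hneg, sub_zero, mul_one] at h3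
  have h4 : ‖NormedSpace.exp ((1 : ℝ) • T) (w₁ 0)‖ ≤ K * ‖w₁ 0‖ :=
    ContinuousLinearMap.le_of_opNorm_le _ (hK 1 zero_le_one le_rfl) _
  have h5 := norm_add_le ((1 : E →L[ℂ] E) (w₁ 1) - NormedSpace.exp ((1 : ℝ) • T) (w₁ 0))
    (NormedSpace.exp ((1 : ℝ) • T) (w₁ 0))
  rw [sub_add_cancel] at h5
  have h6 : (1 : E →L[ℂ] E) (w₁ 1) = w₁ 1 := rfl
  rw [h6] at h5 h3
  linarith

variable {ι : Type} [Fintype ι] [DecidableEq ι]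

lemma toEuclideanCLM_ofReal_smul (s : ℝ) (Q : Matrix ι ι ℂ) :
    Matrix.toEuclideanCLM (𝕜 := ℂ) ((s : ℂ) • Q) = s • Matrix.toEuclideanCLM (𝕜 := ℂ) Q := by
  rw [map_smul]
  ext v : 1
  simp [Complex.coe_smul]

lemma norm_exp_fromBlocks_le {Q H : Matrix ι ι ℂ} {K : ℝ}
    (hK : ∀ r : ℝ, 0 ≤ r → r ≤ 1 →
      ‖Matrix.toEuclideanCLM (𝕜 := ℂ) (NormedSpace.exp ((r : ℂ) • Q))‖ ≤ K) :
    ‖Matrix.toEuclideanCLM (𝕜 := ℂ) (NormedSpace.exp (Matrix.fromBlocks Q H 0 Q))‖ ≤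
      2 * K + K ^ 2 * ‖Matrix.toEuclideanCLM (𝕜 := ℂ) H‖ := by
  set T := Matrix.toEuclideanCLM (𝕜 := ℂ) Q with hT
  set Hc := Matrix.toEuclideanCLM (𝕜 := ℂ) H with hHc
  have hK' : ∀ r : ℝ, 0 ≤ r → r ≤ 1 → ‖NormedSpace.exp (r • T)‖ ≤ K := fun r h0 h1 => by
    rw [hT, ← toEuclideanCLM_ofReal_smul, ← toEuclideanCLM_exp]
    exact hK r h0 h1
  have hK0 : 0 ≤ K := (norm_nonneg _).trans (hK' 0 le_rfl zero_le_one)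
  set B := Matrix.toEuclideanCLM (𝕜 := ℂ) (Matrix.fromBlocks Q H 0 Q) with hB
  rw [toEuclideanCLM_exp, ← hB]
  refine ContinuousLinearMap.opNorm_le_bound _ (by positivity) fun x => ?_
  set w : ℝ → EuclideanSpace ℂ (ι ⊕ ι) := fun t => NormedSpace.exp (t • B) x with hw
  have hwd : ∀ t, HasDerivAt w (B (w t)) t := hasDerivAt_exp_smul_apply B x
  have hv : ∀ v : EuclideanSpace ℂ (ι ⊕ ι),
      v.ofLp = Sum.elim (sumFst ι ι v).ofLp (sumSnd ι ι v).ofLp := fun v => by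
    ext (i | i) <;> rfl
  have h1 : ∀ v, sumFst ι ι (B v) = T (sumFst ι ι v) + Hc (sumSnd ι ι v) := fun v => by
    ext i
    change (Matrix.fromBlocks Q H 0 Q *ᵥ v.ofLp) (Sum.inl i) = _
    rw [hv, Matrix.fromBlocks_mulVec]
    rfl
  have h2 : ∀ v, sumSnd ι ι (B v) = T (sumSnd ι ι v) := fun v => by
    ext i
    change (Matrix.fromBlocks Q H 0 Q *ᵥ v.ofLp) (Sum.inr i) = _
    rw [hv, Matrix.fromBlocks_mulVec, Sum.elim_inr, Matrix.zero_mulVec, zero_add]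
    rfl
  obtain ⟨b2, b1⟩ := norm_duhamel_le (H := Hc) hK' (w₁ := fun t => sumFst ι ι (w t))
    (w₂ := fun t => sumSnd ι ι (w t)) (fun t => by
      have := ((sumFst ι ι).restrictScalars ℝ).hasFDerivAt.comp_hasDerivAt t (hwd t)
      rw [← h1]
      exact this) (fun t => by
      have := ((sumSnd ι ι).restrictScalars ℝ).hasFDerivAt.comp_hasDerivAt t (hwd t)
      rw [← h2]
      exact this)
  have hw0 : w 0 = x := by
    have h0 : (0 : ℝ) • B = 0 := by
      ext v : 1
      simp
    simp only [hw]
    rw [h0, NormedSpace.exp_zero]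
    rfl
  have hw1 : w 1 = NormedSpace.exp B x := by
    have h0 : (1 : ℝ) • B = B := by
      ext v : 1
      simp
    simp only [hw]
    rw [h0]
  rw [hw0] at b1 b2
  have hle1 : ‖sumFst ι ι x‖ ≤ ‖x‖ := le_of_sq_le_sq (by
    rw [norm_sq_eq_sumFst_add_sumSnd x]
    linarith [sq_nonneg ‖sumSnd ι ι x‖]) (norm_nonneg _)
  have hle2 : ‖sumSnd ι ι x‖ ≤ ‖x‖ := le_of_sq_le_sq (by
    rw [norm_sq_eq_sumFst_add_sumSnd x]
    linarith [sq_nonneg ‖sumFst ι ι x‖]) (norm_nonneg _)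
  have hle3 : ‖w 1‖ ≤ ‖sumFst ι ι (w 1)‖ + ‖sumSnd ι ι (w 1)‖ := le_of_sq_le_sq (by
    rw [norm_sq_eq_sumFst_add_sumSnd]
    have : 0 ≤ ‖sumFst ι ι (w 1)‖ * ‖sumSnd ι ι (w 1)‖ := by positivity
    linarith [add_sq ‖sumFst ι ι (w 1)‖ ‖sumSnd ι ι (w 1)‖]) (by positivity)
  rw [← hw1]
  have j1 : K * ‖sumFst ι ι x‖ ≤ K * ‖x‖ := by gcongr
  have j2 : K * ‖sumSnd ι ι x‖ ≤ K * ‖x‖ := by gcongr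
  have j3 : K ^ 2 * ‖Hc‖ * ‖sumSnd ι ι x‖ ≤ K ^ 2 * ‖Hc‖ * ‖x‖ := by gcongr
  linarith

/-- The corner of a power is the difference quotient of the power, without any commutation of `Q₁`
and `Q₂`. Summed in the exponential series, this gives the difference quotient of `exp`. -/
lemma fromBlocks_slope_pow (Q₁ Q₂ : Matrix ι ι ℂ) (h : ℂ) (n : ℕ) :
    Matrix.fromBlocks Q₁ (h • (Q₂ - Q₁)) 0 Q₂ ^ n =
      Matrix.fromBlocks (Q₁ ^ n) (h • (Q₂ ^ n - Q₁ ^ n)) 0 (Q₂ ^ n) := by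
  induction n with
  | zero => simp
  | succ n ih =>
    rw [pow_succ, ih, Matrix.fromBlocks_multiply, pow_succ, pow_succ]
    congr 1
    · simp
    · rw [Matrix.mul_smul, Matrix.smul_mul, ← smul_add]
      congr 1
      noncomm_ring
    · simp
    · simp

lemma exp_fromBlocks_slope (Q₁ Q₂ : Matrix ι ι ℂ) (h : ℂ) (a b : ι) :
    NormedSpace.exp (Matrix.fromBlocks Q₁ (h • (Q₂ - Q₁)) 0 Q₂) (Sum.inl a) (Sum.inr b) =
      h * (NormedSpace.exp Q₂ a b - NormedSpace.exp Q₁ a b) := by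
  refine (hasSum_exp_entry _ _ _).unique ?_
  have h2 := (((hasSum_exp_entry Q₂ a b).sub (hasSum_exp_entry Q₁ a b)).mul_left h)
  refine h2.congr_fun ?_
  intro k
  rw [fromBlocks_slope_pow]
  simp only [Matrix.fromBlocks_apply₁₂, Matrix.smul_apply, Matrix.sub_apply, smul_eq_mul]
  ring

/-- The partial derivative of a matrix symbol. -/
def matDeriv (i : Fin d) (Q : Space d → Matrix ι ι ℂ) (ξ : Space d) : Matrix ι ι ℂ :=
  fun a b => fderiv ℝ (fun η => Q η a b) ξ (basisVec i)

omit [Fintype ι] [DecidableEq ι] in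
lemma TemperateMatrix.deriv {Q : Space d → Matrix ι ι ℂ} (hQ : TemperateMatrix Q) (i : Fin d) :
    TemperateMatrix (matDeriv i Q) := fun a b =>
  hasTemperateGrowth_fderiv_apply (hQ a b) _

open scoped Matrix.Norms.Operator in
lemma TemperateMatrix.contDiff_exp {Q : Space d → Matrix ι ι ℂ} (hQ : TemperateMatrix Q) (a b : ι) :
    ContDiff ℝ (⊤ : ℕ∞) fun ξ => NormedSpace.exp (Q ξ) a b := by
  have h1 : ContDiff ℝ (⊤ : ℕ∞) Q := by
    have h : Q = fun ξ => ∑ a, ∑ b, Q ξ a b • Matrix.single a b (1 : ℂ) := by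
      ext ξ : 1
      conv_lhs => rw [Matrix.matrix_eq_sum_single (Q ξ)]
      simp
    rw [h]
    exact ContDiff.sum fun a _ => ContDiff.sum fun b _ => (hQ a b).1.smul contDiff_const
  exact (entryCLM a b).contDiff.comp (contDiff_matrix_exp.comp h1)

-- Let the increment tend to zero in `exp_fromBlocks_slope`: the derivative of `e^Q` is the corner
-- of the exponential of a doubled triangular matrix, so differentiating stays within exponentials
-- of symbols.
open scoped Matrix.Norms.Operator in
lemma TemperateMatrix.fderiv_exp {Q : Space d → Matrix ι ι ℂ} (hQ : TemperateMatrix Q) (i : Fin d)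
    (a b : ι) (ξ : Space d) :
    fderiv ℝ (fun ξ => NormedSpace.exp (Q ξ) a b) ξ (basisVec i) =
      NormedSpace.exp (Matrix.fromBlocks (Q ξ) (matDeriv i Q ξ) 0 (Q ξ)) (Sum.inl a) (Sum.inr b) := by
  set e : Space d := basisVec i with he
  have hline : HasDerivAt (fun h : ℝ => ξ + h • e) e 0 := by
    simpa using ((hasDerivAt_id (0 : ℝ)).smul_const e).const_add ξ
  have hz : ξ + (0 : ℝ) • e = ξ := by simp
  have hd : ∀ {f : Space d → ℂ}, ContDiff ℝ (⊤ : ℕ∞) f →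
      HasDerivAt (fun h : ℝ => f (ξ + h • e)) (fderiv ℝ f ξ e) 0 := fun {f} hf => by
    have h1 : HasFDerivAt f (fderiv ℝ f ξ) (ξ + (0 : ℝ) • e) := by
      rw [hz]
      exact (hf.differentiable (by simp) ξ).hasFDerivAt
    exact h1.comp_hasDerivAt 0 hline
  have hQd : ∀ a b, Tendsto (fun h : ℝ => ((h⁻¹ : ℝ) : ℂ) * (Q (ξ + h • e) a b - Q ξ a b))
      (𝓝[≠] 0) (𝓝 (matDeriv i Q ξ a b)) := fun a b => by
    have := (hd (hQ a b).1).tendsto_slope_zero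
    simpa [Complex.real_smul, matDeriv] using this
  have hQc : ∀ a b, Tendsto (fun h : ℝ => Q (ξ + h • e) a b) (𝓝[≠] 0) (𝓝 (Q ξ a b)) :=
    fun a b => by
    have h1 : Continuous fun h : ℝ => Q (ξ + h • e) a b :=
      (hQ a b).1.continuous.comp (by fun_prop)
    have := h1.tendsto 0
    simp only [zero_smul, add_zero] at this
    exact this.mono_left nhdsWithin_le_nhds
  have hblk : Tendsto (fun h : ℝ => Matrix.fromBlocks (Q ξ)
      (((h⁻¹ : ℝ) : ℂ) • (Q (ξ + h • e) - Q ξ)) 0 (Q (ξ + h • e))) (𝓝[≠] 0)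
      (𝓝 (Matrix.fromBlocks (Q ξ) (matDeriv i Q ξ) 0 (Q ξ))) := by
    refine tendsto_pi_nhds.2 fun x => tendsto_pi_nhds.2 fun y => ?_
    rcases x with x | x <;> rcases y with y | y
    · exact tendsto_const_nhds
    · exact hQd x y
    · exact tendsto_const_nhds
    · exact hQc x y
  have hexp : Tendsto (fun h : ℝ => NormedSpace.exp (Matrix.fromBlocks (Q ξ)
      (((h⁻¹ : ℝ) : ℂ) • (Q (ξ + h • e) - Q ξ)) 0 (Q (ξ + h • e))) (Sum.inl a) (Sum.inr b)) (𝓝[≠] 0)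
      (𝓝 (NormedSpace.exp (Matrix.fromBlocks (Q ξ) (matDeriv i Q ξ) 0 (Q ξ))
        (Sum.inl a) (Sum.inr b))) :=
    ((((entryCLM (Sum.inl a) (Sum.inr b)).continuous.comp
      contDiff_matrix_exp.continuous).tendsto _).comp hblk)
  simp only [exp_fromBlocks_slope] at hexp
  have h2 := (hd (hQ.contDiff_exp a b)).tendsto_slope_zero
  simp only [zero_add, zero_smul, add_zero] at h2
  refine tendsto_nhds_unique h2 (hexp.congr fun h => ?_)
  rw [Complex.real_smul]

lemma TemperateMatrix.fromBlocks {Q H : Space d → Matrix ι ι ℂ} (hQ : TemperateMatrix Q)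
    (hH : TemperateMatrix H) :
    TemperateMatrix fun ξ => Matrix.fromBlocks (Q ξ) (H ξ) 0 (Q ξ) := fun x y => by
  rcases x with x | x <;> rcases y with y | y
  · exact hQ x y
  · exact hH x y
  · exact .const 0
  · exact hQ x y

lemma TemperateMatrix.exists_norm_le {Q : Space d → Matrix ι ι ℂ} (hQ : TemperateMatrix Q) :
    ∃ (k : ℕ) (C : ℝ), 0 ≤ C ∧
      ∀ ξ, ‖Matrix.toEuclideanCLM (𝕜 := ℂ) (Q ξ)‖ ≤ C * (1 + ‖ξ‖) ^ k := by
  have h := fun a b => (hQ a b).2 0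
  choose k C h using h
  simp only [norm_iteratedFDeriv_zero] at h
  refine ⟨∑ a, ∑ b, k a b, ∑ a, ∑ b, |C a b| *
    ‖Matrix.toEuclideanCLM (𝕜 := ℂ) (Matrix.single a b (1 : ℂ))‖, by positivity, fun ξ => ?_⟩
  have e : Q ξ = ∑ a, ∑ b, Q ξ a b • Matrix.single a b (1 : ℂ) := by
    conv_lhs => rw [Matrix.matrix_eq_sum_single (Q ξ)]
    simp
  rw [e]
  simp only [map_sum, map_smul, Finset.sum_mul]
  refine norm_sum_le_of_le _ fun a _ => norm_sum_le_of_le _ fun b _ => ?_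
  rw [norm_smul]
  have hk : k a b ≤ ∑ a, ∑ b, k a b :=
    (Finset.single_le_sum (f := fun b => k a b) (fun _ _ => Nat.zero_le _) (Finset.mem_univ b)).trans
    (Finset.single_le_sum (f := fun a => ∑ b, k a b) (fun _ _ => Nat.zero_le _) (Finset.mem_univ a))
  have h1 : ‖Q ξ a b‖ ≤ |C a b| * (1 + ‖ξ‖) ^ (∑ a, ∑ b, k a b) := by
    refine (h a b ξ).trans ?_
    calc _ ≤ |C a b| * (1 + ‖ξ‖) ^ k a b := by gcongr; exact le_abs_self _
      _ ≤ _ := by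
        gcongr
        linarith [norm_nonneg ξ]
  calc _ ≤ |C a b| * (1 + ‖ξ‖) ^ (∑ a, ∑ b, k a b) *
        ‖Matrix.toEuclideanCLM (𝕜 := ℂ) (Matrix.single a b (1 : ℂ))‖ := by gcongr
    _ = _ := by ring

/-- A matrix symbol of temperate growth whose exponentials grow at most polynomially. -/
def TemperateGenerator (Q : Space d → Matrix ι ι ℂ) : Prop :=
  TemperateMatrix Q ∧ ∃ (k : ℕ) (C : ℝ), 0 ≤ C ∧ ∀ ξ, ∀ r : ℝ, 0 ≤ r → r ≤ 1 →
    ‖Matrix.toEuclideanCLM (𝕜 := ℂ) (NormedSpace.exp ((r : ℂ) • Q ξ))‖ ≤ C * (1 + ‖ξ‖) ^ k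

/-- By `norm_exp_fromBlocks_le`, doubling the generator keeps its exponentials polynomially bounded,
with degree `2k + k'`. This is the inductive step for higher derivatives. -/
lemma TemperateGenerator.fromBlocks {Q : Space d → Matrix ι ι ℂ} (hQ : TemperateGenerator Q)
    (i : Fin d) :
    TemperateGenerator fun ξ => Matrix.fromBlocks (Q ξ) (matDeriv i Q ξ) 0 (Q ξ) := by
  obtain ⟨hQt, k, C, hC, h⟩ := hQ
  obtain ⟨k', C', hC', h'⟩ := (hQt.deriv i).exists_norm_le
  refine ⟨hQt.fromBlocks (hQt.deriv i), 2 * k + k', 2 * C + C ^ 2 * C', by positivity,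
    fun ξ r hr0 hr1 => ?_⟩
  have e : (r : ℂ) • Matrix.fromBlocks (Q ξ) (matDeriv i Q ξ) 0 (Q ξ) =
      Matrix.fromBlocks ((r : ℂ) • Q ξ) ((r : ℂ) • matDeriv i Q ξ) 0 ((r : ℂ) • Q ξ) := by
    rw [Matrix.fromBlocks_smul, smul_zero]
  rw [e]
  refine (norm_exp_fromBlocks_le (K := C * (1 + ‖ξ‖) ^ k) fun s hs0 hs1 => ?_).trans ?_
  · rw [smul_smul, ← Complex.ofReal_mul]
    exact h ξ (s * r) (by positivity) (mul_le_one₀ hs1 hr0 hr1)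
  · have h1 : ‖Matrix.toEuclideanCLM (𝕜 := ℂ) ((r : ℂ) • matDeriv i Q ξ)‖ ≤
        C' * (1 + ‖ξ‖) ^ k' := by
      rw [map_smul]
      exact (norm_ofReal_smul_le hr0 hr1 _).trans (h' ξ)
    have h2 : (1 : ℝ) ≤ 1 + ‖ξ‖ := by linarith [norm_nonneg ξ]
    have h3 : (1 + ‖ξ‖) ^ k ≤ (1 + ‖ξ‖) ^ (2 * k + k') := pow_le_pow_right₀ h2 (by omega)
    calc _ ≤ 2 * (C * (1 + ‖ξ‖) ^ k) + (C * (1 + ‖ξ‖) ^ k) ^ 2 * (C' * (1 + ‖ξ‖) ^ k') := by gcongr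
      _ = 2 * C * (1 + ‖ξ‖) ^ k + C ^ 2 * C' * (1 + ‖ξ‖) ^ (2 * k + k') := by ring
      _ ≤ 2 * C * (1 + ‖ξ‖) ^ (2 * k + k') + C ^ 2 * C' * (1 + ‖ξ‖) ^ (2 * k + k') := by gcongr
      _ = _ := by ring

lemma norm_entry_le_toEuclideanCLM (M : Matrix ι ι ℂ) (a b : ι) :
    ‖M a b‖ ≤ ‖Matrix.toEuclideanCLM (𝕜 := ℂ) M‖ := by
  have h := (Matrix.toEuclideanCLM (𝕜 := ℂ) M).le_opNorm (EuclideanSpace.single b 1)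
  rw [PiLp.norm_single, norm_one, mul_one] at h
  refine le_trans ?_ h
  have e : M a b = Matrix.toEuclideanCLM (𝕜 := ℂ) M (EuclideanSpace.single b 1) a := by
    change _ = (M *ᵥ (EuclideanSpace.single b (1 : ℂ)).ofLp) a
    rw [PiLp.ofLp_single, Matrix.mulVec_single_one]
    rfl
  rw [e]
  exact PiLp.norm_apply_le _ _

lemma TemperateGenerator.exists_iteratedFDeriv_le (n : ℕ) :
    -- The index type is quantified inside the induction because each derivative doubles it.
    ∀ {ι : Type} [Fintype ι] [DecidableEq ι] {Q : Space d → Matrix ι ι ℂ},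
      TemperateGenerator Q → ∀ a b, ∃ (k : ℕ) (C : ℝ), ∀ ξ,
        ‖iteratedFDeriv ℝ n (fun ξ => NormedSpace.exp (Q ξ) a b) ξ‖ ≤ C * (1 + ‖ξ‖) ^ k := by
  induction n with
  | zero =>
    intro ι _ _ Q hQ a b
    obtain ⟨-, k, C, -, h⟩ := hQ
    refine ⟨k, C, fun ξ => ?_⟩
    rw [norm_iteratedFDeriv_zero]
    have := h ξ 1 zero_le_one le_rfl
    rw [Complex.ofReal_one, one_smul] at this
    exact (norm_entry_le_toEuclideanCLM _ a b).trans this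
  | succ n ih =>
    intro ι _ _ Q hQ a b
    exact exists_iteratedFDeriv_succ_le
      (fun i ξ => TemperateMatrix.fderiv_exp hQ.1 i a b ξ)
      (fun i => TemperateMatrix.contDiff_exp (hQ.fromBlocks i).1 _ _)
      fun i => ih (hQ.fromBlocks i) _ _

lemma TemperateGenerator.exp {Q : Space d → Matrix ι ι ℂ} (hQ : TemperateGenerator Q) :
    TemperateMatrix fun ξ => NormedSpace.exp (Q ξ) := fun a b =>
  ⟨TemperateMatrix.contDiff_exp hQ.1 a b, fun n => hQ.exists_iteratedFDeriv_le n a b⟩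

lemma norm_exp_neg_smul_le_of_accretive {c : ℝ} {M : Matrix ι ι ℂ} (hM : Accretive c M)
    {t : ℝ} (ht : 0 ≤ t) :
    ‖Matrix.toEuclideanCLM (𝕜 := ℂ) (NormedSpace.exp (-((t : ℂ) • M)))‖ ≤ Real.exp (-c * t) := by
  have e : Matrix.toEuclideanCLM (𝕜 := ℂ) (-((t : ℂ) • M)) =
      (-t) • Matrix.toEuclideanCLM (𝕜 := ℂ) M := by
    rw [← toEuclideanCLM_ofReal_smul]
    congr 1
    rw [Complex.ofReal_neg, neg_smul]
  rw [toEuclideanCLM_exp, e]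
  exact ContinuousLinearMap.opNorm_le_bound _ (Real.exp_pos _).le fun x =>
    norm_exp_neg_smul_apply_le hM x ht

lemma IsPartiallyDissipative.temperate_exp_gSymbol {n₁ n₂ : ℕ}
    {A : Fin d → Matrix (Fin n₁ ⊕ Fin n₂) (Fin n₁ ⊕ Fin n₂) ℝ} {D : Matrix (Fin n₂) (Fin n₂) ℝ}
    (hA : IsPartiallyDissipative A D) {t : ℝ} (ht : 0 ≤ t) :
    TemperateMatrix fun ξ => NormedSpace.exp (-((t : ℂ) • gSymbol A D ξ)) := by
  obtain ⟨c, hc, h⟩ := hA.exists_gSymbol_accretive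
  refine TemperateGenerator.exp (Q := fun ξ => -((t : ℂ) • gSymbol A D ξ)) ⟨?_, 0, 1, zero_le_one,
    fun ξ r hr _ => ?_⟩
  · have := TemperateMatrix.smul (.const (-(t : ℂ))) (gSymbol_temperate (A := A) (D := D))
    simpa using this
  · rw [smul_neg, smul_smul, ← Complex.ofReal_mul, pow_zero, mul_one]
    refine (norm_exp_neg_smul_le_of_accretive (h ξ) (mul_nonneg hr ht)).trans ?_
    rw [Real.exp_le_one_iff, neg_mul]
    have : 0 ≤ c * ‖ξ‖ ^ 2 * (r * t) := by positivity
    linarith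

end TemperateExp

/-! ### Synthesis of Schwartz functions and series representation of the solution -/

section Representation

open scoped FourierTransform

variable {d : ℕ}

section Synthesis

variable {h : ℕ → 𝓢(Space d, ℂ)}

lemma summable_norm_lp_one (a : lp (fun _ : ℕ => ℂ) 1) : Summable fun i => ‖a i‖ := by
  have := (lp.memℓp a).summable (by simp)
  simpa using this

lemma norm_lp_one (a : lp (fun _ : ℕ => ℂ) 1) : ‖a‖ = ∑' i, ‖a i‖ := by
  rw [lp.norm_eq_tsum_rpow (by simp)]
  simp

lemma norm_iteratedFDeriv_smul_schwartz_le {k n : ℕ} {C : ℝ} (c : ℂ) {g : 𝓢(Space d, ℂ)}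
    (hg : SchwartzMap.seminorm ℂ k n g ≤ C) (x : Space d) :
    ‖x‖ ^ k * ‖iteratedFDeriv ℝ n (fun x => c * g x) x‖ ≤ ‖c‖ * C := by
  have e : (fun x => c * g x) = fun x => (c • g) x := rfl
  rw [e]
  refine ((c • g).le_seminorm ℂ k n x).trans ?_
  rw [map_smul_eq_mul]
  gcongr

lemma norm_iteratedFDeriv_tsum_schwartz_le
    (hb : ∀ k n : ℕ, ∃ C, ∀ i, SchwartzMap.seminorm ℂ k n (h i) ≤ C) {a : ℕ → ℂ}
    (ha : Summable fun i => ‖a i‖) {k n : ℕ} {C : ℝ}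
    (hC : ∀ i, SchwartzMap.seminorm ℂ k n (h i) ≤ C) (x : Space d) :
    ‖x‖ ^ k * ‖iteratedFDeriv ℝ n (fun x => ∑' i, a i * h i x) x‖ ≤ (∑' i, ‖a i‖) * C := by
  choose B hB using hb
  have hle : ∀ (n i : ℕ) (x : Space d),
      ‖iteratedFDeriv ℝ n (fun x => a i * h i x) x‖ ≤ ‖a i‖ * B 0 n := fun n i x => by
    simpa using norm_iteratedFDeriv_smul_schwartz_le (k := 0) (a i) (hB 0 n i) x
  rw [iteratedFDeriv_tsum_apply (N := ⊤) (fun i => contDiff_const.mul ((h i).smooth ⊤))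
    (fun n _ => ha.mul_right _) (fun n i x _ => hle n i x) le_top]
  rw [← norm_norm x, ← norm_pow, ← norm_smul, ← tsum_const_smul'', ← tsum_mul_right]
  refine tsum_of_norm_bounded (ha.mul_right _).hasSum fun i => ?_
  rw [norm_smul, norm_pow, norm_norm]
  exact norm_iteratedFDeriv_smul_schwartz_le (a i) (hC i) x

/-- The sum `∑ aᵢ hᵢ` of a bounded sequence of Schwartz functions with summable coefficients. -/
def schwartzSeries (hb : ∀ k n : ℕ, ∃ C, ∀ i, SchwartzMap.seminorm ℂ k n (h i) ≤ C)
    (a : lp (fun _ : ℕ => ℂ) 1) : 𝓢(Space d, ℂ) where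
  toFun x := ∑' i, a i * h i x
  smooth' := by
    choose C hC using hb
    refine contDiff_tsum (v := fun n i => ‖a i‖ * C 0 n)
      (fun i => contDiff_const.mul ((h i).smooth ⊤))
      (fun n _ => (summable_norm_lp_one a).mul_right _) fun n i x _ => ?_
    simpa using norm_iteratedFDeriv_smul_schwartz_le (k := 0) (a i) (hC 0 n i) x
  decay' k n := by
    obtain ⟨C, hC⟩ := hb k n
    exact ⟨_, norm_iteratedFDeriv_tsum_schwartz_le hb (summable_norm_lp_one a) hC⟩

variable (hb : ∀ k n : ℕ, ∃ C, ∀ i, SchwartzMap.seminorm ℂ k n (h i) ≤ C)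

lemma schwartzSeries_apply (a : lp (fun _ : ℕ => ℂ) 1) (x : Space d) :
    schwartzSeries hb a x = ∑' i, a i * h i x := rfl

lemma summable_mul_schwartz (hb : ∀ k n : ℕ, ∃ C, ∀ i, SchwartzMap.seminorm ℂ k n (h i) ≤ C)
    (a : lp (fun _ : ℕ => ℂ) 1) (x : Space d) : Summable fun i => a i * h i x := by
  obtain ⟨C, hC⟩ := hb 0 0
  refine Summable.of_norm_bounded ((summable_norm_lp_one a).mul_right C) fun i => ?_
  have := norm_iteratedFDeriv_smul_schwartz_le (k := 0) (n := 0) (a i) (hC i) x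
  rwa [pow_zero, one_mul, norm_iteratedFDeriv_zero] at this

lemma seminorm_schwartzSeries_le {k n : ℕ} {C : ℝ} (hC : ∀ i, SchwartzMap.seminorm ℂ k n (h i) ≤ C)
    (a : lp (fun _ : ℕ => ℂ) 1) :
    SchwartzMap.seminorm ℂ k n (schwartzSeries hb a) ≤ C * ‖a‖ := by
  have hC0 : 0 ≤ C := (apply_nonneg _ _).trans (hC 0)
  refine SchwartzMap.seminorm_le_bound ℂ k n _ (by positivity) fun x => ?_
  rw [norm_lp_one, mul_comm C]
  exact norm_iteratedFDeriv_tsum_schwartz_le hb (summable_norm_lp_one a) hC x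

/-- `schwartzSeries` as a linear map on `ℓ¹`. -/
def schwartzSeriesLM : lp (fun _ : ℕ => ℂ) 1 →ₗ[ℂ] 𝓢(Space d, ℂ) where
  toFun := schwartzSeries hb
  map_add' a b := by
    ext x
    simp only [schwartzSeries_apply, _root_.add_apply, lp.coeFn_add, Pi.add_apply, add_mul]
    exact (summable_mul_schwartz hb a x).tsum_add (summable_mul_schwartz hb b x)
  map_smul' c a := by
    ext x
    simp only [schwartzSeries_apply, _root_.smul_apply, lp.coeFn_smul, Pi.smul_apply,
      smul_eq_mul, mul_assoc, RingHom.id_apply]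
    exact tsum_mul_left

/-- `schwartzSeries` as a continuous linear map on `ℓ¹`. -/
def schwartzSeriesCLM : lp (fun _ : ℕ => ℂ) 1 →L[ℂ] 𝓢(Space d, ℂ) where
  toLinearMap := schwartzSeriesLM hb
  cont := by
    refine WithSeminorms.continuous_normedSpace_dom _ (schwartz_withSeminorms ℂ (Space d) ℂ)
      (schwartzSeriesLM hb) fun i => ?_
    obtain ⟨C, hC⟩ := hb i.1 i.2
    have hC0 : 0 ≤ C := (apply_nonneg _ _).trans (hC 0)
    exact ⟨⟨C, hC0⟩, fun a => seminorm_schwartzSeries_le hb hC a⟩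

lemma schwartzSeriesCLM_apply (a : lp (fun _ : ℕ => ℂ) 1) (x : Space d) :
    schwartzSeriesCLM hb a x = ∑' i, a i * h i x := rfl

lemma schwartzSeriesCLM_single (i : ℕ) : schwartzSeriesCLM hb (lp.single 1 i 1) = h i := by
  ext x
  rw [schwartzSeriesCLM_apply, tsum_eq_single i]
  · simp
  · intro j hj
    simp [hj]

/-- A pointwise bounded family of continuous functionals is uniformly bounded on bounded
sequences of Schwartz functions. -/
lemma exists_norm_apply_le {T : Type*} (U : T → 𝓢(Space d, ℂ) →L[ℂ] ℂ)
    (hU : ∀ φ, ∃ C, ∀ t, ‖U t φ‖ ≤ C)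
    (hb : ∀ k n : ℕ, ∃ C, ∀ i, SchwartzMap.seminorm ℂ k n (h i) ≤ C) :
    ∃ C, ∀ t i, ‖U t (h i)‖ ≤ C := by
  obtain ⟨C, hC⟩ := banach_steinhaus (g := fun t => (U t).comp (schwartzSeriesCLM hb))
    fun a => hU (schwartzSeriesCLM hb a)
  refine ⟨C, fun t i => ?_⟩
  have := ((U t).comp (schwartzSeriesCLM hb)).le_opNorm (lp.single 1 i 1)
  rw [lp.norm_single (by simp), norm_one, mul_one, ContinuousLinearMap.comp_apply,
    schwartzSeriesCLM_single] at this
  exact this.trans (hC t)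

/-- Composing `U` with the synthesis map gives a continuous functional on `ℓ¹`, where the sequence
`a` is the norm convergent sum of its coordinates. This is how `U` passes through the pointwise
series. -/
lemma hasSum_apply_schwartz (U : 𝓢(Space d, ℂ) →L[ℂ] ℂ)
    (hb : ∀ k n : ℕ, ∃ C, ∀ i, SchwartzMap.seminorm ℂ k n (h i) ≤ C) {a : ℕ → ℂ}
    (ha : Summable fun i => ‖a i‖) {g : 𝓢(Space d, ℂ)} (hg : ∀ x, HasSum (fun i => a i * h i x) (g x)) :
    HasSum (fun i => a i * U (h i)) (U g) := by
  let b : lp (fun _ : ℕ => ℂ) 1 := ⟨a, memℓp_gen (by simpa using ha)⟩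
  have e : schwartzSeriesCLM hb b = g := by
    ext x
    exact (hg x).tsum_eq
  have h1 := (lp.hasSum_single (by simp) b).mapL (U.comp (schwartzSeriesCLM hb))
  rw [ContinuousLinearMap.comp_apply, e] at h1
  refine h1.congr_fun fun i => ?_
  have e2 : lp.single 1 i (b i) = a i • lp.single (E := fun _ : ℕ => ℂ) 1 i 1 := by
    rw [← lp.single_smul, smul_eq_mul, mul_one]
  rw [e2, map_smul, ContinuousLinearMap.comp_apply, schwartzSeriesCLM_single, smul_eq_mul]

end Synthesis

end Representation

/-! ### Representation of solutions localised in frequency -/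

section LocalRepresentation

open scoped FourierTransform

variable {d : ℕ} {ι : Type} [Fintype ι] [DecidableEq ι]

/-- The square root of `r^{2k}/k! ≤ e^{r²}`, up to a harmless enlargement. The factorial of the
Taylor coefficients is shared: one factor `√k!` normalises the test functions, the other makes the
series converge. -/
lemma pow_div_sqrt_factorial_le (r : ℝ) (k : ℕ) :
    r ^ k / √(k.factorial : ℝ) ≤ Real.exp (r ^ 2) := by
  have h1 := Real.pow_div_factorial_le_exp (r ^ 2) (sq_nonneg r) k
  have h2 : (1 : ℝ) ≤ Real.exp (r ^ 2) := Real.one_le_exp (sq_nonneg r)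
  refine le_of_sq_le_sq ?_ (by positivity)
  rw [div_pow, Real.sq_sqrt (by positivity), ← pow_mul, mul_comm k 2, pow_mul]
  exact h1.trans (by rw [sq (Real.exp _)]; exact le_mul_of_one_le_left (by positivity) h2)

/-- By the Leibniz rule and induction on `k`, the derivatives up to a fixed order of `E^k` on a
compact set grow only geometrically in `k`. -/
lemma exists_iteratedFDeriv_pow_le {E : Space d → Matrix ι ι ℂ}
    (hE : ∀ a b, ContDiff ℝ (⊤ : ℕ∞) fun ξ => E ξ a b) {K : Set (Space d)} (hK : IsCompact K)
    (n : ℕ) : ∃ ρ : ℝ, 0 ≤ ρ ∧ ∀ k : ℕ, (∀ a b, ContDiff ℝ (⊤ : ℕ∞) fun ξ => (E ξ ^ k) a b) ∧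
      ∀ i ≤ n, ∀ x ∈ K, ∀ a b,
        ‖iteratedFDeriv ℝ i (fun ξ => (E ξ ^ k) a b) x‖ ≤ ρ ^ k := by
  have h1 : ∀ (i : ℕ) (a b : ι), ∃ B : ℝ, ∀ x ∈ K,
      ‖iteratedFDeriv ℝ i (fun ξ => E ξ a b) x‖ ≤ B := fun i a b =>
    hK.exists_bound_of_continuousOn
      ((hE a b).continuous_iteratedFDeriv (mod_cast le_top)).continuousOn
  choose B hB using h1
  set S : ℝ := ∑ i ∈ Finset.range (n + 1), ∑ a, ∑ b, |B i a b| with hS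
  have hS0 : 0 ≤ S := by positivity
  have hBS : ∀ i ≤ n, ∀ a b, ∀ x ∈ K, ‖iteratedFDeriv ℝ i (fun ξ => E ξ a b) x‖ ≤ S := by
    intro i hi a b x hx
    refine (hB i a b x hx).trans ((le_abs_self _).trans ?_)
    refine (Finset.single_le_sum (f := fun b => |B i a b|) (fun _ _ => abs_nonneg _)
      (Finset.mem_univ b)).trans ?_
    refine (Finset.single_le_sum (f := fun a => ∑ b, |B i a b|) (fun _ _ => by positivity)
      (Finset.mem_univ a)).trans ?_
    exact Finset.single_le_sum (f := fun i => ∑ a, ∑ b, |B i a b|) (fun _ _ => by positivity)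
      (Finset.mem_range.2 (by omega))
  -- The cardinality comes from the matrix product, `2^n` from the binomial coefficients, and `S`
  -- bounds the derivatives of `E` up to order `n`.
  set ρ : ℝ := Fintype.card ι * (2 ^ n * S) with hρ
  have hρ0 : 0 ≤ ρ := by positivity
  refine ⟨ρ, hρ0, fun k => ?_⟩
  induction k with
  | zero =>
    simp only [pow_zero]
    refine ⟨fun a b => contDiff_const, fun i _ x _ a b => ?_⟩
    rcases Nat.eq_zero_or_pos i with rfl | hi
    · rw [norm_iteratedFDeriv_zero, Matrix.one_apply]
      split_ifs <;> simp
    · rw [iteratedFDeriv_const_of_ne (by omega)]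
      simp
  | succ k ih =>
    obtain ⟨ihc, ih⟩ := ih
    have e : ∀ a b, (fun ξ => (E ξ ^ (k + 1)) a b) = fun ξ => ∑ c, (E ξ ^ k) a c * E ξ c b :=
      fun a b => by
      ext ξ
      rw [pow_succ, Matrix.mul_apply]
    refine ⟨fun a b => ?_, fun i hi x hx a b => ?_⟩
    · rw [e]
      exact ContDiff.sum fun c _ => (ihc a c).mul (hE c b)
    rw [e, iteratedFDeriv_fun_sum_apply fun c _ =>
      (((ihc a c).mul (hE c b)).of_le (mod_cast le_top)).contDiffAt]
    have h2 : ∀ c, ‖iteratedFDeriv ℝ i (fun ξ => (E ξ ^ k) a c * E ξ c b) x‖ ≤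
        2 ^ n * S * ρ ^ k := by
      intro c
      refine (norm_iteratedFDeriv_mul_le (ihc a c) (hE c b) x (mod_cast le_top)).trans ?_
      calc _ ≤ ∑ j ∈ Finset.range (i + 1), (i.choose j : ℝ) * ρ ^ k * S := by
            refine Finset.sum_le_sum fun j hj => ?_
            have hj' := Finset.mem_range.1 hj
            gcongr
            · exact ih j (by omega) x hx a c
            · exact hBS (i - j) (by omega) c b x hx
        _ = 2 ^ i * S * ρ ^ k := by
            rw [← Finset.sum_mul, ← Finset.sum_mul, ← Nat.cast_sum, Nat.sum_range_choose]
            push_cast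
            ring
        _ ≤ _ := by
            gcongr
            norm_num
    refine (norm_sum_le_of_le _ fun c _ => h2 c).trans ?_
    rw [Finset.sum_const, Finset.card_univ, nsmul_eq_mul, pow_succ, hρ]
    exact le_of_eq (by ring)

lemma exists_schwartz_mul_pow {E : Space d → Matrix ι ι ℂ}
    (hE : ∀ a b, ContDiff ℝ (⊤ : ℕ∞) fun ξ => E ξ a b) {ψ : Space d → ℂ}
    (hψ : ContDiff ℝ (⊤ : ℕ∞) ψ) (hc : HasCompactSupport ψ) :
    ∃ H : ℕ → ι → ι → 𝓢(Space d, ℂ), (∀ k a b ξ, H k a b ξ = ψ ξ * (E ξ ^ k) a b) ∧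
      ∀ l n : ℕ, ∃ C ρ : ℝ, 0 ≤ C ∧ 0 ≤ ρ ∧ ∀ k a b,
        SchwartzMap.seminorm ℂ l n (H k a b) ≤ C * ρ ^ k := by
  have hcd : ∀ k a b, ContDiff ℝ (⊤ : ℕ∞) fun ξ => (E ξ ^ k) a b := fun k =>
    ((exists_iteratedFDeriv_pow_le hE hc 0).choose_spec.2 k).1
  refine ⟨fun k a b => (hc.mul_right (f' := fun ξ => (E ξ ^ k) a b)).toSchwartzMap
    (hψ.mul (hcd k a b)), fun k a b ξ => rfl, fun l n => ?_⟩
  obtain ⟨ρ, hρ, h⟩ := exists_iteratedFDeriv_pow_le hE hc n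
  obtain ⟨R, hR⟩ := hc.isBounded.exists_norm_le
  have h1 : ∀ i : ℕ, ∃ B : ℝ, ∀ x ∈ tsupport ψ, ‖iteratedFDeriv ℝ i ψ x‖ ≤ B := fun i =>
    IsCompact.exists_bound_of_continuousOn hc
      (hψ.continuous_iteratedFDeriv (mod_cast le_top)).continuousOn
  choose B hB using h1
  set S : ℝ := ∑ j ∈ Finset.range (n + 1), (n.choose j : ℝ) * |B j| with hS
  refine ⟨|R| ^ l * S, ρ, by positivity, hρ, fun k a b => ?_⟩
  refine SchwartzMap.seminorm_le_bound ℂ l n _ (by positivity) fun x => ?_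
  by_cases hx : x ∈ tsupport ψ
  · have h2 : ‖iteratedFDeriv ℝ n (fun ξ => ψ ξ * (E ξ ^ k) a b) x‖ ≤ S * ρ ^ k := by
      refine (norm_iteratedFDeriv_mul_le hψ (hcd k a b) x (mod_cast le_top)).trans ?_
      rw [hS, Finset.sum_mul]
      refine Finset.sum_le_sum fun j hj => ?_
      gcongr
      · exact (hB j x hx).trans (le_abs_self _)
      · exact (h k).2 _ (by omega) x hx a b
    calc _ ≤ |R| ^ l * (S * ρ ^ k) := by
          gcongr
          · exact (hR x hx).trans (le_abs_self _)
          · exact h2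
      _ = _ := by ring
  · have h3 : x ∉ tsupport (iteratedFDeriv ℝ n fun ξ => ψ ξ * (E ξ ^ k) a b) := fun h =>
      hx ((tsupport_mul_subset_left (tsupport_iteratedFDeriv_subset n h)))
    have h4 := image_eq_zero_of_notMem_tsupport h3
    change ‖x‖ ^ l * ‖iteratedFDeriv ℝ n (fun ξ => ψ ξ * (E ξ ^ k) a b) x‖ ≤ _
    rw [h4, norm_zero, mul_zero]
    positivity

/-- Geometric growth in `k` is beaten by `√k!`, so the normalised powers are bounded in every
Schwartz seminorm; this is the input of the uniform boundedness argument. -/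
lemma exists_schwartz_mul_pow_normalized {E : Space d → Matrix ι ι ℂ}
    (hE : ∀ a b, ContDiff ℝ (⊤ : ℕ∞) fun ξ => E ξ a b) {ψ : Space d → ℂ}
    (hψ : ContDiff ℝ (⊤ : ℕ∞) ψ) (hc : HasCompactSupport ψ) :
    ∃ H : ℕ → ι → ι → 𝓢(Space d, ℂ),
      (∀ k a b ξ, H k a b ξ = ((√(k.factorial : ℝ) : ℝ) : ℂ)⁻¹ * (ψ ξ * (E ξ ^ k) a b)) ∧
      ∀ a b, ∀ l n : ℕ, ∃ C : ℝ, ∀ k, SchwartzMap.seminorm ℂ l n (H k a b) ≤ C := by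
  obtain ⟨H, hH, hb⟩ := exists_schwartz_mul_pow hE hψ hc
  refine ⟨fun k a b => ((√(k.factorial : ℝ) : ℝ) : ℂ)⁻¹ • H k a b, fun k a b ξ => ?_,
    fun a b l n => ?_⟩
  · rw [← hH]
    rfl
  · obtain ⟨C, ρ, hC, hρ, h⟩ := hb l n
    refine ⟨C * Real.exp (ρ ^ 2), fun k => ?_⟩
    rw [map_smul_eq_mul, norm_inv, Complex.norm_real, Real.norm_of_nonneg (by positivity)]
    calc _ ≤ (√(k.factorial : ℝ))⁻¹ * (C * ρ ^ k) := by
          gcongr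
          exact h k a b
      _ = C * (ρ ^ k / √(k.factorial : ℝ)) := by
          rw [div_eq_mul_inv]
          ring
      _ ≤ _ := by
          gcongr
          exact pow_div_sqrt_factorial_le ρ k

/-- Taylor's formula read backwards from `t`. The derivative of `∑_{k<n} (τ-t)^k/k! · G_k(τ)`
telescopes to its last term; at `τ = t` the sum is `G_0(t)`, at `τ = 0` it is a partial sum of the
series. The remainder is of order `t^n √((n+1)!)/n!`, which tends to zero. -/
lemma hasSum_of_hasDerivWithinAt {G : ℕ → ℝ → ℂ} {t C : ℝ} (ht : 0 ≤ t)
    (hG : ∀ k, ∀ τ ∈ Set.Icc 0 t, HasDerivWithinAt (G k) (-(G (k + 1) τ)) (Set.Ici 0) τ)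
    (hb : ∀ k, ∀ τ ∈ Set.Icc 0 t, ‖G k τ‖ ≤ C * √(k.factorial : ℝ)) (h : Summable fun k : ℕ =>
      ‖(-t : ℂ) ^ k / (k.factorial : ℂ) * G k 0‖) :
    HasSum (fun k : ℕ => (-t : ℂ) ^ k / (k.factorial : ℂ) * G k 0) (G 0 t) := by
  set P : ℕ → ℝ → ℂ := fun n τ => ∑ k ∈ Finset.range n,
    ((τ - t : ℝ) : ℂ) ^ k / (k.factorial : ℂ) * G k τ with hP
  have hPd : ∀ n, ∀ τ ∈ Set.Icc 0 t, HasDerivWithinAt (P (n + 1))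
      (-(((τ - t : ℝ) : ℂ) ^ n / (n.factorial : ℂ) * G (n + 1) τ)) (Set.Ici 0) τ := by
    intro n τ hτ
    have hl : ∀ k : ℕ, HasDerivWithinAt (fun τ : ℝ => ((τ - t : ℝ) : ℂ) ^ (k + 1) /
        ((k + 1).factorial : ℂ)) (((τ - t : ℝ) : ℂ) ^ k / (k.factorial : ℂ)) (Set.Ici 0) τ := by
      intro k
      have h1 : HasDerivAt (fun τ : ℝ => ((τ - t : ℝ) : ℂ)) 1 τ :=
        ((hasDerivAt_id τ).sub_const t).ofReal_comp
      have h2 := ((h1.pow (k + 1)).div_const ((k + 1).factorial : ℂ)).hasDerivWithinAt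
        (s := Set.Ici 0)
      convert! h2 using 1
      have : (k.factorial : ℂ) ≠ 0 := by exact_mod_cast k.factorial_ne_zero
      have h3 : ((k : ℂ) + 1) ≠ 0 := by exact_mod_cast k.succ_ne_zero
      rw [Nat.factorial_succ]
      push_cast
      field_simp
    induction n with
    | zero =>
      have e : P 1 = G 0 := by
        ext τ
        simp [hP]
      rw [zero_add, e]
      simpa using hG 0 τ hτ
    | succ n ih =>
      have e : P (n + 1 + 1) = fun τ => P (n + 1) τ +
          ((τ - t : ℝ) : ℂ) ^ (n + 1) / ((n + 1).factorial : ℂ) * G (n + 1) τ := by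
        ext τ
        rw [hP]
        exact Finset.sum_range_succ _ _
      rw [e]
      have := ih.add ((hl n).mul (hG (n + 1) τ hτ))
      convert! this using 1
      ring
  have hbd : ∀ n, ‖P (n + 1) t - P (n + 1) 0‖ ≤
      C * (n + 1) * t * Real.exp ((2 * t) ^ 2) * (1 / 2 : ℝ) ^ n := by
    intro n
    have hle : ∀ τ ∈ Set.Ico 0 t, ‖-(((τ - t : ℝ) : ℂ) ^ n / (n.factorial : ℂ) * G (n + 1) τ)‖ ≤
        C * (n + 1) * Real.exp ((2 * t) ^ 2) * (1 / 2 : ℝ) ^ n := by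
      intro τ hτ
      have hC : 0 ≤ C := by
        have := (norm_nonneg _).trans (hb 0 τ (Set.Ico_subset_Icc_self hτ))
        simpa using this
      rw [norm_neg, norm_mul, norm_div, norm_pow, Complex.norm_real, Complex.norm_natCast]
      have h1 : ‖τ - t‖ ≤ t := by
        rw [Real.norm_eq_abs, abs_le]
        constructor <;> linarith [hτ.1, hτ.2]
      have h2 := pow_div_sqrt_factorial_le (2 * t) n
      have hs : √(n.factorial : ℝ) * √(n.factorial : ℝ) = n.factorial :=
        Real.mul_self_sqrt (by positivity)
      have hs0 : 0 < √(n.factorial : ℝ) := Real.sqrt_pos.2 (by positivity)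
      have h3 : √((n + 1).factorial : ℝ) ≤ (n + 1) * √(n.factorial : ℝ) := by
        rw [Nat.factorial_succ]
        push_cast
        rw [Real.sqrt_mul (by positivity)]
        gcongr
        rw [Real.sqrt_le_left (by positivity)]
        have : (0 : ℝ) ≤ n := by positivity
        nlinarith
      calc _ ≤ t ^ n / (n.factorial : ℝ) * (C * ((n + 1) * √(n.factorial : ℝ))) := by
            gcongr
            exact (hb (n + 1) τ (Set.Ico_subset_Icc_self hτ)).trans (by gcongr)
        _ = C * (n + 1) * ((2 * t) ^ n / √(n.factorial : ℝ)) * (1 / 2 : ℝ) ^ n := by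
            generalize √(n.factorial : ℝ) = s at hs hs0
            rw [← hs, mul_pow, one_div, inv_pow]
            field_simp
        _ ≤ _ := by gcongr
    have := norm_image_sub_le_of_norm_deriv_le_segment' (f := P (n + 1)) (a := 0) (b := t)
      (fun τ hτ => (hPd n τ hτ).mono Set.Icc_subset_Ici_self) hle t ⟨ht, le_rfl⟩
    refine this.trans (le_of_eq ?_)
    ring
  have hPt : ∀ n, P (n + 1) t = G 0 t := by
    intro n
    simp only [hP]
    rw [Finset.sum_range_succ']
    simp
  have hP0 : ∀ n, P n 0 = ∑ k ∈ Finset.range n, (-t : ℂ) ^ k / (k.factorial : ℂ) * G k 0 := by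
    intro n
    simp [hP]
  refine (Summable.of_norm h).hasSum_iff_tendsto_nat.2 ?_
  rw [← tendsto_add_atTop_iff_nat 1, tendsto_iff_norm_sub_tendsto_zero]
  have hlim : Tendsto (fun n : ℕ => C * (n + 1) * t * Real.exp ((2 * t) ^ 2) * (1 / 2 : ℝ) ^ n)
      atTop (𝓝 0) := by
    have h1 := tendsto_self_mul_const_pow_of_lt_one (r := 1 / 2) (by norm_num) (by norm_num)
    have h2 := tendsto_pow_atTop_nhds_zero_of_lt_one (r := (1 / 2 : ℝ)) (by norm_num) (by norm_num)
    have h3 := (h1.add h2).const_mul (C * t * Real.exp ((2 * t) ^ 2))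
    rw [add_zero, mul_zero] at h3
    refine h3.congr fun n => ?_
    ring
  refine squeeze_zero (fun n => norm_nonneg _) (fun n => ?_) hlim
  rw [← hP0, ← hPt n, norm_sub_rev]
  exact hbd n

lemma summable_pow_div_sqrt_factorial (t : ℝ) :
    Summable fun k : ℕ => |t| ^ k / √(k.factorial : ℝ) := by
  refine Summable.of_nonneg_of_le (fun k => by positivity) (fun k => ?_)
    (summable_geometric_two.mul_left (Real.exp ((2 * |t|) ^ 2)))
  have h2 := pow_div_sqrt_factorial_le (2 * |t|) k
  calc _ = (2 * |t|) ^ k / √(k.factorial : ℝ) * (1 / 2 : ℝ) ^ k := by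
        rw [mul_pow, one_div, inv_pow]
        field_simp
    _ ≤ _ := by gcongr

lemma ofReal_sqrt_factorial_ne_zero (k : ℕ) : ((√(k.factorial : ℝ) : ℝ) : ℂ) ≠ 0 := by
  have : (0 : ℝ) < √(k.factorial : ℝ) := Real.sqrt_pos.2 (by positivity)
  exact_mod_cast this.ne'

lemma norm_pow_div_factorial_mul_sqrt (t : ℝ) (k : ℕ) :
    ‖(-t : ℂ) ^ k / (k.factorial : ℂ) * ((√(k.factorial : ℝ) : ℝ) : ℂ)‖ =
      |t| ^ k / √(k.factorial : ℝ) := by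
  have hs : √(k.factorial : ℝ) * √(k.factorial : ℝ) = k.factorial :=
    Real.mul_self_sqrt (by positivity)
  have hs0 : 0 < √(k.factorial : ℝ) := Real.sqrt_pos.2 (by positivity)
  rw [norm_mul, norm_div, norm_pow, norm_neg, Complex.norm_real, Complex.norm_real,
    Complex.norm_natCast, Real.norm_eq_abs, Real.norm_of_nonneg hs0.le]
  generalize √(k.factorial : ℝ) = s at hs hs0
  rw [← hs]
  field_simp

/-- The test function against which `multiplier m u` is evaluated. -/
lemma multiplier_apply (m : Space d → ℂ) (u : TDist d) (φ : 𝓢(Space d, ℂ)) :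
    multiplier m u φ = u (𝓕 (SchwartzMap.smulLeftCLM ℂ (fun ξ : Space d => m ((2 * Real.pi) • ξ))
      (𝓕⁻ φ : 𝓢(Space d, ℂ)))) := rfl

omit [DecidableEq ι] in
lemma matMul_apply {κ : Type*} (M : Space d → Matrix κ ι ℂ) (u : ι → TDist d) (a : κ)
    (φ : 𝓢(Space d, ℂ)) :
    matMul M u a φ = ∑ b, multiplier (fun ξ => M ξ a b) (u b) φ := by
  have : ∀ s : Finset ι, (∑ b ∈ s, multiplier (fun ξ => M ξ a b) (u b)) φ =
      ∑ b ∈ s, multiplier (fun ξ => M ξ a b) (u b) φ := fun s =>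
    map_sum (PointwiseConvergenceCLM.evalCLM (RingHom.id ℂ) ℂ φ) _ s
  exact this _

/-- Every distributional solution is given by the symbol formula after a compact frequency cut-off;
uniqueness is contained in this. The functions `ψ(D) E(D)^k U` are the successive time derivatives
up to sign, and the lemma on Taylor series applies once they are `O(√k!)` uniformly on `[0, t]`. -/
theorem multiplier_eq_matMul_exp {E : Space d → Matrix ι ι ℂ} (hE : TemperateMatrix E)
    {U : ℝ → ι → TDist d}
    (hU : ∀ t, 0 ≤ t → ∀ a φ,
      HasDerivWithinAt (fun τ => U τ a φ) (-(matMul E (U t) a φ)) (Set.Ici 0) t)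
    {ψ : Space d → ℂ} (hψ : ContDiff ℝ (⊤ : ℕ∞) ψ) (hc : HasCompactSupport ψ) {t : ℝ} (ht : 0 ≤ t)
    (a : ι) :
    multiplier ψ (U t a) =
      matMul (fun ξ => ψ ξ • NormedSpace.exp (-((t : ℂ) • E ξ))) (U 0) a := by
  have hpi : (2 * Real.pi) ≠ 0 := by positivity
  have hψ' : ContDiff ℝ (⊤ : ℕ∞) fun ξ : Space d => ψ ((2 * Real.pi) • ξ) :=
    hψ.comp (contDiff_const_smul _)
  have hc' : HasCompactSupport fun ξ : Space d => ψ ((2 * Real.pi) • ξ) :=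
    hc.comp_homeomorph (Homeomorph.smulOfNeZero (2 * Real.pi) hpi)
  obtain ⟨H, hH, hb⟩ := exists_schwartz_mul_pow_normalized
    (E := fun ξ : Space d => E ((2 * Real.pi) • ξ))
    (fun a b => (hE a b).1.comp (contDiff_const_smul _)) hψ' hc'
  have hψt : ψ.HasTemperateGrowth := by
    have := (hc.toSchwartzMap hψ).hasTemperateGrowth
    exact this
  have hpow : ∀ k, TemperateMatrix fun ξ => E ξ ^ k := by
    intro k
    induction k with
    | zero => exact .const 1
    | succ k ih => simpa only [pow_succ] using ih.mul hE
  set G : ℕ → 𝓢(Space d, ℂ) → ℝ → ℂ := fun k φ τ =>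
    matMul (fun ξ => ψ ξ • E ξ ^ k) (U τ) a φ with hG
  have hGd : ∀ k φ τ, 0 ≤ τ → HasDerivWithinAt (G k φ) (-(G (k + 1) φ τ)) (Set.Ici 0) τ := by
    intro k φ τ hτ
    have e : G (k + 1) φ τ = matMul (fun ξ => ψ ξ • E ξ ^ k) (matMul E (U τ)) a φ := by
      rw [matMul_matMul (TemperateMatrix.smul hψt (hpow k)) hE]
      simp only [hG, Matrix.smul_mul, pow_succ]
    rw [e, hG]
    simp only [matMul_apply (fun ξ => ψ ξ • E ξ ^ k), multiplier_apply, ← Finset.sum_neg_distrib]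
    exact HasDerivWithinAt.fun_sum fun b _ => hU τ hτ b _
  ext φ
  set g : 𝓢(Space d, ℂ) := 𝓕⁻ φ with hg
  have hgt : (g : Space d → ℂ).HasTemperateGrowth := g.hasTemperateGrowth
  -- The fixed test function is absorbed into the functional `W`, so that the cut-off symbols `H k a
  -- b` themselves play the role of test functions.
  let L : 𝓢(Space d, ℂ) →L[ℂ] 𝓢(Space d, ℂ) :=
    (FourierTransform.fourierCLM ℂ 𝓢(Space d, ℂ)).comp (SchwartzMap.smulLeftCLM ℂ g)
  let W : ℝ → ι → 𝓢(Space d, ℂ) →L[ℂ] ℂ := fun τ b =>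
    ContinuousLinearMap.comp (show 𝓢(Space d, ℂ) →L[ℂ] ℂ from U τ b) L
  have hW : ∀ τ b (R : 𝓢(Space d, ℂ)) (m : Space d → ℂ),
      (∀ ξ, R ξ = m ((2 * Real.pi) • ξ)) → multiplier m (U τ b) φ = W τ b R := by
    intro τ b R m hR
    rw [multiplier_apply]
    change U τ b _ = U τ b (𝓕 (SchwartzMap.smulLeftCLM ℂ g R))
    congr 2
    have hm : (fun ξ : Space d => m ((2 * Real.pi) • ξ)) = R := by
      ext ξ
      exact (hR ξ).symm
    rw [hm]
    ext ξ
    rw [SchwartzMap.smulLeftCLM_apply_apply R.hasTemperateGrowth,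
      SchwartzMap.smulLeftCLM_apply_apply hgt, smul_eq_mul, smul_eq_mul, mul_comm]
  have hGW : ∀ k τ, G k φ τ = ((√(k.factorial : ℝ) : ℝ) : ℂ) * ∑ b, W τ b (H k a b) := by
    intro k τ
    simp only [hG]
    rw [matMul_apply, Finset.mul_sum]
    refine Finset.sum_congr rfl fun b _ => ?_
    rw [hW τ b (((√(k.factorial : ℝ) : ℝ) : ℂ) • H k a b) _ fun ξ => ?_, map_smul, smul_eq_mul]
    change _ * H k a b ξ = _
    rw [hH, mul_inv_cancel_left₀ (ofReal_sqrt_factorial_ne_zero k)]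
    rfl
  -- For each fixed test function the pairing is continuous on `[0, t]`, hence bounded; the uniform
  -- boundedness principle makes the bound uniform along the bounded sequence `H k a b`.
  have hbd : ∀ b, ∃ C, ∀ (τ : Set.Icc 0 t) k, ‖W τ b (H k a b)‖ ≤ C := by
    intro b
    refine exists_norm_apply_le (fun τ : Set.Icc 0 t => W τ b) (fun η => ?_) (hb a b)
    have hcont : ContinuousOn (fun τ => W τ b η) (Set.Icc 0 t) := fun τ hτ =>
      ((hU τ hτ.1 b (L η)).continuousWithinAt).mono Set.Icc_subset_Ici_self
    obtain ⟨C, hC⟩ := isCompact_Icc.exists_bound_of_continuousOn hcont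
    exact ⟨C, fun τ => hC τ τ.2⟩
  choose C hC using hbd
  have hGb : ∀ k, ∀ τ ∈ Set.Icc 0 t, ‖G k φ τ‖ ≤ (∑ b, C b) * √(k.factorial : ℝ) := by
    intro k τ hτ
    rw [hGW, norm_mul, Complex.norm_real, Real.norm_of_nonneg (Real.sqrt_nonneg _), mul_comm]
    gcongr
    exact norm_sum_le_of_le _ fun b _ => hC b ⟨τ, hτ⟩ k
  have hsum : Summable fun k : ℕ => ‖(-t : ℂ) ^ k / (k.factorial : ℂ) * G k φ 0‖ := by
    refine Summable.of_nonneg_of_le (fun k => norm_nonneg _) (fun k => ?_)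
      ((summable_pow_div_sqrt_factorial t).mul_right (∑ b, C b))
    rw [hGW, ← mul_assoc, norm_mul, norm_pow_div_factorial_mul_sqrt]
    gcongr
    exact norm_sum_le_of_le _ fun b _ => hC b ⟨0, le_rfl, ht⟩ k
  have key := hasSum_of_hasDerivWithinAt (G := fun k => G k φ) ht
    (fun k τ hτ => hGd k φ τ hτ.1) hGb hsum
  have e0 : G 0 φ t = multiplier ψ (U t a) φ := by
    have h1 := matMul_multiplier hψt (.const (1 : Matrix ι ι ℂ)) (U t)
    rw [matMul_one] at h1
    have h2 := congrFun h1 a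
    simp only [hG, pow_zero]
    rw [h2]
  rw [← e0, matMul_apply]
  refine key.unique ?_
  have hQ : TemperateMatrix fun ξ => -((t : ℂ) • E ξ) := by
    have := TemperateMatrix.smul (.const (-(t : ℂ))) hE
    simpa using this
  have hR : ∀ b, ContDiff ℝ (⊤ : ℕ∞) fun ξ : Space d =>
      NormedSpace.exp (-((t : ℂ) • E ((2 * Real.pi) • ξ))) a b := fun b =>
    (TemperateMatrix.contDiff_exp hQ a b).comp (contDiff_const_smul (2 * Real.pi))
  have hs : ∀ b, HasSum (fun k : ℕ => (-t : ℂ) ^ k / (k.factorial : ℂ) *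
      ((√(k.factorial : ℝ) : ℝ) : ℂ) * W 0 b (H k a b))
      (multiplier (fun ξ => (ψ ξ • NormedSpace.exp (-((t : ℂ) • E ξ))) a b) (U 0 b) φ) := by
    intro b
    rw [hW 0 b ((hc'.mul_right (f' := fun ξ : Space d =>
      NormedSpace.exp (-((t : ℂ) • E ((2 * Real.pi) • ξ))) a b)).toSchwartzMap
      (hψ'.mul (hR b))) _ fun ξ => rfl]
    refine hasSum_apply_schwartz (W 0 b) (hb a b) ?_ fun ξ => ?_
    · simp only [norm_pow_div_factorial_mul_sqrt]
      exact summable_pow_div_sqrt_factorial t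
    · refine ((hasSum_exp_entry (-((t : ℂ) • E ((2 * Real.pi) • ξ))) a b).mul_left
        (ψ ((2 * Real.pi) • ξ))).congr_fun fun k => ?_
      have h0 := ofReal_sqrt_factorial_ne_zero k
      rw [hH, ← neg_smul, smul_pow, Matrix.smul_apply, smul_eq_mul, mul_assoc,
        mul_inv_cancel_left₀ h0]
      ring
  refine (hasSum_sum fun b _ => hs b).congr_fun fun k => ?_
  rw [hGW, ← mul_assoc, Finset.mul_sum]

theorem IsSolution.multiplier_eq {n₁ n₂ : ℕ}
    {A : Fin d → Matrix (Fin n₁ ⊕ Fin n₂) (Fin n₁ ⊕ Fin n₂) ℝ} {D : Matrix (Fin n₂) (Fin n₂) ℝ}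
    {V₀ : Fin n₁ ⊕ Fin n₂ → TDist d} {V : ℝ → Fin n₁ ⊕ Fin n₂ → TDist d}
    (hV : IsSolution A D V₀ V) {ψ : Space d → ℂ} (hψ : ContDiff ℝ (⊤ : ℕ∞) ψ)
    (hc : HasCompactSupport ψ) {t : ℝ} (ht : 0 ≤ t) :
    (fun a => multiplier ψ (V t a)) =
      matMul (fun ξ => ψ ξ • NormedSpace.exp (-((t : ℂ) • fullSymbol A D ξ))) V₀ := by
  ext1 a
  rw [← hV.initial]
  refine multiplier_eq_matMul_exp fullSymbol_temperate (fun τ hτ b φ => ?_) hψ hc ht a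
  rw [← spatialOp_eq]
  exact hV.equation τ hτ b φ

end LocalRepresentation

/-! ### `L²` bounds and scaled symbols -/

section MultiplierBounds

open scoped FourierTransform

variable {d : ℕ} {p : ℝ≥0∞} [hp : Fact (1 ≤ p)] {ι κ : Type*} [Fintype ι] [Fintype κ]

/-- Plancherel: in `L²` only the supremum of the symbol matters. Hence high frequencies need just
pointwise bounds on the symbol. -/
lemma distLpNorm_two_multiplier_le {m : Space d → ℂ} (hm : m.HasTemperateGrowth) {K : ℝ}
    (hK0 : 0 < K) (hK : ∀ ξ, ‖m ξ‖ ≤ K) (u : TDist d) :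
    distLpNorm 2 (multiplier m u) ≤ ENNReal.ofReal K * distLpNorm 2 u := by
  by_cases htop : distLpNorm 2 u = ⊤
  · rw [htop, ENNReal.mul_top (ENNReal.ofReal_pos.2 hK0).ne']
    exact le_top
  obtain ⟨f, rfl⟩ := exists_toTD_of_distLpNorm_lt_top (lt_top_iff_ne_top.2 htop)
  set m' : Space d → ℂ := fun ξ => m ((2 * Real.pi) • ξ) with hm'
  have hmt : m'.HasTemperateGrowth := hasTemperateGrowth_comp_smul hm _
  have hmb : ∀ᵐ ξ : Space d, ‖m' ξ‖ ≤ K := .of_forall fun ξ => hK _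
  have hmm : MemLp m' ⊤ volume :=
    memLp_top_of_bound hmt.1.continuous.aestronglyMeasurable K hmb
  set g : Lp ℂ 2 (volume : Measure (Space d)) := (hmm.toLp m') • 𝓕 f with hg
  have e : multiplier m (toTD f) = toTD (𝓕⁻ g) := by
    rw [multiplier, TemperedDistribution.fourierMultiplierCLM_apply, toTD, toTD,
      ← Lp.fourierInv_toTemperedDistribution_eq, Lp.fourier_toTemperedDistribution_eq, hg,
      Lp.toTemperedDistribution_smul_eq hmt hmm]
  have h1 : ‖hmm.toLp m'‖ ≤ K := by
    rw [Lp.norm_toLp]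
    refine ENNReal.toReal_le_of_le_ofReal hK0.le ?_
    rw [eLpNorm_exponent_top]
    exact eLpNormEssSup_le_of_ae_bound hmb
  have h2 : ‖g‖ ≤ K * ‖f‖ := by
    refine (Lp.norm_smul_le _ _).trans ?_
    rw [Lp.norm_fourier_eq]
    gcongr
  have h3 : ‖(𝓕⁻ g : Lp ℂ 2 (volume : Measure (Space d)))‖ = ‖g‖ := by
    rw [← Lp.norm_fourier_eq, FourierTransform.fourier_fourierInv_eq]
  rw [e, distLpNorm_toTD, distLpNorm_toTD, ← ofReal_norm, ← ofReal_norm, h3,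
    ← ENNReal.ofReal_mul hK0.le]
  exact ENNReal.ofReal_le_ofReal h2

lemma vecNorm_matMul_le_of_entry {M : Space d → Matrix ι κ ℂ} {K : ℝ≥0∞} {u : κ → TDist d}
    (h : ∀ a b, distLpNorm p (multiplier (fun ξ => M ξ a b) (u b)) ≤ K * distLpNorm p (u b)) :
    vecNorm p (matMul M u) ≤ Fintype.card ι * K * vecNorm p u := by
  calc _ ≤ ∑ _a : ι, ∑ b, K * distLpNorm p (u b) :=
        Finset.sum_le_sum fun a _ => (distLpNorm_sum_le _ _).trans
          (Finset.sum_le_sum fun b _ => h a b)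
    _ = _ := by
        rw [Finset.sum_const, Finset.card_univ, nsmul_eq_mul, ← Finset.mul_sum, vecNorm, mul_assoc]

lemma vecNorm_two_matMul_le {M : Space d → Matrix ι κ ℂ} (hM : TemperateMatrix M) {K : ℝ}
    (hK0 : 0 < K) (hK : ∀ ξ a b, ‖M ξ a b‖ ≤ K) (u : κ → TDist d) :
    vecNorm 2 (matMul M u) ≤ Fintype.card ι * ENNReal.ofReal K * vecNorm 2 u :=
  vecNorm_matMul_le_of_entry fun a b =>
    distLpNorm_two_multiplier_le (hM a b) hK0 (fun ξ => hK ξ a b) (u b)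

end MultiplierBounds

/-! ### Dyadic blocks -/

section Blocks

variable {d : ℕ} {χ : Space d → ℝ} {p : ℝ≥0∞} [hp : Fact (1 ≤ p)]
  {ι κ : Type*} [Fintype ι] [Fintype κ]

lemma IsSymbol.comp_smul {F : Type*} [NormedAddCommGroup F] [NormedSpace ℝ F]
    {m : Space d → F} (hm : IsSymbol m) {a : ℝ} (ha : a ≠ 0) : IsSymbol fun ξ => m (a • ξ) := by
  obtain ⟨h, c, R, hR⟩ := hm
  refine ⟨h.comp (contDiff_const_smul a), c, R / |a|, fun ξ hξ => hR _ ?_⟩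
  rw [norm_smul, Real.norm_eq_abs, mul_comm]
  exact (div_le_iff₀ (abs_pos.2 ha)).1 hξ

lemma IsCutoff.eq_zero (hχ : IsCutoff χ) {ξ : Space d} (hξ : 4 / 3 ≤ ‖ξ‖) : χ ξ = 0 := by
  refine image_eq_zero_of_notMem_tsupport fun h => ?_
  have := hχ.tsupport_subset h
  rw [mem_ball_zero_iff] at this
  linarith

lemma IsCutoff.one (hχ : IsCutoff χ) {ξ : Space d} (hξ : ‖ξ‖ < 3 / 4) : χ ξ = 1 :=
  hχ.eq_one ξ (by rwa [mem_ball_zero_iff])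

lemma IsCutoff.nonneg (hχ : IsCutoff χ) (ξ : Space d) : 0 ≤ χ ξ := by
  rcases lt_or_ge ‖ξ‖ (4 / 3) with hd | hd
  · rcases eq_or_ne ξ 0 with rfl | hx
    · rw [hχ.one (by simp)]
      norm_num
    -- The comparison point on the sphere of radius `4/3` lies on the ray through `ξ`, where the
    -- cut-off already vanishes.
    · have hn : ‖((4 / 3) / ‖ξ‖) • ξ‖ = 4 / 3 := by
        rw [norm_smul, Real.norm_of_nonneg (by positivity),
          div_mul_cancel₀ _ (norm_ne_zero_iff.2 hx)]
      rw [← hχ.eq_zero (ξ := ((4 / 3) / ‖ξ‖) • ξ) hn.ge]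
      exact hχ.radial_noninc _ _ (hd.le.trans hn.ge)
  · rw [hχ.eq_zero hd]

lemma IsCutoff.isSymbol_real (hχ : IsCutoff χ) : IsSymbol χ :=
  ⟨hχ.smooth, 0, 4 / 3, fun _ hξ => hχ.eq_zero hξ⟩

lemma IsSymbol.ofReal {m : Space d → ℝ} (hm : IsSymbol m) : IsSymbol fun ξ => ((m ξ : ℝ) : ℂ) :=
  hm.comp_contDiffAt (g := fun x : ℝ => (x : ℂ)) fun _ =>
    Complex.ofRealCLM.contDiff.contDiffAt

lemma IsCutoff.isSymbol (hχ : IsCutoff χ) : IsSymbol fun ξ => ((χ ξ : ℝ) : ℂ) :=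
  hχ.isSymbol_real.ofReal

lemma IsSymbol.sub {F : Type*} [NormedAddCommGroup F] [NormedSpace ℝ F] {m m' : Space d → F}
    (hm : IsSymbol m) (hm' : IsSymbol m') : IsSymbol fun ξ => m ξ - m' ξ :=
  (hm.prodMk hm').comp_contDiffAt (g := fun z => z.1 - z.2) fun _ =>
    (contDiff_fst.sub contDiff_snd).contDiffAt

lemma IsCutoff.isSymbol_annulusBump (hχ : IsCutoff χ) : IsSymbol (annulusBump χ) :=
  (hχ.isSymbol_real.comp_smul (by norm_num)).sub hχ.isSymbol_real

lemma IsCutoff.norm_of_annulusBump_ne_zero (hχ : IsCutoff χ) {ξ : Space d}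
    (h : annulusBump χ ξ ≠ 0) : 3 / 4 ≤ ‖ξ‖ ∧ ‖ξ‖ ≤ 8 / 3 := by
  by_contra hc
  rw [not_and_or, not_le, not_le] at hc
  refine h ?_
  have hn : ‖(1 / 2 : ℝ) • ξ‖ = ‖ξ‖ / 2 := by
    rw [norm_smul]
    norm_num
    ring
  rcases hc with hc | hc
  · rw [annulusBump, hχ.one hc, hχ.one (by rw [hn]; linarith [norm_nonneg ξ]), sub_self]
  · rw [annulusBump, hχ.eq_zero (by rw [hn]; linarith), hχ.eq_zero (by linarith), sub_self]

/-- A wider annular bump, equal to one on the support of `annulusBump χ`. -/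
def wideBump (χ : Space d → ℝ) (ξ : Space d) : ℝ := χ ((1 / 4 : ℝ) • ξ) - χ ((2 : ℝ) • ξ)

lemma IsCutoff.isSymbol_wideBump (hχ : IsCutoff χ) : IsSymbol (wideBump χ) :=
  (hχ.isSymbol_real.comp_smul (by norm_num)).sub (hχ.isSymbol_real.comp_smul (by norm_num))

lemma IsCutoff.wideBump_eq_one (hχ : IsCutoff χ) {ξ : Space d} (h : annulusBump χ ξ ≠ 0) :
    wideBump χ ξ = 1 := by
  obtain ⟨h1, h2⟩ := hχ.norm_of_annulusBump_ne_zero h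
  have e1 : ‖(1 / 4 : ℝ) • ξ‖ = ‖ξ‖ / 4 := by
    rw [norm_smul]
    norm_num
    ring
  have e2 : ‖(2 : ℝ) • ξ‖ = 2 * ‖ξ‖ := by
    rw [norm_smul]
    norm_num
  rw [wideBump, hχ.one (by rw [e1]; linarith), hχ.eq_zero (by rw [e2]; linarith), sub_zero]

lemma IsCutoff.wideBump_nonneg (hχ : IsCutoff χ) (ξ : Space d) : 0 ≤ wideBump χ ξ := by
  refine sub_nonneg.2 (hχ.radial_noninc _ _ ?_)
  rw [norm_smul, norm_smul]
  gcongr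
  norm_num

lemma IsCutoff.wideBump_le_one (hχ : IsCutoff χ) (ξ : Space d) : wideBump χ ξ ≤ 1 := by
  have h1 : χ ((1 / 4 : ℝ) • ξ) ≤ 1 := by
    rw [← hχ.one (ξ := 0) (by simp)]
    exact hχ.radial_noninc _ _ (by simp)
  have h2 := hχ.nonneg ((2 : ℝ) • ξ)
  rw [wideBump]
  linarith

lemma IsCutoff.norm_of_wideBump_ne_zero (hχ : IsCutoff χ) {ξ : Space d}
    (h : wideBump χ ξ ≠ 0) : 3 / 8 ≤ ‖ξ‖ ∧ ‖ξ‖ ≤ 16 / 3 := by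
  by_contra hc
  rw [not_and_or, not_le, not_le] at hc
  refine h ?_
  have e1 : ‖(1 / 4 : ℝ) • ξ‖ = ‖ξ‖ / 4 := by
    rw [norm_smul]
    norm_num
    ring
  have e2 : ‖(2 : ℝ) • ξ‖ = 2 * ‖ξ‖ := by
    rw [norm_smul]
    norm_num
  rcases hc with hc | hc
  · rw [wideBump, hχ.one (by rw [e1]; linarith [norm_nonneg ξ]), hχ.one (by rw [e2]; linarith),
      sub_self]
  · rw [wideBump, hχ.eq_zero (by rw [e1]; linarith), hχ.eq_zero (by rw [e2]; linarith), sub_self]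

/-- The dyadic blocks of the components of a vector. -/
def blockVec (χ : Space d → ℝ) (j : ℤ) (u : ι → TDist d) : ι → TDist d :=
  fun a => dyadicBlock χ j (u a)

/-- The dyadic blocks of the components of a vector, rescaled to unit frequency. -/
def scaledBlock (χ : Space d → ℝ) (j : ℤ) (u : ι → TDist d) : ι → TDist d :=
  fun a => multiplier (fun ξ => ((annulusBump χ ξ : ℝ) : ℂ))
    (dil ((2 : ℝ) ^ j) (zpow_ne_zero j two_ne_zero) (u a))

omit [Fintype ι] in
lemma scaledBlock_eq (hχ : IsCutoff χ) (j : ℤ) (u : ι → TDist d) :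
    scaledBlock χ j u =
      fun a => dil ((2 : ℝ) ^ j) (zpow_ne_zero j two_ne_zero) (blockVec χ j u a) := by
  ext1 a
  have h : (fun ξ : Space d => ((annulusBump χ ((2 : ℝ) ^ (-j) • ξ) : ℝ) : ℂ)).HasTemperateGrowth :=
    (hχ.isSymbol_annulusBump.ofReal.comp_smul (zpow_ne_zero _ two_ne_zero)).hasTemperateGrowth
  rw [blockVec, dyadicBlock, dil_multiplier h, scaledBlock]
  congr 1
  ext ξ
  rw [smul_smul, ← zpow_add₀ two_ne_zero, neg_add_cancel, zpow_zero, one_smul]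

lemma vecNorm_scaledBlock (hχ : IsCutoff χ) (j : ℤ) (u : ι → TDist d) :
    vecNorm p (scaledBlock χ j u) = dilFactor d p ((2 : ℝ) ^ j) * vecNorm p (blockVec χ j u) := by
  rw [scaledBlock_eq hχ, vecNorm_dil]

omit [Fintype ι] in
lemma scaledBlock_sub (j : ℤ) (u v : ι → TDist d) :
    scaledBlock χ j (u - v) = scaledBlock χ j u - scaledBlock χ j v := by
  ext1 a
  rw [scaledBlock, Pi.sub_apply, dil, map_sub, multiplier_map_sub]
  rfl

-- A scaled block contains the factor `annulusBump χ`, so the rescaled symbol may be replaced by any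
-- temperate symbol that agrees with it where this bump is nonzero. All regularisations rest on
-- this.
omit [Fintype ι] in
lemma scaledBlock_matMul (hχ : IsCutoff χ) {j : ℤ} {M M' : Space d → Matrix ι κ ℂ}
    (hM : TemperateMatrix M) (hM' : TemperateMatrix M')
    (h : ∀ ξ, annulusBump χ ξ ≠ 0 → M ((2 : ℝ) ^ j • ξ) = M' ξ) (u : κ → TDist d) :
    scaledBlock χ j (matMul M u) = matMul M' (scaledBlock χ j u) := by
  have hφ := hχ.isSymbol_annulusBump.ofReal.hasTemperateGrowth
  have h2 : TemperateMatrix fun ξ => M ((2 : ℝ) ^ j • ξ) := fun a b =>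
    hasTemperateGrowth_comp_smul (hM a b) _
  have e1 : scaledBlock χ j u = fun b => multiplier (fun ξ => ((annulusBump χ ξ : ℝ) : ℂ))
    (dil ((2 : ℝ) ^ j) (zpow_ne_zero j two_ne_zero) (u b)) := rfl
  rw [e1, matMul_multiplier hφ hM']
  ext1 a
  have h3 : dil ((2 : ℝ) ^ j) (zpow_ne_zero j two_ne_zero) (matMul M u a) =
      matMul (fun ξ => M ((2 : ℝ) ^ j • ξ))
        (fun i => dil ((2 : ℝ) ^ j) (zpow_ne_zero j two_ne_zero) (u i)) a := by
    rw [matMul, dil_sum, matMul]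
    exact Finset.sum_congr rfl fun b _ => dil_multiplier (hM a b) _ _ _
  rw [scaledBlock, h3, multiplier_matMul hφ h2]
  congr 1
  ext ξ : 1
  by_cases hξ : annulusBump χ ξ = 0
  · simp [hξ]
  · rw [h ξ hξ]

end Blocks

/-! ### The regularised symbols on a dyadic annulus -/

section RegularisedSymbols

open scoped Matrix

variable {d n₁ n₂ : ℕ} {χ : Space d → ℝ} {A : Fin d → Matrix (Fin n₁ ⊕ Fin n₂) (Fin n₁ ⊕ Fin n₂) ℝ}
  {D : Matrix (Fin n₂) (Fin n₂) ℝ} {ι κ : Type*} [Fintype ι] [Fintype κ]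

/-- The part `iA(ξ)` is skew-Hermitian and drops out of the real part; the damping is nonnegative.
-/
lemma IsPartiallyDissipative.accretive_fullSymbol (hA : IsPartiallyDissipative A D) (ξ : Space d) :
    Accretive 0 (fullSymbol A D ξ) := by
  refine accretive_iff.2 fun x => ?_
  rw [zero_mul, fullSymbol, Matrix.add_mulVec, dotProduct_add, Complex.add_re, Matrix.smul_mulVec,
    dotProduct_smul, smul_eq_mul, re_dotProduct_cmat]
  have h1 : (star x ⬝ᵥ linSymb A ξ *ᵥ x).im = 0 := by
    have hs : (linSymb A ξ)ᴴ = linSymb A ξ := by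
      ext i j
      simp only [linSymb, Matrix.conjTranspose_apply, star_sum]
      refine Finset.sum_congr rfl fun k _ => ?_
      simp [(hA.symm k).apply i j]
    refine Complex.conj_eq_iff_im.1 ?_
    rw [starRingEnd_apply, ← Matrix.star_dotProduct_star, star_star, Matrix.star_mulVec, hs,
      ← Matrix.dotProduct_mulVec]
  have h2 : ∀ y : Fin n₁ ⊕ Fin n₂ → ℝ, 0 ≤ y ⬝ᵥ dampingMatrix D *ᵥ y := fun y => by
    have := hA.posDef.posSemidef.dotProduct_mulVec_nonneg fun b => y (Sum.inr b)
    rw [dampingMatrix, Matrix.fromBlocks_mulVec]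
    simpa [dotProduct, Fintype.sum_sum_type, Function.comp_def] using this
  have h3 : (Complex.I * (star x ⬝ᵥ linSymb A ξ *ᵥ x)).re = 0 := by
    rw [Complex.I_mul_re, h1, neg_zero]
  rw [h3, zero_add]
  exact add_nonneg (h2 _) (h2 _)

lemma IsPartiallyDissipative.temperate_exp_fullSymbol (hA : IsPartiallyDissipative A D) {t : ℝ}
    (ht : 0 ≤ t) : TemperateMatrix fun ξ => NormedSpace.exp (-((t : ℂ) • fullSymbol A D ξ)) := by
  refine TemperateGenerator.exp (Q := fun ξ => -((t : ℂ) • fullSymbol A D ξ)) ⟨?_, 0, 1,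
    zero_le_one, fun ξ r hr _ => ?_⟩
  · have := TemperateMatrix.smul (.const (-(t : ℂ))) (fullSymbol_temperate (A := A) (D := D))
    simpa using this
  · rw [smul_neg, smul_smul, ← Complex.ofReal_mul, pow_zero, mul_one]
    refine (norm_exp_neg_smul_le_of_accretive (hA.accretive_fullSymbol ξ)
      (mul_nonneg hr ht)).trans ?_
    simp

/-- The solution operator of the full system. -/
def fullFlow (A : Fin d → Matrix (Fin n₁ ⊕ Fin n₂) (Fin n₁ ⊕ Fin n₂) ℝ)
    (D : Matrix (Fin n₂) (Fin n₂) ℝ) (t : ℝ) (u : Fin n₁ ⊕ Fin n₂ → TDist d) :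
    Fin n₁ ⊕ Fin n₂ → TDist d :=
  matMul (fun ξ => NormedSpace.exp (-((t : ℂ) • fullSymbol A D ξ))) u

/-- The symbol `∑ ξ_i N_i`, cut off to an annulus. -/
def annSymb (χ : Space d → ℝ) (N : Fin d → Matrix ι κ ℝ) (η : Space d) : Matrix ι κ ℂ :=
  linSymb N (wideBump χ η • η)

lemma IsCutoff.isSymbol_wideBump_smul (hχ : IsCutoff χ) : IsSymbol fun η => wideBump χ η • η := by
  refine ⟨hχ.isSymbol_wideBump.1.smul contDiff_id, 0, 6, fun ξ hξ => ?_⟩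
  have : wideBump χ ξ = 0 := by
    by_contra h
    linarith [(hχ.norm_of_wideBump_ne_zero h).2]
  simp only [this, zero_smul]

lemma IsCutoff.symbolMatrix_annSymb (hχ : IsCutoff χ) (N : Fin d → Matrix ι κ ℝ) :
    SymbolMatrix (annSymb χ N) :=
  linSymb_comp_symbolMatrix N hχ.isSymbol_wideBump_smul

lemma IsCutoff.linSymb_smul_eq (hχ : IsCutoff χ) (N : Fin d → Matrix ι κ ℝ) (l : ℝ) {ξ : Space d}
    (h : annulusBump χ ξ ≠ 0) : linSymb N (l • ξ) = (l : ℂ) • annSymb χ N ξ := by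
  rw [annSymb, hχ.wideBump_eq_one h, one_smul, linSymb_smul]

/-- The symbol `1 - wideBump`, vanishing on the support of `annulusBump χ`. -/
def coSymb (χ : Space d → ℝ) (n : ℕ) (η : Space d) : Matrix (Fin n) (Fin n) ℂ :=
  ((1 - wideBump χ η : ℝ) : ℂ) • 1

lemma IsCutoff.symbolMatrix_coSymb (hχ : IsCutoff χ) (n : ℕ) : SymbolMatrix (coSymb χ n) :=
  SymbolMatrix.smul ((IsSymbol.const (1 : ℝ)).sub hχ.isSymbol_wideBump).ofReal (.const 1)

lemma IsCutoff.coSymb_eq_zero (hχ : IsCutoff χ) (n : ℕ) {ξ : Space d} (h : annulusBump χ ξ ≠ 0) :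
    coSymb χ n ξ = 0 := by
  rw [coSymb, hχ.wideBump_eq_one h, sub_self, Complex.ofReal_zero, zero_smul]

/-- A uniformly accretive symbol which agrees with `gSymbol` on the support of `annulusBump χ`. -/
def gReg (χ : Space d → ℝ) (A : Fin d → Matrix (Fin n₁ ⊕ Fin n₂) (Fin n₁ ⊕ Fin n₂) ℝ)
    (D : Matrix (Fin n₂) (Fin n₂) ℝ) (η : Space d) : Matrix (Fin n₁) (Fin n₁) ℂ :=
  coSymb χ n₁ η + annSymb χ (blk₁₂ A) η * (cmat D⁻¹ * annSymb χ (blk₂₁ A) η)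

lemma IsCutoff.symbolMatrix_gReg (hχ : IsCutoff χ) : SymbolMatrix (gReg χ A D) :=
  (hχ.symbolMatrix_coSymb n₁).add ((hχ.symbolMatrix_annSymb _).mul
    ((SymbolMatrix.const _).mul (hχ.symbolMatrix_annSymb _)))

lemma IsCutoff.gSymbol_smul_eq (hχ : IsCutoff χ) (l : ℝ) {ξ : Space d}
    (h : annulusBump χ ξ ≠ 0) : gSymbol A D (l • ξ) = ((l ^ 2 : ℝ) : ℂ) • gReg χ A D ξ := by
  rw [gReg, hχ.coSymb_eq_zero n₁ h, zero_add, gSymbol_smul, annSymb, annSymb,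
    hχ.wideBump_eq_one h, one_smul, gSymbol, Complex.ofReal_pow]

lemma Accretive.add {ι : Type*} [Fintype ι] [DecidableEq ι] {c c' : ℝ} {M M' : Matrix ι ι ℂ}
    (h : Accretive c M) (h' : Accretive c' M') : Accretive (c + c') (M + M') := fun x => by
  rw [map_add, add_apply, inner_add_right, Complex.add_re]
  linarith [h x, h' x]

lemma Accretive.mono {ι : Type*} [Fintype ι] [DecidableEq ι] {c c' : ℝ} {M : Matrix ι ι ℂ}
    (h : Accretive c M) (hc : c' ≤ c) : Accretive c' M := fun x =>
  (mul_le_mul_of_nonneg_right hc (by positivity)).trans (h x)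

lemma accretive_ofReal_smul_one {ι : Type*} [Fintype ι] [DecidableEq ι] (c : ℝ) :
    Accretive c ((c : ℂ) • (1 : Matrix ι ι ℂ)) := fun x => by
  rw [map_smul, map_one, smul_apply, one_apply_eq_self, inner_smul_right,
    inner_self_eq_norm_sq_to_K]
  norm_cast
  change _ ≤ ((c : ℂ) * ((‖x‖ ^ 2 : ℝ) : ℂ)).re
  rw [← Complex.ofReal_mul, Complex.ofReal_re]

/-- With `b = wideBump χ η` the symbol is accretive with bound `(1 - b) + c b² |η|²`, and `|η| ≥
3/8` where `b ≠ 0`. Up to the factor `k` this is at least `1 - b + b² = (b - 1/2)² + 3/4`. -/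
lemma IsPartiallyDissipative.exists_gReg_accretive (hA : IsPartiallyDissipative A D)
    (hχ : IsCutoff χ) : ∃ c : ℝ, 0 < c ∧ ∀ η, Accretive c (gReg χ A D η) := by
  obtain ⟨c, hc, h⟩ := hA.exists_gSymbol_accretive
  set k := min 1 (9 / 64 * c) with hk
  have hk0 : 0 < k := by positivity
  refine ⟨3 / 4 * k, by positivity, fun η => ?_⟩
  have h1 := h (wideBump χ η • η)
  refine ((accretive_ofReal_smul_one (1 - wideBump χ η)).add h1).mono ?_
  have hb0 := hχ.wideBump_nonneg η
  have hb1 := hχ.wideBump_le_one η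
  rw [norm_smul, mul_pow, Real.norm_of_nonneg hb0]
  set b := wideBump χ η with hb
  have h2 : k * b ^ 2 ≤ c * (b ^ 2 * ‖η‖ ^ 2) := by
    by_cases hz : b = 0
    · rw [hz]
      simp
    · have h3 := (hχ.norm_of_wideBump_ne_zero hz).1
      have h4 : (3 / 8 : ℝ) ^ 2 ≤ ‖η‖ ^ 2 := by gcongr
      calc k * b ^ 2 ≤ 9 / 64 * c * b ^ 2 := by
            gcongr
            exact min_le_right _ _
        _ = c * (b ^ 2 * (3 / 8 : ℝ) ^ 2) := by ring
        _ ≤ _ := by gcongr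
  have h5 : k * (1 - b) ≤ 1 - b := by
    have : k ≤ 1 := min_le_left _ _
    exact mul_le_of_le_one_left (by linarith) this
  have h6 : 0 ≤ k * (b - 1 / 2) ^ 2 := by positivity
  linarith

/-- The full symbol at frequency `l η`, regularised off the support of `annulusBump χ`. -/
def fReg (χ : Space d → ℝ) (A : Fin d → Matrix (Fin n₁ ⊕ Fin n₂) (Fin n₁ ⊕ Fin n₂) ℝ)
    (D : Matrix (Fin n₂) (Fin n₂) ℝ) (l : ℝ) (η : Space d) :
    Matrix (Fin n₁ ⊕ Fin n₂) (Fin n₁ ⊕ Fin n₂) ℂ :=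
  -- The corner, which vanishes on the block, carries `l²` so that the effective diffusion generator
  -- is `l² gReg`, uniformly accretive also off the annulus.
  Matrix.fromBlocks (((l : ℂ) ^ 2) • coSymb χ n₁ η) (((l : ℂ) * Complex.I) • annSymb χ (blk₁₂ A) η)
    (((l : ℂ) * Complex.I) • annSymb χ (blk₂₁ A) η)
    (cmat D + ((l : ℂ) * Complex.I) • annSymb χ (blk₂₂ A) η)

lemma SymbolMatrix.fromBlocks {ι κ μ ν : Type*} {M : Space d → Matrix ι κ ℂ}
    {N : Space d → Matrix ι ν ℂ} {P : Space d → Matrix μ κ ℂ} {Q : Space d → Matrix μ ν ℂ}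
    (hM : SymbolMatrix M) (hN : SymbolMatrix N) (hP : SymbolMatrix P) (hQ : SymbolMatrix Q) :
    SymbolMatrix fun η => Matrix.fromBlocks (M η) (N η) (P η) (Q η) := by
  rintro (a | a) (b | b)
  · exact hM a b
  · exact hN a b
  · exact hP a b
  · exact hQ a b

lemma IsCutoff.symbolMatrix_fReg (hχ : IsCutoff χ) (l : ℝ) : SymbolMatrix (fReg χ A D l) :=
  .fromBlocks (.const_smul _ (hχ.symbolMatrix_coSymb n₁))
    (.const_smul _ (hχ.symbolMatrix_annSymb _)) (.const_smul _ (hχ.symbolMatrix_annSymb _))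
    ((SymbolMatrix.const _).add (.const_smul _ (hχ.symbolMatrix_annSymb _)))

lemma IsCutoff.fullSymbol_smul_eq (hχ : IsCutoff χ) (hA : IsPartiallyDissipative A D) (l : ℝ)
    {ξ : Space d} (h : annulusBump χ ξ ≠ 0) : fullSymbol A D (l • ξ) = fReg χ A D l ξ := by
  rw [fullSymbol_eq_fromBlocks hA, fReg, hχ.coSymb_eq_zero n₁ h, smul_zero,
    hχ.linSymb_smul_eq _ _ h, hχ.linSymb_smul_eq _ _ h, hχ.linSymb_smul_eq _ _ h, smul_smul,
    smul_smul, smul_smul, mul_comm, add_comm]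

end RegularisedSymbols

/-! ### Operators with matrix symbols acting on rescaled dyadic blocks -/

section BlockOperators

variable {d : ℕ} {χ : Space d → ℝ} {p : ℝ≥0∞} [hp : Fact (1 ≤ p)]
  {ι κ μ ν : Type*} [Fintype ι] [Fintype κ] [Fintype μ] [Fintype ν]

lemma opMat_exp_neg_smul [DecidableEq ι] (hp₁ : 1 < p) (hp₂ : p < ⊤) {H : Space d → Matrix ι ι ℂ}
    (hH : SymbolMatrix H) (t : ℝ) :
    opMat p (fun η => NormedSpace.exp (-((t : ℂ) • H η))) = NormedSpace.exp ((-t) • opMat p H) := by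
  rw [opMat_exp hp₁ hp₂ (hH.const_smul _).neg, opMat_neg hp₁ hp₂ (hH.const_smul _),
    opMat_const_smul hp₁ hp₂ _ hH]
  congr 1
  ext f : 1
  simp [Complex.coe_smul]
  rfl

omit [Fintype ι] in
lemma vecTD_add (f g : LpVec d p ι) : vecTD (f + g) = vecTD f + vecTD g :=
  funext fun _ => toTD_add _ _

omit [Fintype ι] in
lemma vecTD_sub (f g : LpVec d p ι) : vecTD (f - g) = vecTD f - vecTD g :=
  funext fun _ => toTD_sub _ _

lemma opMat_fromBlocks (hp₁ : 1 < p) (hp₂ : p < ⊤) {M : Space d → Matrix ι κ ℂ}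
    {N : Space d → Matrix ι ν ℂ} {P : Space d → Matrix μ κ ℂ} {Q : Space d → Matrix μ ν ℂ}
    (hM : SymbolMatrix M) (hN : SymbolMatrix N) (hP : SymbolMatrix P) (hQ : SymbolMatrix Q)
    (g : LpVec d p (κ ⊕ ν)) :
    (fun a => opMat p (fun η => Matrix.fromBlocks (M η) (N η) (P η) (Q η)) g (Sum.inl a)) =
        opMat p M (fun b => g (Sum.inl b)) + opMat p N (fun b => g (Sum.inr b)) ∧
      (fun a => opMat p (fun η => Matrix.fromBlocks (M η) (N η) (P η) (Q η)) g (Sum.inr a)) =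
        opMat p P (fun b => g (Sum.inl b)) + opMat p Q (fun b => g (Sum.inr b)) := by
  have h := vecTD_opMat hp₁ hp₂ (SymbolMatrix.fromBlocks hM hN hP hQ) g
  constructor
  · apply vecTD_injective
    rw [vecTD_add, vecTD_opMat hp₁ hp₂ hM, vecTD_opMat hp₁ hp₂ hN]
    ext1 a
    refine (congrFun h (Sum.inl a)).trans ?_
    rw [matMul, Fintype.sum_sum_type]
    rfl
  · apply vecTD_injective
    rw [vecTD_add, vecTD_opMat hp₁ hp₂ hP, vecTD_opMat hp₁ hp₂ hQ]
    ext1 a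
    refine (congrFun h (Sum.inr a)).trans ?_
    rw [matMul, Fintype.sum_sum_type]
    rfl

omit [Fintype ι] in
lemma matMul_scaledBlock_congr (hχ : IsCutoff χ) {j : ℤ} {M M' : Space d → Matrix ι κ ℂ}
    (hM : TemperateMatrix M) (hM' : TemperateMatrix M')
    (h : ∀ ξ, annulusBump χ ξ ≠ 0 → M ξ = M' ξ) (u : κ → TDist d) :
    matMul M (scaledBlock χ j u) = matMul M' (scaledBlock χ j u) := by
  have hφ := hχ.isSymbol_annulusBump.ofReal.hasTemperateGrowth
  have e1 : scaledBlock χ j u = fun b => multiplier (fun ξ => ((annulusBump χ ξ : ℝ) : ℂ))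
    (dil ((2 : ℝ) ^ j) (zpow_ne_zero j two_ne_zero) (u b)) := rfl
  rw [e1, matMul_multiplier hφ hM', matMul_multiplier hφ hM]
  congr 1
  ext ξ : 1
  by_cases hξ : annulusBump χ ξ = 0
  · simp [hξ]
  · rw [h ξ hξ]

lemma vecNorm_matMul_le_opMat (hp₁ : 1 < p) (hp₂ : p < ⊤) {M : Space d → Matrix ι κ ℂ}
    (hM : SymbolMatrix M) {K : ℝ} (hK0 : 0 < K) (hK : ‖opMat p M‖ ≤ K) (u : κ → TDist d) :
    vecNorm p (matMul M u) ≤ ENNReal.ofReal ((Fintype.card ι + 1) * K) * vecNorm p u := by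
  -- Positivity of `K` and the `+ 1` keep the factor nonzero, also for an empty index type, so
  -- vectors of infinite norm are covered.
  by_cases htop : vecNorm p u = ⊤
  · rw [htop, ENNReal.mul_top (ENNReal.ofReal_pos.2 (by positivity)).ne']
    exact le_top
  obtain ⟨f, rfl⟩ := exists_toTD_of_vecNorm_lt_top (lt_top_iff_ne_top.2 htop)
  change vecNorm p (matMul M (vecTD f)) ≤ _
  rw [← vecTD_opMat hp₁ hp₂ hM f]
  refine (vecNorm_toTD_le _).trans ?_
  have h1 : ‖opMat p M f‖ₑ ≤ ENNReal.ofReal K * ‖f‖ₑ := by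
    rw [← ofReal_norm, ← ofReal_norm, ← ENNReal.ofReal_mul hK0.le]
    exact ENNReal.ofReal_le_ofReal ((opMat p M).le_of_opNorm_le hK f)
  calc _ ≤ (Fintype.card ι : ℝ≥0∞) * (ENNReal.ofReal K * ‖f‖ₑ) := by gcongr
    _ = ENNReal.ofReal (Fintype.card ι * K) * ‖f‖ₑ := by
        rw [← mul_assoc, ENNReal.ofReal_mul (by positivity), ENNReal.ofReal_natCast]
    _ ≤ _ := by
        gcongr
        · linarith
        · exact enorm_le_vecNorm_toTD f

/-- All blocks are dilated by the same `2^j`, so the dilation factor cancels and an estimate at unit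
frequency holds for the original blocks with the same constants. -/
lemma vecNorm_blockVec_le_of_scaledBlock (hχ : IsCutoff χ) {j : ℤ} {u : ι → TDist d}
    {v : κ → TDist d} {w : μ → TDist d} {a b : ℝ≥0∞}
    (h : vecNorm p (scaledBlock χ j u) ≤
      a * vecNorm p (scaledBlock χ j v) + b * vecNorm p (scaledBlock χ j w)) :
    vecNorm p (blockVec χ j u) ≤ a * vecNorm p (blockVec χ j v) + b * vecNorm p (blockVec χ j w) := by
  rw [vecNorm_scaledBlock hχ, vecNorm_scaledBlock hχ, vecNorm_scaledBlock hχ, mul_left_comm a,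
    mul_left_comm b, ← mul_add] at h
  exact (ENNReal.mul_le_mul_iff_right (dilFactor_ne_zero (zpow_ne_zero j two_ne_zero))
    (dilFactor_ne_top _)).1 h

lemma vecNorm_blockVec_le_of_eq_matMul (hχ : IsCutoff χ) (hp₁ : 1 < p) (hp₂ : p < ⊤) {j : ℤ}
    {u : ι → TDist d} {v : κ → TDist d} {M : Space d → Matrix ι κ ℂ} (hM : SymbolMatrix M) {K : ℝ}
    (hK0 : 0 < K) (hK : ‖opMat p M‖ ≤ K)
    (h : scaledBlock χ j u = matMul M (scaledBlock χ j v)) :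
    vecNorm p (blockVec χ j u) ≤
      ENNReal.ofReal ((Fintype.card ι + 1) * K) * vecNorm p (blockVec χ j v) := by
  have h1 := vecNorm_matMul_le_opMat hp₁ hp₂ hM hK0 hK (scaledBlock χ j v)
  rw [← h] at h1
  have := vecNorm_blockVec_le_of_scaledBlock hχ (v := v) (w := v)
    (a := ENNReal.ofReal ((Fintype.card ι + 1) * K)) (b := 0) (h1.trans (by simp))
  simpa using this

end BlockOperators

/-! ### Low frequency estimates on dyadic blocks -/

section LowBlocks

variable {d n₁ n₂ : ℕ} {χ : Space d → ℝ} {p : ℝ≥0∞} [hp : Fact (1 ≤ p)]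
  {A : Fin d → Matrix (Fin n₁ ⊕ Fin n₂) (Fin n₁ ⊕ Fin n₂) ℝ} {D : Matrix (Fin n₂) (Fin n₂) ℝ}

/-- The conservative components. -/
def consPart (u : Fin n₁ ⊕ Fin n₂ → TDist d) : Fin n₁ → TDist d := fun a => u (Sum.inl a)

/-- The dissipative components. -/
def dissPart (u : Fin n₁ ⊕ Fin n₂ → TDist d) : Fin n₂ → TDist d := fun b => u (Sum.inr b)

lemma scaledBlock_fullFlow (hχ : IsCutoff χ) (hA : IsPartiallyDissipative A D) {t : ℝ} (ht : 0 ≤ t)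
    (j : ℤ) (u : Fin n₁ ⊕ Fin n₂ → TDist d) :
    scaledBlock χ j (fullFlow A D t u) =
      matMul (fun η => NormedSpace.exp (-((t : ℂ) • fReg χ A D ((2 : ℝ) ^ j) η)))
        (scaledBlock χ j u) :=
  scaledBlock_matMul hχ (hA.temperate_exp_fullSymbol ht)
    ((hχ.symbolMatrix_fReg _).const_smul _).neg.exp.temperate
    (fun ξ hξ => by rw [hχ.fullSymbol_smul_eq hA _ hξ]) u

lemma scaledBlock_diffusionFlow (hχ : IsCutoff χ) (hA : IsPartiallyDissipative A D) {t : ℝ}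
    (ht : 0 ≤ t) (j : ℤ) (u : Fin n₁ → TDist d) :
    scaledBlock χ j (diffusionFlow A D t u) =
      matMul (fun η => NormedSpace.exp (-(((((2 : ℝ) ^ j) ^ 2 * t : ℝ) : ℂ) • gReg χ A D η)))
        (scaledBlock χ j u) := by
  rw [diffusionFlow_eq]
  refine scaledBlock_matMul hχ (hA.temperate_exp_gSymbol ht)
    (hχ.symbolMatrix_gReg.const_smul _).neg.exp.temperate (fun ξ hξ => ?_) u
  rw [hχ.gSymbol_smul_eq _ hξ, smul_smul]
  congr 3
  push_cast
  ring

lemma scaledBlock_effective (hχ : IsCutoff χ) (j : ℤ) (u : Fin n₁ ⊕ Fin n₂ → TDist d) :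
    scaledBlock χ j (effective A D u) = scaledBlock χ j (consPart u) -
      matMul (fun η => ((((2 : ℝ) ^ j : ℝ) : ℂ) * Complex.I) •
        (annSymb χ (blk₁₂ A) η * cmat D⁻¹)) (scaledBlock χ j (dissPart u)) := by
  rw [effective_eq, scaledBlock_sub]
  congr 1
  refine scaledBlock_matMul hχ (.smul (.const _) ((linSymb_temperate _).mul (.const _)))
    (((hχ.symbolMatrix_annSymb _).mul (.const _)).const_smul _).temperate (fun ξ hξ => ?_) _
  rw [hχ.linSymb_smul_eq _ _ hξ, Matrix.smul_mul, smul_smul, mul_comm]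

lemma scaledBlock_profile (hχ : IsCutoff χ) (j : ℤ) (u : Fin n₁ ⊕ Fin n₂ → TDist d) (t : ℝ) :
    scaledBlock χ j (dissPart (profile A D u t)) =
      matMul (fun η => -(((((2 : ℝ) ^ j : ℝ) : ℂ) * Complex.I) •
        (cmat D⁻¹ * annSymb χ (blk₂₁ A) η)))
        (scaledBlock χ j (diffusionFlow A D t (effective A D u))) := by
  have h := profile_inr_eq (A := A) (D := D) u t
  rw [← matMul_neg (.smul (.const _) ((TemperateMatrix.const _).mul (linSymb_temperate _)))] at h
  change scaledBlock χ j (fun b => profile A D u t (Sum.inr b)) = _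
  rw [h]
  refine scaledBlock_matMul hχ ?_
    (((SymbolMatrix.const _).mul (hχ.symbolMatrix_annSymb _)).const_smul _).neg.temperate
    (fun ξ hξ => ?_) _
  · have := TemperateMatrix.smul (.const (-Complex.I)) ((TemperateMatrix.const (cmat D⁻¹)).mul
      (linSymb_temperate (blk₂₁ A)))
    simpa using this
  · rw [hχ.linSymb_smul_eq _ _ hξ, Matrix.mul_smul, smul_smul, mul_comm]

/-- Decay of the regularised parabolic semigroup. -/
lemma IsPartiallyDissipative.exists_opMat_gReg_le (hA : IsPartiallyDissipative A D)
    (hχ : IsCutoff χ) (hp₁ : 1 < p) (hp₂ : p < ⊤) : ∃ C c : ℝ, 0 < C ∧ 0 < c ∧ ∀ s : ℝ, 0 ≤ s →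
      ‖opMat p (fun η => NormedSpace.exp (-((s : ℂ) • gReg χ A D η)))‖ ≤ C * Real.exp (-c * s) ∧
      ‖opMat p (fun η => NormedSpace.exp (-(((-s : ℝ) : ℂ) • gReg χ A D η)))‖ ≤
        C * Real.exp (C * s) := by
  obtain ⟨c₀, hc₀, hacc⟩ := hA.exists_gReg_accretive hχ
  obtain ⟨t₀, ht₀, hhalf⟩ := exists_norm_exp_opMat_le_half (p := p) hp₁ hp₂
    (hχ.symbolMatrix_gReg (A := A) (D := D)) hc₀ hacc
  obtain ⟨C, c, η, hC, hc, hη, h⟩ := exists_norm_exp_neg_smul_le ht₀ hhalf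
  set G := opMat p (gReg χ A D) with hG
  refine ⟨C + 1 + ‖G‖, c, by positivity, hc, fun s hs => ⟨?_, ?_⟩⟩
  · rw [opMat_exp_neg_smul hp₁ hp₂ hχ.symbolMatrix_gReg, ← hG]
    refine (h G (by rw [sub_self, norm_zero]; exact hη.le) s hs).trans ?_
    gcongr
    linarith [norm_nonneg G]
  -- The heat flow can be reversed here because the regularised generator is bounded. The growth
  -- `e^{Cs}` is harmless, since it is used only for `s = 4^j t` bounded.
  · rw [opMat_exp_neg_smul hp₁ hp₂ hχ.symbolMatrix_gReg, ← hG, neg_neg]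
    refine (norm_exp_clm_le _).trans ?_
    have h1 : ‖s • G‖ ≤ (C + 1 + ‖G‖) * s := by
      have e : s • G = (s : ℂ) • G := by
        ext f : 1
        simp [Complex.coe_smul]
        rfl
      rw [e]
      refine (norm_ofReal_smul hs G).le.trans ?_
      rw [mul_comm]
      gcongr
      linarith
    refine (Real.exp_le_exp.2 h1).trans (le_mul_of_one_le_left (Real.exp_pos _).le ?_)
    linarith [norm_nonneg G]

/-- Upper and lower bounds for the parabolic semigroup on dyadic blocks. -/
lemma IsPartiallyDissipative.exists_diffusionFlow_block (hA : IsPartiallyDissipative A D)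
    (hχ : IsCutoff χ) (hp₁ : 1 < p) (hp₂ : p < ⊤) : ∃ C c : ℝ, 0 < C ∧ 0 < c ∧
      ∀ (j : ℤ) (t : ℝ), 0 ≤ t → ∀ u : Fin n₁ → TDist d,
        vecNorm p (blockVec χ j (diffusionFlow A D t u)) ≤
          ENNReal.ofReal (C * Real.exp (-c * (((2 : ℝ) ^ j) ^ 2 * t))) *
            vecNorm p (blockVec χ j u) ∧
        vecNorm p (blockVec χ j u) ≤
          ENNReal.ofReal (C * Real.exp (C * (((2 : ℝ) ^ j) ^ 2 * t))) *
            vecNorm p (blockVec χ j (diffusionFlow A D t u)) := by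
  obtain ⟨C, c, hC, hc, h⟩ := hA.exists_opMat_gReg_le hχ hp₁ hp₂ (p := p)
  refine ⟨((n₁ : ℝ) + 1) * C, c, by positivity, hc, fun j t ht u => ?_⟩
  have hs : 0 ≤ ((2 : ℝ) ^ j) ^ 2 * t := by positivity
  have hsym : ∀ s : ℝ, SymbolMatrix fun η => NormedSpace.exp (-((s : ℂ) • gReg χ A D η)) :=
    fun s => (hχ.symbolMatrix_gReg.const_smul _).neg.exp
  obtain ⟨h1, h2⟩ := h _ hs
  have e := scaledBlock_diffusionFlow hχ hA ht j u
  constructor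
  · have := vecNorm_blockVec_le_of_eq_matMul hχ hp₁ hp₂ (hsym _) (by positivity) h1 e
    rwa [Fintype.card_fin, ← mul_assoc] at this
  -- The lower bound comes from running the regularised flow backwards from time `t`.
  · have e2 : scaledBlock χ j u = matMul (fun η => NormedSpace.exp
        (-(((-(((2 : ℝ) ^ j) ^ 2 * t) : ℝ) : ℂ) • gReg χ A D η)))
        (scaledBlock χ j (diffusionFlow A D t u)) := by
      rw [e, matMul_matMul (hsym _).temperate (hsym _).temperate]
      conv_lhs => rw [← matMul_one (scaledBlock χ j u)]
      congr 1
      ext η : 1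
      rw [Complex.ofReal_neg, neg_smul, neg_neg, Matrix.exp_neg, Matrix.mul_nonsing_inv]
      exact (Matrix.isUnit_iff_isUnit_det _).1 (Matrix.isUnit_exp _)
    refine (vecNorm_blockVec_le_of_eq_matMul hχ hp₁ hp₂ (hsym _) (by positivity) h2 e2).trans ?_
    rw [Fintype.card_fin, ← mul_assoc]
    gcongr
    refine le_mul_of_one_le_left hC.le ?_
    have : (0 : ℝ) ≤ n₁ := by positivity
    linarith

/-- The effective quantity is comparable to the conservative components. -/
lemma exists_effective_block (hχ : IsCutoff χ) (hp₁ : 1 < p) (hp₂ : p < ⊤)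
    (A : Fin d → Matrix (Fin n₁ ⊕ Fin n₂) (Fin n₁ ⊕ Fin n₂) ℝ) (D : Matrix (Fin n₂) (Fin n₂) ℝ) :
    ∃ C : ℝ, 0 < C ∧ ∀ (j : ℤ) (u : Fin n₁ ⊕ Fin n₂ → TDist d),
      vecNorm p (blockVec χ j (effective A D u)) ≤ vecNorm p (blockVec χ j (consPart u)) +
        ENNReal.ofReal (C * (2 : ℝ) ^ j) * vecNorm p (blockVec χ j (dissPart u)) ∧
      vecNorm p (blockVec χ j (consPart u)) ≤ vecNorm p (blockVec χ j (effective A D u)) +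
        ENNReal.ofReal (C * (2 : ℝ) ^ j) * vecNorm p (blockVec χ j (dissPart u)) := by
  set N : Space d → Matrix (Fin n₁) (Fin n₂) ℂ := fun η => annSymb χ (blk₁₂ A) η * cmat D⁻¹ with hN
  have hNs : SymbolMatrix N := (hχ.symbolMatrix_annSymb _).mul (.const _)
  set C := ‖opMat p N‖ + 1 with hC
  have hC0 : 0 < C := by positivity
  refine ⟨((n₁ : ℝ) + 1) * C, by positivity, fun j u => ?_⟩
  set l : ℝ := (2 : ℝ) ^ j with hl
  have hl0 : 0 < l := by positivity
  have hK : ‖opMat p fun η => ((l : ℂ) * Complex.I) • N η‖ ≤ l * C := by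
    rw [opMat_const_smul hp₁ hp₂ _ hNs]
    refine (norm_I_mul_smul hl0.le (opMat p N)).le.trans ?_
    gcongr
    linarith
  have h1 := vecNorm_matMul_le_opMat hp₁ hp₂ (hNs.const_smul ((l : ℂ) * Complex.I))
    (by positivity) hK (scaledBlock χ j (dissPart u))
  have e := scaledBlock_effective (A := A) (D := D) hχ j u
  have hr : ((Fintype.card (Fin n₁) : ℝ) + 1) * (l * C) = ((n₁ : ℝ) + 1) * C * l := by
    rw [Fintype.card_fin]
    ring
  rw [hr] at h1
  constructor
  · have := vecNorm_blockVec_le_of_scaledBlock hχ (j := j) (u := effective A D u)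
      (v := consPart u) (w := dissPart u) (a := 1) (b := ENNReal.ofReal (((n₁ : ℝ) + 1) * C * l)) (by
        rw [e, one_mul]
        exact (vecNorm_sub_le _ _).trans (by gcongr))
    rwa [one_mul] at this
  · have := vecNorm_blockVec_le_of_scaledBlock hχ (j := j) (u := consPart u)
      (v := effective A D u) (w := dissPart u) (a := 1)
      (b := ENNReal.ofReal (((n₁ : ℝ) + 1) * C * l)) (by
        have e2 := sub_eq_iff_eq_add.1 e.symm
        rw [e2, one_mul]
        exact (vecNorm_add_le _ _).trans (by gcongr))
    rwa [one_mul] at this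

lemma Accretive.isUnit {ι : Type*} [Fintype ι] [DecidableEq ι] {c : ℝ} {M : Matrix ι ι ℂ}
    (hM : Accretive c M) (hc : 0 < c) : IsUnit M := by
  rw [← Matrix.mulVec_injective_iff_isUnit]
  refine (injective_iff_map_eq_zero (Matrix.mulVecLin M)).2 fun v hv => ?_
  have h := accretive_iff.1 hM v
  rw [show M.mulVec v = 0 from hv, dotProduct_zero, Complex.zero_re] at h
  have h1 : ∑ i, ‖v i‖ ^ 2 = 0 := le_antisymm (nonpos_of_mul_nonpos_right h hc) (by positivity)
  ext i
  have := (Finset.sum_eq_zero_iff_of_nonneg fun i _ => by positivity).1 h1 i (Finset.mem_univ i)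
  simpa using this

/-- The dissipative component of the profile is comparable to a derivative of the conservative
one. -/
lemma IsPartiallyDissipative.exists_profile_block (hA : IsPartiallyDissipative A D)
    (hχ : IsCutoff χ) (hp₁ : 1 < p) (hp₂ : p < ⊤) : ∃ C : ℝ, 0 < C ∧
      ∀ (j : ℤ) (u : Fin n₁ ⊕ Fin n₂ → TDist d) (t : ℝ),
      vecNorm p (blockVec χ j (dissPart (profile A D u t))) ≤ ENNReal.ofReal (C * (2 : ℝ) ^ j) *
        vecNorm p (blockVec χ j (diffusionFlow A D t (effective A D u))) ∧
      ENNReal.ofReal ((2 : ℝ) ^ j) *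
          vecNorm p (blockVec χ j (diffusionFlow A D t (effective A D u))) ≤
        ENNReal.ofReal C * vecNorm p (blockVec χ j (dissPart (profile A D u t))) := by
  obtain ⟨c₀, hc₀, hacc⟩ := hA.exists_gReg_accretive hχ
  set N : Space d → Matrix (Fin n₂) (Fin n₁) ℂ := fun η => cmat D⁻¹ * annSymb χ (blk₂₁ A) η with hN
  have hNs : SymbolMatrix N := (SymbolMatrix.const _).mul (hχ.symbolMatrix_annSymb _)
  have hu : ∀ η, IsUnit (gReg χ A D η) := fun η => (hacc η).isUnit hc₀
  -- On the block `a₁₂ N = gReg` is invertible, so `gReg⁻¹ a₁₂` is a left inverse of `N = D⁻¹ a₂₁`;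
  -- this gives the lower bound of the dissipative profile.
  set P : Space d → Matrix (Fin n₁) (Fin n₂) ℂ :=
    fun η => (gReg χ A D η)⁻¹ * annSymb χ (blk₁₂ A) η with hP
  have hPs : SymbolMatrix P := (hχ.symbolMatrix_gReg.inv hu).mul (hχ.symbolMatrix_annSymb _)
  set C := ‖opMat p N‖ + ‖opMat p P‖ + 1 with hC
  have hC0 : 0 < C := by positivity
  refine ⟨((n₁ : ℝ) + n₂ + 1) * C, by positivity, fun j u t => ?_⟩
  set l : ℝ := (2 : ℝ) ^ j with hl
  have hl0 : 0 < l := by positivity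
  have e := scaledBlock_profile (A := A) (D := D) hχ j u t
  set S := diffusionFlow A D t (effective A D u) with hS
  set W := dissPart (profile A D u t) with hW
  have hNs' : SymbolMatrix fun η => -(((l : ℂ) * Complex.I) • N η) := (hNs.const_smul _).neg
  constructor
  · have hK : ‖opMat p fun η => -(((l : ℂ) * Complex.I) • N η)‖ ≤ l * C := by
      rw [opMat_neg hp₁ hp₂ (hNs.const_smul _), norm_neg, opMat_const_smul hp₁ hp₂ _ hNs]
      refine (norm_I_mul_smul hl0.le (opMat p N)).le.trans ?_
      gcongr
      linarith [norm_nonneg (opMat p P)]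
    refine (vecNorm_blockVec_le_of_eq_matMul hχ hp₁ hp₂ hNs' (by positivity) hK e).trans ?_
    refine mul_le_mul_left (ENNReal.ofReal_le_ofReal ?_) _
    rw [Fintype.card_fin]
    have : (0 : ℝ) ≤ n₁ * C * l := by positivity
    linarith
  · have hlI : ((l : ℂ) * Complex.I) ≠ 0 :=
      mul_ne_zero (by exact_mod_cast hl0.ne') Complex.I_ne_zero
    have e2 : scaledBlock χ j S = matMul (fun η => -(((l : ℂ) * Complex.I)⁻¹ • P η))
        (scaledBlock χ j W) := by
      rw [e, matMul_matMul (hPs.const_smul _).neg.temperate hNs'.temperate]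
      conv_lhs => rw [← matMul_one (scaledBlock χ j S)]
      refine matMul_scaledBlock_congr hχ (.const 1)
        ((hPs.const_smul _).neg.mul hNs').temperate (fun ξ hξ => ?_) S
      have hg : annSymb χ (blk₁₂ A) ξ * N ξ = gReg χ A D ξ := by
        rw [gReg, hχ.coSymb_eq_zero n₁ hξ, zero_add]
      rw [Matrix.neg_mul, Matrix.mul_neg, neg_neg, Matrix.smul_mul, Matrix.mul_smul, smul_smul, inv_mul_cancel₀ hlI, one_smul,
        hP]
      simp only
      rw [Matrix.mul_assoc, hg, Matrix.nonsing_inv_mul]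
      exact (Matrix.isUnit_iff_isUnit_det _).1 (hu ξ)
    have hK : ‖opMat p fun η => -(((l : ℂ) * Complex.I)⁻¹ • P η)‖ ≤ l⁻¹ * C := by
      rw [opMat_neg hp₁ hp₂ (hPs.const_smul _), norm_neg, opMat_const_smul hp₁ hp₂ _ hPs]
      refine (norm_smul_le ((l : ℂ) * Complex.I)⁻¹ (opMat p P)).trans ?_
      rw [norm_inv, norm_mul, Complex.norm_I, mul_one, Complex.norm_real,
        Real.norm_of_nonneg hl0.le]
      gcongr
      linarith [norm_nonneg (opMat p N)]
    have h1 := vecNorm_blockVec_le_of_eq_matMul hχ hp₁ hp₂ (hPs.const_smul _).neg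
      (by positivity) hK e2
    calc _ ≤ ENNReal.ofReal l * (ENNReal.ofReal ((Fintype.card (Fin n₁) + 1) * (l⁻¹ * C)) *
          vecNorm p (blockVec χ j W)) := by gcongr
      _ = ENNReal.ofReal (((n₁ : ℝ) + 1) * C) * vecNorm p (blockVec χ j W) := by
          rw [← mul_assoc, ← ENNReal.ofReal_mul hl0.le, Fintype.card_fin]
          congr 2
          field_simp
      _ ≤ _ := by
          gcongr
          linarith

/-- Blocks of the data are finite if those of the solution are. -/
lemma IsPartiallyDissipative.blockVec_lt_top_of_fullFlow (hA : IsPartiallyDissipative A D)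
    (hχ : IsCutoff χ) (hp₁ : 1 < p) (hp₂ : p < ⊤) {j : ℤ} {t : ℝ} (ht : 0 ≤ t)
    {u : Fin n₁ ⊕ Fin n₂ → TDist d} (h : vecNorm p (blockVec χ j (fullFlow A D t u)) < ⊤) :
    vecNorm p (blockVec χ j u) < ⊤ := by
  have e := scaledBlock_fullFlow hχ hA ht j u
  have hsym : ∀ s : ℂ, SymbolMatrix fun η =>
      NormedSpace.exp (-(s • fReg χ A D ((2 : ℝ) ^ j) η)) :=
    fun s => ((hχ.symbolMatrix_fReg _).const_smul _).neg.exp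
  have e2 : scaledBlock χ j u = matMul (fun η => NormedSpace.exp
      (-(-(t : ℂ) • fReg χ A D ((2 : ℝ) ^ j) η))) (scaledBlock χ j (fullFlow A D t u)) := by
    rw [e, matMul_matMul (hsym _).temperate (hsym _).temperate]
    conv_lhs => rw [← matMul_one (scaledBlock χ j u)]
    congr 1
    ext η : 1
    rw [neg_smul, neg_neg, Matrix.exp_neg, Matrix.mul_nonsing_inv]
    exact (Matrix.isUnit_iff_isUnit_det _).1 (Matrix.isUnit_exp _)
  refine (vecNorm_blockVec_le_of_eq_matMul hχ hp₁ hp₂ (hsym _)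
    (lt_of_lt_of_le one_pos (le_max_left 1 _)) (le_max_right _ _) e2).trans_lt ?_
  exact ENNReal.mul_lt_top ENNReal.ofReal_lt_top h

end LowBlocks

/-! ### Comparison of the full system and its diffusive profile on low frequency blocks -/

section LowBlockDecay

variable {d n₁ n₂ : ℕ} {χ : Space d → ℝ} {p : ℝ≥0∞} [hp : Fact (1 ≤ p)]
  {A : Fin d → Matrix (Fin n₁ ⊕ Fin n₂) (Fin n₁ ⊕ Fin n₂) ℝ} {D : Matrix (Fin n₂) (Fin n₂) ℝ}

lemma matMul_exp_vecTD {ι : Type*} [Fintype ι] [DecidableEq ι] (hp₁ : 1 < p) (hp₂ : p < ⊤)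
    {H : Space d → Matrix ι ι ℂ} (hH : SymbolMatrix H) (t : ℝ) (f : LpVec d p ι) :
    matMul (fun η => NormedSpace.exp (-((t : ℂ) • H η))) (vecTD f) =
      vecTD (NormedSpace.exp ((-t) • opMat p H) f) := by
  rw [← opMat_exp_neg_smul hp₁ hp₂ hH, vecTD_opMat hp₁ hp₂ (hH.const_smul _).neg.exp]

lemma vecNorm_vecTD_le_of_norm_le {ι κ μ : Type*} [Fintype ι] [Fintype κ] [Fintype μ]
    {f : LpVec d p ι} {g : LpVec d p κ} {h : LpVec d p μ} {a b : ℝ} (ha : 0 ≤ a) (hb : 0 ≤ b)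
    (hf : ‖f‖ ≤ a * ‖g‖ + b * ‖h‖) :
    vecNorm p (vecTD f) ≤ ENNReal.ofReal (Fintype.card ι * a) * vecNorm p (vecTD g) +
      ENNReal.ofReal (Fintype.card ι * b) * vecNorm p (vecTD h) := by
  have h1 : ‖f‖ₑ ≤ ENNReal.ofReal a * ‖g‖ₑ + ENNReal.ofReal b * ‖h‖ₑ := by
    rw [← ofReal_norm, ← ofReal_norm, ← ofReal_norm, ← ENNReal.ofReal_mul ha,
      ← ENNReal.ofReal_mul hb, ← ENNReal.ofReal_add (by positivity) (by positivity)]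
    exact ENNReal.ofReal_le_ofReal hf
  refine (vecNorm_toTD_le f).trans ?_
  calc _ ≤ (Fintype.card ι : ℝ≥0∞) * (ENNReal.ofReal a * vecNorm p (vecTD g) +
        ENNReal.ofReal b * vecNorm p (vecTD h)) := by
        gcongr
        refine h1.trans ?_
        gcongr
        · exact enorm_le_vecNorm_toTD g
        · exact enorm_le_vecNorm_toTD h
    _ = _ := by
        rw [mul_add, ← mul_assoc, ← mul_assoc, ENNReal.ofReal_mul (by positivity),
          ENNReal.ofReal_mul (by positivity), ENNReal.ofReal_natCast]

set_option maxHeartbeats 1600000 in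
/-- The difference between the full system and the profile on low frequency blocks. -/
theorem IsPartiallyDissipative.exists_lowBlock_decay (hA : IsPartiallyDissipative A D)
    (hχ : IsCutoff χ) (hp₁ : 1 < p) (hp₂ : p < ⊤) : ∃ C c l₀ : ℝ, 0 < C ∧ 0 < c ∧ 0 < l₀ ∧
      l₀ ≤ 1 ∧ ∀ (j : ℤ), (2 : ℝ) ^ j ≤ l₀ → ∀ (t : ℝ), 0 ≤ t →
      ∀ (u : Fin n₁ ⊕ Fin n₂ → TDist d) (l : ℝ), l = (2 : ℝ) ^ j →
        vecNorm p (blockVec χ j (consPart (fullFlow A D t u) - consPart (profile A D u t))) ≤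
          ENNReal.ofReal (C * (l * Real.exp (-c * (l ^ 2 * t)))) *
            vecNorm p (blockVec χ j (consPart u)) +
          ENNReal.ofReal (C * (l ^ 2 * Real.exp (-c * (l ^ 2 * t)) + l * Real.exp (-c * t))) *
            vecNorm p (blockVec χ j (dissPart u)) ∧
        vecNorm p (blockVec χ j (dissPart (fullFlow A D t u) - dissPart (profile A D u t))) ≤
          ENNReal.ofReal (C * (l ^ 2 * Real.exp (-c * (l ^ 2 * t)) + l * Real.exp (-c * t))) *
            vecNorm p (blockVec χ j (consPart u)) +
          ENNReal.ofReal (C * (l ^ 3 * Real.exp (-c * (l ^ 2 * t)) + Real.exp (-c * t))) *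
            vecNorm p (blockVec χ j (dissPart u)) := by
  obtain ⟨c₀, hc₀, hacc⟩ := hA.exists_gReg_accretive hχ
  obtain ⟨c₁, hc₁, haccD⟩ := exists_accretive_cmat hA.posDef
  have hs₁₂ := hχ.symbolMatrix_annSymb (blk₁₂ A)
  have hs₂₁ := hχ.symbolMatrix_annSymb (blk₂₁ A)
  have hs₂₂ := hχ.symbolMatrix_annSymb (blk₂₂ A)
  have hsK := hχ.symbolMatrix_coSymb n₁
  have hsD : SymbolMatrix fun _ : Space d => cmat D := .const _
  have hsDi : SymbolMatrix fun _ : Space d => cmat D⁻¹ := .const _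
  obtain ⟨t₁, ht₁, hG⟩ := exists_norm_exp_opMat_le_half (p := p) hp₁ hp₂
    (hχ.symbolMatrix_gReg (A := A) (D := D)) hc₀ hacc
  obtain ⟨t₂, ht₂, hD⟩ := exists_norm_exp_opMat_le_half (p := p) hp₁ hp₂ hsD hc₁ fun _ => haccD
  -- The regularised diffusion operator is exactly the operator `K + a₁₂ D⁻¹ a₂₁` of
  -- `exists_block_decay`.
  have eG : opMat p (gReg χ A D) = opMat p (coSymb χ n₁) + (opMat p (annSymb χ (blk₁₂ A))).comp
      ((opMat p fun _ => cmat D⁻¹).comp (opMat p (annSymb χ (blk₂₁ A)))) := by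
    rw [← opMat_mul hp₁ hp₂ hsDi hs₂₁, ← opMat_mul hp₁ hp₂ hs₁₂ (hsDi.mul hs₂₁),
      ← opMat_add hp₁ hp₂ hsK (hs₁₂.mul (hsDi.mul hs₂₁))]
    rfl
  have hDi₁ : ∀ x, opMat p (fun _ : Space d => cmat D) (opMat p (fun _ => cmat D⁻¹) x) = x := by
    intro x
    rw [← ContinuousLinearMap.comp_apply, ← opMat_mul hp₁ hp₂ hsD hsDi, hA.cmat_mul_inv,
      opMat_one hp₁ hp₂]
    rfl
  have hDi₂ : ∀ x, opMat p (fun _ : Space d => cmat D⁻¹) (opMat p (fun _ => cmat D) x) = x := by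
    intro x
    rw [← ContinuousLinearMap.comp_apply, ← opMat_mul hp₁ hp₂ hsDi hsD, hA.cmat_inv_mul,
      opMat_one hp₁ hp₂]
    rfl
  obtain ⟨C, c, l₀, hC, hc, hl₀, hl₀1, h⟩ := exists_block_decay (opMat p (coSymb χ n₁))
    (opMat p (annSymb χ (blk₁₂ A))) (opMat p (annSymb χ (blk₂₁ A)))
    (opMat p (annSymb χ (blk₂₂ A))) (opMat p fun _ => cmat D) (opMat p fun _ => cmat D⁻¹)
    hDi₁ hDi₂ ht₁ ht₂ (by rw [← eG]; exact hG) hD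
  rw [← eG] at h
  refine ⟨((n₁ : ℝ) + n₂ + 1) * C, c, l₀, by positivity, hc, hl₀, hl₀1,
    fun j hj t ht u l hl => ?_⟩
  have hl0 : 0 < l := by rw [hl]; positivity
  rw [← hl] at hj
  set N₁ := vecNorm p (blockVec χ j (consPart u)) with hN₁
  set N₂ := vecNorm p (blockVec χ j (dissPart u)) with hN₂
  have hpos : ∀ {x : ℝ}, 0 < x → ENNReal.ofReal (((n₁ : ℝ) + n₂ + 1) * C * x) ≠ 0 := fun hx =>
    (ENNReal.ofReal_pos.2 (by positivity)).ne'
  -- All coefficients on the right are positive, so an infinite data block makes both estimates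
  -- trivial.
  by_cases hN₁t : N₁ = ⊤
  · rw [hN₁t, ENNReal.mul_top (hpos (by positivity)), ENNReal.mul_top (hpos (by positivity)),
      top_add, top_add]
    exact ⟨le_top, le_top⟩
  by_cases hN₂t : N₂ = ⊤
  · rw [hN₂t, ENNReal.mul_top (hpos (by positivity)), ENNReal.mul_top (hpos (by positivity)),
      add_top, add_top]
    exact ⟨le_top, le_top⟩
  -- Finite blocks are `L^p` functions, so the estimates for differential equations in the Banach
  -- space `LpVec` apply to them.
  have hfin : ∀ {m : ℕ} (w : Fin m → TDist d), vecNorm p (blockVec χ j w) ≠ ⊤ →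
      ∃ f : LpVec d p (Fin m), scaledBlock χ j w = vecTD f := fun w hw =>
    exists_toTD_of_vecNorm_lt_top (p := p) (by
      rw [vecNorm_scaledBlock hχ]
      exact ENNReal.mul_lt_top (lt_top_iff_ne_top.2 (dilFactor_ne_top _))
        (lt_top_iff_ne_top.2 hw))
  obtain ⟨f₁, hf₁⟩ := hfin _ hN₁t
  obtain ⟨f₂, hf₂⟩ := hfin _ hN₂t
  set f : LpVec d p (Fin n₁ ⊕ Fin n₂) := Sum.elim f₁ f₂ with hf
  have hfu : scaledBlock χ j u = vecTD f := by
    ext1 x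
    rcases x with a | b
    · exact congrFun hf₁ a
    · exact congrFun hf₂ b
  set T := opMat p (fReg χ A D l) with hT
  set v : ℝ → LpVec d p (Fin n₁ ⊕ Fin n₂) := fun t => NormedSpace.exp ((-t) • T) f with hv
  have hvd : ∀ t, HasDerivAt v (-(T (v t))) t := hasDerivAt_exp_neg_smul_apply T f
  have hTv := fun g => opMat_fromBlocks (p := p) hp₁ hp₂
    (hsK.const_smul ((l : ℂ) ^ 2)) (hs₁₂.const_smul ((l : ℂ) * Complex.I))
    (hs₂₁.const_smul ((l : ℂ) * Complex.I)) (hsD.add (hs₂₂.const_smul ((l : ℂ) * Complex.I))) g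
  let P₁ : LpVec d p (Fin n₁ ⊕ Fin n₂) →L[ℂ] LpVec d p (Fin n₁) :=
    ContinuousLinearMap.pi fun a => ContinuousLinearMap.proj (Sum.inl a)
  let P₂ : LpVec d p (Fin n₁ ⊕ Fin n₂) →L[ℂ] LpVec d p (Fin n₂) :=
    ContinuousLinearMap.pi fun a => ContinuousLinearMap.proj (Sum.inr a)
  have hv0 : v 0 = f := by
    have h0 : (-(0 : ℝ)) • T = 0 := by
      ext x : 1
      simp
    simp only [hv]
    rw [h0, NormedSpace.exp_zero]
    rfl
  have hd₁ : ∀ t, HasDerivAt (fun t => P₁ (v t)) (-(((l : ℂ) ^ 2) • opMat p (coSymb χ n₁) (P₁ (v t)) +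
      ((l : ℂ) * Complex.I) • opMat p (annSymb χ (blk₁₂ A)) (P₂ (v t)))) t := fun t => by
    have h1 := (P₁.restrictScalars ℝ).hasFDerivAt.comp_hasDerivAt t (hvd t)
    refine h1.congr_deriv ?_
    have h2 := (hTv (v t)).1
    rw [opMat_const_smul hp₁ hp₂ _ hsK, opMat_const_smul hp₁ hp₂ _ hs₁₂] at h2
    rw [ContinuousLinearMap.coe_restrictScalars', map_neg]
    exact congrArg Neg.neg h2
  have hd₂ : ∀ t, HasDerivAt (fun t => P₂ (v t))
      (-(((l : ℂ) * Complex.I) • opMat p (annSymb χ (blk₂₁ A)) (P₁ (v t)) +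
        opMat p (fun _ => cmat D) (P₂ (v t)) +
        ((l : ℂ) * Complex.I) • opMat p (annSymb χ (blk₂₂ A)) (P₂ (v t)))) t := fun t => by
    have h1 := (P₂.restrictScalars ℝ).hasFDerivAt.comp_hasDerivAt t (hvd t)
    refine h1.congr_deriv ?_
    have h2 := (hTv (v t)).2
    rw [opMat_const_smul hp₁ hp₂ _ hs₂₁, opMat_add hp₁ hp₂ hsD (hs₂₂.const_smul _),
      opMat_const_smul hp₁ hp₂ _ hs₂₂] at h2
    rw [ContinuousLinearMap.coe_restrictScalars', map_neg, add_assoc]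
    exact congrArg Neg.neg h2
  obtain ⟨k1, k2⟩ := h l hl0 hj (fun t => P₁ (v t)) (fun t => P₂ (v t)) hd₁ hd₂ t ht _ rfl
  have e₁ : P₁ (v 0) = f₁ := by
    rw [hv0]
    rfl
  have e₂ : P₂ (v 0) = f₂ := by
    rw [hv0]
    rfl
  rw [e₁, e₂] at k1 k2
  set ψ := f₁ - ((l : ℂ) * Complex.I) • opMat p (annSymb χ (blk₁₂ A))
    (opMat p (fun _ => cmat D⁻¹) f₂) with hψ
  set S := NormedSpace.exp ((-(l ^ 2 * t)) • opMat p (gReg χ A D)) ψ with hS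
  -- The abstract initial value and profile of the Banach space estimate are identified with the
  -- blocks of `Ψ₀` and of `V^*`.
  have eψ : scaledBlock χ j (effective A D u) = vecTD ψ := by
    rw [scaledBlock_effective hχ, hf₁, hf₂, ← vecTD_opMat hp₁ hp₂ ((hs₁₂.mul hsDi).const_smul _),
      ← vecTD_sub, opMat_const_smul hp₁ hp₂ _ (hs₁₂.mul hsDi), opMat_mul hp₁ hp₂ hs₁₂ hsDi, ← hl]
    rfl
  have eS : scaledBlock χ j (diffusionFlow A D t (effective A D u)) = vecTD S := by
    rw [scaledBlock_diffusionFlow hχ hA ht, eψ, matMul_exp_vecTD hp₁ hp₂ hχ.symbolMatrix_gReg, ← hl]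
  have eW : scaledBlock χ j (dissPart (profile A D u t)) =
      vecTD (-(((l : ℂ) * Complex.I) • opMat p (fun _ => cmat D⁻¹)
        (opMat p (annSymb χ (blk₂₁ A)) S))) := by
    rw [scaledBlock_profile hχ, eS, ← vecTD_opMat hp₁ hp₂ ((hsDi.mul hs₂₁).const_smul _).neg,
      opMat_neg hp₁ hp₂ ((hsDi.mul hs₂₁).const_smul _),
      opMat_const_smul hp₁ hp₂ _ (hsDi.mul hs₂₁), opMat_mul hp₁ hp₂ hsDi hs₂₁, ← hl]
    rfl
  have ev : scaledBlock χ j (fullFlow A D t u) = vecTD (v t) := by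
    rw [scaledBlock_fullFlow hχ hA ht, hfu, matMul_exp_vecTD hp₁ hp₂ (hχ.symbolMatrix_fReg _), ← hl]
  have ev₁ : scaledBlock χ j (consPart (fullFlow A D t u)) = vecTD (P₁ (v t)) :=
    funext fun a => congrFun ev (Sum.inl a)
  have ev₂ : scaledBlock χ j (dissPart (fullFlow A D t u)) = vecTD (P₂ (v t)) :=
    funext fun a => congrFun ev (Sum.inr a)
  have hcard : ∀ {m : ℕ} {x : ℝ}, (m : ℝ) ≤ (n₁ : ℝ) + n₂ + 1 → 0 ≤ x →
      ENNReal.ofReal (Fintype.card (Fin m) * (C * x)) ≤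
        ENNReal.ofReal (((n₁ : ℝ) + n₂ + 1) * C * x) := fun hm hx => by
    rw [Fintype.card_fin, ← mul_assoc]
    exact ENNReal.ofReal_le_ofReal (by gcongr)
  have hn₁ : (0 : ℝ) ≤ n₁ := by positivity
  have hn₂ : (0 : ℝ) ≤ n₂ := by positivity
  have haux : ∀ a b x y : ℝ, C * (a * x + b * y) = C * a * x + C * b * y := fun a b x y => by ring
  constructor
  · refine vecNorm_blockVec_le_of_scaledBlock hχ ?_
    rw [scaledBlock_sub, ev₁, hf₁, hf₂, show scaledBlock χ j (consPart (profile A D u t)) = _ from eS,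
      ← vecTD_sub]
    refine (vecNorm_vecTD_le_of_norm_le (a := C * (l * Real.exp (-c * (l ^ 2 * t))))
      (b := C * (l ^ 2 * Real.exp (-c * (l ^ 2 * t)) + l * Real.exp (-c * t)))
      (by positivity) (by positivity) (k1.trans_eq (haux _ _ _ _))).trans ?_
    exact add_le_add (mul_le_mul_left (hcard (by linarith) (by positivity)) _)
      (mul_le_mul_left (hcard (by linarith) (by positivity)) _)
  · refine vecNorm_blockVec_le_of_scaledBlock hχ ?_
    rw [scaledBlock_sub, ev₂, hf₁, hf₂, eW, ← vecTD_sub, sub_neg_eq_add]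
    refine (vecNorm_vecTD_le_of_norm_le
      (a := C * (l ^ 2 * Real.exp (-c * (l ^ 2 * t)) + l * Real.exp (-c * t)))
      (b := C * (l ^ 3 * Real.exp (-c * (l ^ 2 * t)) + Real.exp (-c * t)))
      (by positivity) (by positivity) (k2.trans_eq (haux _ _ _ _))).trans ?_
    exact add_le_add (mul_le_mul_left (hcard (by linarith) (by positivity)) _)
      (mul_le_mul_left (hcard (by linarith) (by positivity)) _)

end LowBlockDecay

/-! ### Frequency localisation of the flow, the effective quantity and the profile -/

section Localisation

variable {d n₁ n₂ : ℕ} {χ : Space d → ℝ} {p : ℝ≥0∞} [hp : Fact (1 ≤ p)]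
  {A : Fin d → Matrix (Fin n₁ ⊕ Fin n₂) (Fin n₁ ⊕ Fin n₂) ℝ} {D : Matrix (Fin n₂) (Fin n₂) ℝ}
  {ι κ : Type} [Fintype ι] [Fintype κ]

lemma IsCutoff.isSymbol_low (hχ : IsCutoff χ) (J : ℤ) :
    IsSymbol fun ξ : Space d => ((χ ((2 : ℝ) ^ (-J) • ξ) : ℝ) : ℂ) :=
  hχ.isSymbol.comp_smul (zpow_ne_zero _ two_ne_zero)

lemma IsCutoff.isSymbol_block (hχ : IsCutoff χ) (j : ℤ) :
    IsSymbol fun ξ : Space d => ((annulusBump χ ((2 : ℝ) ^ (-j) • ξ) : ℝ) : ℂ) :=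
  hχ.isSymbol_annulusBump.ofReal.comp_smul (zpow_ne_zero _ two_ne_zero)

lemma IsCutoff.hasCompactSupport_low (hχ : IsCutoff χ) (J : ℤ) :
    HasCompactSupport fun ξ : Space d => ((χ ((2 : ℝ) ^ (-J) • ξ) : ℝ) : ℂ) := by
  refine hasCompactSupport_of_eq_zero (R := 4 / 3 * (2 : ℝ) ^ J) fun ξ hξ => ?_
  rw [hχ.eq_zero, Complex.ofReal_zero]
  rw [norm_smul, Real.norm_of_nonneg (by positivity), zpow_neg, ← div_eq_inv_mul]
  exact (le_div_iff₀ (by positivity)).2 hξ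

lemma IsCutoff.hasCompactSupport_block (hχ : IsCutoff χ) (j : ℤ) :
    HasCompactSupport fun ξ : Space d => ((annulusBump χ ((2 : ℝ) ^ (-j) • ξ) : ℝ) : ℂ) := by
  refine hasCompactSupport_of_eq_zero (R := 3 * (2 : ℝ) ^ j) fun ξ hξ => ?_
  by_contra h
  have h1 := (hχ.norm_of_annulusBump_ne_zero (Complex.ofReal_ne_zero.1 h)).2
  rw [norm_smul, Real.norm_of_nonneg (by positivity), zpow_neg, ← div_eq_inv_mul] at h1
  have h2 := (le_div_iff₀ (by positivity)).2 hξ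
  linarith

omit [Fintype ι] in
lemma lowFreq_matMul (hχ : IsCutoff χ) {M : Space d → Matrix ι κ ℂ} (hM : TemperateMatrix M)
    (J : ℤ) (u : κ → TDist d) : lowFreq χ J (matMul M u) = matMul M (lowFreq χ J u) := by
  have h := (hχ.isSymbol_low J).hasTemperateGrowth
  change _ = matMul M (fun b => multiplier _ (u b))
  rw [matMul_multiplier h hM]
  ext1 a
  exact multiplier_matMul h hM u a

omit [Fintype ι] in
lemma lowFreq_sub (J : ℤ) (u v : ι → TDist d) :
    lowFreq χ J (u - v) = lowFreq χ J u - lowFreq χ J v :=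
  funext fun a => multiplier_map_sub _ (u a) (v a)

omit [Fintype ι] in
lemma blockVec_sub (j : ℤ) (u v : ι → TDist d) :
    blockVec χ j (u - v) = blockVec χ j u - blockVec χ j v := by
  ext1 a
  simp only [blockVec, dyadicBlock, Pi.sub_apply, multiplier_map_sub]

/-- Disjoint supports: the bump of block `j ≥ J + 1` lives where `|ξ| ≥ (3/2) 2^J`, while the
low-frequency cut-off vanishes for `|ξ| ≥ (4/3) 2^J`. -/
lemma IsCutoff.annulusBump_mul_eq_zero (hχ : IsCutoff χ) {J j : ℤ} (h : J < j) (ξ : Space d) :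
    annulusBump χ ((2 : ℝ) ^ (-j) • ξ) * χ ((2 : ℝ) ^ (-J) • ξ) = 0 := by
  rw [mul_eq_zero, or_iff_not_imp_left]
  intro hξ
  have h1 := (hχ.norm_of_annulusBump_ne_zero hξ).1
  refine hχ.eq_zero ?_
  rw [norm_smul, Real.norm_of_nonneg (by positivity)] at h1 ⊢
  have h2 : (2 : ℝ) ^ (-J) = 2 ^ (j - J) * 2 ^ (-j) := by
    rw [← zpow_add₀ two_ne_zero]
    congr 1
    ring
  have h3 : (2 : ℝ) ≤ 2 ^ (j - J) := by
    calc (2 : ℝ) = 2 ^ (1 : ℤ) := by norm_num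
      _ ≤ _ := zpow_le_zpow_right₀ one_le_two (by omega)
  rw [h2, mul_assoc]
  have h4 := mul_le_mul h3 h1 (by norm_num) (by linarith)
  linarith

omit [Fintype ι] in
lemma blockVec_lowFreq_eq_zero (hχ : IsCutoff χ) {J j : ℤ} (h : J < j) (u : ι → TDist d) :
    blockVec χ j (lowFreq χ J u) = 0 := by
  ext1 a
  refine (multiplier_multiplier (hχ.isSymbol_block j).hasTemperateGrowth
    (hχ.isSymbol_low J).hasTemperateGrowth _).trans ?_
  refine Eq.trans (congrArg (fun m => multiplier m (u a)) ?_) (multiplier_zero (u a))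
  ext ξ
  exact (Complex.ofReal_mul _ _).symm.trans
    (by rw [hχ.annulusBump_mul_eq_zero h, Complex.ofReal_zero])

lemma lowFreq_diffusionFlow (hχ : IsCutoff χ) (hA : IsPartiallyDissipative A D) {t : ℝ}
    (ht : 0 ≤ t) (J : ℤ) (u : Fin n₁ → TDist d) :
    lowFreq χ J (diffusionFlow A D t u) = diffusionFlow A D t (lowFreq χ J u) := by
  rw [diffusionFlow_eq, diffusionFlow_eq, lowFreq_matMul hχ (hA.temperate_exp_gSymbol ht)]

lemma lowFreq_effective (hχ : IsCutoff χ) (J : ℤ) (u : Fin n₁ ⊕ Fin n₂ → TDist d) :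
    lowFreq χ J (effective A D u) = effective A D (lowFreq χ J u) := by
  rw [effective_eq, effective_eq, lowFreq_sub, lowFreq_matMul hχ
    (.smul (.const _) ((linSymb_temperate _).mul (.const _)))]
  rfl

lemma lowFreq_profile (hχ : IsCutoff χ) (hA : IsPartiallyDissipative A D) {t : ℝ}
    (ht : 0 ≤ t) (J : ℤ) (u : Fin n₁ ⊕ Fin n₂ → TDist d) :
    lowFreq χ J (profile A D u t) = profile A D (lowFreq χ J u) t := by
  have h1 : lowFreq χ J (diffusionFlow A D t (effective A D u)) =
      diffusionFlow A D t (effective A D (lowFreq χ J u)) := by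
    rw [lowFreq_diffusionFlow hχ hA ht, lowFreq_effective hχ]
  ext1 x
  rcases x with a | b
  · exact congrFun h1 a
  · have hM := TemperateMatrix.smul (.const Complex.I) ((TemperateMatrix.const (cmat D⁻¹)).mul
      (linSymb_temperate (blk₂₁ A)))
    have e := fun v => congrFun (profile_inr_eq (A := A) (D := D) v t) b
    rw [e, ← h1, ← lowFreq_matMul hχ hM]
    change multiplier _ (profile A D u t (Sum.inr b)) = _
    rw [e]
    exact multiplier_map_neg _ _

lemma lowFreq_fullFlow (hχ : IsCutoff χ) (hA : IsPartiallyDissipative A D) {t : ℝ}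
    (ht : 0 ≤ t) (J : ℤ) (u : Fin n₁ ⊕ Fin n₂ → TDist d) :
    lowFreq χ J (fullFlow A D t u) = fullFlow A D t (lowFreq χ J u) :=
  lowFreq_matMul hχ (hA.temperate_exp_fullSymbol ht) J u

lemma IsSolution.lowFreq_eq {V₀ : Fin n₁ ⊕ Fin n₂ → TDist d} {V : ℝ → Fin n₁ ⊕ Fin n₂ → TDist d}
    (hV : IsSolution A D V₀ V) (hχ : IsCutoff χ) (hA : IsPartiallyDissipative A D) {t : ℝ}
    (ht : 0 ≤ t) (J : ℤ) : lowFreq χ J (V t) = fullFlow A D t (lowFreq χ J V₀) := by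
  have h := hχ.isSymbol_low J
  refine (hV.multiplier_eq h.1 (hχ.hasCompactSupport_low J) ht).trans ?_
  exact (matMul_multiplier h.hasTemperateGrowth (hA.temperate_exp_fullSymbol ht) V₀).symm

/-- The wider bump is one on the block and can be inserted freely; it confines the symbol to an
annulus away from zero, where its exponential decays uniformly. -/
lemma IsSolution.blockVec_eq {V₀ : Fin n₁ ⊕ Fin n₂ → TDist d} {V : ℝ → Fin n₁ ⊕ Fin n₂ → TDist d}
    (hV : IsSolution A D V₀ V) (hχ : IsCutoff χ) (hA : IsPartiallyDissipative A D) {t : ℝ}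
    (ht : 0 ≤ t) (j : ℤ) : blockVec χ j (V t) =
      matMul (fun ξ => ((wideBump χ ((2 : ℝ) ^ (-j) • ξ) : ℝ) : ℂ) •
        NormedSpace.exp (-((t : ℂ) • fullSymbol A D ξ))) (blockVec χ j V₀) := by
  have h := hχ.isSymbol_block j
  have hw : IsSymbol fun ξ : Space d => ((wideBump χ ((2 : ℝ) ^ (-j) • ξ) : ℝ) : ℂ) :=
    hχ.isSymbol_wideBump.ofReal.comp_smul (zpow_ne_zero _ two_ne_zero)
  refine (hV.multiplier_eq h.1 (hχ.hasCompactSupport_block j) ht).trans ?_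
  refine Eq.trans ?_ (matMul_multiplier h.hasTemperateGrowth
    (TemperateMatrix.smul hw.hasTemperateGrowth (hA.temperate_exp_fullSymbol ht)) V₀).symm
  congr 1
  ext ξ : 1
  by_cases hξ : annulusBump χ ((2 : ℝ) ^ (-j) • ξ) = 0
  · simp only [hξ, Complex.ofReal_zero, zero_smul]
  · rw [hχ.wideBump_eq_one hξ, Complex.ofReal_one, one_smul]

/-- Exponential decay of the high frequency blocks of a solution. -/
lemma IsPartiallyDissipative.exists_highBlock_decay (hA : IsPartiallyDissipative A D)
    (hχ : IsCutoff χ) (J : ℤ) : ∃ C c : ℝ, 0 < C ∧ 0 < c ∧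
      ∀ {V₀ : Fin n₁ ⊕ Fin n₂ → TDist d} {V : ℝ → Fin n₁ ⊕ Fin n₂ → TDist d},
        IsSolution A D V₀ V → ∀ (j : ℤ), J ≤ j → ∀ t : ℝ, 0 ≤ t →
        vecNorm 2 (blockVec χ j (V t)) ≤
          ENNReal.ofReal (C * Real.exp (-c * t)) * vecNorm 2 (blockVec χ j V₀) := by
  -- The radius is the inner radius of the widened annulus for `j = J`, the lowest block under
  -- consideration.
  obtain ⟨C, c, hC, hc, h⟩ := hA.exists_norm_exp_fullSymbol_le (r := 3 / 8 * (2 : ℝ) ^ J)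
    (by positivity)
  refine ⟨(n₁ + n₂ + 1 : ℝ) * C, c, by positivity, hc, fun {V₀ V} hV j hj t ht => ?_⟩
  have hw : IsSymbol fun ξ : Space d => ((wideBump χ ((2 : ℝ) ^ (-j) • ξ) : ℝ) : ℂ) :=
    hχ.isSymbol_wideBump.ofReal.comp_smul (zpow_ne_zero _ two_ne_zero)
  rw [hV.blockVec_eq hχ hA ht]
  refine (vecNorm_two_matMul_le (TemperateMatrix.smul hw.hasTemperateGrowth
    (hA.temperate_exp_fullSymbol ht)) (K := C * Real.exp (-c * t)) (by positivity)
    (fun ξ a b => ?_) _).trans ?_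
  · rw [Matrix.smul_apply, smul_eq_mul, norm_mul, Complex.norm_real,
      Real.norm_of_nonneg (hχ.wideBump_nonneg _)]
    by_cases hξ : wideBump χ ((2 : ℝ) ^ (-j) • ξ) = 0
    · rw [hξ, zero_mul]
      positivity
    · refine (mul_le_of_le_one_left (norm_nonneg _) (hχ.wideBump_le_one _)).trans
        (h ξ ?_ t ht a b)
      have h1 := (hχ.norm_of_wideBump_ne_zero hξ).1
      rw [norm_smul, Real.norm_of_nonneg (by positivity), zpow_neg, ← div_eq_inv_mul,
        le_div_iff₀ (by positivity)] at h1
      refine le_trans ?_ h1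
      gcongr
      exact one_le_two
  · refine mul_le_mul_left ?_ _
    rw [← ENNReal.ofReal_natCast, ← ENNReal.ofReal_mul (by positivity)]
    refine ENNReal.ofReal_le_ofReal ?_
    rw [mul_assoc]
    refine mul_le_mul_of_nonneg_right ?_ (by positivity)
    rw [Fintype.card_sum, Fintype.card_fin, Fintype.card_fin]
    push_cast
    linarith

end Localisation

/-! ### Weighted dyadic sums -/

section DyadicSums

/-- The weighted sum `∑_j 2^{jα} a_j`. -/
def dyadicSum (α : ℝ) (a : ℤ → ℝ≥0∞) : ℝ≥0∞ :=
  ∑' j : ℤ, ENNReal.ofReal (((2 : ℝ) ^ j) ^ α) * a j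

lemma dyadicSum_mono {α : ℝ} {a b : ℤ → ℝ≥0∞} (h : ∀ j, a j ≤ b j) :
    dyadicSum α a ≤ dyadicSum α b :=
  ENNReal.tsum_le_tsum fun j => mul_le_mul_right (h j) _

lemma dyadicSum_add (α : ℝ) (a b : ℤ → ℝ≥0∞) :
    dyadicSum α (fun j => a j + b j) = dyadicSum α a + dyadicSum α b := by
  simp only [dyadicSum, mul_add]
  exact ENNReal.tsum_add

lemma dyadicSum_const_mul (α : ℝ) (x : ℝ≥0∞) (a : ℤ → ℝ≥0∞) :
    dyadicSum α (fun j => x * a j) = x * dyadicSum α a := by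
  rw [dyadicSum, dyadicSum, ← ENNReal.tsum_mul_left]
  exact tsum_congr fun j => by rw [mul_left_comm]

lemma dyadicSum_weight (α β : ℝ) (a : ℤ → ℝ≥0∞) :
    dyadicSum α (fun j => ENNReal.ofReal (((2 : ℝ) ^ j) ^ β) * a j) = dyadicSum (α + β) a := by
  refine tsum_congr fun j => ?_
  rw [← mul_assoc, ← ENNReal.ofReal_mul (by positivity), Real.rpow_add (by positivity)]

lemma le_dyadicSum (α : ℝ) (a : ℤ → ℝ≥0∞) (j : ℤ) :
    ENNReal.ofReal (((2 : ℝ) ^ j) ^ α) * a j ≤ dyadicSum α a :=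
  ENNReal.le_tsum (f := fun j : ℤ => ENNReal.ofReal (((2 : ℝ) ^ j) ^ α) * a j) j

/-- For `k → +∞` the Gaussian wins; for `k → -∞` the sum is geometric, which needs `α > 0`. -/
lemma summable_zpow_rpow_mul_exp {α c : ℝ} (hα : 0 < α) (hc : 0 < c) :
    Summable fun k : ℤ => ((2 : ℝ) ^ k) ^ α * Real.exp (-c * ((2 : ℝ) ^ k) ^ 2) := by
  refine summable_int_iff_summable_nat_and_neg.2 ⟨?_, ?_⟩
  · have h1 : Tendsto (fun n : ℕ => (2 : ℝ) ^ n) atTop atTop :=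
      tendsto_pow_atTop_atTop_of_one_lt one_lt_two
    have h2 := (tendsto_rpow_mul_exp_neg_mul_atTop_nhds_zero (α + 1) c hc).comp h1
    refine Summable.of_norm_bounded_eventually_nat (summable_geometric_two) ?_
    filter_upwards [h2.eventually_le_const zero_lt_one] with n hn
    have hx : (1 : ℝ) ≤ 2 ^ n := one_le_pow₀ one_le_two
    rw [Real.norm_of_nonneg (by positivity), zpow_natCast]
    simp only [Function.comp_apply] at hn
    rw [Real.rpow_add (by positivity), Real.rpow_one] at hn
    have h3 : Real.exp (-c * ((2 : ℝ) ^ n) ^ 2) ≤ Real.exp (-c * 2 ^ n) := by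
      refine Real.exp_le_exp.2 ?_
      have : (2 : ℝ) ^ n ≤ (2 ^ n) ^ 2 := le_self_pow₀ hx two_ne_zero
      nlinarith
    calc _ ≤ ((2 : ℝ) ^ n) ^ α * Real.exp (-c * 2 ^ n) := by gcongr
      _ ≤ 1 / 2 ^ n := by
          rw [le_div_iff₀ (by positivity)]
          linarith
      _ = _ := by rw [one_div_pow]
  · refine Summable.of_nonneg_of_le (fun n => by positivity) (fun n => ?_)
      (summable_geometric_of_lt_one (r := ((2 : ℝ) ^ α)⁻¹) (by positivity)
        (inv_lt_one_of_one_lt₀ (Real.one_lt_rpow one_lt_two hα)))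
    have h1 : Real.exp (-c * ((2 : ℝ) ^ (-(n : ℤ))) ^ 2) ≤ 1 := by
      rw [Real.exp_le_one_iff, neg_mul]
      exact neg_nonpos.2 (by positivity)
    refine (mul_le_of_le_one_right (by positivity) h1).trans_eq ?_
    rw [zpow_neg, zpow_natCast, Real.inv_rpow (by positivity), inv_pow, ← Real.rpow_natCast,
      ← Real.rpow_mul two_pos.le, mul_comm, Real.rpow_mul two_pos.le, Real.rpow_natCast]

lemma tsum_exp_ne_top {α c : ℝ} (hα : 0 < α) (hc : 0 < c) :
    ∑' k : ℤ, ENNReal.ofReal (((2 : ℝ) ^ k) ^ α * Real.exp (-c * ((2 : ℝ) ^ k) ^ 2)) ≠ ⊤ :=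
  (summable_zpow_rpow_mul_exp hα hc).tsum_ofReal_ne_top

/-- Scale invariance: for `t` comparable to `4^m`, shifting the index by `m` reduces the sum to its
value at time one and produces the factor `2^{-mα}`, of order `t^{-α/2}`. -/
lemma exists_dyadicSum_exp_le {α c : ℝ} (hα : 0 < α) (hc : 0 < c) : ∃ K : ℝ, 0 < K ∧
    ∀ t : ℝ, 0 < t → dyadicSum α (fun j => ENNReal.ofReal (Real.exp (-c * (((2 : ℝ) ^ j) ^ 2 * t)))) ≤
      ENNReal.ofReal (K * t ^ (-(α / 2))) := by
  set F := ∑' k : ℤ, ENNReal.ofReal (((2 : ℝ) ^ k) ^ α * Real.exp (-c * ((2 : ℝ) ^ k) ^ 2)) with hF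
  have hFt : F ≠ ⊤ := tsum_exp_ne_top hα hc
  refine ⟨2 ^ α * (F.toReal + 1), by positivity, fun t ht => ?_⟩
  obtain ⟨m, hm1, hm2⟩ := exists_mem_Ico_zpow (Real.sqrt_pos.2 ht) (one_lt_two (α := ℝ))
  have hm3 : ((2 : ℝ) ^ m) ^ 2 ≤ t := by
    calc _ ≤ Real.sqrt t ^ 2 := by gcongr
      _ = t := Real.sq_sqrt ht.le
  have h1 : ∀ j : ℤ, ENNReal.ofReal (((2 : ℝ) ^ j) ^ α) *
      ENNReal.ofReal (Real.exp (-c * (((2 : ℝ) ^ j) ^ 2 * t))) ≤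
      ENNReal.ofReal (((2 : ℝ) ^ m) ^ (-α)) * ENNReal.ofReal
        (((2 : ℝ) ^ (j + m)) ^ α * Real.exp (-c * ((2 : ℝ) ^ (j + m)) ^ 2)) := fun j => by
    rw [← ENNReal.ofReal_mul (by positivity), ← ENNReal.ofReal_mul (by positivity)]
    refine ENNReal.ofReal_le_ofReal ?_
    have h2 : ((2 : ℝ) ^ m) ^ (-α) * ((2 : ℝ) ^ (j + m)) ^ α = ((2 : ℝ) ^ j) ^ α := by
      rw [zpow_add₀ two_ne_zero, Real.mul_rpow (by positivity) (by positivity), mul_left_comm,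
        ← Real.rpow_add (by positivity), neg_add_cancel, Real.rpow_zero, mul_one]
    rw [← mul_assoc (((2 : ℝ) ^ m) ^ (-α)), h2, zpow_add₀ two_ne_zero, mul_pow]
    refine mul_le_mul_of_nonneg_left (Real.exp_le_exp.2 ?_) (by positivity)
    have h3 := mul_le_mul_of_nonneg_left hm3 (sq_nonneg ((2 : ℝ) ^ j))
    rw [neg_mul, neg_mul]
    exact neg_le_neg (mul_le_mul_of_nonneg_left h3 hc.le)
  calc _ ≤ _ := ENNReal.tsum_le_tsum h1
    _ = ENNReal.ofReal (((2 : ℝ) ^ m) ^ (-α)) * F := by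
        rw [ENNReal.tsum_mul_left]
        congr 1
        exact (Equiv.addRight m).tsum_eq fun k : ℤ =>
          ENNReal.ofReal (((2 : ℝ) ^ k) ^ α * Real.exp (-c * ((2 : ℝ) ^ k) ^ 2))
    _ ≤ ENNReal.ofReal (((2 : ℝ) ^ m) ^ (-α)) * ENNReal.ofReal (F.toReal + 1) := by
        gcongr
        exact (ENNReal.ofReal_toReal hFt).ge.trans (ENNReal.ofReal_le_ofReal (by linarith))
    _ ≤ _ := by
        rw [← ENNReal.ofReal_mul (by positivity)]
        refine ENNReal.ofReal_le_ofReal ?_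
        have h2 : ((2 : ℝ) ^ m) ^ (-α) ≤ 2 ^ α * t ^ (-(α / 2)) := by
          have h3 : Real.sqrt t / 2 ≤ 2 ^ m := by
            rw [zpow_add_one₀ two_ne_zero] at hm2
            linarith
          have h4 := Real.sqrt_pos.2 ht
          refine (Real.rpow_le_rpow_of_nonpos (by positivity) h3 (by linarith)).trans_eq ?_
          rw [Real.div_rpow h4.le two_pos.le, Real.sqrt_eq_rpow, ← Real.rpow_mul ht.le,
            Real.rpow_neg two_pos.le, div_inv_eq_mul, mul_comm]
          congr 2
          ring
        calc _ ≤ 2 ^ α * t ^ (-(α / 2)) * (F.toReal + 1) := by gcongr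
          _ = _ := by ring

lemma sqrt_one_add_sq_pos (t : ℝ) : 0 < Real.sqrt (1 + t ^ 2) := Real.sqrt_pos.2 (by positivity)

lemma one_add_rpow_le {θ t : ℝ} (hθ : 0 ≤ θ) (ht : 0 ≤ t) :
    (1 + t) ^ (-θ) ≤ Real.sqrt (1 + t ^ 2) ^ (-θ) := by
  refine Real.rpow_le_rpow_of_nonpos (sqrt_one_add_sq_pos t) ?_ (by linarith)
  rw [Real.sqrt_le_left (by positivity)]
  nlinarith

/-- Raise `y ≤ e^y` to the power `θ` at `y = c(1+t)/θ`. It turns exponential decay into any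
polynomial rate. -/
lemma exp_neg_le_rpow {θ c t : ℝ} (hθ : 0 < θ) (hc : 0 < c) (ht : 0 ≤ t) :
    Real.exp (-c * t) ≤ (θ / c) ^ θ * Real.exp c * Real.sqrt (1 + t ^ 2) ^ (-θ) := by
  have hy : 0 < c / θ * (1 + t) := by positivity
  have h1 : c / θ * (1 + t) ≤ Real.exp (c / θ * (1 + t)) := by
    linarith [Real.add_one_le_exp (c / θ * (1 + t))]
  have h2 := Real.rpow_le_rpow hy.le h1 hθ.le
  rw [← Real.exp_mul, Real.mul_rpow (by positivity) (by positivity)] at h2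
  have h3 : c / θ * (1 + t) * θ = c + c * t := by field_simp
  rw [h3, Real.exp_add] at h2
  have h4 : (θ / c) ^ θ * (c / θ) ^ θ = 1 := by
    rw [← Real.mul_rpow (by positivity) (by positivity)]
    rw [show θ / c * (c / θ) = 1 by field_simp, Real.one_rpow]
  have h5 : (1 + t) ^ θ ≤ (θ / c) ^ θ * (Real.exp c * Real.exp (c * t)) := by
    calc (1 + t) ^ θ = (θ / c) ^ θ * ((c / θ) ^ θ * (1 + t) ^ θ) := by
          rw [← mul_assoc, h4, one_mul]
      _ ≤ _ := by gcongr
  have h6 : (0 : ℝ) < (1 + t) ^ θ := by positivity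
  calc Real.exp (-c * t) = Real.exp (-c * t) * (1 + t) ^ θ * (1 + t) ^ (-θ) := by
        rw [mul_assoc, ← Real.rpow_add (by positivity), add_neg_cancel, Real.rpow_zero, mul_one]
    _ ≤ Real.exp (-c * t) * ((θ / c) ^ θ * (Real.exp c * Real.exp (c * t))) *
        Real.sqrt (1 + t ^ 2) ^ (-θ) := by
        refine mul_le_mul ?_ (one_add_rpow_le hθ.le ht) (by positivity) (by positivity)
        gcongr
    _ = (θ / c) ^ θ * Real.exp c * (Real.exp (-c * t) * Real.exp (c * t)) *
        Real.sqrt (1 + t ^ 2) ^ (-θ) := by ring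
    _ = _ := by rw [← Real.exp_add, neg_mul, neg_add_cancel, Real.exp_zero, mul_one]

lemma rate_mono {C C' θ t : ℝ} (h : C ≤ C') : rate C θ t ≤ rate C' θ t :=
  ENNReal.ofReal_le_ofReal (by gcongr)

lemma rate_add {C C' θ t : ℝ} (hC : 0 ≤ C) (hC' : 0 ≤ C') :
    rate C θ t + rate C' θ t = rate (C + C') θ t := by
  rw [rate, rate, rate, ← ENNReal.ofReal_add (by positivity) (by positivity), add_mul]

lemma ofReal_mul_rate {B C θ t : ℝ} (hB : 0 ≤ B) :
    ENNReal.ofReal B * rate C θ t = rate (B * C) θ t := by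
  rw [rate, rate, ← ENNReal.ofReal_mul hB, mul_assoc]

lemma one_le_sqrt_one_add_sq (t : ℝ) : 1 ≤ Real.sqrt (1 + t ^ 2) :=
  Real.one_le_sqrt.2 (by nlinarith [sq_nonneg t])

lemma rate_anti {C θ θ' t : ℝ} (hC : 0 ≤ C) (h : θ ≤ θ') : rate C θ' t ≤ rate C θ t :=
  ENNReal.ofReal_le_ofReal (mul_le_mul_of_nonneg_left
    (Real.rpow_le_rpow_of_exponent_le (one_le_sqrt_one_add_sq t) (by linarith)) hC)

lemma rate_le_rpow {C θ t : ℝ} (hC : 0 ≤ C) (hθ : 0 ≤ θ) (ht : 0 < t) :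
    rate C θ t ≤ ENNReal.ofReal (C * t ^ (-θ)) := by
  refine ENNReal.ofReal_le_ofReal (mul_le_mul_of_nonneg_left ?_ hC)
  refine Real.rpow_le_rpow_of_nonpos ht ?_ (by linarith)
  exact Real.le_sqrt_of_sq_le (by linarith)

/-- A faster decaying error does not affect a lower bound for large times. -/
lemma exists_rate_le_of_le_add {c K θ : ℝ} (hc : 0 < c) (hK : 0 < K) : ∃ t₁ : ℝ, 0 < t₁ ∧
    ∀ t : ℝ, t₁ ≤ t → ∀ x y : ℝ≥0∞, rate c θ t ≤ x + y → y ≤ rate K (θ + 1 / 2) t →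
      rate (c / 2) θ t ≤ x := by
  -- From this time on the extra factor of order `t^{-1/2}` makes the error at most half of the
  -- lower bound.
  refine ⟨(2 * K / c) ^ 2, by positivity, fun t ht x y h1 h2 => ?_⟩
  have ht0 : 0 < t := lt_of_lt_of_le (by positivity) ht
  have h3 : rate K (θ + 1 / 2) t ≤ rate (c / 2) θ t := by
    refine ENNReal.ofReal_le_ofReal ?_
    set s := Real.sqrt (1 + t ^ 2) with hs
    have hs0 : 0 < s := sqrt_one_add_sq_pos t
    have hts : t ≤ s := Real.le_sqrt_of_sq_le (by linarith)
    have h4 : 2 * K / c ≤ s ^ (1 / 2 : ℝ) := by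
      rw [← Real.sqrt_eq_rpow]
      exact Real.le_sqrt_of_sq_le (ht.trans hts)
    rw [div_le_iff₀ hc] at h4
    rw [neg_add, Real.rpow_add hs0, Real.rpow_neg hs0.le (1 / 2)]
    have h5 : 0 < s ^ (1 / 2 : ℝ) := by positivity
    calc _ = s ^ (-θ) * (K * (s ^ (1 / 2 : ℝ))⁻¹) := by ring
      _ ≤ s ^ (-θ) * (c / 2) := by
          gcongr
          rw [← div_eq_mul_inv, div_le_iff₀ h5]
          linarith
      _ = _ := by ring
  have h6 : rate (c / 2) θ t + rate (c / 2) θ t ≤ x + rate (c / 2) θ t := by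
    rw [rate_add (by positivity) (by positivity), add_halves]
    exact h1.trans (by gcongr; exact h2.trans h3)
  exact (ENNReal.add_le_add_iff_right ENNReal.ofReal_ne_top).1 h6

/-- Decay of weighted sums over low frequencies. -/
lemma exists_dyadicSum_le_rate {α c : ℝ} (k : ℕ) (hα : 0 < α) (hc : 0 < c) : ∃ K : ℝ, 0 < K ∧
    ∀ (B t : ℝ) (a : ℤ → ℝ≥0∞), 0 ≤ B → 0 ≤ t → (∀ j, 0 < j → a j = 0) →
      (∀ j : ℤ, j ≤ 0 → a j ≤ ENNReal.ofReal (B * (((2 : ℝ) ^ j) ^ k *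
        Real.exp (-c * (((2 : ℝ) ^ j) ^ 2 * t)) + Real.exp (-c * t)))) →
      dyadicSum α a ≤ rate (B * K) ((α + k) / 2) t := by
  have hαk : 0 < α + k := by positivity
  obtain ⟨K₁, hK₁, h₁⟩ := exists_dyadicSum_exp_le hαk hc
  obtain ⟨K₂, hK₂, h₂⟩ := exists_dyadicSum_exp_le hα hc
  set P := ((α + k) / 2 / c) ^ ((α + k) / 2) * Real.exp c with hP
  have hP0 : 0 < P := by positivity
  refine ⟨Real.exp c * K₁ + Real.exp c * K₂ * P, by positivity, fun B t a hB ht h0 ha => ?_⟩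
  have hle : ∀ (j : ℤ), j ≤ 0 → ((2 : ℝ) ^ j) ^ 2 ≤ 1 := fun j hj =>
    pow_le_one₀ (by positivity) (zpow_le_one_of_nonpos₀ one_le_two hj)
  -- For `j ≤ 0` one has `4^j ≤ 1`, so `t` may be replaced by `1 + t` at the cost of `e^c`. This
  -- makes the rate uniform down to `t = 0`.
  have hexp : ∀ (j : ℤ), j ≤ 0 → ∀ s : ℝ, Real.exp (-c * (((2 : ℝ) ^ j) ^ 2 * s)) ≤
      Real.exp c * Real.exp (-c * (((2 : ℝ) ^ j) ^ 2 * (1 + s))) := fun j hj s => by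
    rw [← Real.exp_add]
    refine Real.exp_le_exp.2 ?_
    have := mul_le_mul_of_nonneg_left (hle j hj) hc.le
    nlinarith
  have key : ∀ j, a j ≤ ENNReal.ofReal (B * Real.exp c) * (ENNReal.ofReal (((2 : ℝ) ^ j) ^ (k : ℝ)) *
      ENNReal.ofReal (Real.exp (-c * (((2 : ℝ) ^ j) ^ 2 * (1 + t))))) +
      ENNReal.ofReal (B * Real.exp c * Real.exp (-c * t)) *
        ENNReal.ofReal (Real.exp (-c * (((2 : ℝ) ^ j) ^ 2 * 1))) := fun j => by
    rcases lt_or_ge 0 j with hj | hj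
    · rw [h0 j hj]
      exact zero_le
    · refine (ha j hj).trans ?_
      rw [← ENNReal.ofReal_mul (by positivity), ← ENNReal.ofReal_mul (by positivity),
        ← ENNReal.ofReal_mul (by positivity), ← ENNReal.ofReal_add (by positivity) (by positivity)]
      refine ENNReal.ofReal_le_ofReal ?_
      rw [Real.rpow_natCast]
      have h3 := hexp j hj t
      have h4 := hexp j hj 0
      rw [mul_zero, mul_zero, Real.exp_zero, add_zero] at h4
      calc B * (((2 : ℝ) ^ j) ^ k * Real.exp (-c * (((2 : ℝ) ^ j) ^ 2 * t)) + Real.exp (-c * t))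
          = B * (((2 : ℝ) ^ j) ^ k * Real.exp (-c * (((2 : ℝ) ^ j) ^ 2 * t)) +
            1 * Real.exp (-c * t)) := by rw [one_mul]
        _ ≤ B * (((2 : ℝ) ^ j) ^ k * (Real.exp c * Real.exp (-c * (((2 : ℝ) ^ j) ^ 2 * (1 + t)))) +
            Real.exp c * Real.exp (-c * (((2 : ℝ) ^ j) ^ 2 * 1)) * Real.exp (-c * t)) := by gcongr
        _ = _ := by ring
  refine (dyadicSum_mono key).trans ?_
  rw [dyadicSum_add, dyadicSum_const_mul, dyadicSum_const_mul, dyadicSum_weight]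
  have e1 : dyadicSum (α + k) (fun j =>
      ENNReal.ofReal (Real.exp (-c * (((2 : ℝ) ^ j) ^ 2 * (1 + t))))) ≤ rate K₁ ((α + k) / 2) t := by
    refine (h₁ (1 + t) (by positivity)).trans (ENNReal.ofReal_le_ofReal ?_)
    exact mul_le_mul_of_nonneg_left (one_add_rpow_le (by positivity) ht) hK₁.le
  have e2 : ENNReal.ofReal (Real.exp (-c * t)) ≤ rate P ((α + k) / 2) t :=
    ENNReal.ofReal_le_ofReal (exp_neg_le_rpow (by positivity) hc ht)
  have e3 := h₂ 1 one_pos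
  rw [Real.one_rpow, mul_one] at e3
  calc _ ≤ ENNReal.ofReal (B * Real.exp c) * rate K₁ ((α + k) / 2) t +
        ENNReal.ofReal (B * Real.exp c) * rate P ((α + k) / 2) t * ENNReal.ofReal K₂ := by
        rw [ENNReal.ofReal_mul (p := B * Real.exp c) (by positivity)]
        gcongr
    _ = _ := by
        rw [mul_comm _ (ENNReal.ofReal K₂), ofReal_mul_rate (by positivity),
          ofReal_mul_rate (by positivity), ofReal_mul_rate (by positivity),
          rate_add (by positivity) (by positivity)]
        congr 1
        ring

end DyadicSums

/-! ### Decay of sequences of dyadic blocks -/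

section FlowBlocks

/-- Sizes of the dyadic blocks of the data (`N₁`, `N₂`), of the effective quantity (`E`), of the
diffusive profile (`S`, `W`), of the solution (`u`, `w`) and of their difference (`d₁`, `d₂`). -/
structure FlowBlocks where
  N₁ : ℤ → ℝ≥0∞
  N₂ : ℤ → ℝ≥0∞
  E : ℤ → ℝ≥0∞
  S : ℝ → ℤ → ℝ≥0∞
  W : ℝ → ℤ → ℝ≥0∞
  u : ℝ → ℤ → ℝ≥0∞
  w : ℝ → ℤ → ℝ≥0∞
  d₁ : ℝ → ℤ → ℝ≥0∞
  d₂ : ℝ → ℤ → ℝ≥0∞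

/-- The relations between the blocks, for data with frequencies below `2^J`. -/
structure FlowBlocks.Estimates (b : FlowBlocks) (C c : ℝ) (J : ℤ) : Prop where
  C_pos : 0 < C
  c_pos : 0 < c
  supp : ∀ j, J < j → b.N₁ j = 0 ∧ b.N₂ j = 0
  d₁_le : ∀ t, 0 ≤ t → ∀ j, b.d₁ t j ≤
    ENNReal.ofReal (C * ((2 : ℝ) ^ j * Real.exp (-c * (((2 : ℝ) ^ j) ^ 2 * t)))) * b.N₁ j +
    ENNReal.ofReal (C * ((2 : ℝ) ^ j * Real.exp (-c * (((2 : ℝ) ^ j) ^ 2 * t)) +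
      Real.exp (-c * t))) * b.N₂ j
  d₂_le : ∀ t, 0 ≤ t → ∀ j, b.d₂ t j ≤
    ENNReal.ofReal (C * (((2 : ℝ) ^ j) ^ 3 * Real.exp (-c * (((2 : ℝ) ^ j) ^ 2 * t)) +
      ((2 : ℝ) ^ j) ^ 2 * Real.exp (-c * t))) * b.N₁ j +
    ENNReal.ofReal (C * (((2 : ℝ) ^ j) ^ 3 * Real.exp (-c * (((2 : ℝ) ^ j) ^ 2 * t)) +
      Real.exp (-c * t))) * b.N₂ j
  S_le : ∀ t, 0 ≤ t → ∀ j, b.S t j ≤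
    ENNReal.ofReal (C * Real.exp (-c * (((2 : ℝ) ^ j) ^ 2 * t))) * b.E j
  -- The heat flow is reversible on a block; the bound is useful while `4^j t` stays bounded.
  E_le_S : ∀ t, 0 ≤ t → ∀ j, b.E j ≤
    ENNReal.ofReal (C * Real.exp (C * (((2 : ℝ) ^ j) ^ 2 * t))) * b.S t j
  E_le : ∀ j, b.E j ≤ b.N₁ j + ENNReal.ofReal C * b.N₂ j
  N₁_le : ∀ j, b.N₁ j ≤ b.E j + ENNReal.ofReal C * b.N₂ j
  W_le : ∀ t j, b.W t j ≤ ENNReal.ofReal (C * ((2 : ℝ) ^ j) ^ 2) * b.S t j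
  S_le_W : ∀ t j, ENNReal.ofReal (((2 : ℝ) ^ j) ^ 2) * b.S t j ≤ ENNReal.ofReal C * b.W t j
  u_le : ∀ t j, b.u t j ≤ b.d₁ t j + b.S t j
  S_le_u : ∀ t j, b.S t j ≤ b.u t j + b.d₁ t j
  w_le : ∀ t j, b.w t j ≤ b.d₂ t j + b.W t j
  W_le_w : ∀ t j, b.W t j ≤ b.w t j + b.d₂ t j
  -- Finiteness of the data block is what allows it to be absorbed in `exists_N₁_le`.
  fin : ∀ t, 0 ≤ t → ∀ j, b.u t j < ⊤ → b.w t j < ⊤ → b.N₁ j < ⊤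

namespace FlowBlocks

variable {b : FlowBlocks} {C c α β K : ℝ} {J : ℤ}

lemma Estimates.E_le_ofReal (h : b.Estimates C c J) (hK : 0 ≤ K)
    (hN₁ : ∀ j, b.N₁ j ≤ ENNReal.ofReal K) (hN₂ : ∀ j, b.N₂ j ≤ ENNReal.ofReal K) (j : ℤ) :
    b.E j ≤ ENNReal.ofReal (K + C * K) := by
  have hC := h.C_pos
  calc b.E j ≤ ENNReal.ofReal K + ENNReal.ofReal C * ENNReal.ofReal K := by
        refine (h.E_le j).trans ?_
        gcongr
        · exact hN₁ j
        · exact hN₂ j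
    _ = _ := by
        rw [← ENNReal.ofReal_mul hC.le, ← ENNReal.ofReal_add hK (by positivity)]

lemma Estimates.E_eq_zero (h : b.Estimates C c J) {j : ℤ} (hj : J < j) : b.E j = 0 := by
  have := h.E_le j
  rw [(h.supp j hj).1, (h.supp j hj).2, mul_zero, add_zero] at this
  exact le_antisymm this zero_le

/-- Decay of the profile and of the error. -/
lemma Estimates.exists_decay (h : b.Estimates C c J) (hJ : J ≤ 0) (hα : 0 < α) (hβ : 0 < β)
    (hK : 0 < K) (hN₁ : ∀ j, b.N₁ j ≤ ENNReal.ofReal K) (hN₂ : ∀ j, b.N₂ j ≤ ENNReal.ofReal K) :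
    ∃ B : ℝ, 0 < B ∧ ∀ t, 0 ≤ t → dyadicSum α (b.d₁ t) ≤ rate B (α / 2 + 1 / 2) t ∧
      dyadicSum β (b.d₂ t) ≤ rate B (β / 2 + 1 + 1 / 2) t ∧
      dyadicSum α (b.S t) ≤ rate B (α / 2) t ∧ dyadicSum β (b.W t) ≤ rate B (β / 2 + 1) t := by
  have hC := h.C_pos
  -- The natural number is the power of `2^j` in front of the heat factor: `1` and `3` for the
  -- errors, `0` and `2` for the two components of the profile. Each power improves the rate by one
  -- half.
  obtain ⟨K₁, hK₁, h₁⟩ := exists_dyadicSum_le_rate 1 hα h.c_pos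
  obtain ⟨K₂, hK₂, h₂⟩ := exists_dyadicSum_le_rate 3 hβ h.c_pos
  obtain ⟨K₃, hK₃, h₃⟩ := exists_dyadicSum_le_rate 0 hα h.c_pos
  obtain ⟨K₄, hK₄, h₄⟩ := exists_dyadicSum_le_rate 2 hβ h.c_pos
  set KE := K + C * K with hKE
  have hKE0 : 0 < KE := by positivity
  have hE := h.E_le_ofReal hK.le hN₁ hN₂
  have hS0 : ∀ t, 0 ≤ t → ∀ j, 0 < j → b.S t j = 0 := fun t ht j hj => by
    have := h.S_le t ht j
    rw [h.E_eq_zero (by omega), mul_zero] at this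
    exact le_antisymm this zero_le
  have hS : ∀ t, 0 ≤ t → ∀ j, b.S t j ≤
      ENNReal.ofReal (C * KE * Real.exp (-c * (((2 : ℝ) ^ j) ^ 2 * t))) := fun t ht j => by
    calc _ ≤ ENNReal.ofReal (C * Real.exp (-c * (((2 : ℝ) ^ j) ^ 2 * t))) * ENNReal.ofReal KE :=
          (h.S_le t ht j).trans (mul_le_mul_right (hE j) _)
      _ = _ := by
          rw [← ENNReal.ofReal_mul (by positivity)]
          congr 1
          ring
  refine ⟨2 * C * K * K₁ + 2 * C * K * K₂ + C * KE * K₃ + C * (C * KE) * K₄, by positivity,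
    fun t ht => ⟨?_, ?_, ?_, ?_⟩⟩
  · refine (h₁ (2 * C * K) t (b.d₁ t) (by positivity) ht (fun j hj => ?_) (fun j hj => ?_)).trans ?_
    · have := h.d₁_le t ht j
      rw [(h.supp j (by omega)).1, (h.supp j (by omega)).2, mul_zero, mul_zero, add_zero] at this
      exact le_antisymm this zero_le
    · set e := Real.exp (-c * (((2 : ℝ) ^ j) ^ 2 * t)) with he
      have he0 : 0 < e := Real.exp_pos _
      have he1 := Real.exp_pos (-c * t)
      calc _ ≤ _ := h.d₁_le t ht j
        _ ≤ ENNReal.ofReal (C * ((2 : ℝ) ^ j * e)) * ENNReal.ofReal K +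
            ENNReal.ofReal (C * ((2 : ℝ) ^ j * e + Real.exp (-c * t))) * ENNReal.ofReal K :=
          add_le_add (mul_le_mul_right (hN₁ j) _) (mul_le_mul_right (hN₂ j) _)
        _ = ENNReal.ofReal (C * ((2 : ℝ) ^ j * e) * K +
            C * ((2 : ℝ) ^ j * e + Real.exp (-c * t)) * K) := by
          rw [← ENNReal.ofReal_mul (by positivity), ← ENNReal.ofReal_mul (by positivity),
            ← ENNReal.ofReal_add (by positivity) (by positivity)]
        _ ≤ _ := by
          refine ENNReal.ofReal_le_ofReal ?_
          have : 0 ≤ C * Real.exp (-c * t) * K := by positivity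
          rw [pow_one]
          linarith
    · rw [Nat.cast_one, add_div]
      refine rate_mono ?_
      have h5 : 0 < 2 * C * K * K₂ := by positivity
      have h6 : 0 < C * KE * K₃ := by positivity
      have h7 : 0 < C * (C * KE) * K₄ := by positivity
      linarith
  · refine (h₂ (2 * C * K) t (b.d₂ t) (by positivity) ht (fun j hj => ?_) (fun j hj => ?_)).trans ?_
    · have := h.d₂_le t ht j
      rw [(h.supp j (by omega)).1, (h.supp j (by omega)).2, mul_zero, mul_zero, add_zero] at this
      exact le_antisymm this zero_le
    · set e := Real.exp (-c * (((2 : ℝ) ^ j) ^ 2 * t)) with he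
      have he0 : 0 < e := Real.exp_pos _
      have he1 := Real.exp_pos (-c * t)
      have hl : ((2 : ℝ) ^ j) ^ 2 ≤ 1 :=
        pow_le_one₀ (by positivity) (zpow_le_one_of_nonpos₀ one_le_two hj)
      calc _ ≤ _ := h.d₂_le t ht j
        _ ≤ ENNReal.ofReal (C * (((2 : ℝ) ^ j) ^ 3 * e + ((2 : ℝ) ^ j) ^ 2 * Real.exp (-c * t))) *
              ENNReal.ofReal K +
            ENNReal.ofReal (C * (((2 : ℝ) ^ j) ^ 3 * e + Real.exp (-c * t))) * ENNReal.ofReal K :=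
          add_le_add (mul_le_mul_right (hN₁ j) _) (mul_le_mul_right (hN₂ j) _)
        _ = ENNReal.ofReal (C * (((2 : ℝ) ^ j) ^ 3 * e + ((2 : ℝ) ^ j) ^ 2 * Real.exp (-c * t)) * K +
            C * (((2 : ℝ) ^ j) ^ 3 * e + Real.exp (-c * t)) * K) := by
          rw [← ENNReal.ofReal_mul (by positivity), ← ENNReal.ofReal_mul (by positivity),
            ← ENNReal.ofReal_add (by positivity) (by positivity)]
        _ ≤ ENNReal.ofReal (C * (((2 : ℝ) ^ j) ^ 3 * e + 1 * Real.exp (-c * t)) * K +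
            C * (((2 : ℝ) ^ j) ^ 3 * e + Real.exp (-c * t)) * K) := by gcongr
        _ = _ := by
          congr 1
          ring
    · have e1 : (β + (3 : ℕ)) / 2 = β / 2 + 1 + 1 / 2 := by
        push_cast
        ring
      rw [e1]
      refine rate_mono ?_
      have h5 : 0 < 2 * C * K * K₁ := by positivity
      have h6 : 0 < C * KE * K₃ := by positivity
      have h7 : 0 < C * (C * KE) * K₄ := by positivity
      linarith
  · refine (h₃ (C * KE) t (b.S t) (by positivity) ht (hS0 t ht) (fun j hj => ?_)).trans ?_
    · refine (hS t ht j).trans (ENNReal.ofReal_le_ofReal ?_)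
      rw [pow_zero, one_mul]
      refine mul_le_mul_of_nonneg_left ?_ (by positivity)
      linarith [Real.exp_pos (-c * t)]
    · rw [Nat.cast_zero, add_zero]
      refine rate_mono ?_
      have h5 : 0 < 2 * C * K * K₁ := by positivity
      have h6 : 0 < 2 * C * K * K₂ := by positivity
      have h7 : 0 < C * (C * KE) * K₄ := by positivity
      linarith
  · refine (h₄ (C * (C * KE)) t (b.W t) (by positivity) ht (fun j hj => ?_) (fun j hj => ?_)).trans ?_
    · have := h.W_le t j
      rw [hS0 t ht j hj, mul_zero] at this
      exact le_antisymm this zero_le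
    · refine (h.W_le t j).trans ((mul_le_mul_right (hS t ht j) _).trans ?_)
      rw [← ENNReal.ofReal_mul (by positivity)]
      refine ENNReal.ofReal_le_ofReal ?_
      have : 0 < C * (C * KE) * Real.exp (-c * t) := by positivity
      linarith
    · have e1 : (β + (2 : ℕ)) / 2 = β / 2 + 1 := by
        push_cast
        ring
      rw [e1]
      refine rate_mono ?_
      have h5 : 0 < 2 * C * K * K₁ := by positivity
      have h6 : 0 < C * KE * K₃ := by positivity
      have h7 : 0 < 2 * C * K * K₂ := by positivity
      linarith

/-- Decay of the solution. -/
lemma Estimates.exists_upper (h : b.Estimates C c J) (hJ : J ≤ 0) (hα : 0 < α) (hβ : 0 < β)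
    (hK : 0 < K) (hN₁ : ∀ j, b.N₁ j ≤ ENNReal.ofReal K) (hN₂ : ∀ j, b.N₂ j ≤ ENNReal.ofReal K) :
    ∃ B : ℝ, 0 < B ∧ ∀ t, 0 ≤ t → dyadicSum α (b.u t) ≤ rate B (α / 2) t ∧
      dyadicSum β (b.w t) ≤ rate B (β / 2 + 1) t := by
  obtain ⟨B, hB, hd⟩ := h.exists_decay hJ hα hβ hK hN₁ hN₂
  refine ⟨B + B, by positivity, fun t ht => ?_⟩
  obtain ⟨h1, h2, h3, h4⟩ := hd t ht
  rw [← rate_add hB.le hB.le, ← rate_add hB.le hB.le]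
  constructor
  · refine (dyadicSum_mono (h.u_le t)).trans ?_
    rw [dyadicSum_add]
    exact add_le_add (h1.trans (rate_anti hB.le (by linarith))) h3
  · refine (dyadicSum_mono (h.w_le t)).trans ?_
    rw [dyadicSum_add]
    exact add_le_add (h2.trans (rate_anti hB.le (by linarith))) h4

/-- The decay of the solution determines the size of the data. -/
lemma Estimates.exists_N₁_le (h : b.Estimates C c J) (hJ : C ^ 2 * Real.exp C * (2 : ℝ) ^ J ≤ 1 / 2)
    (hα : 0 < α) (hK : 0 < K) (hN₂ : ∀ j, b.N₂ j ≤ ENNReal.ofReal K)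
    (hu : ∀ t, 0 < t → dyadicSum α (b.u t) ≤ rate K (α / 2) t)
    (hw : ∀ t, 0 < t → dyadicSum β (b.w t) < ⊤) :
    ∃ B : ℝ, 0 < B ∧ ∀ j, b.N₁ j ≤ ENNReal.ofReal B := by
  have hC := h.C_pos
  have hc := h.c_pos
  refine ⟨2 * (C * Real.exp C * (K + 2 * C * K) + C * K + K), by positivity, fun j => ?_⟩
  rcases lt_or_ge J j with hj | hj
  · rw [(h.supp j hj).1]
    exact zero_le
  set l := (2 : ℝ) ^ j with hl
  have hl0 : 0 < l := by positivity
  have hlJ : l ≤ (2 : ℝ) ^ J := zpow_le_zpow_right₀ one_le_two hj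
  -- The parabolic time of block `j`. Here `l² t = 1`, and the rate `t^{-α/2}` is the weight `l^α`
  -- of the block, so the decay bound says precisely that the block of the solution is bounded.
  set t := (l ^ 2)⁻¹ with ht
  have ht0 : 0 < t := by positivity
  have hlt : l ^ 2 * t = 1 := mul_inv_cancel₀ (by positivity)
  have hu1 : b.u t j ≤ ENNReal.ofReal K := by
    have h1 := (le_dyadicSum α (b.u t) j).trans ((hu t ht0).trans
      (rate_le_rpow hK.le (by positivity) ht0))
    have h2 : t ^ (-(α / 2)) = l ^ α := by
      rw [ht, Real.inv_rpow (by positivity), ← Real.rpow_neg (by positivity), neg_neg,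
        ← Real.rpow_natCast, ← Real.rpow_mul hl0.le]
      congr 1
      push_cast
      ring
    rw [h2, mul_comm K, ENNReal.ofReal_mul (by positivity)] at h1
    exact (ENNReal.mul_le_mul_iff_right (ENNReal.ofReal_pos.2 (by positivity)).ne'
      ENNReal.ofReal_ne_top).1 h1
  have hw1 : b.w t j < ⊤ := by
    have h1 := (le_dyadicSum β (b.w t) j).trans_lt (hw t ht0)
    by_contra h2
    rw [not_lt_top_iff.1 h2, ENNReal.mul_top (ENNReal.ofReal_pos.2 (by positivity)).ne'] at h1
    exact lt_irrefl _ h1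
  -- The unknown block now becomes a real number `x`, on which an inequality of the form `x ≤ B' +
  -- x/2` can be solved.
  have hfin := h.fin t ht0.le j (hu1.trans_lt ENNReal.ofReal_lt_top) hw1
  set x := (b.N₁ j).toReal with hx
  have hx0 : 0 ≤ x := ENNReal.toReal_nonneg
  have hNx : b.N₁ j = ENNReal.ofReal x := (ENNReal.ofReal_toReal hfin.ne).symm
  have he : Real.exp (-c * (l ^ 2 * t)) ≤ 1 := by
    rw [Real.exp_le_one_iff, hlt]
    linarith
  have he' : Real.exp (-c * t) ≤ 1 := by
    rw [Real.exp_le_one_iff, neg_mul]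
    exact neg_nonpos.2 (by positivity)
  have hxl : x ≤ C * Real.exp C * (K + 2 * C * K) + C * K + C ^ 2 * Real.exp C * l * x +
      C * Real.exp C * (C * l * K) := by
    refine (ENNReal.ofReal_le_ofReal_iff (by positivity)).1 ?_
    have hd : b.d₁ t j ≤ ENNReal.ofReal (C * l * x + (C * l + C) * K) := by
      refine (h.d₁_le t ht0.le j).trans ?_
      rw [hNx]
      calc _ ≤ ENNReal.ofReal (C * (l * 1)) * ENNReal.ofReal x +
            ENNReal.ofReal (C * (l * 1 + 1)) * ENNReal.ofReal K := by
            refine add_le_add (mul_le_mul_left (ENNReal.ofReal_le_ofReal ?_) _)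
              (mul_le_mul' (ENNReal.ofReal_le_ofReal ?_) (hN₂ j))
            · gcongr
            · gcongr
        _ = _ := by
            rw [← ENNReal.ofReal_mul (by positivity), ← ENNReal.ofReal_mul (by positivity),
              ← ENNReal.ofReal_add (by positivity) (by positivity)]
            congr 1
            ring
    have hS : b.S t j ≤ ENNReal.ofReal (K + (C * l * x + (C * l + C) * K)) := by
      rw [ENNReal.ofReal_add (by positivity) (by positivity)]
      exact (h.S_le_u t j).trans (add_le_add hu1 hd)
    have hE : b.E j ≤ ENNReal.ofReal (C * Real.exp C * (K + (C * l * x + (C * l + C) * K))) := by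
      refine (h.E_le_S t ht0.le j).trans ?_
      rw [← hl, hlt, mul_one, ENNReal.ofReal_mul (p := C * Real.exp C) (by positivity)]
      gcongr
    rw [← hNx]
    calc _ ≤ _ := h.N₁_le j
      _ ≤ ENNReal.ofReal (C * Real.exp C * (K + (C * l * x + (C * l + C) * K))) +
          ENNReal.ofReal C * ENNReal.ofReal K := by
          gcongr
          exact hN₂ j
      _ ≤ _ := by
          rw [← ENNReal.ofReal_mul hC.le, ← ENNReal.ofReal_add (by positivity) (by positivity)]
          refine ENNReal.ofReal_le_ofReal ?_
          have : 0 ≤ C * Real.exp C * (C * K) := by positivity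
          linarith
  rw [hNx]
  refine ENNReal.ofReal_le_ofReal ?_
  -- The low threshold: the error carries a factor `l`, and its contribution is at most half of `x`.
  have h1 : C ^ 2 * Real.exp C * l ≤ 1 / 2 := le_trans (by gcongr) hJ
  have h2 := mul_le_mul_of_nonneg_right h1 hx0
  have h3 := mul_le_mul_of_nonneg_right h1 hK.le
  linarith

end FlowBlocks

end FlowBlocks

/-! ### Lower bounds for sequences of dyadic blocks -/

section LowerBounds

namespace FlowBlocks

variable {b : FlowBlocks} {C c α β K : ℝ} {J : ℤ}

/-- The lower bound of the profile caused by a sequence of non-vanishing blocks. -/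
lemma Estimates.exists_lower_S (h : b.Estimates C c J) (hα : 0 < α) {c₀ M : ℝ} (hc₀ : 0 < c₀)
    {j : ℕ → ℤ} (hj : Tendsto j atTop atBot) (hM : ∀ k, |(j k : ℝ) - (j (k + 1) : ℝ)| ≤ M)
    (hE : ∀ k, ENNReal.ofReal c₀ ≤ b.E (j k)) : ∃ t₁ B : ℝ, 0 < t₁ ∧ 0 < B ∧
      ∀ t, t₁ ≤ t → rate B (α / 2) t ≤ dyadicSum α (b.S t) := by
  classical
  have hC := h.C_pos
  -- This time is large enough to force `j 0 > -m` for the scale `2^m ≤ √t < 2^{m+1}`. The constant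
  -- loses `2^{-Mα}` for the gaps and `e^{4C}` for reversing the heat flow, as `4^{j k} t ≤ 4`.
  refine ⟨((2 : ℝ) ^ (-(j 0) + 1)) ^ 2, (2 : ℝ) ^ (-M * α) * (c₀ / (C * Real.exp (C * 4))),
    by positivity, by positivity, fun t ht => ?_⟩
  have ht0 : 0 < t := lt_of_lt_of_le (by positivity) ht
  obtain ⟨m, hm1, hm2⟩ := exists_mem_Ico_zpow (Real.sqrt_pos.2 ht0) (one_lt_two (α := ℝ))
  have hjm : -m < j 0 := by
    have h1 : (2 : ℝ) ^ (-(j 0) + 1) ≤ Real.sqrt t := Real.le_sqrt_of_sq_le ht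
    have h2 := (zpow_lt_zpow_iff_right₀ (one_lt_two (α := ℝ))).1 (h1.trans_lt hm2)
    omega
  -- Take the first index at which the sequence has dropped to `-m`. Its predecessor is still above
  -- `-m`, so the gap bound puts `j k` between `-m - M` and `-m`, at the scale of time `t`.
  have hex : ∃ k, j k ≤ -m := (hj.eventually_le_atBot (-m)).exists
  set k := Nat.find hex with hk
  have hk1 : j k ≤ -m := Nat.find_spec hex
  have hk0 : k ≠ 0 := fun h0 => by
    rw [h0] at hk1
    omega
  obtain ⟨i, hi⟩ := Nat.exists_eq_succ_of_ne_zero hk0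
  have hi1 : -m < j i := not_le.1 (Nat.find_min hex (by omega))
  have hk2 : -(m : ℝ) - M ≤ j k := by
    have h1 := (abs_le.1 (hM i)).2
    rw [← Nat.succ_eq_add_one, ← hi] at h1
    have h2 : (-m : ℝ) < j i := by exact_mod_cast hi1
    linarith
  set l := (2 : ℝ) ^ (j k) with hl
  have hl0 : 0 < l := by positivity
  have hlt : l ^ 2 * t ≤ 4 := by
    have h1 : l ≤ (2 : ℝ) ^ (-m) := zpow_le_zpow_right₀ one_le_two hk1
    have h2 : l * Real.sqrt t ≤ 2 := by
      calc _ ≤ (2 : ℝ) ^ (-m) * 2 ^ (m + 1) := by gcongr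
        _ = 2 := by
          rw [← zpow_add₀ two_ne_zero]
          norm_num
    calc _ = (l * Real.sqrt t) ^ 2 := by rw [mul_pow, Real.sq_sqrt ht0.le]
      _ ≤ 2 ^ 2 := by gcongr
      _ = 4 := by norm_num
  have hS : ENNReal.ofReal (c₀ / (C * Real.exp (C * 4))) ≤ b.S t (j k) := by
    have h1 : ENNReal.ofReal c₀ ≤ ENNReal.ofReal (C * Real.exp (C * 4)) * b.S t (j k) := by
      refine (hE k).trans ((h.E_le_S t ht0.le (j k)).trans ?_)
      gcongr
    rw [ENNReal.ofReal_div_of_pos (by positivity)]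
    exact ENNReal.div_le_of_le_mul' h1
  refine le_trans ?_ (le_dyadicSum α (b.S t) (j k))
  refine le_trans ?_ (mul_le_mul_right hS _)
  rw [← ENNReal.ofReal_mul (by positivity)]
  refine ENNReal.ofReal_le_ofReal ?_
  have h3 : Real.sqrt (1 + t ^ 2) ^ (-(α / 2)) ≤ t ^ (-(α / 2)) :=
    Real.rpow_le_rpow_of_nonpos ht0 (Real.le_sqrt_of_sq_le (by linarith)) (by linarith)
  have h4 : (2 : ℝ) ^ (-M * α) * t ^ (-(α / 2)) ≤ l ^ α := by
    have h5 : (2 : ℝ) ^ (-M) * (Real.sqrt t)⁻¹ ≤ l := by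
      calc _ ≤ (2 : ℝ) ^ (-M) * ((2 : ℝ) ^ m)⁻¹ := by gcongr
        _ = (2 : ℝ) ^ (-(m : ℝ) - M) := by
          rw [← zpow_neg, ← Real.rpow_intCast, ← Real.rpow_add two_pos]
          congr 1
          push_cast
          ring
        _ ≤ (2 : ℝ) ^ (j k : ℝ) := Real.rpow_le_rpow_of_exponent_le one_le_two hk2
        _ = l := Real.rpow_intCast _ _
    refine le_trans (le_of_eq ?_) (Real.rpow_le_rpow (by positivity) h5 hα.le)
    rw [Real.mul_rpow (by positivity) (by positivity), ← Real.rpow_mul two_pos.le,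
      Real.inv_rpow (by positivity), Real.sqrt_eq_rpow, ← Real.rpow_mul ht0.le,
      ← Real.rpow_neg ht0.le]
    congr 2
    ring
  have h6 : 0 ≤ c₀ / (C * Real.exp (C * 4)) := by positivity
  calc _ = (2 : ℝ) ^ (-M * α) * Real.sqrt (1 + t ^ 2) ^ (-(α / 2)) *
        (c₀ / (C * Real.exp (C * 4))) := by ring
    _ ≤ (2 : ℝ) ^ (-M * α) * t ^ (-(α / 2)) * (c₀ / (C * Real.exp (C * 4))) := by gcongr
    _ ≤ _ := by gcongr

/-- Lower bounds of the solution. -/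
lemma Estimates.exists_lower (h : b.Estimates C c J) (hJ : J ≤ 0) (hα : 0 < α) (hβ : 0 < β)
    (hK : 0 < K) (hN₁ : ∀ j, b.N₁ j ≤ ENNReal.ofReal K) (hN₂ : ∀ j, b.N₂ j ≤ ENNReal.ofReal K)
    {c₀ M : ℝ} (hc₀ : 0 < c₀) {j : ℕ → ℤ} (hj : Tendsto j atTop atBot)
    (hM : ∀ k, |(j k : ℝ) - (j (k + 1) : ℝ)| ≤ M) (hE : ∀ k, ENNReal.ofReal c₀ ≤ b.E (j k)) :
    ∃ t₁ B : ℝ, 0 < t₁ ∧ 0 < B ∧ ∀ t, t₁ ≤ t → rate B (α / 2) t ≤ dyadicSum α (b.u t) ∧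
      rate B (β / 2 + 1) t ≤ dyadicSum β (b.w t) := by
  have hC := h.C_pos
  obtain ⟨B, hB, hd⟩ := h.exists_decay hJ hα hβ hK hN₁ hN₂
  obtain ⟨t₁, B₁, ht₁, hB₁, h₁⟩ := h.exists_lower_S hα hc₀ hj hM hE
  -- The dissipative profile is comparable to `4^j` times the conservative one in these weights, so
  -- its lower bound is that of `S` with the exponent `β + 2`.
  obtain ⟨t₂, B₂, ht₂, hB₂, h₂⟩ := h.exists_lower_S (α := β + (2 : ℕ)) (by positivity) hc₀ hj hM hE
  obtain ⟨t₃, ht₃, h₃⟩ := exists_rate_le_of_le_add (θ := α / 2) hB₁ hB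
  obtain ⟨t₄, ht₄, h₄⟩ := exists_rate_le_of_le_add (θ := β / 2 + 1) (div_pos hB₂ hC) hB
  refine ⟨t₁ + t₂ + t₃ + t₄, min (B₁ / 2) (B₂ / C / 2), by positivity,
    lt_min (by positivity) (by positivity), fun t ht => ?_⟩
  obtain ⟨d1, d2, -, -⟩ := hd t (by linarith)
  constructor
  · refine (rate_mono (min_le_left _ _)).trans (h₃ t (by linarith) _ _ ?_ d1)
    refine (h₁ t (by linarith)).trans ?_
    rw [← dyadicSum_add]
    exact dyadicSum_mono (h.S_le_u t)
  · refine (rate_mono (min_le_right _ _)).trans (h₄ t (by linarith) _ _ ?_ d2)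
    have h5 : rate B₂ (β / 2 + 1) t ≤ ENNReal.ofReal C * dyadicSum β (b.W t) := by
      have e1 : (β + (2 : ℕ)) / 2 = β / 2 + 1 := by
        push_cast
        ring
      rw [← e1]
      refine (h₂ t (by linarith)).trans ?_
      rw [← dyadicSum_weight, ← dyadicSum_const_mul]
      refine dyadicSum_mono fun j => ?_
      rw [Real.rpow_natCast]
      exact h.S_le_W t j
    have h6 : rate (B₂ / C) (β / 2 + 1) t ≤ dyadicSum β (b.W t) := by
      have h7 : rate (B₂ / C) (β / 2 + 1) t = rate B₂ (β / 2 + 1) t / ENNReal.ofReal C := by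
        rw [rate, rate, ← ENNReal.ofReal_div_of_pos hC]
        congr 1
        ring
      rw [h7]
      exact ENNReal.div_le_of_le_mul' h5
    refine h6.trans ?_
    rw [← dyadicSum_add]
    exact dyadicSum_mono (h.W_le_w t)

/-- A lower bound of the profile forces a sequence of non-vanishing blocks. -/
lemma Estimates.exists_blocks (h : b.Estimates C c J) (hα : 0 < α) (hK : 0 < K)
    (hE : ∀ j, b.E j ≤ ENNReal.ofReal K) {t₁ c₀ : ℝ} (hc₀ : 0 < c₀)
    (hS : ∀ t, t₁ ≤ t → rate c₀ (α / 2) t ≤ dyadicSum α (b.S t)) :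
    ∃ c₁ M : ℝ, 0 < c₁ ∧ 0 < M ∧ ∃ j : ℕ → ℤ, Tendsto j atTop atBot ∧
      (∀ k, |(j k : ℝ) - (j (k + 1) : ℝ)| ≤ M) ∧ ∀ k, ENNReal.ofReal c₁ ≤ b.E (j k) := by
  have hC := h.C_pos
  set F : ℤ → ℝ≥0∞ := fun k => ENNReal.ofReal
    (((2 : ℝ) ^ k) ^ α * Real.exp (-c * ((2 : ℝ) ^ k) ^ 2)) with hF
  have hFt : ∑' k, F k ≠ ⊤ := tsum_exp_ne_top hα h.c_pos
  set f := (∑' k, F k).toReal with hf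
  have hf0 : 0 ≤ f := ENNReal.toReal_nonneg
  have hFf : ∑' k, F k = ENNReal.ofReal f := (ENNReal.ofReal_toReal hFt).symm
  -- The assumed lower bound in units of the heat estimate; the power of two comes from `√(1 + t²) ≤
  -- 2t`. The two parts of the sum below are each made at most `δ/3`.
  set δ := c₀ * (2 : ℝ) ^ (-(α / 2)) / C with hδ
  have hδ0 : 0 < δ := by positivity
  set c₁ := δ / (3 * (f + 1)) with hc₁
  have hc₁0 : 0 < c₁ := by positivity
  -- A finite set of shifts outside which the heat weights sum to at most `δ/(3K)`; there the crude
  -- bound `K` on the blocks suffices.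
  obtain ⟨s, hs⟩ := ((ENNReal.tendsto_tsum_compl_atTop_zero hFt).eventually_le_const
    (ENNReal.ofReal_pos.2 (show 0 < δ / (3 * K) by positivity))).exists
  obtain ⟨N, hN⟩ : ∃ N : ℕ, ∀ k ∈ s, |k| ≤ N := by
    refine ⟨∑ k ∈ s, k.natAbs, fun k hk => ?_⟩
    rw [Int.abs_eq_natAbs]
    exact_mod_cast Finset.single_le_sum (f := Int.natAbs) (fun _ _ => Nat.zero_le _) hk
  -- At time `4^m`, if every block within distance `N` of `-m` were below `c₁`, the whole sum would
  -- reach at most two thirds of its lower bound.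
  have key : ∀ m : ℕ, t₁ ≤ ((2 : ℝ) ^ (m : ℤ)) ^ 2 →
      ∃ j : ℤ, |j + m| ≤ N ∧ ENNReal.ofReal c₁ ≤ b.E j := by
    intro m hm
    by_contra! hcon
    set t := ((2 : ℝ) ^ (m : ℤ)) ^ 2 with ht
    have ht1 : 1 ≤ t := one_le_pow₀ (one_le_zpow₀ one_le_two (by positivity))
    have h1 : ∀ j : ℤ, ENNReal.ofReal (((2 : ℝ) ^ j) ^ α) * b.S t j ≤
        ENNReal.ofReal (C * ((2 : ℝ) ^ (m : ℤ)) ^ (-α)) * (ENNReal.ofReal c₁ * F (j + m) +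
          ENNReal.ofReal K * (sᶜ : Set ℤ).indicator F (j + m)) := fun j => by
      have h2 : ENNReal.ofReal (((2 : ℝ) ^ j) ^ α) *
          ENNReal.ofReal (C * Real.exp (-c * (((2 : ℝ) ^ j) ^ 2 * t))) =
          ENNReal.ofReal (C * ((2 : ℝ) ^ (m : ℤ)) ^ (-α)) * F (j + m) := by
        simp only [hF]
        rw [← ENNReal.ofReal_mul (by positivity), ← ENNReal.ofReal_mul (by positivity)]
        congr 1
        have h3 : ((2 : ℝ) ^ (m : ℤ)) ^ (-α) * ((2 : ℝ) ^ (j + m)) ^ α = ((2 : ℝ) ^ j) ^ α := by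
          rw [zpow_add₀ two_ne_zero, Real.mul_rpow (by positivity) (by positivity), mul_left_comm,
            ← Real.rpow_add (by positivity), neg_add_cancel, Real.rpow_zero, mul_one]
        rw [← h3, zpow_add₀ two_ne_zero, mul_pow, ht]
        ring
      have h4 : F (j + m) * b.E j ≤ ENNReal.ofReal c₁ * F (j + m) +
          ENNReal.ofReal K * (sᶜ : Set ℤ).indicator F (j + m) := by
        by_cases hjs : j + m ∈ s
        · rw [mul_comm]
          exact le_add_right (mul_le_mul_left (hcon j (hN _ hjs)).le _)
        · rw [Set.indicator_of_mem (by simpa using hjs), mul_comm]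
          exact le_add_left (mul_le_mul_left (hE j) _)
      calc _ ≤ ENNReal.ofReal (((2 : ℝ) ^ j) ^ α) *
            (ENNReal.ofReal (C * Real.exp (-c * (((2 : ℝ) ^ j) ^ 2 * t))) * b.E j) := by
            gcongr
            exact h.S_le t (by positivity) j
        _ = ENNReal.ofReal (C * ((2 : ℝ) ^ (m : ℤ)) ^ (-α)) * (F (j + m) * b.E j) := by
            rw [← mul_assoc, h2, mul_assoc]
        _ ≤ _ := by gcongr
    have h5 : dyadicSum α (b.S t) ≤ ENNReal.ofReal (C * ((2 : ℝ) ^ (m : ℤ)) ^ (-α)) *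
        (ENNReal.ofReal c₁ * ENNReal.ofReal f + ENNReal.ofReal K * ENNReal.ofReal (δ / (3 * K))) := by
      refine (ENNReal.tsum_le_tsum h1).trans ?_
      rw [ENNReal.tsum_mul_left, ENNReal.tsum_add, ENNReal.tsum_mul_left, ENNReal.tsum_mul_left]
      have h6 : ∀ G : ℤ → ℝ≥0∞, ∑' j : ℤ, G (j + m) = ∑' k, G k := fun G =>
        (Equiv.addRight (m : ℤ)).tsum_eq G
      rw [h6, h6, hFf, ← tsum_subtype]
      gcongr
      exact hs
    have h7 := (hS t hm).trans h5
    rw [← ENNReal.ofReal_mul hc₁0.le, ← ENNReal.ofReal_mul hK.le,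
      ← ENNReal.ofReal_add (by positivity) (by positivity), ← ENNReal.ofReal_mul (by positivity),
      rate, ENNReal.ofReal_le_ofReal_iff (by positivity)] at h7
    have h8 : (2 : ℝ) ^ (-(α / 2)) * ((2 : ℝ) ^ (m : ℤ)) ^ (-α) ≤
        Real.sqrt (1 + t ^ 2) ^ (-(α / 2)) := by
      have h9 : Real.sqrt (1 + t ^ 2) ≤ 2 * t := by
        rw [Real.sqrt_le_left (by positivity)]
        nlinarith
      refine le_trans (le_of_eq ?_) (Real.rpow_le_rpow_of_nonpos (sqrt_one_add_sq_pos t) h9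
        (by linarith))
      rw [Real.mul_rpow two_pos.le (by positivity), ht, ← Real.rpow_natCast (_ ^ (m : ℤ)) 2,
        ← Real.rpow_mul (by positivity)]
      congr 2
      push_cast
      ring
    set P := ((2 : ℝ) ^ (m : ℤ)) ^ (-α) with hP
    have hP0 : 0 < P := by positivity
    have h10 : c₁ * f ≤ δ / 3 := by
      rw [hc₁, div_mul_eq_mul_div, div_le_div_iff₀ (by positivity) (by positivity)]
      nlinarith
    have h11 : K * (δ / (3 * K)) = δ / 3 := by field_simp
    have h12 : C * P * (c₁ * f + K * (δ / (3 * K))) ≤ C * P * (δ / 3 + δ / 3) := by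
      rw [h11]
      gcongr
    have h13 : C * P * δ = c₀ * ((2 : ℝ) ^ (-(α / 2)) * P) := by
      rw [hδ]
      field_simp
    have h14 := mul_le_mul_of_nonneg_left h8 hc₀.le
    have h15 : 0 < C * P * δ := by positivity
    linarith
  obtain ⟨m₀, hm₀⟩ : ∃ m₀ : ℕ, ∀ m, m₀ ≤ m → t₁ ≤ ((2 : ℝ) ^ (m : ℤ)) ^ 2 := by
    obtain ⟨n, hn⟩ := pow_unbounded_of_one_lt t₁ (one_lt_two (α := ℝ))
    refine ⟨n, fun m hm => ?_⟩
    rw [zpow_natCast]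
    calc t₁ ≤ 2 ^ n := hn.le
      _ ≤ 2 ^ m := pow_le_pow_right₀ one_le_two hm
      _ ≤ (2 ^ m) ^ 2 := le_self_pow₀ (one_le_pow₀ one_le_two) two_ne_zero
  choose j hj1 hj2 using fun k : ℕ => key (m₀ + k) (hm₀ _ (Nat.le_add_right _ _))
  -- The chosen indices lie within `N` of `-(m₀ + k)`, so consecutive ones differ by at most `2N +
  -- 1`.
  refine ⟨c₁, 2 * N + 1, hc₁0, by positivity, j, ?_, fun k => ?_, hj2⟩
  · refine tendsto_atBot.2 fun a => ?_
    filter_upwards [eventually_ge_atTop (N + a.natAbs)] with k hk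
    have := (abs_le.1 (hj1 k)).2
    push_cast at this
    omega
  · have h1 := abs_le.1 (hj1 k)
    have h2 := abs_le.1 (hj1 (k + 1))
    have h3 : |j k - j (k + 1)| ≤ 2 * N + 1 := by
      push_cast at h1 h2
      rw [abs_le]
      constructor <;> omega
    exact_mod_cast h3

end FlowBlocks

end LowerBounds

/-! ### The blocks of a solution with low frequency data -/

section SolutionBlocks

variable {d n₁ n₂ : ℕ} {χ : Space d → ℝ} {p : ℝ≥0∞} [hp : Fact (1 ≤ p)]
  {A : Fin d → Matrix (Fin n₁ ⊕ Fin n₂) (Fin n₁ ⊕ Fin n₂) ℝ} {D : Matrix (Fin n₂) (Fin n₂) ℝ}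
  {ι : Type} [Fintype ι]

/-- `2^{jσ} ‖Δ̇_j u‖_{L^p}` for a vector `u`. -/
def blockNorm (χ : Space d → ℝ) (σ : ℝ) (p : ℝ≥0∞) (u : ι → TDist d) (j : ℤ) : ℝ≥0∞ :=
  ENNReal.ofReal (((2 : ℝ) ^ j) ^ σ) * vecNorm p (blockVec χ j u)

lemma blockNorm_add_one (σ : ℝ) (u : ι → TDist d) (j : ℤ) :
    blockNorm χ (σ + 1) p u j = ENNReal.ofReal ((2 : ℝ) ^ j) * blockNorm χ σ p u j := by
  rw [blockNorm, blockNorm, Real.rpow_add (by positivity), Real.rpow_one,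
    ENNReal.ofReal_mul (by positivity), ← mul_assoc, mul_comm (ENNReal.ofReal ((2 : ℝ) ^ j))]

lemma blockNorm_mono {κ : Type} [Fintype κ] {σ : ℝ} {u : ι → TDist d} {v : κ → TDist d} {j : ℤ}
    {x : ℝ≥0∞} (h : vecNorm p (blockVec χ j u) ≤ x * vecNorm p (blockVec χ j v)) :
    blockNorm χ σ p u j ≤ x * blockNorm χ σ p v j := by
  rw [blockNorm, blockNorm, mul_left_comm]
  gcongr

lemma blockNorm_mono_add {κ μ : Type} [Fintype κ] [Fintype μ] {σ : ℝ} {u : ι → TDist d}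
    {v : κ → TDist d} {w : μ → TDist d} {j : ℤ} {x y : ℝ≥0∞}
    (h : vecNorm p (blockVec χ j u) ≤
      x * vecNorm p (blockVec χ j v) + y * vecNorm p (blockVec χ j w)) :
    blockNorm χ σ p u j ≤ x * blockNorm χ σ p v j + y * blockNorm χ σ p w j := by
  rw [blockNorm, blockNorm, blockNorm, mul_left_comm, mul_left_comm y, ← mul_add]
  gcongr

lemma blockNorm_le_sub_add (σ : ℝ) (u v : ι → TDist d) (j : ℤ) :
    blockNorm χ σ p u j ≤ blockNorm χ σ p (u - v) j + blockNorm χ σ p v j := by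
  rw [blockNorm, blockNorm, blockNorm, ← mul_add, blockVec_sub]
  gcongr
  conv_lhs => rw [← sub_add_cancel (blockVec χ j u) (blockVec χ j v)]
  exact vecNorm_add_le _ _

lemma blockNorm_le_add_sub (σ : ℝ) (u v : ι → TDist d) (j : ℤ) :
    blockNorm χ σ p v j ≤ blockNorm χ σ p u j + blockNorm χ σ p (u - v) j := by
  rw [blockNorm, blockNorm, blockNorm, ← mul_add, blockVec_sub]
  gcongr
  conv_lhs => rw [← sub_sub_cancel (blockVec χ j u) (blockVec χ j v)]
  exact vecNorm_sub_le _ _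

lemma vecNorm_zero : vecNorm p (0 : ι → TDist d) = 0 := by
  simp [vecNorm, distLpNorm_zero]

lemma blockNorm_lowFreq_eq_zero (hχ : IsCutoff χ) {J j : ℤ} (h : J < j) (σ : ℝ) (u : ι → TDist d) :
    blockNorm χ σ p (lowFreq χ J u) j = 0 := by
  rw [blockNorm, blockVec_lowFreq_eq_zero hχ h, vecNorm_zero, mul_zero]

lemma vecNorm_eq_add (u : Fin n₁ ⊕ Fin n₂ → TDist d) :
    vecNorm p u = vecNorm p (consPart u) + vecNorm p (dissPart u) :=
  Fintype.sum_sum_type _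

lemma lt_top_of_blockNorm_lt_top {σ : ℝ} {u : ι → TDist d} {j : ℤ}
    (h : blockNorm χ σ p u j < ⊤) : vecNorm p (blockVec χ j u) < ⊤ := by
  by_contra h1
  rw [blockNorm, not_lt_top_iff.1 h1,
    ENNReal.mul_top (ENNReal.ofReal_pos.2 (by positivity)).ne'] at h
  exact lt_irrefl _ h

/-- The blocks of the solution with data `U`, weighted for data in `Ḃ^σ × Ḃ^{σ+1}`. -/
def flowBlocks (χ : Space d → ℝ) (σ : ℝ) (p : ℝ≥0∞)
    (A : Fin d → Matrix (Fin n₁ ⊕ Fin n₂) (Fin n₁ ⊕ Fin n₂) ℝ) (D : Matrix (Fin n₂) (Fin n₂) ℝ)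
    (U : Fin n₁ ⊕ Fin n₂ → TDist d) : FlowBlocks where
  N₁ := blockNorm χ σ p (consPart U)
  N₂ := blockNorm χ (σ + 1) p (dissPart U)
  E := blockNorm χ σ p (effective A D U)
  S t := blockNorm χ σ p (diffusionFlow A D t (effective A D U))
  W t := blockNorm χ (σ + 1) p (dissPart (profile A D U t))
  u t := blockNorm χ σ p (consPart (fullFlow A D t U))
  w t := blockNorm χ (σ + 1) p (dissPart (fullFlow A D t U))
  d₁ t := blockNorm χ σ p (consPart (fullFlow A D t U) - consPart (profile A D U t))
  d₂ t := blockNorm χ (σ + 1) p (dissPart (fullFlow A D t U) - dissPart (profile A D U t))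

-- The block estimates for the system, with constants and threshold independent of `σ` and of the
-- data. Measuring the dissipative part with one more derivative turns the powers of `2^j` of the
-- unweighted estimates into those required by `Estimates`.
set_option maxHeartbeats 1000000 in
theorem IsPartiallyDissipative.exists_estimates (hA : IsPartiallyDissipative A D)
    (hχ : IsCutoff χ) (hp₁ : 1 < p) (hp₂ : p < ⊤) : ∃ (C c : ℝ) (Jmax : ℤ), ∀ J ≤ Jmax,
      J ≤ 0 ∧ C ^ 2 * Real.exp C * (2 : ℝ) ^ J ≤ 1 / 2 ∧
      ∀ (σ : ℝ) (V₀ : Fin n₁ ⊕ Fin n₂ → TDist d),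
        (flowBlocks χ σ p A D (lowFreq χ J V₀)).Estimates C c J := by
  obtain ⟨C₁, c₁, l₀, hC₁, hc₁, hl₀, hl₀1, h₁⟩ := hA.exists_lowBlock_decay (p := p) hχ hp₁ hp₂
  obtain ⟨C₂, c₂, hC₂, hc₂, h₂⟩ := hA.exists_diffusionFlow_block (p := p) hχ hp₁ hp₂
  obtain ⟨C₃, hC₃, h₃⟩ := exists_effective_block (p := p) hχ hp₁ hp₂ A D
  obtain ⟨C₄, hC₄, h₄⟩ := hA.exists_profile_block (p := p) hχ hp₁ hp₂
  set C := C₁ + C₂ + C₃ + C₄ with hC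
  set c := min c₁ c₂ with hc
  have hC0 : 0 < C := by positivity
  have hc0 : 0 < c := lt_min hc₁ hc₂
  have hcc₁ : c ≤ c₁ := min_le_left _ _
  have hcc₂ : c ≤ c₂ := min_le_right _ _
  -- Two smallness conditions on `2^J`: validity of the decoupling for all blocks up to `J`, and
  -- absorption in the converse estimate.
  set κ := min l₀ (1 / (2 * (C ^ 2 * Real.exp C))) with hκ
  have hκ0 : 0 < κ := lt_min hl₀ (by positivity)
  obtain ⟨n, hn⟩ := exists_pow_lt_of_lt_one hκ0 (show (1 / 2 : ℝ) < 1 by norm_num)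
  refine ⟨C, c, -(n : ℤ), fun J hJ => ?_⟩
  have hJκ : (2 : ℝ) ^ J ≤ κ := by
    refine (zpow_le_zpow_right₀ one_le_two hJ).trans (le_trans (le_of_eq ?_) hn.le)
    rw [zpow_neg, zpow_natCast, one_div, inv_pow]
  refine ⟨by omega, ?_, fun σ V₀ => ?_⟩
  · calc _ ≤ C ^ 2 * Real.exp C * (1 / (2 * (C ^ 2 * Real.exp C))) := by
          gcongr
          exact hJκ.trans (min_le_right _ _)
      _ = 1 / 2 := by
          field_simp
  set U := lowFreq χ J V₀ with hU
  have hexp : ∀ {x : ℝ}, 0 ≤ x → Real.exp (-c₁ * x) ≤ Real.exp (-c * x) := fun hx =>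
    Real.exp_le_exp.2 (mul_le_mul_of_nonneg_right (neg_le_neg hcc₁) hx)
  have hl : ∀ j : ℤ, 0 < (2 : ℝ) ^ j := fun j => by positivity
  have hCC₁ : C₁ ≤ C := by linarith
  have hCC₂ : C₂ ≤ C := by linarith
  have hCC₃ : C₃ ≤ C := by linarith
  have hCC₄ : C₄ ≤ C := by linarith
  -- The comparison with the profile is available only for small `2^j`; above the threshold the
  -- blocks of the difference vanish, since both flows commute with the cut-off.
  have hdz : ∀ t, 0 ≤ t → ∀ j, J < j → ∀ σ : ℝ,
      blockNorm χ σ p (consPart (fullFlow A D t U) - consPart (profile A D U t)) j = 0 ∧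
      blockNorm χ σ p (dissPart (fullFlow A D t U) - dissPart (profile A D U t)) j = 0 :=
    fun t ht j hj σ => by
      rw [hU, ← lowFreq_fullFlow hχ hA ht, ← lowFreq_profile hχ hA ht]
      constructor
      · change blockNorm χ σ p (lowFreq χ J (consPart (fullFlow A D t V₀)) -
          lowFreq χ J (consPart (profile A D V₀ t))) j = 0
        rw [← lowFreq_sub]
        exact blockNorm_lowFreq_eq_zero hχ hj _ _
      · change blockNorm χ σ p (lowFreq χ J (dissPart (fullFlow A D t V₀)) -
          lowFreq χ J (dissPart (profile A D V₀ t))) j = 0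
        rw [← lowFreq_sub]
        exact blockNorm_lowFreq_eq_zero hχ hj _ _
  refine
    { C_pos := hC0
      c_pos := hc0
      supp := fun j hj => ⟨blockNorm_lowFreq_eq_zero hχ hj σ (consPart V₀),
        blockNorm_lowFreq_eq_zero hχ hj (σ + 1) (dissPart V₀)⟩
      d₁_le := fun t ht j => ?_
      d₂_le := fun t ht j => ?_
      S_le := fun t ht j => ?_
      E_le_S := fun t ht j => ?_
      E_le := fun j => ?_
      N₁_le := fun j => ?_
      W_le := fun t j => ?_
      S_le_W := fun t j => ?_
      u_le := fun t j => blockNorm_le_sub_add σ _ _ j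
      S_le_u := fun t j => blockNorm_le_add_sub σ _ _ j
      w_le := fun t j => blockNorm_le_sub_add (σ + 1) _ _ j
      W_le_w := fun t j => blockNorm_le_add_sub (σ + 1) _ _ j
      fin := fun t ht j hu hw => ?_ }
  · rcases lt_or_ge J j with hj | hj
    · exact ((hdz t ht j hj σ).1.le).trans zero_le
    have hjl : (2 : ℝ) ^ j ≤ l₀ := (zpow_le_zpow_right₀ one_le_two hj).trans
      (hJκ.trans (min_le_left _ _))
    have hx := blockNorm_mono_add (σ := σ) (h₁ j hjl t ht U _ rfl).1
    refine hx.trans ?_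
    change _ ≤ _ * blockNorm χ σ p (consPart U) j + _ * blockNorm χ (σ + 1) p (dissPart U) j
    rw [blockNorm_add_one, ← mul_assoc _ _ (blockNorm χ σ p (dissPart U) j),
      ← ENNReal.ofReal_mul (by positivity)]
    have e1 := hexp (x := ((2 : ℝ) ^ j) ^ 2 * t) (by positivity)
    have e2 := hexp ht
    refine add_le_add (mul_le_mul_left (ENNReal.ofReal_le_ofReal ?_) _)
      (mul_le_mul_left (ENNReal.ofReal_le_ofReal ?_) _)
    · gcongr
    · calc _ ≤ C * (((2 : ℝ) ^ j) ^ 2 * Real.exp (-c * (((2 : ℝ) ^ j) ^ 2 * t)) +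
            (2 : ℝ) ^ j * Real.exp (-c * t)) := by gcongr
        _ = _ := by ring
  · rcases lt_or_ge J j with hj | hj
    · exact ((hdz t ht j hj (σ + 1)).2.le).trans zero_le
    have hjl : (2 : ℝ) ^ j ≤ l₀ := (zpow_le_zpow_right₀ one_le_two hj).trans
      (hJκ.trans (min_le_left _ _))
    have hx := blockNorm_mono_add (σ := σ + 1) (h₁ j hjl t ht U _ rfl).2
    refine hx.trans ?_
    change _ ≤ _ * blockNorm χ σ p (consPart U) j + _ * blockNorm χ (σ + 1) p (dissPart U) j
    rw [blockNorm_add_one (u := consPart U), ← mul_assoc _ _ (blockNorm χ σ p (consPart U) j),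
      ← ENNReal.ofReal_mul (by positivity)]
    have e1 := hexp (x := ((2 : ℝ) ^ j) ^ 2 * t) (by positivity)
    have e2 := hexp ht
    refine add_le_add (mul_le_mul_left (ENNReal.ofReal_le_ofReal ?_) _)
      (mul_le_mul_left (ENNReal.ofReal_le_ofReal ?_) _)
    · calc _ ≤ C * (((2 : ℝ) ^ j) ^ 2 * Real.exp (-c * (((2 : ℝ) ^ j) ^ 2 * t)) +
            (2 : ℝ) ^ j * Real.exp (-c * t)) * (2 : ℝ) ^ j := by gcongr
        _ = _ := by ring
    · gcongr
  · refine (blockNorm_mono (h₂ j t ht _).1).trans (mul_le_mul_left (ENNReal.ofReal_le_ofReal ?_) _)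
    have : Real.exp (-c₂ * (((2 : ℝ) ^ j) ^ 2 * t)) ≤ Real.exp (-c * (((2 : ℝ) ^ j) ^ 2 * t)) :=
      Real.exp_le_exp.2 (mul_le_mul_of_nonneg_right (neg_le_neg hcc₂) (by positivity))
    gcongr
  · refine (blockNorm_mono (h₂ j t ht _).2).trans (mul_le_mul_left (ENNReal.ofReal_le_ofReal ?_) _)
    gcongr
  · have hx := blockNorm_mono_add (σ := σ) (u := effective A D U) (v := consPart U) (w := dissPart U) (x := 1)
      (y := ENNReal.ofReal (C₃ * (2 : ℝ) ^ j)) (by rw [one_mul]; exact (h₃ j U).1)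
    refine hx.trans ?_
    change _ ≤ blockNorm χ σ p (consPart U) j +
      ENNReal.ofReal C * blockNorm χ (σ + 1) p (dissPart U) j
    rw [blockNorm_add_one, ← mul_assoc _ _ (blockNorm χ σ p (dissPart U) j), one_mul,
      ← ENNReal.ofReal_mul hC0.le]
    gcongr
  · have hx := blockNorm_mono_add (σ := σ) (u := consPart U) (v := effective A D U) (w := dissPart U) (x := 1)
      (y := ENNReal.ofReal (C₃ * (2 : ℝ) ^ j)) (by rw [one_mul]; exact (h₃ j U).2)
    refine hx.trans ?_
    change _ ≤ blockNorm χ σ p (effective A D U) j +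
      ENNReal.ofReal C * blockNorm χ (σ + 1) p (dissPart U) j
    rw [blockNorm_add_one, ← mul_assoc _ _ (blockNorm χ σ p (dissPart U) j), one_mul,
      ← ENNReal.ofReal_mul hC0.le]
    gcongr
  · have hx := blockNorm_mono (σ := σ + 1) (h₄ j U t).1
    refine hx.trans ?_
    rw [blockNorm_add_one, ← mul_assoc, ← ENNReal.ofReal_mul (by positivity)]
    refine mul_le_mul_left (ENNReal.ofReal_le_ofReal ?_) _
    calc _ ≤ C * (2 : ℝ) ^ j * (2 : ℝ) ^ j := by gcongr
      _ = _ := by ring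
  · have hx : ENNReal.ofReal ((2 : ℝ) ^ j) *
        blockNorm χ (σ + 1) p (diffusionFlow A D t (effective A D U)) j ≤
        ENNReal.ofReal C₄ * blockNorm χ (σ + 1) p (dissPart (profile A D U t)) j := by
      rw [blockNorm, blockNorm, mul_left_comm, mul_left_comm (ENNReal.ofReal C₄)]
      exact mul_le_mul_right (h₄ j U t).2 _
    rw [blockNorm_add_one, ← mul_assoc, ← ENNReal.ofReal_mul (hl j).le, ← sq] at hx
    refine hx.trans (mul_le_mul_left (ENNReal.ofReal_le_ofReal hCC₄) _)
  · have h5 : vecNorm p (blockVec χ j (fullFlow A D t U)) < ⊤ := by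
      rw [vecNorm_eq_add]
      exact ENNReal.add_lt_top.2 ⟨lt_top_of_blockNorm_lt_top hu, lt_top_of_blockNorm_lt_top hw⟩
    have h6 := hA.blockVec_lt_top_of_fullFlow hχ hp₁ hp₂ ht h5
    rw [vecNorm_eq_add] at h6
    exact ENNReal.mul_lt_top ENNReal.ofReal_lt_top (ENNReal.add_lt_top.1 h6).1

end SolutionBlocks

/-! ### Hybrid norms -/

section HybridNorms

variable {d n₁ n₂ : ℕ} {χ : Space d → ℝ} {p : ℝ≥0∞} [hp : Fact (1 ≤ p)]
  {A : Fin d → Matrix (Fin n₁ ⊕ Fin n₂) (Fin n₁ ⊕ Fin n₂) ℝ} {D : Matrix (Fin n₂) (Fin n₂) ℝ}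
  {ι κ : Type} [Fintype ι] [Fintype κ]

lemma weightedBlock_eq (σ : ℝ) (u : TDist d) (j : ℤ) : weightedBlock χ σ p j u =
    ENNReal.ofReal (((2 : ℝ) ^ j) ^ σ) * distLpNorm p (dyadicBlock χ j u) := by
  rw [weightedBlock, Real.rpow_mul two_pos.le, Real.rpow_intCast]

lemma sum_weightedBlock (σ : ℝ) (u : ι → TDist d) (j : ℤ) :
    ∑ a, weightedBlock χ σ p j (u a) = blockNorm χ σ p u j := by
  simp only [weightedBlock_eq]
  rw [← Finset.mul_sum]
  rfl

lemma besovNormOne_eq (σ : ℝ) (u : ι → TDist d) :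
    besovNormOne χ σ p u = ∑' j : ℤ, blockNorm χ σ p u j := by
  rw [besovNormOne, ← Summable.tsum_finsetSum fun _ _ => ENNReal.summable]
  exact tsum_congr fun j => sum_weightedBlock σ u j

lemma highNorm_eq (J : ℤ) (s : ℝ) (u : ι → TDist d) :
    highNorm χ J s u = ∑' j : Set.Ici (J - 1), blockNorm χ s 2 u j := by
  rw [highNorm, ← Summable.tsum_finsetSum fun _ _ => ENNReal.summable]
  exact tsum_congr fun j => sum_weightedBlock s u j

lemma blockNorm_projP (σ : ℝ) (u : Fin n₁ ⊕ Fin n₂ → TDist d) (j : ℤ) :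
    blockNorm χ σ p (projP u) j = blockNorm χ σ p (consPart u) j := by
  rw [blockNorm, blockNorm, vecNorm_eq_add]
  have h : dissPart (blockVec χ j (projP u)) = 0 := by
    ext1 b
    simp only [dissPart, blockVec, dyadicBlock, projP, Sum.elim_inr, multiplier_map_zero, Pi.zero_apply]
  rw [h, vecNorm_zero, add_zero]
  rfl

lemma blockNorm_projIP (σ : ℝ) (u : Fin n₁ ⊕ Fin n₂ → TDist d) (j : ℤ) :
    blockNorm χ σ p (projIP u) j = blockNorm χ σ p (dissPart u) j := by
  rw [blockNorm, blockNorm, vecNorm_eq_add]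
  have h : consPart (blockVec χ j (projIP u)) = 0 := by
    ext1 b
    simp only [consPart, blockVec, dyadicBlock, projIP, Sum.elim_inl, multiplier_map_zero, Pi.zero_apply]
  rw [h, vecNorm_zero, zero_add]
  rfl

lemma lowFreq_projP (J : ℤ) (u : Fin n₁ ⊕ Fin n₂ → TDist d) :
    lowFreq χ J (projP u) = projP (lowFreq χ J u) := by
  ext1 x
  rcases x with a | b
  · rfl
  · exact multiplier_map_zero _

lemma lowFreq_projIP (J : ℤ) (u : Fin n₁ ⊕ Fin n₂ → TDist d) :
    lowFreq χ J (projIP u) = projIP (lowFreq χ J u) := by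
  ext1 x
  rcases x with a | b
  · exact multiplier_map_zero _
  · rfl

/-- The weight is split so that the blocks are measured at the regularity `τ` of the data and the
surplus `σ - τ` produces the decay. -/
lemma tsum_blockNorm (σ τ : ℝ) (u : ι → TDist d) :
    ∑' j : ℤ, blockNorm χ σ p u j = dyadicSum (σ - τ) (blockNorm χ τ p u) := by
  change _ = dyadicSum (σ - τ) (fun j => ENNReal.ofReal (((2 : ℝ) ^ j) ^ τ) *
    vecNorm p (blockVec χ j u))
  rw [dyadicSum_weight, sub_add_cancel]
  rfl

lemma hybridNorm_projP (J : ℤ) (σ τ s : ℝ) (u : Fin n₁ ⊕ Fin n₂ → TDist d) :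
    hybridNorm χ J σ s p (projP u) =
      dyadicSum (σ - τ) (blockNorm χ τ p (consPart (lowFreq χ J u))) + highNorm χ J s (projP u) := by
  rw [hybridNorm, lowFreq_projP, besovNormOne_eq, ← tsum_blockNorm]
  simp only [blockNorm_projP]

lemma hybridNorm_projIP (J : ℤ) (σ τ s : ℝ) (u : Fin n₁ ⊕ Fin n₂ → TDist d) :
    hybridNorm χ J σ s p (projIP u) =
      dyadicSum (σ - τ) (blockNorm χ τ p (dissPart (lowFreq χ J u))) + highNorm χ J s (projIP u) := by
  rw [hybridNorm, lowFreq_projIP, besovNormOne_eq, ← tsum_blockNorm]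
  simp only [blockNorm_projIP]

lemma memBesovInf_iff (σ : ℝ) (u : ι → TDist d) :
    MemBesovInf χ σ p u ↔ ∃ K : ℝ, 0 < K ∧ ∀ j, blockNorm χ σ p u j ≤ ENNReal.ofReal K := by
  constructor
  · intro h
    refine ⟨(besovNormInf χ σ p u).toReal + 1, by positivity, fun j => ?_⟩
    rw [← sum_weightedBlock]
    calc _ ≤ besovNormInf χ σ p u := Finset.sum_le_sum fun a _ =>
          le_iSup (fun j => weightedBlock χ σ p j (u a)) j
      _ = ENNReal.ofReal (besovNormInf χ σ p u).toReal := (ENNReal.ofReal_toReal h.ne).symm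
      _ ≤ _ := ENNReal.ofReal_le_ofReal (by linarith)
  · rintro ⟨K, -, hK⟩
    refine ENNReal.sum_lt_top.2 fun a _ => (iSup_le fun j => ?_).trans_lt
      (ENNReal.ofReal_lt_top (r := K))
    refine le_trans ?_ (hK j)
    rw [← sum_weightedBlock]
    exact Finset.single_le_sum (f := fun a => weightedBlock χ σ p j (u a)) (fun _ _ => zero_le)
      (Finset.mem_univ a)

lemma highNorm_le_of_blockVec {J : ℤ} {s : ℝ} {u : ι → TDist d} {v : κ → TDist d} {x : ℝ≥0∞}
    (h : ∀ j, J - 1 ≤ j → vecNorm 2 (blockVec χ j u) ≤ x * vecNorm 2 (blockVec χ j v)) :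
    highNorm χ J s u ≤ x * highNorm χ J s v := by
  rw [highNorm_eq, highNorm_eq, ← ENNReal.tsum_mul_left]
  exact ENNReal.tsum_le_tsum fun j => blockNorm_mono (h j j.2)

lemma highNorm_sub_le (J : ℤ) (s : ℝ) (u v : ι → TDist d) :
    highNorm χ J s (u - v) ≤ highNorm χ J s u + highNorm χ J s v := by
  rw [highNorm_eq, highNorm_eq, highNorm_eq, ← ENNReal.tsum_add]
  refine ENNReal.tsum_le_tsum fun j => ?_
  rw [blockNorm, blockNorm, blockNorm, ← mul_add, blockVec_sub]
  gcongr
  exact vecNorm_sub_le _ _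

lemma highNorm_projP_le (J : ℤ) (s : ℝ) (u : Fin n₁ ⊕ Fin n₂ → TDist d) :
    highNorm χ J s (projP u) ≤ highNorm χ J s u := by
  rw [highNorm_eq, highNorm_eq]
  refine ENNReal.tsum_le_tsum fun j => ?_
  rw [blockNorm_projP, blockNorm, blockNorm, vecNorm_eq_add (blockVec χ j u)]
  exact mul_le_mul_right le_self_add _

lemma highNorm_projIP_le (J : ℤ) (s : ℝ) (u : Fin n₁ ⊕ Fin n₂ → TDist d) :
    highNorm χ J s (projIP u) ≤ highNorm χ J s u := by
  rw [highNorm_eq, highNorm_eq]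
  refine ENNReal.tsum_le_tsum fun j => ?_
  rw [blockNorm_projIP, blockNorm, blockNorm, vecNorm_eq_add (blockVec χ j u)]
  exact mul_le_mul_right le_add_self _

/-- Exponential decay of the high frequencies of the solution. -/
lemma IsSolution.exists_highNorm_le {V₀ : Fin n₁ ⊕ Fin n₂ → TDist d}
    {V : ℝ → Fin n₁ ⊕ Fin n₂ → TDist d} (hV : IsSolution A D V₀ V)
    (hA : IsPartiallyDissipative A D) (hχ : IsCutoff χ) {J : ℤ} {s : ℝ}
    (hs : highNorm χ J s V₀ < ⊤) {θ : ℝ} (hθ : 0 < θ) : ∃ K : ℝ, 0 < K ∧ ∀ t, 0 ≤ t →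
      highNorm χ J s (V t) ≤ rate K θ t := by
  obtain ⟨C, c, hC, hc, h⟩ := hA.exists_highBlock_decay hχ (J - 1)
  set H := (highNorm χ J s V₀).toReal + 1 with hH
  have hH0 : 0 < H := by positivity
  have hHV : highNorm χ J s V₀ ≤ ENNReal.ofReal H :=
    (ENNReal.ofReal_toReal hs.ne).ge.trans (ENNReal.ofReal_le_ofReal (by linarith))
  refine ⟨C * ((θ / c) ^ θ * Real.exp c) * H, by positivity, fun t ht => ?_⟩
  refine (highNorm_le_of_blockVec fun j hj => h hV j hj t ht).trans
    ((mul_le_mul_right hHV _).trans ?_)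
  rw [← ENNReal.ofReal_mul (by positivity)]
  refine ENNReal.ofReal_le_ofReal ?_
  calc _ ≤ C * ((θ / c) ^ θ * Real.exp c * Real.sqrt (1 + t ^ 2) ^ (-θ)) * H := by
        have := exp_neg_le_rpow hθ hc ht
        gcongr
    _ = _ := by ring

/-- Exponential decay of the high frequencies of the profile. -/
lemma IsPartiallyDissipative.exists_highNorm_profile_le (hA : IsPartiallyDissipative A D)
    (hχ : IsCutoff χ) {V₀ : Fin n₁ ⊕ Fin n₂ → TDist d} {J : ℤ} {s : ℝ}
    (hs : highNorm χ J s V₀ < ⊤) {θ : ℝ} (hθ : 0 < θ) : ∃ K : ℝ, 0 < K ∧ ∀ t, 1 ≤ t →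
      highNorm χ J s (profile A D V₀ t) ≤ rate K θ t := by
  have h12 : (1 : ℝ≥0∞) < 2 := ENNReal.one_lt_two
  have h2t : (2 : ℝ≥0∞) < ⊤ := ENNReal.ofNat_lt_top
  obtain ⟨C₂, c₂, hC₂, hc₂, h₂⟩ := hA.exists_diffusionFlow_block hχ h12 h2t
  obtain ⟨C₃, hC₃, h₃⟩ := exists_effective_block hχ h12 h2t A D
  obtain ⟨C₄, hC₄, h₄⟩ := hA.exists_profile_block hχ h12 h2t
  set r := (2 : ℝ) ^ (J - 1) with hr
  have hr0 : 0 < r := by positivity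
  -- Half of the heat decay yields `e^{-ct}` for `l ≥ r`; for `t ≥ 1` the other half absorbs the
  -- factor `(1 + l)²` from the derivatives in the profile, leaving `2 + 4/c₂`.
  set c := c₂ * r ^ 2 / 2 with hc
  have hc0 : 0 < c := by positivity
  set M := (1 + C₄) * C₂ * (1 + C₃) * (2 + 4 / c₂) with hM
  have hM0 : 0 < M := by positivity
  set H := (highNorm χ J s V₀).toReal + 1 with hH
  have hH0 : 0 < H := by positivity
  have hHV : highNorm χ J s V₀ ≤ ENNReal.ofReal H :=
    (ENNReal.ofReal_toReal hs.ne).ge.trans (ENNReal.ofReal_le_ofReal (by linarith))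
  have key : ∀ t, 1 ≤ t → ∀ j, J - 1 ≤ j → vecNorm 2 (blockVec χ j (profile A D V₀ t)) ≤
      ENNReal.ofReal (M * Real.exp (-c * t)) * vecNorm 2 (blockVec χ j V₀) := by
    intro t ht j hj
    set l := (2 : ℝ) ^ j with hl
    have hl0 : 0 < l := by positivity
    have hrl : r ≤ l := zpow_le_zpow_right₀ one_le_two hj
    set S := vecNorm 2 (blockVec χ j (diffusionFlow A D t (effective A D V₀))) with hS
    have e1 : vecNorm 2 (blockVec χ j (effective A D V₀)) ≤
        ENNReal.ofReal (1 + C₃ * l) * vecNorm 2 (blockVec χ j V₀) := by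
      refine (h₃ j V₀).1.trans ?_
      rw [vecNorm_eq_add (blockVec χ j V₀), ENNReal.ofReal_add zero_le_one (by positivity),
        ENNReal.ofReal_one, add_mul, one_mul]
      exact add_le_add le_self_add (mul_le_mul_right le_add_self _)
    have e2 : S ≤ ENNReal.ofReal (C₂ * Real.exp (-c₂ * (l ^ 2 * t))) *
        (ENNReal.ofReal (1 + C₃ * l) * vecNorm 2 (blockVec χ j V₀)) :=
      (h₂ j t (by linarith) _).1.trans (mul_le_mul_right e1 _)
    have e3 : vecNorm 2 (blockVec χ j (profile A D V₀ t)) ≤ ENNReal.ofReal (1 + C₄ * l) * S := by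
      rw [vecNorm_eq_add, ENNReal.ofReal_add zero_le_one (by positivity), ENNReal.ofReal_one,
        add_mul, one_mul]
      exact add_le_add le_rfl (h₄ j V₀ t).1
    refine e3.trans ((mul_le_mul_right e2 _).trans ?_)
    rw [← mul_assoc, ← mul_assoc, ← ENNReal.ofReal_mul (by positivity),
      ← ENNReal.ofReal_mul (by positivity)]
    refine mul_le_mul_left (ENNReal.ofReal_le_ofReal ?_) _
    have e4 : Real.exp (-c₂ * (l ^ 2 * t)) ≤
        Real.exp (-(c₂ / 2 * l ^ 2)) * Real.exp (-c * t) := by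
      rw [← Real.exp_add]
      refine Real.exp_le_exp.2 ?_
      have h5 : r ^ 2 ≤ l ^ 2 := by gcongr
      have h6 : c * t ≤ c₂ / 2 * l ^ 2 * t := by
        rw [hc]
        refine mul_le_mul_of_nonneg_right ?_ (by linarith)
        linarith [mul_le_mul_of_nonneg_left h5 (show 0 ≤ c₂ / 2 by positivity)]
      have h7 : c₂ / 2 * l ^ 2 * 1 ≤ c₂ / 2 * l ^ 2 * t :=
        mul_le_mul_of_nonneg_left ht (by positivity)
      linarith
    have e5 : (1 + l) ^ 2 * Real.exp (-(c₂ / 2 * l ^ 2)) ≤ 2 + 4 / c₂ := by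
      have h5 := Real.add_one_le_exp (c₂ / 2 * l ^ 2)
      rw [Real.exp_neg, ← div_eq_mul_inv, div_le_iff₀ (Real.exp_pos _)]
      have h6 : (1 + l) ^ 2 ≤ 2 + 2 * l ^ 2 := by nlinarith [sq_nonneg (1 - l)]
      have h7 : (2 + 4 / c₂) * (c₂ / 2 * l ^ 2 + 1) =
          c₂ * l ^ 2 + 2 * l ^ 2 + 2 + 4 / c₂ := by
        field_simp
        ring
      have h8 : 0 < 4 / c₂ := by positivity
      have h9 := mul_le_mul_of_nonneg_left h5 (show 0 ≤ 2 + 4 / c₂ by positivity)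
      have h10 : 0 < c₂ * l ^ 2 := by positivity
      linarith
    have e6 : 1 + C₄ * l ≤ (1 + C₄) * (1 + l) := by nlinarith
    have e7 : 1 + C₃ * l ≤ (1 + C₃) * (1 + l) := by nlinarith
    calc (1 + C₄ * l) * (C₂ * Real.exp (-c₂ * (l ^ 2 * t))) * (1 + C₃ * l)
        ≤ (1 + C₄) * (1 + l) * (C₂ * (Real.exp (-(c₂ / 2 * l ^ 2)) * Real.exp (-c * t))) *
          ((1 + C₃) * (1 + l)) := by gcongr
      _ = (1 + C₄) * C₂ * (1 + C₃) * ((1 + l) ^ 2 * Real.exp (-(c₂ / 2 * l ^ 2))) *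
          Real.exp (-c * t) := by ring
      _ ≤ (1 + C₄) * C₂ * (1 + C₃) * (2 + 4 / c₂) * Real.exp (-c * t) := by gcongr
  refine ⟨M * ((θ / c) ^ θ * Real.exp c) * H, by positivity, fun t ht => ?_⟩
  refine (highNorm_le_of_blockVec (key t ht)).trans ((mul_le_mul_right hHV _).trans ?_)
  rw [← ENNReal.ofReal_mul (by positivity)]
  refine ENNReal.ofReal_le_ofReal ?_
  calc _ ≤ M * ((θ / c) ^ θ * Real.exp c * Real.sqrt (1 + t ^ 2) ^ (-θ)) * H := by
        have := exp_neg_le_rpow hθ hc0 (show 0 ≤ t by linarith)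
        gcongr
    _ = _ := by ring

end HybridNorms

end

end DissipativeSystem

open DissipativeSystem in
theorem proposition3p3 (d n₁ n₂ : ℕ) (hd : 1 ≤ d) (hn₁ : 1 ≤ n₁) (hn₂ : 1 ≤ n₂)
    (A : Fin d → Matrix (Fin n₁ ⊕ Fin n₂) (Fin n₁ ⊕ Fin n₂) ℝ)
    (D : Matrix (Fin n₂) (Fin n₂) ℝ) (hA : IsPartiallyDissipative A D)
    (χ : Space d → ℝ) (hχ : IsCutoff χ)
    (p : ℝ≥0∞) (hp₁ : 1 < p) (hp₂ : p < ⊤) :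
    ∃ Jmax : ℤ, ∀ J : ℤ, J ≤ Jmax →
      ∀ σ₁ s σ σ' : ℝ, σ₁ < σ → σ₁ + 1 < σ' →
      ∀ (V₀ : Fin n₁ ⊕ Fin n₂ → TDist d) (V : ℝ → Fin n₁ ⊕ Fin n₂ → TDist d),
        MemBesovInf χ (σ₁ + 1) p (lowFreq χ J (projIP V₀)) →
        besovNormOne χ s 2 (highFreq χ J V₀) < ⊤ →
        highNorm χ J s V₀ < ⊤ →
        IsSolution A D V₀ V →
        -- upper bounds
        ((∃ C : ℝ, 0 < C ∧ ∀ t : ℝ, 0 < t →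
            hybridNorm χ J σ s p (projP (V t)) ≤ rate C ((σ - σ₁) / 2) t ∧
            hybridNorm χ J σ' s p (projIP (V t)) ≤ rate C ((σ' - σ₁) / 2 + 1 / 2) t) ↔
          MemBesovInf χ σ₁ p (lowFreq χ J (projP V₀))) ∧
        -- asymptotics
        (MemBesovInf χ σ₁ p (lowFreq χ J (projP V₀)) →
          ∃ t₀ : ℝ, 0 < t₀ ∧ ∃ C : ℝ, 0 < C ∧ ∀ t : ℝ, t₀ ≤ t →
            hybridNorm χ J σ s p (projP (V t - profile A D V₀ t)) ≤
              rate C ((σ - σ₁) / 2 + 1 / 2) t ∧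
            hybridNorm χ J σ' s p (projIP (V t - profile A D V₀ t)) ≤
              rate C ((σ' - σ₁) / 2 + 1) t) ∧
        -- two-sided bounds
        (((∃ C : ℝ, 0 < C ∧ ∀ t : ℝ, 0 < t →
              hybridNorm χ J σ s p (projP (V t)) ≤ rate C ((σ - σ₁) / 2) t ∧
              hybridNorm χ J σ' s p (projIP (V t)) ≤ rate C ((σ' - σ₁) / 2 + 1 / 2) t) ∧
            ∃ t₁ : ℝ, 0 < t₁ ∧ ∃ c C : ℝ, 0 < c ∧ 0 < C ∧ ∀ t : ℝ, t₁ ≤ t →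
              (rate c ((σ - σ₁) / 2) t ≤ hybridNorm χ J σ s p (projP (V t)) ∧
                hybridNorm χ J σ s p (projP (V t)) ≤ rate C ((σ - σ₁) / 2) t) ∧
              (rate c ((σ' - σ₁) / 2 + 1 / 2) t ≤ hybridNorm χ J σ' s p (projIP (V t)) ∧
                hybridNorm χ J σ' s p (projIP (V t)) ≤ rate C ((σ' - σ₁) / 2 + 1 / 2) t)) ↔
          MemBesovInfLower χ σ₁ p (lowFreq χ J (effective A D V₀))) := by
  have : Fact (1 ≤ p) := ⟨hp₁.le⟩
  obtain ⟨C, c, Jmax, hJmax⟩ := hA.exists_estimates (p := p) hχ hp₁ hp₂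
  refine ⟨Jmax, fun J hJ σ₁ s σ σ' hσ hσ' V₀ V hdiss _ hhigh hV => ?_⟩
  obtain ⟨hJ0, hJC, hest⟩ := hJmax J hJ
  have est := hest σ₁ V₀
  set b := flowBlocks χ σ₁ p A D (lowFreq χ J V₀) with hb
  have hα : 0 < σ - σ₁ := by linarith
  have hβ : 0 < σ' - (σ₁ + 1) := by linarith
  -- The dissipative part is measured relative to `σ₁ + 1`, so its exponents are those of
  -- `FlowBlocks` with `β = σ' - (σ₁ + 1)`.
  have er₁ : (σ' - σ₁) / 2 + 1 / 2 = (σ' - (σ₁ + 1)) / 2 + 1 := by ring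
  have er₂ : (σ' - σ₁) / 2 + 1 = (σ' - (σ₁ + 1)) / 2 + 1 + 1 / 2 := by ring
  -- Here the given solution enters: its low-frequency part is the explicit flow of the
  -- low-frequency data, so the hybrid norm is a dyadic sum plus the high-frequency norm.
  have hP : ∀ t, 0 ≤ t → hybridNorm χ J σ s p (projP (V t)) =
      dyadicSum (σ - σ₁) (b.u t) + highNorm χ J s (projP (V t)) := fun t ht => by
    rw [hybridNorm_projP J σ σ₁ s, hV.lowFreq_eq hχ hA ht]
    rfl
  have hIP : ∀ t, 0 ≤ t → hybridNorm χ J σ' s p (projIP (V t)) =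
      dyadicSum (σ' - (σ₁ + 1)) (b.w t) + highNorm χ J s (projIP (V t)) := fun t ht => by
    rw [hybridNorm_projIP J σ' (σ₁ + 1) s, hV.lowFreq_eq hχ hA ht]
    rfl
  have hdP : ∀ t, 0 ≤ t → hybridNorm χ J σ s p (projP (V t - profile A D V₀ t)) =
      dyadicSum (σ - σ₁) (b.d₁ t) + highNorm χ J s (projP (V t - profile A D V₀ t)) :=
    fun t ht => by
      rw [hybridNorm_projP J σ σ₁ s, lowFreq_sub, hV.lowFreq_eq hχ hA ht, lowFreq_profile hχ hA ht]
      rfl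
  have hdIP : ∀ t, 0 ≤ t → hybridNorm χ J σ' s p (projIP (V t - profile A D V₀ t)) =
      dyadicSum (σ' - (σ₁ + 1)) (b.d₂ t) + highNorm χ J s (projIP (V t - profile A D V₀ t)) :=
    fun t ht => by
      rw [hybridNorm_projIP J σ' (σ₁ + 1) s, lowFreq_sub, hV.lowFreq_eq hχ hA ht,
        lowFreq_profile hχ hA ht]
      rfl
  obtain ⟨K₂, hK₂, hN₂⟩ := (memBesovInf_iff _ _).1 hdiss
  replace hN₂ : ∀ j, b.N₂ j ≤ ENNReal.ofReal K₂ := fun j => by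
    have := hN₂ j
    rw [lowFreq_projIP, blockNorm_projIP] at this
    exact this
  have hmem : MemBesovInf χ σ₁ p (lowFreq χ J (projP V₀)) ↔
      ∃ K : ℝ, 0 < K ∧ ∀ j, b.N₁ j ≤ ENNReal.ofReal K := by
    rw [memBesovInf_iff, lowFreq_projP]
    simp only [blockNorm_projP]
    rfl
  -- the high frequencies decay faster than every rate
  obtain ⟨H₁, hH₁, hh₁⟩ := hV.exists_highNorm_le hA hχ hhigh
    (θ := (σ - σ₁) / 2 + 1 / 2) (by positivity)
  obtain ⟨H₂, hH₂, hh₂⟩ := hV.exists_highNorm_le hA hχ hhigh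
    (θ := (σ' - (σ₁ + 1)) / 2 + 1 + 1 / 2) (by positivity)
  obtain ⟨H₃, hH₃, hh₃⟩ := hA.exists_highNorm_profile_le hχ hhigh
    (θ := (σ - σ₁) / 2 + 1 / 2) (by positivity)
  obtain ⟨H₄, hH₄, hh₄⟩ := hA.exists_highNorm_profile_le hχ hhigh
    (θ := (σ' - (σ₁ + 1)) / 2 + 1 + 1 / 2) (by positivity)
  have hupper : (∃ K : ℝ, 0 < K ∧ ∀ j, b.N₁ j ≤ ENNReal.ofReal K) →
      ∃ C : ℝ, 0 < C ∧ ∀ t : ℝ, 0 < t →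
        hybridNorm χ J σ s p (projP (V t)) ≤ rate C ((σ - σ₁) / 2) t ∧
        hybridNorm χ J σ' s p (projIP (V t)) ≤ rate C ((σ' - σ₁) / 2 + 1 / 2) t := by
    rintro ⟨K₁, hK₁, hN₁⟩
    obtain ⟨B, hB, hup⟩ := est.exists_upper hJ0 hα hβ (K := K₁ + K₂) (by positivity)
      (fun j => (hN₁ j).trans (ENNReal.ofReal_le_ofReal (by linarith)))
      (fun j => (hN₂ j).trans (ENNReal.ofReal_le_ofReal (by linarith)))
    refine ⟨B + (H₁ + H₂), by positivity, fun t ht => ?_⟩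
    obtain ⟨h1, h2⟩ := hup t ht.le
    rw [er₁, ← rate_add hB.le (by positivity), ← rate_add hB.le (by positivity), hP t ht.le,
      hIP t ht.le]
    refine ⟨add_le_add h1 ?_, add_le_add h2 ?_⟩
    · exact (highNorm_projP_le _ _ _).trans ((hh₁ t ht.le).trans
        ((rate_anti hH₁.le (by linarith)).trans (rate_mono (by linarith))))
    · exact (highNorm_projIP_le _ _ _).trans ((hh₂ t ht.le).trans
        ((rate_anti hH₂.le (by linarith)).trans (rate_mono (by linarith))))
  have hconv : (∃ C : ℝ, 0 < C ∧ ∀ t : ℝ, 0 < t →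
        hybridNorm χ J σ s p (projP (V t)) ≤ rate C ((σ - σ₁) / 2) t ∧
        hybridNorm χ J σ' s p (projIP (V t)) ≤ rate C ((σ' - σ₁) / 2 + 1 / 2) t) →
      ∃ K : ℝ, 0 < K ∧ ∀ j, b.N₁ j ≤ ENNReal.ofReal K := by
    rintro ⟨B, hB, h⟩
    refine est.exists_N₁_le (α := σ - σ₁) (β := σ' - (σ₁ + 1)) (K := B + K₂) hJC hα (by positivity)
      (fun j => (hN₂ j).trans (ENNReal.ofReal_le_ofReal (by linarith))) (fun t ht => ?_)
      (fun t ht => ?_)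
    · have h1 := (h t ht).1
      rw [hP t ht.le] at h1
      exact le_self_add.trans (h1.trans (rate_mono (by linarith)))
    · have h1 := (h t ht).2
      rw [hIP t ht.le] at h1
      exact (le_self_add.trans h1).trans_lt ENNReal.ofReal_lt_top
  refine ⟨⟨fun h => hmem.2 (hconv h), fun h => hupper (hmem.1 h)⟩, fun h => ?_, ?_⟩
  · obtain ⟨K₁, hK₁, hN₁⟩ := hmem.1 h
    obtain ⟨B, hB, hd⟩ := est.exists_decay hJ0 hα hβ (K := K₁ + K₂) (by positivity)
      (fun j => (hN₁ j).trans (ENNReal.ofReal_le_ofReal (by linarith)))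
      (fun j => (hN₂ j).trans (ENNReal.ofReal_le_ofReal (by linarith)))
    -- Times below one are excluded because the profile contains derivatives of the high-frequency
    -- data, which only the smoothing of the heat flow compensates.
    refine ⟨1, one_pos, B + (H₁ + H₃) + (H₂ + H₄), by positivity, fun t ht => ?_⟩
    have ht0 : 0 ≤ t := by linarith
    obtain ⟨h1, h2, -, -⟩ := hd t ht0
    rw [er₂, hdP t ht0, hdIP t ht0]
    constructor
    · refine le_trans ?_ (rate_mono (C := B + (H₁ + H₃)) (by linarith))
      rw [← rate_add hB.le (by positivity), ← rate_add hH₁.le hH₃.le]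
      exact add_le_add h1 ((highNorm_projP_le _ _ _).trans ((highNorm_sub_le _ _ _ _).trans
        (add_le_add (hh₁ t ht0) (hh₃ t ht))))
    · refine le_trans ?_ (rate_mono (C := B + (H₂ + H₄)) (by linarith))
      rw [← rate_add hB.le (by positivity), ← rate_add hH₂.le hH₄.le]
      exact add_le_add h2 ((highNorm_projIP_le _ _ _).trans ((highNorm_sub_le _ _ _ _).trans
        (add_le_add (hh₂ t ht0) (hh₄ t ht))))
  · have hE : ∀ j, blockNorm χ σ₁ p (lowFreq χ J (effective A D V₀)) j = b.E j := fun j => by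
      rw [lowFreq_effective hχ]
      rfl
    rw [MemBesovInfLower, memBesovInf_iff]
    simp only [sum_weightedBlock, hE]
    constructor
    · rintro ⟨hup, t₁, ht₁, c₀, C₀, hc₀, hC₀, hlow⟩
      obtain ⟨K₁, hK₁, hN₁⟩ := hconv hup
      have hN₁' : ∀ j, b.N₁ j ≤ ENNReal.ofReal (K₁ + K₂) := fun j =>
        (hN₁ j).trans (ENNReal.ofReal_le_ofReal (by linarith))
      have hN₂' : ∀ j, b.N₂ j ≤ ENNReal.ofReal (K₁ + K₂) := fun j =>
        (hN₂ j).trans (ENNReal.ofReal_le_ofReal (by linarith))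
      have hEK := est.E_le_ofReal (by positivity) hN₁' hN₂'
      have hC := est.C_pos
      obtain ⟨B, hB, hd⟩ := est.exists_decay hJ0 hα hβ (by positivity) hN₁' hN₂'
      -- The lower bound passes from the solution to the profile: their difference and the high
      -- frequencies decay faster by a factor of order `t^{-1/2}`.
      obtain ⟨t₂, ht₂, h₂⟩ := exists_rate_le_of_le_add (θ := (σ - σ₁) / 2) hc₀
        (show 0 < B + H₁ by positivity)
      refine ⟨⟨_, by positivity, hEK⟩, est.exists_blocks hα (by positivity) hEK
        (t₁ := t₁ + t₂) (half_pos hc₀) fun t ht => ?_⟩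
      have ht0 : 0 ≤ t := by linarith
      refine h₂ t (by linarith) _ (dyadicSum (σ - σ₁) (b.d₁ t) + highNorm χ J s (projP (V t))) ?_ ?_
      · refine (hlow t (by linarith)).1.1.trans ?_
        rw [hP t ht0, ← add_assoc]
        refine add_le_add ?_ le_rfl
        rw [add_comm, ← dyadicSum_add]
        exact dyadicSum_mono (est.u_le t)
      · rw [← rate_add hB.le hH₁.le]
        exact add_le_add (hd t ht0).1 ((highNorm_projP_le _ _ _).trans (hh₁ t ht0))
    · rintro ⟨⟨K₃, hK₃, hEK⟩, c₀, M, hc₀, -, j, hj, hM, hEj⟩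
      have hC := est.C_pos
      -- Boundedness of the blocks of `Ψ₀` and of the dissipative data recovers that of the
      -- conservative data, hence the upper bounds.
      have hN₁ : ∀ j, b.N₁ j ≤ ENNReal.ofReal (K₃ + C * K₂) := fun j => by
        rw [ENNReal.ofReal_add hK₃.le (by positivity), ENNReal.ofReal_mul hC.le]
        exact (est.N₁_le j).trans (add_le_add (hEK j) (mul_le_mul_right (hN₂ j) _))
      have hup := hupper ⟨_, by positivity, hN₁⟩
      obtain ⟨t₁, B, ht₁, hB, hlow⟩ := est.exists_lower hJ0 hα hβ (K := K₃ + C * K₂ + K₂)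
        (by positivity) (fun j => (hN₁ j).trans (ENNReal.ofReal_le_ofReal (by linarith)))
        (fun j => (hN₂ j).trans (ENNReal.ofReal_le_ofReal (by nlinarith))) hc₀ hj hM hEj
      refine ⟨hup, t₁, ht₁, ?_⟩
      obtain ⟨C₀, hC₀, hup⟩ := hup
      refine ⟨B, C₀, hB, hC₀, fun t ht => ?_⟩
      have ht0 : 0 < t := by linarith
      refine ⟨⟨?_, (hup t ht0).1⟩, ?_, (hup t ht0).2⟩
      · rw [hP t ht0.le]
        exact (hlow t ht).1.trans le_self_add
      · rw [hIP t ht0.le, er₁]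
        exact (hlow t ht).2.trans le_self_add
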